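/- **Setting.** Let $d\ge 2$, let $E$ be a finite non-empty set, and let $G$ be the star graph with one vertex $v$ and edges $I_e=(0,\ell_e)$, $\ell_e\in(0,\infty]$, $e\in E$, where $0$ corresponds to $v$. Let $Y_e$ ($e\in E$) and $X_v$ be compact smooth Riemannian manifolds, possibly with boundary and corners, of dimension $d-1$ and $d$, with metrics $h_e$ and $g_v$. Let $\ell_->0$ be a real number with $\ell_-\le \ell_e$ for all $e$ (for example $\ell_-=\min_e\ell_e$ if this is finite), and assume that $X_v$ has, for each $e$, a boundary component $\partial_eX_v\cong Y_e$ with a collar neighbourhood isometric to the product $[0,\ell_-)\times Y_e$, $\{0\}\times Y_e$ corresponding to $\partial_e X_v$, these neighbourhoods being pairwise disjoint. For $\varepsilon>0$ let $X_\varepsilon$ be the manifold obtained by gluing the cylinders $X_{\varepsilon,e}=I_e\times\varepsilon Y_e$ (metric $ds^2+\varepsilon^2h_e$) to $\varepsilon X_v$ (metric $\varepsilon^2g_v$) along $\{0\}\times Y_e\cong\partial_eX_v$, so that $$L^2(X_\varepsilon)=\bigoplus_e L^2(X_{\varepsilon,e})\oplus L^2(\varepsilon X_v),\qquad \|u\|^2=\sum_e\varepsilon^{d-1}\int_{I_e\times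 Y_e}|u|^2\,dy\,ds+\varepsilon^d\int_{X_v}|u|^2\,dx ,$$ and let $H^1(X_\varepsilon)$ be the completion of the smooth functions with compact support (smooth up to the boundary of $X_\varepsilon$, not required to vanish there) in the norm $(\|du\|^2+\|u\|^2)^{1/2}$. Let $Q\in L^\infty(X_v)$ be real-valued, with norm $\|Q\|_\infty$. * $H_\varepsilon$ is the operator in $L^2(X_\varepsilon)$ associated with the form $\|du\|^2_{X_\varepsilon}+\langle u,Q_\varepsilon u\rangle$ on $H^1(X_\varepsilon)$, where $Q_\varepsilon=\varepsilon^{-1}Q$ on $X_v$ and $Q_\varepsilon=0$ elsewhere (Neumann Laplacian plus potential). * Put $p_e=(\operatorname{vol}Y_e)^{1/2}$, $q(v)=\int_{X_v}Q\,dx$. $H$ is the operator in $L^2(G)=\bigoplus_eL^2(I_e)$ associated with the form $\sum_e\|f_e'\|^2+q(v)|f(v)|^2$ on the space of all $f\in\bigoplus_eH^1(I_e)$ such that $f_e(0)=f(v)p_e$ for all $e$ with some $f(v)\in\mathbb C$. * $J:L^2(G)\to L^2(X_\varepsilon)$, $Jf=\varepsilon^{-(d-1)/2}\bigoplus_e\bigl(f_e\otimes(\operatorname{vol}Y_e)^{-1/2}\bigr)\oplus0$.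 Let $\lambda_2(v)$ and $\lambda_2(e)$ be the second eigenvalues (counted with multiplicity) of the Neumann Laplacians on $X_v$ and $Y_e$; they are assumed to be positive, i.e. to be the first non-zero eigenvalues, as is the case when $X_v$ and $Y_e$ are connected. Put $\lambda_2(E)=\min_e\lambda_2(e)$, $c_{\rm vol}=\operatorname{vol}X_v/\sum_e\operatorname{vol}Y_e$, $\ell_0=\min\{1,\ell_-\}$, $$\varepsilon_{1/2}=\frac1{8\|Q\|_\infty}\Bigl[\frac1{\lambda_2(v)}+c_{\rm vol}\Bigl(\ell_-+\frac2{\ell_-\lambda_2(v)}\Bigr)\Bigr]^{-1}\ (=\infty\text{ if }Q=0),\qquad \widetilde C_{1/2}=8c_{\rm vol}\|Q\|_\infty\max\Bigl\{8c_{\rm vol}\|Q\|_\infty,\frac1{\ell_-}\Bigr\},$$ $\lambda_0=-\widetilde C_{1/2}$, and $$\delta_\varepsilon^2=\max\Bigl\{\frac{8\varepsilon c_{\rm vol}}{\ell_0},\ \frac{\varepsilon^2}{\lambda_2(E)},\ 4\varepsilon^2\Bigl[\frac1{\lambda_2(v)}+c_{\rm vol}\Bigl(1+\frac2{\ell_0\lambda_2(v)}\Bigr)\Bigr],\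 \frac{2\varepsilon}{\ell_0}\Bigl(1+\frac2{\ell_0\lambda_2(v)}\Bigr),\ \frac{4\varepsilon c_{\rm vol}\|Q\|_\infty^2}{\ell_0\lambda_2(v)}\Bigr\}.$$ **Theorem.** $\delta_\varepsilon=O(\varepsilon^{1/2})$ as $\varepsilon\to0$. For every finite $\varepsilon\in(0,\varepsilon_{1/2}]$, the operators $H_\varepsilon-\lambda_0$ and $H-\lambda_0$ are $\sqrt2\,\delta_\varepsilon$-close, in the following sense: $J$ is bounded with $J^*J=\mathrm{id}$, the number $\lambda_0-1$ is in the resolvent sets of $H$ and $H_\varepsilon$, and $$\bigl\|(\mathrm{id}-JJ^*)(H_\varepsilon-\lambda_0+1)^{-1}\bigr\|\le\sqrt2\,\delta_\varepsilon,\qquad \bigl\|J(H-\lambda_0+1)^{-1}-(H_\varepsilon-\lambda_0+1)^{-1}J\bigr\|\le3\sqrt2\,\delta_\varepsilon .$$ Moreover, for these $\varepsilon$, $\mathrm i$ is in the resolvent sets of $H$ and $H_\varepsilon$, and $$\bigl\|J(H-\mathrm i)^{-1}-(H_\varepsilon-\mathrm i)^{-1}J\bigr\|\le10\,\delta_\varepsilon\max\{\widetilde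 C_{1/2},\sqrt2\}.$$ -/

import Mathlib

open MeasureTheory Filter Topology Set
open scoped Manifold ContDiff ComplexConjugate

noncomputable section

namespace ThinStar

universe u w

/-! ### Compact Riemannian manifolds, possibly with boundary and corners -/

/-- A compact smooth `n`-dimensional Riemannian manifold, possibly with boundary and corners.
The boundary points belong to the manifold. -/
structure RiemMfd (n : ℕ) where
  carrier : Type u
  model : Type u
  [top : TopologicalSpace carrier]
  [t2 : T2Space carrier]
  [secondCountable : SecondCountableTopology carrier]
  [compact : CompactSpace carrier]
  [modelTop : TopologicalSpace model]
  I : ModelWithCorners ℝ (EuclideanSpace ℝ (Fin n)) model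
  [charted : ChartedSpace model carrier]
  [isManifold : IsManifold I ∞ carrier]
  metric : Bundle.ContMDiffRiemannianMetric I ∞ (EuclideanSpace ℝ (Fin n))
    (fun x : carrier => TangentSpace I x)

instance (n : ℕ) : CoeSort (RiemMfd.{u} n) (Type u) := ⟨RiemMfd.carrier⟩

attribute [instance] RiemMfd.top RiemMfd.t2 RiemMfd.secondCountable RiemMfd.compact
  RiemMfd.modelTop RiemMfd.charted RiemMfd.isManifold

instance {n : ℕ} (M : RiemMfd.{u} n) : MeasurableSpace M := borel M

instance {n : ℕ} (M : RiemMfd.{u} n) : BorelSpace M := ⟨rfl⟩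

namespace RiemMfd

variable {n : ℕ} (M : RiemMfd.{u} n)

/-- The `i`-th standard basis vector of `ℝⁿ`. -/
def stdVec (n : ℕ) (i : Fin n) : EuclideanSpace ℝ (Fin n) := EuclideanSpace.single i 1

/-- The `i`-th standard basis vector of `T_x M = ℝⁿ`, in the coordinates of the preferred chart
at `x`. -/
def tanVec (x : M) (i : Fin n) : TangentSpace M.I x := stdVec n i

/-- The tangent vector `σ ∂_s + v` of the product `ℝ × M`. -/
def prodVec (s : ℝ) (y : M) (σ : ℝ) (v : TangentSpace M.I y) :
    TangentSpace (𝓘(ℝ, ℝ).prod M.I) (s, y) := (σ, v)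

/-- The `i`-th coordinate vector field `∂ᵢ` of the chart at `x₀`, at the point with
coordinates `z`. -/
def coordVec (x₀ : M) (z : EuclideanSpace ℝ (Fin n)) (i : Fin n) :
    TangentSpace M.I ((extChartAt M.I x₀).symm z) :=
  mfderivWithin 𝓘(ℝ, EuclideanSpace ℝ (Fin n)) M.I (extChartAt M.I x₀).symm (range M.I) z
    (stdVec n i)

/-- The matrix `g_{ij} = g(∂ᵢ, ∂ⱼ)` of the metric in the chart at `x₀`, as a function of the
coordinates. -/
def chartGram (x₀ : M) (z : EuclideanSpace ℝ (Fin n)) : Matrix (Fin n) (Fin n) ℝ :=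
  Matrix.of fun i j =>
    M.metric.inner ((extChartAt M.I x₀).symm z) (M.coordVec x₀ z i) (M.coordVec x₀ z j)

/-- The measure `√(det g_{ij}) dz` of the chart at `x₀`, transported to the domain of that
chart. -/
def chartVol (x₀ : M) : Measure M :=
  Measure.map (extChartAt M.I x₀).symm
    ((volume.restrict (extChartAt M.I x₀).target).withDensity
      fun z => ENNReal.ofReal (Real.sqrt (M.chartGram x₀ z).det))

/-- The Riemannian volume measure: the smallest measure that dominates `√(det g_{ij}) dz` in
every chart.  (The chart measures agree on overlaps, so it restricts to `√(det g_{ij}) dz` on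
each chart domain.) -/
def vol : Measure M := ⨆ x₀ : M, M.chartVol x₀

/-- The total volume, as a real number. -/
def totalVol : ℝ := M.vol.real univ

/-- The matrix `g_{ij}` at `x`, in the coordinates of `T_x M` (those of the preferred chart at
`x`). -/
def gram (x : M) : Matrix (Fin n) (Fin n) ℝ :=
  Matrix.of fun i j =>
    M.metric.inner x (M.tanVec x i) (M.tanVec x j)

/-- The inner product `∑ g^{ij} conj(αᵢ) βⱼ` of complex covectors at `x`. -/
def coInner (x : M) (α β : TangentSpace M.I x →L[ℝ] ℂ) : ℂ :=
  ∑ i, ∑ j, (((M.gram x)⁻¹ i j : ℝ) : ℂ) *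
    conj (α (M.tanVec x i)) * β (M.tanVec x j)

/-- The exterior derivative of a complex function at `x`. -/
def d (u : M → ℂ) (x : M) : TangentSpace M.I x →L[ℝ] ℂ := mfderiv M.I 𝓘(ℝ, ℂ) u x

/-- Smooth complex functions (smooth up to the boundary). -/
def Smooth (u : M → ℂ) : Prop := ContMDiff M.I 𝓘(ℝ, ℂ) ∞ u

/-- The `k`-th eigenvalue (counted from `1`, with multiplicity) of the Neumann Laplacian of
`M`, by the min-max principle: the infimum over `k`-dimensional spaces of smooth functions of
the maximal Rayleigh quotient `‖du‖² / ‖u‖²`. -/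
def neumannEigenvalue (k : ℕ) : ℝ :=
  sInf {r : ℝ | 0 ≤ r ∧ ∃ L : Submodule ℂ (M → ℂ), Module.finrank ℂ L = k ∧
    ∀ u ∈ L, M.Smooth u ∧
      (∫ x, M.coInner x (M.d u x) (M.d u x) ∂M.vol).re ≤ r * ∫ x, ‖u x‖ ^ 2 ∂M.vol}

end RiemMfd

/-! ### Operators given by their graphs, and resolvents -/

/-- `R = (T - z)⁻¹` for the (possibly unbounded) operator with graph `T`: the bounded operator
`R` is defined everywhere, and `R g = f` exactly if `f ∈ dom T` and `T f - z f = g`. -/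
def IsResolvent {𝓗 : Type*} [NormedAddCommGroup 𝓗] [InnerProductSpace ℂ 𝓗]
    (T : Set (𝓗 × 𝓗)) (z : ℂ) (R : 𝓗 →L[ℂ] 𝓗) : Prop :=
  ∀ g f : 𝓗, R g = f ↔ (f, g + z • f) ∈ T

/-! ### The star graph and the thin manifold -/

/-- The data of a star graph with edge set `E` and of the associated branched manifold of
dimension `n + 1`. -/
structure FatStar (n : ℕ) (E : Type w) where
  /-- The edge lengths, in `(0, ∞]`. -/
  len : E → ENNReal
  /-- A positive real lower bound of the edge lengths, for instance their minimum if that is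
  finite. -/
  ellMinus : ℝ
  ellMinus_pos : 0 < ellMinus
  ellMinus_le : ∀ e, ENNReal.ofReal ellMinus ≤ len e
  /-- The cross-sections of the edge neighbourhoods. -/
  Y : E → RiemMfd.{u} n
  /-- The vertex neighbourhood. -/
  X : RiemMfd.{u} (n + 1)
  /-- The collar `[0, ellMinus) × Y e → X` at the boundary component belonging to `e`, which
  is the image of `{0} × Y e`.  Its values outside `[0, ellMinus) × Y e` play no role. -/
  collar : ∀ e, ℝ × Y e → X
  collar_embedding : ∀ e, IsOpenEmbedding ((Ico 0 ellMinus ×ˢ univ).domRestrict (collar e))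
  collar_smooth : ∀ e,
    ContMDiffOn (𝓘(ℝ, ℝ).prod (Y e).I) X.I ∞ (collar e) (Ico 0 ellMinus ×ˢ univ)
  /-- The metric of `X` on the collar is the product metric `ds² + h`. -/
  collar_isometric : ∀ e, ∀ s ∈ Ioo 0 ellMinus, ∀ (y : Y e) (σ τ : ℝ)
    (v w : TangentSpace (Y e).I y),
    X.metric.inner (collar e (s, y))
      (mfderiv (𝓘(ℝ, ℝ).prod (Y e).I) X.I (collar e) (s, y)
        ((Y e).prodVec s y σ v))
      (mfderiv (𝓘(ℝ, ℝ).prod (Y e).I) X.I (collar e) (s, y)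
        ((Y e).prodVec s y τ w))
      = σ * τ + (Y e).metric.inner y v w
  collar_disjoint : ∀ e e', e ≠ e' →
    Disjoint (collar e '' (Ico 0 ellMinus ×ˢ univ)) (collar e' '' (Ico 0 ellMinus ×ˢ univ))

namespace FatStar

variable {n : ℕ} {E : Type w} [Fintype E] (S : FatStar.{u, w} n E)

/-- The open edge `I_e = (0, ℓ_e)`. -/
def edge (e : E) : Set ℝ := {s | 0 < s ∧ ENNReal.ofReal s < S.len e}

/-- The weight `p_e = (vol Y_e)^{1/2}`. -/
def p (e : E) : ℝ := Real.sqrt (S.Y e).totalVol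

/-- The coupling strength `q(v) = ∫_{X_v} Q`. -/
def q (Q : S.X → ℝ) : ℝ := ∫ x, Q x ∂S.X.vol

/-! #### The graph operator -/

/-- `L²(G) = ⨁_e L²(I_e)`. -/
abbrev L2G : Type w :=
  PiLp 2 fun e : E => Lp ℂ 2 (volume.restrict (S.edge e) : Measure ℝ)

/-- `f` lies in the Sobolev space `H¹_p(G)`, with derivative `f' = g` and vertex value
`f(v) = c`: on each edge `f` is absolutely continuous with `f_e(0) = c p_e` and square-integrable
derivative `g_e`. -/
def IsH1G (f g : S.L2G) (c : ℂ) : Prop :=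
  ∀ e, ∀ᵐ s ∂(volume.restrict (S.edge e) : Measure ℝ),
    f e s = c * S.p e + ∫ t in (0 : ℝ)..s, g e t

/-- The graph of the operator `H` with `δ`-coupling of strength `q(v) = ∫ Q`, that is, of the
operator associated with the form `h(f) = ‖f'‖² + q(v) |f(v)|²` on `H¹_p(G)`. -/
def graphOp (Q : S.X → ℝ) : Set (S.L2G × S.L2G) :=
  {fw | ∃ (g : S.L2G) (c : ℂ), S.IsH1G fw.1 g c ∧
    ∀ (φ φ' : S.L2G) (b : ℂ), S.IsH1G φ φ' b →
      inner ℂ φ' g + S.q Q * (conj b * c) = inner ℂ φ fw.2}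

/-! #### The manifold operator -/

/-- The unscaled measure `ds dy` on the edge neighbourhood `X_e = I_e × Y_e`. -/
def edgeVol (e : E) : Measure (ℝ × S.Y e) := (volume.restrict (S.edge e)).prod (S.Y e).vol

/-- `L²(X_ε) = ⨁_e L²(I_e × εY_e) ⊕ L²(εX_v)`, for the Riemannian measures `ε^{d-1} ds dy` and
`ε^d dx`, where `d = n + 1`. -/
abbrev L2X (ε : ℝ) : Type (max u w) :=
  WithLp 2 ((PiLp 2 fun e : E => Lp ℂ 2 (ENNReal.ofReal (ε ^ n) • S.edgeVol e)) ×
    Lp ℂ 2 (ENNReal.ofReal (ε ^ (n + 1)) • S.X.vol))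

/-- Functions on the branched manifold, given by their restrictions to the vertex neighbourhood
and to the edge neighbourhoods (of which only the values for `0 ≤ s ≤ ℓ_e` play a role). -/
abbrev Fn : Type (max u w) := (S.X → ℂ) × (∀ e, ℝ × S.Y e → ℂ)

/-- The function `u` near the edge `e`, as a function of the arc length `t` and of `y`, where
`t ≥ 0` in the edge neighbourhood and `-ε ellMinus < t ≤ 0` in the scaled collar. -/
def glue (ε : ℝ) (u : S.Fn) (e : E) (z : ℝ × S.Y e) : ℂ :=
  if z.1 ≤ 0 then u.1 (S.collar e (-z.1 / ε, z.2)) else u.2 e z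

/-- Smooth functions with compact support on `X_ε`, smooth up to the boundary of `X_ε`, in
particular across the hypersurfaces where edge and vertex neighbourhoods are glued. -/
def smoothFn (ε : ℝ) : Set S.Fn :=
  {u | S.X.Smooth u.1 ∧
    (∀ e y, u.2 e (0, y) = u.1 (S.collar e (0, y))) ∧
    (∀ e, ContMDiffOn (𝓘(ℝ, ℝ).prod (S.Y e).I) 𝓘(ℝ, ℂ) ∞ (S.glue ε u e)
      {z | -(ε * S.ellMinus) < z.1 ∧ ENNReal.ofReal z.1 ≤ S.len e}) ∧
    ∀ e, ∃ b : ℝ, ∀ z : ℝ × S.Y e, b < z.1 → ENNReal.ofReal z.1 ≤ S.len e → u.2 e z = 0}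

/-- The sesquilinear form `∫_{X_ε} ⟨du, dv⟩` of the metric of `X_ε`. -/
def dForm (ε : ℝ) (u v : S.Fn) : ℂ :=
  (∑ e, (ε : ℂ) ^ n * ∫ z, (conj (deriv (fun s => u.2 e (s, z.2)) z.1) *
        deriv (fun s => v.2 e (s, z.2)) z.1 +
      ((ε : ℂ) ^ 2)⁻¹ * (S.Y e).coInner z.2 ((S.Y e).d (fun y => u.2 e (z.1, y)) z.2)
        ((S.Y e).d (fun y => v.2 e (z.1, y)) z.2)) ∂S.edgeVol e) +
    (ε : ℂ) ^ (n + 1) *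
      ∫ x, ((ε : ℂ) ^ 2)⁻¹ * S.X.coInner x (S.X.d u.1 x) (S.X.d v.1 x) ∂S.X.vol

/-- The sesquilinear form `h_ε(u, v) = ∫_{X_ε} ⟨du, dv⟩ + ⟨u, Q_ε v⟩` with `Q_ε = ε⁻¹ Q` on the
vertex neighbourhood and `Q_ε = 0` elsewhere. -/
def hForm (Q : S.X → ℝ) (ε : ℝ) (u v : S.Fn) : ℂ :=
  S.dForm ε u v +
    (ε : ℂ) ^ (n + 1) * ∫ x, conj (u.1 x) * (((ε⁻¹ * Q x : ℝ) : ℂ) * v.1 x) ∂S.X.vol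

/-- The function `u` represents the element `U` of `L²(X_ε)`. -/
def Represents (ε : ℝ) (u : S.Fn) (U : S.L2X ε) : Prop :=
  (∀ e, U.fst e =ᵐ[ENNReal.ofReal (ε ^ n) • S.edgeVol e] u.2 e) ∧
    U.snd =ᵐ[ENNReal.ofReal (ε ^ (n + 1)) • S.X.vol] u.1

/-- The sequence `c` of smooth functions with compact support is Cauchy in the norm of
`H¹(X_ε)`, `‖u‖²_{H¹} = ‖du‖² + ‖u‖²`, and its limit in `L²(X_ε)` is `U`.  Since `H¹(X_ε)` is the
completion of these functions, its elements are the `U` that admit such a sequence. -/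
def ApproxH1 (ε : ℝ) (c : ℕ → S.Fn) (U : S.L2X ε) : Prop :=
  (∀ k, c k ∈ S.smoothFn ε) ∧
    (∃ V : ℕ → S.L2X ε, (∀ k, S.Represents ε (c k) (V k)) ∧ Tendsto V atTop (𝓝 U)) ∧
    ∀ η > 0, ∃ N, ∀ j ≥ N, ∀ k ≥ N, (S.dForm ε (c j - c k) (c j - c k)).re < η

/-- The graph of the operator `H_ε` associated with the form `h_ε` on `H¹(X_ε)`: `U` is in
`H¹(X_ε)` and `h_ε(φ, U) = ⟨φ, W⟩` for all `φ` in the dense subspace of smooth functions with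
compact support, where `h_ε(φ, U)` is the extension by continuity. -/
def mfdOp (Q : S.X → ℝ) (ε : ℝ) : Set (S.L2X ε × S.L2X ε) :=
  {UW | ∃ c : ℕ → S.Fn, S.ApproxH1 ε c UW.1 ∧
    ∀ φ ∈ S.smoothFn ε, ∀ Φ : S.L2X ε, S.Represents ε φ Φ →
      Tendsto (fun k => S.hForm Q ε φ (c k)) atTop (𝓝 (inner ℂ Φ UW.2))}

/-- `J` is the identification operator `J f = ε^{-(d-1)/2} ⨁_e (f_e ⊗ (vol Y_e)^{-1/2}) ⊕ 0`. -/
def IsIdentification (ε : ℝ) (J : S.L2G →L[ℂ] S.L2X ε) : Prop :=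
  ∀ f : S.L2G,
    (∀ e, (J f).fst e =ᵐ[ENNReal.ofReal (ε ^ n) • S.edgeVol e]
      fun z => ((ε ^ (-(n : ℝ) / 2) * (S.p e)⁻¹ : ℝ) : ℂ) * f e z.1) ∧
    (J f).snd = 0

/-! #### The constants -/

/-- `‖Q‖_∞`. -/
def supNorm (Q : S.X → ℝ) : ℝ := (eLpNorm Q ⊤ S.X.vol).toReal

/-- `c_vol = vol X_v / vol ∂X_v`, where `∂X_v` is the union of the cross-sections `Y_e`. -/
def cVol : ℝ := S.X.totalVol / ∑ e, (S.Y e).totalVol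

/-- `λ₂(v)`, the second Neumann eigenvalue of `X_v`. -/
def lamV : ℝ := S.X.neumannEigenvalue 2

/-- `λ₂(e)`, the second Neumann eigenvalue of `Y_e`. -/
def lamEdge (e : E) : ℝ := (S.Y e).neumannEigenvalue 2

/-- `λ₂(E) = min_e λ₂(e)`. -/
def lamE : ℝ := ⨅ e, S.lamEdge e

/-- `ε_η`, which is infinite for `Q = 0`. -/
def epsEta (Q : S.X → ℝ) (η : ℝ) : ENNReal :=
  ENNReal.ofReal η / ENNReal.ofReal (4 * S.supNorm Q *
    (1 / S.lamV + S.cVol * (S.ellMinus + 2 / (S.ellMinus * S.lamV))))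

/-- `C̃_η`. -/
def cTilde (Q : S.X → ℝ) (η : ℝ) : ℝ :=
  8 * S.cVol * S.supNorm Q * max (4 * S.cVol * S.supNorm Q / η) (1 / S.ellMinus)

/-- `λ₀ = -C̃_{1/2}`. -/
def lam0 (Q : S.X → ℝ) : ℝ := -S.cTilde Q (1 / 2)

/-- `ℓ₀ = min {1, ℓ₋}`. -/
def ell0 : ℝ := min 1 S.ellMinus

/-- The error `δ_ε`. -/
def delta (Q : S.X → ℝ) (ε : ℝ) : ℝ :=
  Real.sqrt (max (8 * ε * S.cVol / S.ell0) (max (ε ^ 2 / S.lamE)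
    (max (4 * ε ^ 2 * (1 / S.lamV + S.cVol * (1 + 2 / (S.ell0 * S.lamV))))
      (max (2 * ε / S.ell0 * (1 + 2 / (S.ell0 * S.lamV)))
        (4 * ε * S.cVol * S.supNorm Q ^ 2 / (S.ell0 * S.lamV))))))

end FatStar

end ThinStar

end

noncomputable section

namespace ThinStar

universe u w

/-! Both operators come from quadratic forms, so the forms are compared and the resolvents follow by
duality. Write `n = d - 1` for the dimension of the cross-sections.

On the thin manifold, finite energy makes a function nearly constant in the short directions. The
transversal energy on an edge carries the factor `ε⁻²`, so the Poincaré inequality on `Y e` leaves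
an error `ε² / λ₂(e)` in the squared norm (`integral_sq_norm_edge_le`). On the vertex part the
energy scales like `ε^(n-1)` while the squared norm scales like `ε^(n+1)`: the function is close to
its mean over `X`, this mean is close to the means over the boundary components by a trace estimate
in the collars (`sum_sq_edgeMean_sub_mean_le`), and those are controlled from the edges by the same
trace estimate. Hence the vertex part has norm of order `√ε` (`integral_sq_norm_vertex_le`), and
`JJ*` is nearly the identity on functions of bounded energy (`norm_sub_identJ_toL2_le`).

The operator `J` does not map between the form domains, so it is replaced by two maps that do. A
graph function is lifted by the constant of its vertex value (`liftFn`). A function on the manifold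
is averaged over the cross-sections, and a linear cut-off times the jump between the mean over `X`
and the mean over `Y e` restores the vertex condition (`isH1G_average`). The longitudinal energies
then agree exactly (`dForm_lift`). What remains of the difference of the forms is the derivative of
the correction and the integral of `Q` against the deviation from the mean; both are of order `√ε`
(`norm_form_sub_le`). The factor `ε⁻¹` in the potential is exactly the one for which the vertex term
survives with strength `∫ Q`.

With `C` the constant `C̃` at `1/2`, both forms are at least `½‖x‖² - ½(C+1)‖ιx‖²` in terms of the
`H¹` and `L²` norms, on the manifold provided that `ε` is at most its threshold (`formG_lower`,
`hForm_lower`). Lax–Milgram then gives weak solutions at `-C - 1` and at `i`, with explicit bounds.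
For the difference `w` of the two sides of the resolvent estimate applied to `g`, solving the
adjoint problem with right-hand side `w` expresses `‖w‖²` through the forms, and the bound `(δ₁ +
δ₂) a + δ₃ a²` follows, where `a` bounds the `H¹` norm of solutions
(`FormsClose.norm_resolvent_sub_le`).

Some groundwork is needed. The chart measures agree on overlaps, the volume is finite, and the
isometric collar preserves measure (`map_collar`). The Poincaré inequality is read off the min-max
definition of the eigenvalue (`poincare`). The two operators, given as graphs of relations, are
those of bounded forms on the Hilbert spaces `H1G` and `H1X` (`graphOp_eq_formRel`,
`mfdOp_eq_formRel`). The forms are compared only on dense subspaces; on the graph these are smooth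
functions that are constant near the vertex, whose lifts are smooth across the gluing
(`dense_isSmoothG`). -/

/-- The Gram matrix of the vectors `b i` with respect to the bilinear form `B`. -/
def gramMatrix {n : ℕ} {V : Type*} [TopologicalSpace V] [AddCommGroup V]
    [IsTopologicalAddGroup V] [Module ℝ V] (B : V →L[ℝ] V →L[ℝ] ℝ)
    (b : Fin n → V) : Matrix (Fin n) (Fin n) ℝ := Matrix.of fun i j => B (b i) (b j)

/-- The form on complex covectors dual to `B`, computed with the vectors `b i`. -/
def dualForm {n : ℕ} {V : Type*} [TopologicalSpace V] [AddCommGroup V]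
    [IsTopologicalAddGroup V] [Module ℝ V] (B : V →L[ℝ] V →L[ℝ] ℝ)
    (b : Fin n → V) (α β : V →L[ℝ] ℂ) : ℂ :=
  ∑ i, ∑ j, (((gramMatrix B b)⁻¹ i j : ℝ) : ℂ) * conj (α (b i)) * β (b j)

/-! ### Gram matrices and the dual form on covectors -/

section LinearAlgebra

variable {n : ℕ} {V : Type*} [TopologicalSpace V] [AddCommGroup V]
    [IsTopologicalAddGroup V] [Module ℝ V] (B : V →L[ℝ] V →L[ℝ] ℝ)
    (b : Fin n → V)

theorem gramMatrix_change (P : Matrix (Fin n) (Fin n) ℝ) :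
    gramMatrix B (fun i => ∑ k, P k i • b k) = P.transpose * gramMatrix B b * P := by
  ext i j
  simp only [gramMatrix, Matrix.of_apply, map_sum, map_smul, Matrix.mul_apply,
    Matrix.transpose_apply, Finset.sum_mul, sum_apply,
    smul_apply, smul_eq_mul]
  rw [Finset.sum_comm]
  rw [Finset.sum_comm]
  refine Finset.sum_congr rfl fun k _ => ?_
  rw [Finset.mul_sum]
  exact Finset.sum_congr rfl fun l _ => by ring

theorem dualForm_eq_dotProduct (α β : V →L[ℝ] ℂ) :
    dualForm B b α β = star (fun i => α (b i)) ⬝ᵥ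
      ((gramMatrix B b)⁻¹.map Complex.ofReal).mulVec (fun j => β (b j)) := by
  simp only [dualForm, dotProduct, Matrix.mulVec, Finset.mul_sum, Matrix.map_apply, Pi.star_apply]
  refine Finset.sum_congr rfl fun i _ => Finset.sum_congr rfl fun j _ => ?_
  simp only [RCLike.star_def]
  ring

/-- The Gram matrix becomes `Pᵀ G P`, so its inverse acquires the factors `P⁻¹` and `P⁻ᵀ`. They
cancel the factors that the values of the two covectors acquire. This makes the energy density
independent of the frame. -/
theorem dualForm_change (P : Matrix (Fin n) (Fin n) ℝ) (hP : IsUnit P.det) (α β : V →L[ℝ] ℂ) :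
    dualForm B (fun i => ∑ k, P k i • b k) α β = dualForm B b α β := by
  have hα (γ : V →L[ℝ] ℂ) : (fun i => γ (∑ k, P k i • b k)) =
      (P.map Complex.ofReal).transpose.mulVec (fun i => γ (b i)) := by
    ext i
    simp [Matrix.mulVec, dotProduct]
  have hstar (a : Fin n → ℂ) : star ((P.map Complex.ofReal).transpose.mulVec a) =
      (P.map Complex.ofReal).transpose.mulVec (star a) := by
    ext i
    simp [Matrix.mulVec, dotProduct]
  rw [dualForm_eq_dotProduct, dualForm_eq_dotProduct, gramMatrix_change, hα, hα, hstar,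
    Matrix.mulVec_transpose, ← Matrix.dotProduct_mulVec, Matrix.mulVec_mulVec, Matrix.mulVec_mulVec,
    ← Matrix.transpose_map]
  have hmap (X Y : Matrix (Fin n) (Fin n) ℝ) : X.map Complex.ofReal * Y.map Complex.ofReal
      = (X * Y).map Complex.ofReal := (Matrix.map_mul (f := Complex.ofRealHom)).symm
  rw [hmap, hmap, Matrix.mul_inv_rev, Matrix.mul_inv_rev]
  congr 3
  have hPt : IsUnit P.transpose.det := by rwa [Matrix.det_transpose]
  rw [Matrix.mul_assoc, Matrix.mul_assoc, Matrix.mul_assoc, Matrix.nonsing_inv_mul _ hPt,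
    Matrix.mul_one, ← Matrix.mul_assoc, Matrix.mul_nonsing_inv _ hP, Matrix.one_mul]

variable {B b}

theorem posDef_gramMatrix (hsymm : ∀ v w, B v w = B w v) (hpos : ∀ v, v ≠ 0 → 0 < B v v)
    (hb : LinearIndependent ℝ b) : (gramMatrix B b).PosDef := by
  refine Matrix.PosDef.of_dotProduct_mulVec_pos ?_ ?_
  · ext i j
    simp [gramMatrix, hsymm (b j) (b i)]
  · intro x hx
    have : star x ⬝ᵥ (gramMatrix B b).mulVec x = B (∑ i, x i • b i) (∑ i, x i • b i) := by
      simp only [dotProduct, Matrix.mulVec, gramMatrix, Matrix.of_apply, map_sum, map_smul,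
        sum_apply, smul_apply, smul_eq_mul, star_trivial,
        Finset.mul_sum]
      rw [Finset.sum_comm]
      refine Finset.sum_congr rfl fun i _ => Finset.sum_congr rfl fun j _ => ?_
      ring
    rw [this]
    refine hpos _ fun h0 => hx ?_
    ext i
    exact Fintype.linearIndependent_iff.1 hb x h0 i

theorem dualForm_add_right (α β γ : V →L[ℝ] ℂ) :
    dualForm B b α (β + γ) = dualForm B b α β + dualForm B b α γ := by
  simp only [dualForm, add_apply, mul_add, Finset.sum_add_distrib]

theorem dualForm_smul_right (α β : V →L[ℝ] ℂ) (c : ℂ) :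
    dualForm B b α (c • β) = c * dualForm B b α β := by
  simp only [dualForm, smul_apply, smul_eq_mul, Finset.mul_sum]
  exact Finset.sum_congr rfl fun i _ => Finset.sum_congr rfl fun j _ => by ring

theorem conj_dualForm (hsymm : ∀ v w, B v w = B w v) (α β : V →L[ℝ] ℂ) :
    conj (dualForm B b α β) = dualForm B b β α := by
  have hG : (gramMatrix B b).transpose = gramMatrix B b := by
    ext i j
    simp [gramMatrix, hsymm (b j) (b i)]
  have hs (i j) : (gramMatrix B b)⁻¹ i j = (gramMatrix B b)⁻¹ j i := by
    rw [← Matrix.transpose_apply (gramMatrix B b)⁻¹, Matrix.transpose_nonsing_inv, hG]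
  simp only [dualForm, map_sum, map_mul, Complex.conj_ofReal, Complex.conj_conj]
  rw [Finset.sum_comm]
  refine Finset.sum_congr rfl fun i _ => Finset.sum_congr rfl fun j _ => ?_
  rw [hs]; ring

/-- Cauchy–Schwarz for the inner product of `G` and the vectors `v` and `w = G⁻¹ a`: the quadratic
polynomial `t ↦ ⟨tv - w, G(tv - w)⟩` is nonnegative, hence has nonpositive discriminant. -/
theorem sq_dotProduct_le_of_posDef {G : Matrix (Fin n) (Fin n) ℝ} (hG : G.PosDef)
    (a v : Fin n → ℝ) : (a ⬝ᵥ v) ^ 2 ≤ (a ⬝ᵥ G⁻¹.mulVec a) * (v ⬝ᵥ G.mulVec v) := by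
  have hdet : IsUnit G.det := (Matrix.isUnit_iff_isUnit_det _).1 hG.isUnit
  have hT : G.transpose = G := by simpa using hG.isHermitian.eq
  set w := G⁻¹.mulVec a
  have hw : G.mulVec w = a := by
    rw [Matrix.mulVec_mulVec, Matrix.mul_nonsing_inv _ hdet, Matrix.one_mulVec]
  have hvw : v ⬝ᵥ G.mulVec w = w ⬝ᵥ G.mulVec v := by
    rw [Matrix.dotProduct_mulVec, dotProduct_comm, ← Matrix.mulVec_transpose, hT]
  have key (t : ℝ) : 0 ≤ (v ⬝ᵥ G.mulVec v) * (t * t) + (-2 * (a ⬝ᵥ v)) * t + a ⬝ᵥ w := by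
    have h := hG.posSemidef.dotProduct_mulVec_nonneg (t • v - w)
    have e : star (t • v - w) ⬝ᵥ G.mulVec (t • v - w) =
        (v ⬝ᵥ G.mulVec v) * (t * t) + (-2 * (a ⬝ᵥ v)) * t + a ⬝ᵥ w := by
      simp only [star_trivial, Matrix.mulVec_sub, Matrix.mulVec_smul, sub_dotProduct,
        dotProduct_sub, smul_dotProduct, dotProduct_smul, smul_eq_mul, ← hvw, hw]
      rw [dotProduct_comm v a, dotProduct_comm w a]; ring
    rwa [e] at h
  have := discrim_le_zero key
  rw [discrim] at this
  nlinarith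

theorem dualForm_self (hsymm : ∀ v w, B v w = B w v) (α : V →L[ℝ] ℂ) :
    dualForm B b α α = (((fun i => (α (b i)).re) ⬝ᵥ (gramMatrix B b)⁻¹.mulVec
      (fun i => (α (b i)).re) + (fun i => (α (b i)).im) ⬝ᵥ (gramMatrix B b)⁻¹.mulVec
      (fun i => (α (b i)).im) : ℝ) : ℂ) := by
  have hreal : ((dualForm B b α α).re : ℂ) = dualForm B b α α :=
    Complex.conj_eq_iff_re.1 (conj_dualForm hsymm α α)
  rw [← hreal]
  congr 1
  simp only [dualForm, Complex.re_sum, dotProduct, Matrix.mulVec, Finset.mul_sum,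
    ← Finset.sum_add_distrib]
  refine Finset.sum_congr rfl fun i _ => Finset.sum_congr rfl fun j _ => ?_
  simp
  ring

theorem dualForm_self_re_nonneg (hsymm : ∀ v w, B v w = B w v) (hpos : ∀ v, v ≠ 0 → 0 < B v v)
    (hb : LinearIndependent ℝ b) (α : V →L[ℝ] ℂ) : 0 ≤ (dualForm B b α α).re := by
  have hS := (posDef_gramMatrix hsymm hpos hb).inv.posSemidef
  rw [dualForm_self hsymm, Complex.ofReal_re]
  exact add_nonneg (by simpa using hS.dotProduct_mulVec_nonneg (fun i => (α (b i)).re))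
    (by simpa using hS.dotProduct_mulVec_nonneg (fun i => (α (b i)).im))

/-- The real Cauchy–Schwarz inequality is applied to the real and imaginary parts of `α` separately.
The intended `v` is the unit normal of the collar, whose derivative is thereby bounded by the full
energy density. -/
theorem norm_sq_apply_le_dualForm (hsymm : ∀ v w, B v w = B w v)
    (hpos : ∀ v, v ≠ 0 → 0 < B v v) (hb : LinearIndependent ℝ b) (α : V →L[ℝ] ℂ) (v : V)
    (hv : v ∈ Submodule.span ℝ (range b)) :
    ‖α v‖ ^ 2 ≤ (dualForm B b α α).re * B v v := by
  have hG := posDef_gramMatrix hsymm hpos hb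
  obtain ⟨x, rfl⟩ := (Submodule.mem_span_range_iff_exists_fun ℝ).1 hv
  have hB : B (∑ i, x i • b i) (∑ i, x i • b i) = x ⬝ᵥ (gramMatrix B b).mulVec x := by
    simp only [dotProduct, Matrix.mulVec, gramMatrix, Matrix.of_apply, map_sum, map_smul,
      sum_apply, smul_apply, smul_eq_mul,
      Finset.mul_sum]
    rw [Finset.sum_comm]
    exact Finset.sum_congr rfl fun i _ => Finset.sum_congr rfl fun j _ => by ring
  have hre : (α (∑ i, x i • b i)).re = (fun i => (α (b i)).re) ⬝ᵥ x := by
    simp [dotProduct, mul_comm]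
  have him : (α (∑ i, x i • b i)).im = (fun i => (α (b i)).im) ⬝ᵥ x := by
    simp [dotProduct, mul_comm]
  rw [dualForm_self hsymm, Complex.ofReal_re, hB, ← Complex.normSq_eq_norm_sq,
    Complex.normSq_apply, hre, him]
  have h1 := sq_dotProduct_le_of_posDef hG (fun i => (α (b i)).re) x
  have h2 := sq_dotProduct_le_of_posDef hG (fun i => (α (b i)).im) x
  nlinarith

end LinearAlgebra

/-- Charts and collars are continuous only on a measurable set, and arbitrary elsewhere;
measurability is obtained on the subtype and pushed forward. -/
theorem measurableSet_inter_preimage_of_continuousOn {X Y : Type*} [TopologicalSpace X]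
    [MeasurableSpace X] [OpensMeasurableSpace X] [TopologicalSpace Y] [MeasurableSpace Y]
    [BorelSpace Y] {f : X → Y} {s : Set X} (hf : ContinuousOn f s) (hs : MeasurableSet s)
    {t : Set Y} (ht : MeasurableSet t) : MeasurableSet (s ∩ f ⁻¹' t) := by
  have h1 : Measurable fun x : s => f x := (continuousOn_iff_continuous_domRestrict.1 hf).measurable
  have h2 := hs.subtype_image (h1 ht)
  convert h2 using 1
  ext x
  simp [and_comm]

/-- The matrix of an endomorphism of `ℝⁿ`. -/
def matrixOf {n : ℕ} (L : EuclideanSpace ℝ (Fin n) →L[ℝ] EuclideanSpace ℝ (Fin n)) :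
    Matrix (Fin n) (Fin n) ℝ := Matrix.of fun k i => L (RiemMfd.stdVec n i) k

section MatrixOf

variable {n : ℕ} (L : EuclideanSpace ℝ (Fin n) →L[ℝ] EuclideanSpace ℝ (Fin n))

theorem sum_smul_stdVec (v : EuclideanSpace ℝ (Fin n)) : ∑ k, v k • RiemMfd.stdVec n k = v := by
  ext i
  simp [RiemMfd.stdVec, Pi.single_apply]

theorem apply_stdVec_eq_sum (i : Fin n) :
    L (RiemMfd.stdVec n i) = ∑ k, matrixOf L k i • RiemMfd.stdVec n k :=
  (sum_smul_stdVec _).symm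

theorem det_matrixOf : (matrixOf L).det = L.det := by
  rw [ContinuousLinearMap.det,
    ← LinearMap.det_toMatrix (EuclideanSpace.basisFun (Fin n) ℝ).toBasis]
  congr 1

theorem isUnit_det_matrixOf {L' : EuclideanSpace ℝ (Fin n) →L[ℝ] EuclideanSpace ℝ (Fin n)}
    (h : L' ∘L L = ContinuousLinearMap.id ℝ _) : IsUnit (matrixOf L).det := by
  rw [det_matrixOf]
  have h1 : L'.det * L.det = 1 := by
    rw [ContinuousLinearMap.det, ContinuousLinearMap.det, ← LinearMap.det_comp]
    have h' : (L' : EuclideanSpace ℝ (Fin n) →ₗ[ℝ] EuclideanSpace ℝ (Fin n)) ∘ₗ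
        (L : EuclideanSpace ℝ (Fin n) →ₗ[ℝ] EuclideanSpace ℝ (Fin n)) = LinearMap.id := by
      ext1 v
      exact DFunLike.congr_fun h v
    rw [h', LinearMap.det_id]
  exact IsUnit.of_mul_eq_one _ (by rw [mul_comm]; exact h1)

theorem linearIndependent_stdVec : LinearIndependent ℝ (RiemMfd.stdVec n) := by
  refine Fintype.linearIndependent_iff.2 fun g hg i => ?_
  have h := sum_smul_stdVec (WithLp.toLp 2 g)
  simp only at h
  rw [hg] at h
  exact (congrArg (fun v : EuclideanSpace ℝ (Fin n) => v i) h).symm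

end MatrixOf

/-! ### The Riemannian volume in charts -/

namespace RiemMfd

variable {n : ℕ} (M : RiemMfd.{u} n)

/-- The coordinate fields are the frame of the tangent bundle trivialization at `x₀`. Their
smoothness, and with it the continuity of the Gram matrix in a chart, is inherited from the
trivialization. -/
theorem coordVec_eq_symm (x₀ : M) {z : EuclideanSpace ℝ (Fin n)}
    (hz : z ∈ (extChartAt M.I x₀).target) (i : Fin n) :
    M.coordVec x₀ z i = (trivializationAt (EuclideanSpace ℝ (Fin n)) (TangentSpace M.I) x₀).symm
      ((extChartAt M.I x₀).symm z) (stdVec n i) := by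
  have hx : (extChartAt M.I x₀).symm z ∈ (chartAt M.model x₀).source := by
    simpa using (extChartAt M.I x₀).map_target hz
  have h := TangentBundle.symmL_trivializationAt (𝕜 := ℝ) (I := M.I) hx
  rw [(extChartAt M.I x₀).right_inv hz] at h
  have h' := DFunLike.congr_fun h (stdVec n i)
  rw [Bundle.Trivialization.symmL_apply _ (by simpa using hx)] at h'
  exact h'.symm

theorem contMDiffOn_coordVec (x₀ : M) (i : Fin n) :
    ContMDiffOn 𝓘(ℝ, EuclideanSpace ℝ (Fin n)) (M.I.prod 𝓘(ℝ, EuclideanSpace ℝ (Fin n))) ∞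
      (fun z => Bundle.TotalSpace.mk' (EuclideanSpace ℝ (Fin n)) (E := TangentSpace M.I)
        ((extChartAt M.I x₀).symm z) (M.coordVec x₀ z i)) (extChartAt M.I x₀).target := by
  set e := trivializationAt (EuclideanSpace ℝ (Fin n)) (TangentSpace M.I) x₀ with he
  have h1 : ContMDiffOn 𝓘(ℝ, EuclideanSpace ℝ (Fin n)) (M.I.prod 𝓘(ℝ, EuclideanSpace ℝ (Fin n))) ∞
      (fun z => ((extChartAt M.I x₀).symm z, stdVec n i)) (extChartAt M.I x₀).target :=
    (contMDiffOn_extChartAt_symm x₀).prodMk contMDiffOn_const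
  have h2 := (e.contMDiffOn_symm (n := ∞) (IB := M.I)).comp h1 (fun z hz => by
    rw [e.target_eq]
    refine ⟨?_, mem_univ _⟩
    simpa [he] using (extChartAt M.I x₀).map_target hz)
  refine h2.congr fun z hz => ?_
  rw [M.coordVec_eq_symm x₀ hz]
  exact (e.mk_symm (by simpa [he] using (extChartAt M.I x₀).map_target hz) _)

theorem continuousOn_chartGram (x₀ : M) :
    ContinuousOn (M.chartGram x₀) (extChartAt M.I x₀).target := by
  refine continuousOn_pi.2 fun i => continuousOn_pi.2 fun j => ?_
  have h : ContMDiffOn 𝓘(ℝ, EuclideanSpace ℝ (Fin n)) (M.I.prod 𝓘(ℝ, ℝ)) ∞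
      (fun z => Bundle.TotalSpace.mk' ℝ (E := Bundle.Trivial M ℝ) ((extChartAt M.I x₀).symm z)
        (M.metric.inner ((extChartAt M.I x₀).symm z) (M.coordVec x₀ z i) (M.coordVec x₀ z j)))
      (extChartAt M.I x₀).target := by
    refine ContMDiffOn.clm_bundle_apply₂ (F₁ := EuclideanSpace ℝ (Fin n))
      (F₂ := EuclideanSpace ℝ (Fin n)) ?_ (M.contMDiffOn_coordVec x₀ i)
      (M.contMDiffOn_coordVec x₀ j)
    exact M.metric.contMDiff.comp_contMDiffOn (contMDiffOn_extChartAt_symm x₀)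
  intro z hz
  have h' := h z hz
  rw [Bundle.contMDiffWithinAt_totalSpace] at h'
  exact h'.2.continuousWithinAt

theorem measurableSet_extChartAt_target (x₀ : M) :
    MeasurableSet (extChartAt M.I x₀).target := by
  rw [extChartAt_target]
  exact ((chartAt M.model x₀).open_target.preimage M.I.continuous_symm).measurableSet.inter
    M.I.isClosed_range.measurableSet

theorem aemeasurable_extChartAt_symm (x₀ : M) :
    AEMeasurable (extChartAt M.I x₀).symm (volume.restrict (extChartAt M.I x₀).target) :=
  (continuousOn_extChartAt_symm x₀).aemeasurable (M.measurableSet_extChartAt_target x₀)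

theorem lintegral_chartVol (x₀ : M) {f : M → ENNReal} (hf : Measurable f) :
    ∫⁻ x, f x ∂M.chartVol x₀ = ∫⁻ z in (extChartAt M.I x₀).target,
      ENNReal.ofReal (Real.sqrt (M.chartGram x₀ z).det) * f ((extChartAt M.I x₀).symm z) := by
  have h1 := M.aemeasurable_extChartAt_symm x₀
  rw [chartVol, lintegral_map' hf.aemeasurable
    (h1.mono_ac (withDensity_absolutelyContinuous _ _))]
  refine (lintegral_withDensity_eq_lintegral_mul₀ ?_ (hf.comp_aemeasurable h1)).trans rfl
  · refine ENNReal.measurable_ofReal.comp_aemeasurable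
      (Real.continuous_sqrt.measurable.comp_aemeasurable ?_)
    exact (Continuous.comp_continuousOn (Continuous.matrix_det continuous_id)
      (M.continuousOn_chartGram x₀)).aemeasurable (M.measurableSet_extChartAt_target x₀)

theorem isOpen_extChartAt_source (x₀ : M) : IsOpen (extChartAt M.I x₀).source :=
  _root_.isOpen_extChartAt_source x₀

theorem measurableSet_extChartAt_source (x₀ : M) : MeasurableSet (extChartAt M.I x₀).source :=
  (M.isOpen_extChartAt_source x₀).measurableSet

/-- The chart measure of a parametrized set, by change of variables. -/
theorem chartVol_image (x₁ : M) {s : Set (EuclideanSpace ℝ (Fin n))} (hs : MeasurableSet s)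
    {F : EuclideanSpace ℝ (Fin n) → M} (hF : InjOn F s)
    (hsrc : MapsTo F s (extChartAt M.I x₁).source)
    {D : EuclideanSpace ℝ (Fin n) → EuclideanSpace ℝ (Fin n) →L[ℝ] EuclideanSpace ℝ (Fin n)}
    (hD : ∀ z ∈ s, HasFDerivWithinAt (extChartAt M.I x₁ ∘ F) (D z) s z) :
    MeasurableSet (F '' s) ∧ M.chartVol x₁ (F '' s) = ∫⁻ z in s, ENNReal.ofReal |(D z).det| *
      ENNReal.ofReal (Real.sqrt (M.chartGram x₁ (extChartAt M.I x₁ (F z))).det) := by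
  set φ := extChartAt M.I x₁
  have hinj : InjOn (φ ∘ F) s := φ.injOn.comp hF hsrc
  -- Seen in the chart, the image is measurable because an injective differentiable map sends
  -- measurable sets to measurable sets; `himg` pulls this back to `M`.
  have hT : MeasurableSet ((φ ∘ F) '' s) := measurable_image_of_fderivWithin hs hD hinj
  have himg : F '' s = φ.source ∩ φ ⁻¹' ((φ ∘ F) '' s) := by
    ext x
    constructor
    · rintro ⟨z, hz, rfl⟩
      exact ⟨hsrc hz, z, hz, rfl⟩
    · rintro ⟨hx, z, hz, hzx⟩
      exact ⟨z, hz, φ.injOn (hsrc hz) hx hzx⟩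
  have hm : MeasurableSet (F '' s) := by
    rw [himg]
    exact measurableSet_inter_preimage_of_continuousOn (continuousOn_extChartAt x₁)
      (M.measurableSet_extChartAt_source x₁) hT
  refine ⟨hm, ?_⟩
  refine Eq.trans ?_ (lintegral_image_eq_lintegral_abs_det_fderiv_mul volume hs hD hinj
    (fun z => ENNReal.ofReal (Real.sqrt (M.chartGram x₁ z).det)))
  rw [← lintegral_indicator_one hm,
    M.lintegral_chartVol x₁ (measurable_one.indicator hm), ← lintegral_indicator hT,
    ← lintegral_indicator (M.measurableSet_extChartAt_target x₁)]
  refine lintegral_congr fun z => ?_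
  by_cases hz : z ∈ φ.target
  · by_cases hz' : z ∈ (φ ∘ F) '' s
    · have : φ.symm z ∈ F '' s := by
        rw [himg]
        exact ⟨φ.map_target hz, by rw [mem_preimage, φ.right_inv hz]; exact hz'⟩
      rw [indicator_of_mem hz, indicator_of_mem hz', indicator_of_mem this, Pi.one_apply, mul_one]
    · have : φ.symm z ∉ F '' s := by
        rw [himg]
        rintro ⟨-, h⟩
        rw [mem_preimage, φ.right_inv hz] at h
        exact hz' h
      rw [indicator_of_mem hz, indicator_of_notMem hz', indicator_of_notMem this, mul_zero]
  · have : z ∉ (φ ∘ F) '' s := by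
      rintro ⟨w, hw, rfl⟩
      exact hz (φ.map_source (hsrc hw))
    rw [indicator_of_notMem hz, indicator_of_notMem this]

theorem gramMatrix_eq_chartGram (x₁ : M) {x : M} (hx : x ∈ (extChartAt M.I x₁).source)
    (v : Fin n → TangentSpace M.I x) (P : Matrix (Fin n) (Fin n) ℝ)
    (hP : ∀ i, (mfderiv M.I 𝓘(ℝ, EuclideanSpace ℝ (Fin n)) (extChartAt M.I x₁) x (v i) :
      EuclideanSpace ℝ (Fin n)) = ∑ k, P k i • stdVec n k) :
    gramMatrix (M.metric.inner x) v =
      P.transpose * M.chartGram x₁ (extChartAt M.I x₁ x) * P := by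
  obtain ⟨w, hw, rfl⟩ : ∃ w ∈ (extChartAt M.I x₁).target, (extChartAt M.I x₁).symm w = x :=
    ⟨_, (extChartAt M.I x₁).map_source hx, (extChartAt M.I x₁).left_inv hx⟩
  rw [(extChartAt M.I x₁).right_inv hw]
  have hv : v = fun i => ∑ k, P k i • M.coordVec x₁ w k := by
    ext1 i
    have h := DFunLike.congr_fun (mfderivWithin_extChartAt_symm_comp_mfderiv_extChartAt hw) (v i)
    refine h.symm.trans ((congrArg (mfderivWithin 𝓘(ℝ, EuclideanSpace ℝ (Fin n)) M.I
      (extChartAt M.I x₁).symm (range M.I) w) (hP i)).trans ?_)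
    refine (map_sum _ _ _).trans (Finset.sum_congr rfl fun k _ => map_smul _ _ _)
  rw [hv]
  exact gramMatrix_change _ _ _

/-- The volume density of a parametrization, in a chart. -/
theorem sqrt_det_gramMatrix_param (x₁ : M) {F : EuclideanSpace ℝ (Fin n) → M}
    {U : Set (EuclideanSpace ℝ (Fin n))} {z : EuclideanSpace ℝ (Fin n)}
    (hU : UniqueDiffWithinAt ℝ U z)
    (hF : MDifferentiableWithinAt 𝓘(ℝ, EuclideanSpace ℝ (Fin n)) M.I F U z)
    (hz : F z ∈ (extChartAt M.I x₁).source) :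
    HasFDerivWithinAt (extChartAt M.I x₁ ∘ F) (fderivWithin ℝ (extChartAt M.I x₁ ∘ F) U z) U z ∧
    Real.sqrt (gramMatrix (M.metric.inner (F z)) fun i =>
      mfderivWithin 𝓘(ℝ, EuclideanSpace ℝ (Fin n)) M.I F U z (stdVec n i)).det =
    |(fderivWithin ℝ (extChartAt M.I x₁ ∘ F) U z).det| *
      Real.sqrt (M.chartGram x₁ (extChartAt M.I x₁ (F z))).det := by
  have hφ : MDifferentiableAt M.I 𝓘(ℝ, EuclideanSpace ℝ (Fin n)) (extChartAt M.I x₁) (F z) :=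
    mdifferentiableAt_extChartAt (by simpa using hz)
  have hcomp := hφ.comp_mdifferentiableWithinAt z hF
  have hd : DifferentiableWithinAt ℝ (extChartAt M.I x₁ ∘ F) U z :=
    mdifferentiableWithinAt_iff_differentiableWithinAt.1 hcomp
  refine ⟨hd.hasFDerivWithinAt, ?_⟩
  have hD : mfderivWithin 𝓘(ℝ, EuclideanSpace ℝ (Fin n)) 𝓘(ℝ, EuclideanSpace ℝ (Fin n))
      (extChartAt M.I x₁ ∘ F) U z = (mfderiv M.I 𝓘(ℝ, EuclideanSpace ℝ (Fin n))
        (extChartAt M.I x₁) (F z)).comp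
      (mfderivWithin 𝓘(ℝ, EuclideanSpace ℝ (Fin n)) M.I F U z) :=
    mfderiv_comp_mfderivWithin z hφ hF hU.uniqueMDiffWithinAt
  rw [mfderivWithin_eq_fderivWithin] at hD
  rw [M.gramMatrix_eq_chartGram x₁ hz _ (matrixOf (fderivWithin ℝ (extChartAt M.I x₁ ∘ F) U z))]
  · rw [Matrix.det_mul, Matrix.det_mul, Matrix.det_transpose, det_matrixOf, mul_right_comm,
      Real.sqrt_mul (mul_self_nonneg _), Real.sqrt_mul_self_eq_abs]
  · intro i
    rw [← apply_stdVec_eq_sum, hD]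
    rfl

theorem uniqueDiffWithinAt_range {z : EuclideanSpace ℝ (Fin n)} (hz : z ∈ range M.I) :
    UniqueDiffWithinAt ℝ (range M.I) z := M.I.uniqueDiffOn z hz

/-- The chart measures agree on overlaps. -/
theorem chartVol_eq_of_subset (x₀ x₁ : M) {A : Set M} (hA : MeasurableSet A)
    (h₀ : A ⊆ (extChartAt M.I x₀).source) (h₁ : A ⊆ (extChartAt M.I x₁).source) :
    M.chartVol x₀ A = M.chartVol x₁ A := by
  set φ := extChartAt M.I x₀
  set s := φ.target ∩ φ.symm ⁻¹' A
  have hs : MeasurableSet s := measurableSet_inter_preimage_of_continuousOn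
    (continuousOn_extChartAt_symm x₀) (M.measurableSet_extChartAt_target x₀) hA
  have himg : φ.symm '' s = A := by
    ext x
    constructor
    · rintro ⟨z, hz, rfl⟩
      exact hz.2
    · exact fun hx => ⟨φ x, ⟨φ.map_source (h₀ hx), by
        rw [mem_preimage, φ.left_inv (h₀ hx)]; exact hx⟩, φ.left_inv (h₀ hx)⟩
  have hsub : s ⊆ range M.I := fun z hz => extChartAt_target_subset_range x₀ hz.1
  have hP (y : M) (hy : A ⊆ (extChartAt M.I y).source) (z) (hz : z ∈ s) :=
    M.sqrt_det_gramMatrix_param y (F := φ.symm) (M.uniqueDiffWithinAt_range (hsub hz))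
      (mdifferentiableWithinAt_extChartAt_symm hz.1) (hy hz.2)
  -- The set is parametrized by the inverse chart at `x₀` whatever `y` is. The Jacobian and the
  -- density of the chart at `y` combine into the Gram determinant of the parametrization, which no
  -- longer involves `y`.
  have key (y : M) (hy : A ⊆ (extChartAt M.I y).source) :
      M.chartVol y A = ∫⁻ z in s, ENNReal.ofReal (Real.sqrt (gramMatrix
        (M.metric.inner (φ.symm z)) fun i => mfderivWithin 𝓘(ℝ, EuclideanSpace ℝ (Fin n)) M.I
          φ.symm (range M.I) z (stdVec n i)).det) := by
    have h := (M.chartVol_image y hs (φ.symm.injOn.mono inter_subset_left)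
      (fun z hz => hy hz.2) (fun z hz => (hP y hy z hz).1.mono hsub)).2
    rw [himg] at h
    rw [h]
    refine setLIntegral_congr_fun hs fun z hz => ?_
    rw [(hP y hy z hz).2, ENNReal.ofReal_mul (abs_nonneg _)]
  rw [key x₀ h₀, key x₁ h₁]

theorem chartVol_compl_source (x₀ : M) : M.chartVol x₀ (extChartAt M.I x₀).sourceᶜ = 0 := by
  have hm := (M.measurableSet_extChartAt_source x₀).compl
  rw [← lintegral_indicator_one hm, M.lintegral_chartVol x₀ (measurable_one.indicator hm)]
  refine (setLIntegral_congr_fun (M.measurableSet_extChartAt_target x₀) fun z hz => ?_).trans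
    lintegral_zero
  have : (extChartAt M.I x₀).symm z ∉ (extChartAt M.I x₀).sourceᶜ :=
    fun h => h ((extChartAt M.I x₀).map_target hz)
  simp only [indicator_of_notMem this, mul_zero]

/-- Compactness gives a finite cover by chart domains, and `disjointed` makes it a partition.
Identities of measures can then be checked on pieces that lie in a single chart. -/
theorem exists_finite_partition : ∃ (m : ℕ) (c : Fin m → M) (P : Fin m → Set M),
    (∀ i, MeasurableSet (P i)) ∧ Pairwise (Function.onFun Disjoint P) ∧ ⋃ i, P i = univ ∧
      ∀ i, P i ⊆ (extChartAt M.I (c i)).source := by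
  obtain ⟨t, ht⟩ := isCompact_univ.elim_finite_subcover (fun x : M => (extChartAt M.I x).source)
    (fun x => M.isOpen_extChartAt_source x) (fun x _ => mem_iUnion.2 ⟨x, mem_extChartAt_source x⟩)
  let c : Fin t.card → M := fun i => (t.equivFin.symm i : M)
  refine ⟨t.card, c, disjointed fun i => (extChartAt M.I (c i)).source, fun i => ?_,
    disjoint_disjointed _, ?_, fun i => disjointed_subset _ i⟩
  · rw [disjointed_apply, Finset.sup_set_eq_biUnion]
    exact (M.measurableSet_extChartAt_source (c i)).diff
      (Finset.measurableSet_biUnion _ fun j _ => M.measurableSet_extChartAt_source (c j))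
  · rw [iUnion_disjointed, eq_univ_iff_forall]
    intro x
    obtain ⟨y, hy, hxy⟩ := mem_iUnion₂.1 (ht (mem_univ x))
    exact mem_iUnion.2 ⟨t.equivFin ⟨y, hy⟩, by simpa [c] using hxy⟩

/-- One inequality is the definition of the supremum. For the other, the measure `μ` glued from the
chart measures of a finite partition agrees with each chart measure on the corresponding chart
domain; it therefore dominates all of them, hence also `M.vol`. -/
theorem vol_apply_of_subset (x₀ : M) {A : Set M} (hA : MeasurableSet A)
    (h₀ : A ⊆ (extChartAt M.I x₀).source) : M.vol A = M.chartVol x₀ A := by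
  obtain ⟨m, c, P, hPm, hPd, hPu, hPs⟩ := M.exists_finite_partition
  set μ : Measure M := Measure.sum fun i => (M.chartVol (c i)).restrict (P i) with hμ
  have hsplit (ν : Measure M) (B : Set M) (hB : MeasurableSet B) : ν B = ∑' i, ν (B ∩ P i) := by
    rw [← measure_iUnion (fun i j hij => (hPd hij).mono inter_subset_right inter_subset_right)
      (fun i => hB.inter (hPm i)), ← inter_iUnion, hPu, inter_univ]
  have hμB (B : Set M) (hB : MeasurableSet B) : μ B = ∑' i, M.chartVol (c i) (B ∩ P i) := by
    rw [hμ, Measure.sum_apply _ hB]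
    exact tsum_congr fun i => Measure.restrict_apply hB
  have hinter (x : M) (B : Set M) (hB : MeasurableSet B) :
      M.chartVol x B = μ (B ∩ (extChartAt M.I x).source) := by
    have h1 : M.chartVol x B = M.chartVol x (B ∩ (extChartAt M.I x).source) :=
      (measure_inter_conull (M.chartVol_compl_source x)).symm
    have hBx := hB.inter (M.measurableSet_extChartAt_source x)
    rw [h1, hsplit _ _ hBx, hμB _ hBx]
    exact tsum_congr fun i => M.chartVol_eq_of_subset x (c i) (hBx.inter (hPm i))
      (inter_subset_left.trans inter_subset_right) (inter_subset_right.trans (hPs i))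
  have hle : M.vol ≤ μ := iSup_le fun x => Measure.le_intro fun B hB _ => by
    rw [hinter x B hB]
    exact measure_mono inter_subset_left
  refine le_antisymm ?_ (le_iSup M.chartVol x₀ A)
  rw [hinter x₀ A hA, inter_eq_self_of_subset_left h₀]
  exact hle A

end RiemMfd

/-! ### Finiteness of the volume, and covectors in charts -/

namespace RiemMfd

variable {n : ℕ} (M : RiemMfd.{u} n)

/-- The density is continuous in the chart, so near the centre it is below its value there plus one.
Compactness turns this local finiteness into finiteness of the volume. -/
theorem exists_open_vol_lt_top (x : M) : ∃ U ∈ 𝓝 x, M.vol U < ⊤ := by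
  set φ := extChartAt M.I x
  have hc : ContinuousOn (fun z => Real.sqrt (M.chartGram x z).det) φ.target :=
    Real.continuous_sqrt.comp_continuousOn
      ((Continuous.matrix_det continuous_id).comp_continuousOn (M.continuousOn_chartGram x))
  have hx : φ x ∈ φ.target := mem_extChartAt_target x
  set C := Real.sqrt (M.chartGram x (φ x)).det + 1
  have hev : ∀ᶠ z in 𝓝[φ.target] (φ x), Real.sqrt (M.chartGram x z).det < C :=
    (hc _ hx).eventually_lt_const (lt_add_one _)
  obtain ⟨r, hr, hball⟩ := Metric.mem_nhdsWithin_iff.1 hev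
  set A := φ.source ∩ φ ⁻¹' (Metric.ball (φ x) r)
  have hAo : IsOpen A := (continuousOn_extChartAt x).isOpen_inter_preimage
    (M.isOpen_extChartAt_source x) Metric.isOpen_ball
  refine ⟨A, hAo.mem_nhds ⟨mem_extChartAt_source x, Metric.mem_ball_self hr⟩, ?_⟩
  rw [M.vol_apply_of_subset x hAo.measurableSet inter_subset_left,
    ← lintegral_indicator_one hAo.measurableSet,
    M.lintegral_chartVol x (measurable_one.indicator hAo.measurableSet)]
  calc _ ≤ ∫⁻ z in φ.target, (Metric.ball (φ x) r).indicator (fun _ => ENNReal.ofReal C) z := by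
        refine setLIntegral_mono' (M.measurableSet_extChartAt_target x) fun z hz => ?_
        by_cases hzA : φ.symm z ∈ A
        · have hzb : z ∈ Metric.ball (φ x) r := by
            have := hzA.2
            rwa [mem_preimage, φ.right_inv hz] at this
          rw [indicator_of_mem hzb, indicator_of_mem hzA, Pi.one_apply, mul_one]
          exact ENNReal.ofReal_le_ofReal (le_of_lt (hball ⟨hzb, hz⟩))
        · rw [indicator_of_notMem hzA, mul_zero]
          exact zero_le
    _ ≤ ∫⁻ z, (Metric.ball (φ x) r).indicator (fun _ => ENNReal.ofReal C) z :=
        setLIntegral_le_lintegral _ _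
    _ = ENNReal.ofReal C * volume (Metric.ball (φ x) r) :=
        lintegral_indicator_const Metric.isOpen_ball.measurableSet _
    _ < ⊤ := ENNReal.mul_lt_top ENNReal.ofReal_lt_top measure_ball_lt_top

instance : IsFiniteMeasure M.vol := by
  have : IsLocallyFiniteMeasure M.vol := ⟨fun x => M.exists_open_vol_lt_top x⟩
  infer_instance

/-- The derivative of the inverse chart has the derivative of the chart as a left inverse. So a
coordinate frame differs from the standard frame of the tangent space by an invertible matrix, and
`dualForm_change` applies. -/
theorem isUnit_det_mfderivWithin_symm (x₀ : M) {w : EuclideanSpace ℝ (Fin n)}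
    (hw : w ∈ (extChartAt M.I x₀).target) :
    ∃ P : Matrix (Fin n) (Fin n) ℝ, IsUnit P.det ∧
      M.coordVec x₀ w = fun i => ∑ k, P k i • M.tanVec ((extChartAt M.I x₀).symm w) k := by
  let L : EuclideanSpace ℝ (Fin n) →L[ℝ] EuclideanSpace ℝ (Fin n) :=
    mfderivWithin 𝓘(ℝ, EuclideanSpace ℝ (Fin n)) M.I (extChartAt M.I x₀).symm (range M.I) w
  let L' : EuclideanSpace ℝ (Fin n) →L[ℝ] EuclideanSpace ℝ (Fin n) :=
    mfderiv M.I 𝓘(ℝ, EuclideanSpace ℝ (Fin n)) (extChartAt M.I x₀)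
      ((extChartAt M.I x₀).symm w)
  have h : L' ∘L L = ContinuousLinearMap.id ℝ _ :=
    mfderiv_extChartAt_comp_mfderivWithin_extChartAt_symm hw
  refine ⟨matrixOf L, isUnit_det_matrixOf L h, funext fun i => ?_⟩
  exact apply_stdVec_eq_sum L i

theorem posDef_chartGram (x₀ : M) {w : EuclideanSpace ℝ (Fin n)}
    (hw : w ∈ (extChartAt M.I x₀).target) : (M.chartGram x₀ w).PosDef := by
  obtain ⟨P, hP, h⟩ := M.isUnit_det_mfderivWithin_symm x₀ hw
  have h1 : M.chartGram x₀ w = gramMatrix (M.metric.inner ((extChartAt M.I x₀).symm w))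
      (M.coordVec x₀ w) := rfl
  have hG : (gramMatrix (M.metric.inner ((extChartAt M.I x₀).symm w))
      (M.tanVec ((extChartAt M.I x₀).symm w))).PosDef :=
    posDef_gramMatrix (M.metric.symm _) (M.metric.pos _) linearIndependent_stdVec
  rw [h1, h, gramMatrix_change]
  have := hG.conjTranspose_mul_mul_same (B := P)
    (Matrix.mulVec_injective_of_isUnit ((Matrix.isUnit_iff_isUnit_det P).2 hP))
  simpa using this

/-- The inner product of covectors, computed in the chart at `x₀`. -/
theorem coInner_eq_chart (x₀ : M) {w : EuclideanSpace ℝ (Fin n)}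
    (hw : w ∈ (extChartAt M.I x₀).target)
    (α β : TangentSpace M.I ((extChartAt M.I x₀).symm w) →L[ℝ] ℂ) :
    M.coInner _ α β = ∑ i, ∑ j, (((M.chartGram x₀ w)⁻¹ i j : ℝ) : ℂ) *
      conj (α (M.coordVec x₀ w i)) * β (M.coordVec x₀ w j) := by
  obtain ⟨P, hP, h⟩ := M.isUnit_det_mfderivWithin_symm x₀ hw
  have h1 := dualForm_change (M.metric.inner ((extChartAt M.I x₀).symm w))
    (M.tanVec ((extChartAt M.I x₀).symm w)) P hP α β
  rw [← h] at h1
  exact h1.symm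

theorem coInner_add_right (x : M) (α β γ : TangentSpace M.I x →L[ℝ] ℂ) :
    M.coInner x α (β + γ) = M.coInner x α β + M.coInner x α γ :=
  dualForm_add_right (B := M.metric.inner x) (b := M.tanVec x) α β γ

theorem coInner_smul_right (x : M) (α β : TangentSpace M.I x →L[ℝ] ℂ) (c : ℂ) :
    M.coInner x α (c • β) = c * M.coInner x α β :=
  dualForm_smul_right (B := M.metric.inner x) (b := M.tanVec x) α β c

theorem conj_coInner (x : M) (α β : TangentSpace M.I x →L[ℝ] ℂ) :
    conj (M.coInner x α β) = M.coInner x β α :=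
  conj_dualForm (B := M.metric.inner x) (b := M.tanVec x) (M.metric.symm x) α β

theorem coInner_self_re_nonneg (x : M) (α : TangentSpace M.I x →L[ℝ] ℂ) :
    0 ≤ (M.coInner x α α).re :=
  dualForm_self_re_nonneg (B := M.metric.inner x) (b := M.tanVec x) (M.metric.symm x)
    (M.metric.pos x) linearIndependent_stdVec α

theorem norm_sq_apply_le_coInner (x : M) (α : TangentSpace M.I x →L[ℝ] ℂ)
    (v : TangentSpace M.I x) : ‖α v‖ ^ 2 ≤ (M.coInner x α α).re * M.metric.inner x v v := by
  refine norm_sq_apply_le_dualForm (B := M.metric.inner x) (b := M.tanVec x) (M.metric.symm x)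
    (M.metric.pos x) linearIndependent_stdVec α v ?_
  exact (Submodule.mem_span_range_iff_exists_fun ℝ).2
    ⟨fun k => WithLp.ofLp (show EuclideanSpace ℝ (Fin n) from v) k, sum_smul_stdVec (n := n) v⟩

/-! ### Smooth functions on the product of an interval and a manifold -/

section Product

variable {M} {T : Set ℝ} {w : ℝ × M → ℂ}

theorem contDiffOn_chart (hw : ContMDiffOn (𝓘(ℝ, ℝ).prod M.I) 𝓘(ℝ, ℂ) ∞ w (T ×ˢ univ))
    (x₀ : M) : ContDiffOn ℝ ∞ (fun p : ℝ × EuclideanSpace ℝ (Fin n) =>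
      w (p.1, (extChartAt M.I x₀).symm p.2)) (T ×ˢ (extChartAt M.I x₀).target) := by
  have h := hw.comp ((contMDiffOn_fst (I := 𝓘(ℝ, ℝ)) (J := 𝓘(ℝ, EuclideanSpace ℝ (Fin n)))
    (s := T ×ˢ (extChartAt M.I x₀).target)).prodMk
    ((contMDiffOn_extChartAt_symm x₀).comp contMDiffOn_snd fun p hp => hp.2))
    fun p hp => ⟨hp.1, mem_univ _⟩
  rw [← contMDiffOn_iff_contDiffOn, modelWithCornersSelf_prod, ← chartedSpaceSelf_prod]
  exact h

theorem contMDiff_slice (hw : ContMDiffOn (𝓘(ℝ, ℝ).prod M.I) 𝓘(ℝ, ℂ) ∞ w (T ×ˢ univ))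
    {s : ℝ} (hs : s ∈ T) : M.Smooth fun y => w (s, y) := by
  have : ContMDiffOn M.I 𝓘(ℝ, ℂ) ∞ (fun y => w (s, y)) univ :=
    hw.comp (contMDiffOn_const.prodMk contMDiffOn_id) fun y _ => ⟨hs, mem_univ _⟩
  exact contMDiffOn_univ.1 this

/-- The derivative in `s`, here, and those along `M`, in `d_coordVec_eq_fderivWithin_chart`, are
values of the Fréchet derivative of a single smooth function of `(s, z)`, which yields their joint
continuity. Derivatives are taken within `T` because `T` may contain an end point. -/
theorem hasDerivWithinAt_chart
    (hw : ContMDiffOn (𝓘(ℝ, ℝ).prod M.I) 𝓘(ℝ, ℂ) ∞ w (T ×ˢ univ)) (x₀ : M)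
    {s : ℝ} (hs : s ∈ T) {y : M} (hy : y ∈ (extChartAt M.I x₀).source) :
    HasDerivWithinAt (fun t => w (t, y)) (fderivWithin ℝ (fun p : ℝ × EuclideanSpace ℝ (Fin n) =>
        w (p.1, (extChartAt M.I x₀).symm p.2)) (T ×ˢ (extChartAt M.I x₀).target)
        (s, extChartAt M.I x₀ y) (1, 0)) T s := by
  have hyt := (extChartAt M.I x₀).map_source hy
  have hd := ((contDiffOn_chart hw x₀).differentiableOn (by simp) (s, extChartAt M.I x₀ y)
    ⟨hs, hyt⟩).hasFDerivWithinAt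
  have hi : HasDerivWithinAt (fun t : ℝ => (t, extChartAt M.I x₀ y))
      ((1 : ℝ), (0 : EuclideanSpace ℝ (Fin n))) T s :=
    (hasDerivWithinAt_id s T).prodMk (hasDerivWithinAt_const s T _)
  have h := hd.comp_hasDerivWithinAt s hi fun t ht => mk_mem_prod ht hyt
  simp only [Function.comp_def, (extChartAt M.I x₀).left_inv hy] at h
  exact h

theorem d_coordVec_eq_fderivWithin_chart
    (hw : ContMDiffOn (𝓘(ℝ, ℝ).prod M.I) 𝓘(ℝ, ℂ) ∞ w (T ×ˢ univ)) (x₀ : M)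
    {s : ℝ} (hs : s ∈ T) {z : EuclideanSpace ℝ (Fin n)} (hz : z ∈ (extChartAt M.I x₀).target)
    (i : Fin n) :
    M.d (fun y => w (s, y)) ((extChartAt M.I x₀).symm z) (M.coordVec x₀ z i) =
      fderivWithin ℝ (fun p : ℝ × EuclideanSpace ℝ (Fin n) =>
        w (p.1, (extChartAt M.I x₀).symm p.2)) (T ×ˢ (extChartAt M.I x₀).target)
        (s, z) (0, stdVec n i) := by
  have hzr : z ∈ range M.I := extChartAt_target_subset_range x₀ hz
  have hslice : MDifferentiableAt M.I 𝓘(ℝ, ℂ) (fun y => w (s, y)) ((extChartAt M.I x₀).symm z) :=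
    (contMDiff_slice hw hs).mdifferentiable (by simp) _
  have h1 : mfderivWithin 𝓘(ℝ, EuclideanSpace ℝ (Fin n)) 𝓘(ℝ, ℂ)
      ((fun y => w (s, y)) ∘ (extChartAt M.I x₀).symm) (range M.I) z =
      (mfderiv M.I 𝓘(ℝ, ℂ) (fun y => w (s, y)) ((extChartAt M.I x₀).symm z)).comp
        (mfderivWithin 𝓘(ℝ, EuclideanSpace ℝ (Fin n)) M.I (extChartAt M.I x₀).symm
          (range M.I) z) :=
    mfderiv_comp_mfderivWithin z hslice (mdifferentiableWithinAt_extChartAt_symm hz)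
      (M.uniqueDiffWithinAt_range hzr).uniqueMDiffWithinAt
  have h2 : M.d (fun y => w (s, y)) ((extChartAt M.I x₀).symm z) (M.coordVec x₀ z i) =
      fderivWithin ℝ ((fun y => w (s, y)) ∘ (extChartAt M.I x₀).symm) (range M.I) z
        (stdVec n i) := by
    rw [← mfderivWithin_eq_fderivWithin, h1]
    rfl
  rw [h2]
  have hd := ((contDiffOn_chart hw x₀).differentiableOn (by simp) (s, z)
    ⟨hs, hz⟩).hasFDerivWithinAt
  have hi : HasFDerivWithinAt (fun v : EuclideanSpace ℝ (Fin n) => (s, v))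
      (ContinuousLinearMap.inr ℝ ℝ (EuclideanSpace ℝ (Fin n))) (extChartAt M.I x₀).target z :=
    hasFDerivAt_prodMk_right s z |>.hasFDerivWithinAt
  have h := hd.comp z hi fun t ht => ⟨hs, ht⟩
  have hn : (extChartAt M.I x₀).target ∈ 𝓝[range M.I] z :=
    extChartAt_target_mem_nhdsWithin_of_mem hz
  have h' := h.mono_of_mem_nhdsWithin hn
  have := h'.fderivWithin (M.uniqueDiffWithinAt_range hzr)
  simp only [Function.comp_def] at this ⊢
  rw [this]
  simp

theorem continuousOn_fderivWithin_chart (hT : UniqueDiffOn ℝ T)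
    (hw : ContMDiffOn (𝓘(ℝ, ℝ).prod M.I) 𝓘(ℝ, ℂ) ∞ w (T ×ˢ univ)) (x₀ : M)
    (v : ℝ × EuclideanSpace ℝ (Fin n)) :
    ContinuousOn (fun p : ℝ × M => fderivWithin ℝ (fun p : ℝ × EuclideanSpace ℝ (Fin n) =>
        w (p.1, (extChartAt M.I x₀).symm p.2)) (T ×ˢ (extChartAt M.I x₀).target)
        (p.1, extChartAt M.I x₀ p.2) v) (T ×ˢ (extChartAt M.I x₀).source) := by
  have h := (contDiffOn_chart hw x₀).continuousOn_fderivWithin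
    (hT.prod (uniqueDiffOn_extChartAt_target x₀)) (by simp)
  have h2 : ContinuousOn (fun p : ℝ × M => (p.1, extChartAt M.I x₀ p.2))
      (T ×ˢ (extChartAt M.I x₀).source) :=
    continuousOn_fst.prodMk ((continuousOn_extChartAt x₀).comp continuousOn_snd fun p hp => hp.2)
  exact (h.comp h2 fun p hp => ⟨hp.1, (extChartAt M.I x₀).map_source hp.2⟩).clm_apply
    continuousOn_const

theorem prod_source_mem_nhdsWithin (x₀ : M) (s : ℝ) :
    T ×ˢ (extChartAt M.I x₀).source ∈ 𝓝[T ×ˢ univ] (s, x₀) := by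
  have : univ ×ˢ (extChartAt M.I x₀).source ∈ 𝓝 (s, x₀) :=
    (isOpen_univ.prod (M.isOpen_extChartAt_source x₀)).mem_nhds
      ⟨mem_univ _, mem_extChartAt_source x₀⟩
  filter_upwards [mem_nhdsWithin_of_mem_nhds this, self_mem_nhdsWithin] with p hp hp'
  exact ⟨hp'.1, hp.2⟩

theorem continuousOn_derivWithin (hT : UniqueDiffOn ℝ T)
    (hw : ContMDiffOn (𝓘(ℝ, ℝ).prod M.I) 𝓘(ℝ, ℂ) ∞ w (T ×ˢ univ)) :
    ContinuousOn (fun p : ℝ × M => derivWithin (fun t => w (t, p.2)) T p.1) (T ×ˢ univ) := by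
  rintro ⟨s₀, x₀⟩ h₀
  have hn := prod_source_mem_nhdsWithin (T := T) x₀ s₀
  have h1 : ContinuousOn (fun p : ℝ × M => derivWithin (fun t => w (t, p.2)) T p.1)
      (T ×ˢ (extChartAt M.I x₀).source) :=
    (continuousOn_fderivWithin_chart hT hw x₀ (1, 0)).congr fun p hp =>
      (hasDerivWithinAt_chart hw x₀ hp.1 hp.2).derivWithin (hT p.1 hp.1)
  exact (h1 _ ⟨h₀.1, mem_extChartAt_source x₀⟩).mono_of_mem_nhdsWithin hn

theorem hasDerivWithinAt_derivWithin
    (hw : ContMDiffOn (𝓘(ℝ, ℝ).prod M.I) 𝓘(ℝ, ℂ) ∞ w (T ×ˢ univ)) {s : ℝ} (hs : s ∈ T) (y : M) :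
    HasDerivWithinAt (fun t => w (t, y)) (derivWithin (fun t => w (t, y)) T s) T s :=
  (hasDerivWithinAt_chart hw y hs (mem_extChartAt_source y)).differentiableWithinAt.hasDerivWithinAt

theorem continuousOn_coInner_slice {w' : ℝ × M → ℂ} (hT : UniqueDiffOn ℝ T)
    (hw : ContMDiffOn (𝓘(ℝ, ℝ).prod M.I) 𝓘(ℝ, ℂ) ∞ w (T ×ˢ univ))
    (hw' : ContMDiffOn (𝓘(ℝ, ℝ).prod M.I) 𝓘(ℝ, ℂ) ∞ w' (T ×ˢ univ)) :
    ContinuousOn (fun p : ℝ × M => M.coInner p.2 (M.d (fun y => w (p.1, y)) p.2)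
      (M.d (fun y => w' (p.1, y)) p.2)) (T ×ˢ univ) := by
  rintro ⟨s₀, x₀⟩ h₀
  have hn := prod_source_mem_nhdsWithin (T := T) x₀ s₀
  have hinv : ContinuousOn (fun p : ℝ × M => (M.chartGram x₀ (extChartAt M.I x₀ p.2))⁻¹)
      (T ×ˢ (extChartAt M.I x₀).source) := by
    have hg : ContinuousOn (fun p : ℝ × M => M.chartGram x₀ (extChartAt M.I x₀ p.2))
        (T ×ˢ (extChartAt M.I x₀).source) :=
      (M.continuousOn_chartGram x₀).comp ((continuousOn_extChartAt x₀).comp continuousOn_snd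
        fun p hp => hp.2) fun p hp => (extChartAt M.I x₀).map_source hp.2
    simp only [Matrix.inv_def, Ring.inverse_eq_inv']
    refine ContinuousOn.smul (ContinuousOn.inv₀
      ((Continuous.matrix_det continuous_id).comp_continuousOn hg) fun p hp => ?_)
      ((Continuous.matrix_adjugate continuous_id).comp_continuousOn hg)
    exact (M.posDef_chartGram x₀ ((extChartAt M.I x₀).map_source hp.2)).det_pos.ne'
  have hd {v : ℝ × M → ℂ} (hv : ContMDiffOn (𝓘(ℝ, ℝ).prod M.I) 𝓘(ℝ, ℂ) ∞ v (T ×ˢ univ)) (i) :=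
    continuousOn_fderivWithin_chart hT hv x₀ (0, stdVec n i)
  have h1 : ContinuousOn (fun p : ℝ × M => M.coInner p.2 (M.d (fun y => w (p.1, y)) p.2)
      (M.d (fun y => w' (p.1, y)) p.2)) (T ×ˢ (extChartAt M.I x₀).source) := by
    refine ContinuousOn.congr (continuousOn_finsetSum Finset.univ fun i _ =>
      continuousOn_finsetSum Finset.univ fun j _ => ((Complex.continuous_ofReal.comp_continuousOn (continuousOn_pi.1
        (continuousOn_pi.1 hinv i) j)).mul (Complex.continuous_conj.comp_continuousOn (hd hw i))).mul
        (hd hw' j)) fun p hp => ?_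
    obtain ⟨s, y⟩ := p
    obtain ⟨z, hz, rfl⟩ : ∃ z ∈ (extChartAt M.I x₀).target, (extChartAt M.I x₀).symm z = y :=
      ⟨_, (extChartAt M.I x₀).map_source hp.2, (extChartAt M.I x₀).left_inv hp.2⟩
    simp only [Function.comp_apply, Pi.mul_apply]
    rw [M.coInner_eq_chart x₀ hz, (extChartAt M.I x₀).right_inv hz]
    simp only [d_coordVec_eq_fderivWithin_chart hw x₀ hp.1 hz,
      d_coordVec_eq_fderivWithin_chart hw' x₀ hp.1 hz]
  exact (h1 _ ⟨h₀.1, mem_extChartAt_source x₀⟩).mono_of_mem_nhdsWithin hn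

end Product

end RiemMfd

/-! ### The collar preserves the measure -/

/-- The splitting `ℝⁿ⁺¹ = ℝ × ℝⁿ`. -/
def splitEquiv (n : ℕ) :
    EuclideanSpace ℝ (Fin (n + 1)) ≃L[ℝ] ℝ × EuclideanSpace ℝ (Fin n) :=
  LinearEquiv.toContinuousLinearEquiv
    { toFun := fun z => (z 0, WithLp.toLp 2 fun i => z i.succ)
      invFun := fun p => WithLp.toLp 2 (Fin.cons p.1 fun i => p.2 i)
      map_add' := fun _ _ => rfl
      map_smul' := fun _ _ => rfl
      left_inv := fun z => by
        ext i
        refine Fin.cases rfl (fun i => rfl) i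
      right_inv := fun _ => rfl }

theorem splitEquiv_apply (n : ℕ) (z : EuclideanSpace ℝ (Fin (n + 1))) :
    splitEquiv n z = (z 0, WithLp.toLp 2 fun i => z i.succ) := rfl

/-- The first component of `splitEquiv`. -/
def splitFst (n : ℕ) : EuclideanSpace ℝ (Fin (n + 1)) →L[ℝ] ℝ :=
  (ContinuousLinearMap.fst ℝ ℝ (EuclideanSpace ℝ (Fin n))).comp
    (splitEquiv n : EuclideanSpace ℝ (Fin (n + 1)) →L[ℝ] ℝ × EuclideanSpace ℝ (Fin n))

/-- The second component of `splitEquiv`. -/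
def splitSnd (n : ℕ) : EuclideanSpace ℝ (Fin (n + 1)) →L[ℝ] EuclideanSpace ℝ (Fin n) :=
  (ContinuousLinearMap.snd ℝ ℝ (EuclideanSpace ℝ (Fin n))).comp
    (splitEquiv n : EuclideanSpace ℝ (Fin (n + 1)) →L[ℝ] ℝ × EuclideanSpace ℝ (Fin n))

theorem measurePreserving_splitEquiv (n : ℕ) :
    MeasurePreserving (splitEquiv n) volume volume := by
  have h1 := PiLp.volume_preserving_ofLp (Fin (n + 1))
  have h2 := volume_preserving_piFinSuccAbove (fun _ : Fin (n + 1) => ℝ) 0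
  have h3 : MeasurePreserving (Prod.map id (WithLp.toLp 2) :
      ℝ × (Fin n → ℝ) → ℝ × EuclideanSpace ℝ (Fin n)) volume volume :=
    (MeasurePreserving.id volume).prod (PiLp.volume_preserving_toLp (Fin n))
  exact (h3.comp (h2.comp h1))

theorem splitEquiv_stdVec_zero (n : ℕ) : splitEquiv n (RiemMfd.stdVec (n + 1) 0) = (1, 0) := by
  rw [splitEquiv_apply]
  refine Prod.ext (by simp [RiemMfd.stdVec]) ?_
  ext i
  simp [RiemMfd.stdVec]

theorem splitEquiv_stdVec_succ (n : ℕ) (i : Fin n) :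
    splitEquiv n (RiemMfd.stdVec (n + 1) i.succ) = (0, RiemMfd.stdVec n i) := by
  rw [splitEquiv_apply]
  refine Prod.ext (by simp [RiemMfd.stdVec]) ?_
  ext j
  simp [RiemMfd.stdVec]

/-- Serves for the Gram matrix of a product metric, where the first vector `∂_s` is a unit vector
orthogonal to the cross-section. -/
theorem det_succ_of_block {n : ℕ} (G : Matrix (Fin (n + 1)) (Fin (n + 1)) ℝ)
    (h0 : G 0 0 = 1) (hr : ∀ j : Fin n, G 0 j.succ = 0) :
    G.det = (G.submatrix Fin.succ Fin.succ).det := by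
  rw [Matrix.det_succ_row_zero, Fin.sum_univ_succ]
  simp [h0, hr]

namespace FatStar

variable {n : ℕ} {E : Type w} (S : FatStar.{u, w} n E)

/-- The collar of the edge `e` in the coordinates of the chart of `Y e` at `y₀`. -/
def collarChart (e : E) (y₀ : S.Y e) (z : EuclideanSpace ℝ (Fin (n + 1))) : ℝ × S.Y e :=
  ((splitEquiv n z).1, (extChartAt (S.Y e).I y₀).symm (splitEquiv n z).2)

/-- The domain of the collar in the coordinates of the model of `Y e`. -/
def collarDomain (e : E) : Set (EuclideanSpace ℝ (Fin (n + 1))) :=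
  splitEquiv n ⁻¹' (Ioo 0 S.ellMinus ×ˢ range (S.Y e).I)

theorem uniqueDiffOn_collarDomain (e : E) : UniqueDiffOn ℝ (S.collarDomain e) :=
  (splitEquiv n).uniqueDiffOn_preimage_iff.2 ((uniqueDiffOn_Ioo 0 S.ellMinus).prod (S.Y e).I.uniqueDiffOn)

theorem mdifferentiableAt_collar (e : E) {s : ℝ} (hs : s ∈ Ioo 0 S.ellMinus) (y : S.Y e) :
    MDifferentiableAt (𝓘(ℝ, ℝ).prod (S.Y e).I) S.X.I (S.collar e) (s, y) := by
  have hn : Ico 0 S.ellMinus ×ˢ univ ∈ 𝓝 (s, y) :=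
    prod_mem_nhds (mem_of_superset (Ioo_mem_nhds hs.1 hs.2) Ioo_subset_Ico_self) univ_mem
  exact ((S.collar_smooth e).contMDiffAt hn).mdifferentiableAt (by simp)

theorem hasMFDerivWithinAt_collarChart (e : E) (y₀ : S.Y e) {z : EuclideanSpace ℝ (Fin (n + 1))}
    (hz : (splitEquiv n z).2 ∈ (extChartAt (S.Y e).I y₀).target) :
    HasMFDerivWithinAt 𝓘(ℝ, EuclideanSpace ℝ (Fin (n + 1))) (𝓘(ℝ, ℝ).prod (S.Y e).I)
      (S.collarChart e y₀) (S.collarDomain e) z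
      ((splitFst n).prod
      ((mfderivWithin 𝓘(ℝ, EuclideanSpace ℝ (Fin n)) (S.Y e).I (extChartAt (S.Y e).I y₀).symm
        (range (S.Y e).I) (splitEquiv n z).2).comp
        (splitSnd n))) := by
  have h1 : HasMFDerivWithinAt 𝓘(ℝ, EuclideanSpace ℝ (Fin (n + 1))) 𝓘(ℝ, ℝ)
      (fun z => (splitEquiv n z).1) (S.collarDomain e) z
      (splitFst n) :=
    HasFDerivWithinAt.hasMFDerivWithinAt
      (splitFst n).hasFDerivWithinAt
  have h2 : HasMFDerivWithinAt 𝓘(ℝ, EuclideanSpace ℝ (Fin (n + 1)))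
      𝓘(ℝ, EuclideanSpace ℝ (Fin n))
      (fun z => (splitEquiv n z).2) (S.collarDomain e) z
      (splitSnd n) :=
    HasFDerivWithinAt.hasMFDerivWithinAt
      (splitSnd n).hasFDerivWithinAt
  have h3 := (mdifferentiableWithinAt_extChartAt_symm hz).hasMFDerivWithinAt
  have hsub : S.collarDomain e ⊆ (fun z => (splitEquiv n z).2) ⁻¹' range (S.Y e).I :=
    fun v hv => hv.2
  exact h1.prodMk (h3.comp z h2 hsub)

/-- In the coordinates of `Y e`, the metric of `X` on the collar has the density of `Y e`. -/
theorem sqrt_det_gram_collar (e : E) (y₀ : S.Y e) {z : EuclideanSpace ℝ (Fin (n + 1))}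
    (hzD : z ∈ S.collarDomain e) (hz : (splitEquiv n z).2 ∈ (extChartAt (S.Y e).I y₀).target) :
    (gramMatrix (S.X.metric.inner ((S.collar e ∘ S.collarChart e y₀) z)) fun i =>
      mfderivWithin 𝓘(ℝ, EuclideanSpace ℝ (Fin (n + 1))) S.X.I (S.collar e ∘ S.collarChart e y₀)
        (S.collarDomain e) z (RiemMfd.stdVec (n + 1) i)).det =
      ((S.Y e).chartGram y₀ (splitEquiv n z).2).det := by
  have hU := S.uniqueDiffOn_collarDomain e z hzD
  have hκ := S.hasMFDerivWithinAt_collarChart e y₀ hz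
  have hs : (splitEquiv n z).1 ∈ Ioo 0 S.ellMinus := hzD.1
  let L : EuclideanSpace ℝ (Fin n) →L[ℝ] EuclideanSpace ℝ (Fin n) :=
    mfderivWithin 𝓘(ℝ, EuclideanSpace ℝ (Fin n)) (S.Y e).I (extChartAt (S.Y e).I y₀).symm
      (range (S.Y e).I) (splitEquiv n z).2
  set s := (splitEquiv n z).1
  set y := (extChartAt (S.Y e).I y₀).symm (splitEquiv n z).2
  have hc : MDifferentiableAt (𝓘(ℝ, ℝ).prod (S.Y e).I) S.X.I (S.collar e)
      (S.collarChart e y₀ z) := S.mdifferentiableAt_collar e hs y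
  have hcomp := (hc.hasMFDerivAt.comp_hasMFDerivWithinAt z hκ).mfderivWithin hU.uniqueMDiffWithinAt
  have h0 : mfderivWithin 𝓘(ℝ, EuclideanSpace ℝ (Fin (n + 1))) S.X.I
      (S.collar e ∘ S.collarChart e y₀) (S.collarDomain e) z (RiemMfd.stdVec (n + 1) 0) =
      mfderiv (𝓘(ℝ, ℝ).prod (S.Y e).I) S.X.I (S.collar e) (s, y) ((S.Y e).prodVec s y 1 0) := by
    rw [hcomp]
    refine congrArg (mfderiv (𝓘(ℝ, ℝ).prod (S.Y e).I) S.X.I (S.collar e) (s, y)) ?_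
    have hfst : splitFst n (RiemMfd.stdVec (n + 1) 0) = 1 :=
      congrArg Prod.fst (splitEquiv_stdVec_zero n)
    have hsnd : splitSnd n (RiemMfd.stdVec (n + 1) 0) = 0 :=
      congrArg Prod.snd (splitEquiv_stdVec_zero n)
    exact Prod.ext hfst ((congrArg L hsnd).trans (map_zero L))
  have h1 (i : Fin n) : mfderivWithin 𝓘(ℝ, EuclideanSpace ℝ (Fin (n + 1))) S.X.I
      (S.collar e ∘ S.collarChart e y₀) (S.collarDomain e) z (RiemMfd.stdVec (n + 1) i.succ) =
      mfderiv (𝓘(ℝ, ℝ).prod (S.Y e).I) S.X.I (S.collar e) (s, y)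
        ((S.Y e).prodVec s y 0 ((S.Y e).coordVec y₀ (splitEquiv n z).2 i)) := by
    rw [hcomp]
    refine congrArg (mfderiv (𝓘(ℝ, ℝ).prod (S.Y e).I) S.X.I (S.collar e) (s, y)) ?_
    have hfst : splitFst n (RiemMfd.stdVec (n + 1) i.succ) = 0 :=
      congrArg Prod.fst (splitEquiv_stdVec_succ n i)
    have hsnd : splitSnd n (RiemMfd.stdVec (n + 1) i.succ) = RiemMfd.stdVec n i :=
      congrArg Prod.snd (splitEquiv_stdVec_succ n i)
    exact Prod.ext hfst (congrArg L hsnd)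
  rw [det_succ_of_block]
  · congr 1
    ext i j
    simp only [gramMatrix, Matrix.submatrix_apply, Matrix.of_apply, h1]
    refine (S.collar_isometric e s hs y 0 0 _ _).trans ?_
    rw [zero_mul, zero_add]
    rfl
  · simp only [gramMatrix, Matrix.of_apply, h0]
    refine (S.collar_isometric e s hs y 1 1 _ _).trans ?_
    simp
  · intro j
    simp only [gramMatrix, Matrix.of_apply, h0, h1]
    refine (S.collar_isometric e s hs y 1 0 _ _).trans ?_
    simp

/-- The measure `ds dy` on the product `(0, ellMinus) × Y e`. -/
def collarVol (e : E) : Measure (ℝ × S.Y e) :=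
  (volume.restrict (Ioo 0 S.ellMinus)).prod (S.Y e).vol

theorem injOn_collar (e : E) : InjOn (S.collar e) (Ico 0 S.ellMinus ×ˢ univ) :=
  injOn_iff_injective.2 (S.collar_embedding e).injective

theorem continuousOn_collar (e : E) : ContinuousOn (S.collar e) (Ico 0 S.ellMinus ×ˢ univ) :=
  (S.collar_smooth e).continuousOn

/-- Fubini, with the measure of each slice computed in one chart of `Y e`, and the fact that the
splitting of `ℝⁿ⁺¹` preserves Lebesgue measure. -/
theorem collarVol_apply_of_subset (e : E) (y₀ : S.Y e) {A : Set (ℝ × S.Y e)}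
    (hA : MeasurableSet A) (hsub : A ⊆ Ioo 0 S.ellMinus ×ˢ (extChartAt (S.Y e).I y₀).source) :
    S.collarVol e A = ∫⁻ z in splitEquiv n ⁻¹' (Ioo 0 S.ellMinus ×ˢ
        (extChartAt (S.Y e).I y₀).target) ∩ S.collarChart e y₀ ⁻¹' A,
      ENNReal.ofReal (Real.sqrt ((S.Y e).chartGram y₀ (splitEquiv n z).2).det) := by
  set φ := extChartAt (S.Y e).I y₀
  set f : ℝ × EuclideanSpace ℝ (Fin n) → ENNReal := fun p =>
    ENNReal.ofReal (Real.sqrt ((S.Y e).chartGram y₀ p.2).det)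
  set κ : ℝ × EuclideanSpace ℝ (Fin n) → ℝ × S.Y e := fun p => (p.1, φ.symm p.2)
  set B : Set (ℝ × EuclideanSpace ℝ (Fin n)) := (Ioo 0 S.ellMinus ×ˢ φ.target) ∩ κ ⁻¹' A with hBdef
  have hT := (S.Y e).measurableSet_extChartAt_target y₀
  have hIT : MeasurableSet (Ioo 0 S.ellMinus ×ˢ φ.target) := measurableSet_Ioo.prod hT
  have hB : MeasurableSet B := measurableSet_inter_preimage_of_continuousOn
    (continuousOn_fst.prodMk ((continuousOn_extChartAt_symm y₀).comp continuousOn_snd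
      fun p hp => hp.2)) hIT hA
  have hf : ContinuousOn f (Ioo 0 S.ellMinus ×ˢ φ.target) :=
    (ENNReal.continuous_ofReal.comp Real.continuous_sqrt).comp_continuousOn
      ((Continuous.matrix_det continuous_id).comp_continuousOn
        (((S.Y e).continuousOn_chartGram y₀).comp continuousOn_snd fun p hp => hp.2))
  have hBf : AEMeasurable (B.indicator f) (volume : Measure (ℝ × EuclideanSpace ℝ (Fin n))) :=
    (aemeasurable_indicator_iff hB).2 ((hf.mono inter_subset_left).aemeasurable hB)
  have hemb : MeasurableEmbedding (splitEquiv n) :=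
    (splitEquiv n).toHomeomorph.measurableEmbedding
  have hR : ∫⁻ z in splitEquiv n ⁻¹' (Ioo 0 S.ellMinus ×ˢ φ.target) ∩ S.collarChart e y₀ ⁻¹' A,
      ENNReal.ofReal (Real.sqrt ((S.Y e).chartGram y₀ (splitEquiv n z).2).det) =
      ∫⁻ p, B.indicator f p := by
    rw [← (measurePreserving_splitEquiv n).lintegral_comp_emb hemb]
    change ∫⁻ z in splitEquiv n ⁻¹' B, f (splitEquiv n z) = _
    rw [← lintegral_indicator ((splitEquiv n).continuous.measurable hB)]
    rfl
  rw [hR, Measure.volume_eq_prod, lintegral_prod _ hBf, collarVol, Measure.prod_apply hA,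
    ← lintegral_indicator measurableSet_Ioo]
  refine lintegral_congr fun t => ?_
  by_cases ht : t ∈ Ioo 0 S.ellMinus
  · have hm : MeasurableSet (Prod.mk t ⁻¹' A) := measurable_prodMk_left hA
    rw [indicator_of_mem ht, (S.Y e).vol_apply_of_subset y₀ hm fun y hy => (hsub hy).2,
      ← lintegral_indicator_one hm, (S.Y e).lintegral_chartVol y₀ (measurable_one.indicator hm),
      ← lintegral_indicator hT]
    refine lintegral_congr fun z => ?_
    by_cases hz : z ∈ φ.target
    · rw [indicator_of_mem hz]
      by_cases hzA : (t, φ.symm z) ∈ A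
      · rw [indicator_of_mem (show φ.symm z ∈ Prod.mk t ⁻¹' A from hzA),
          indicator_of_mem (show (t, z) ∈ B from ⟨⟨ht, hz⟩, hzA⟩), Pi.one_apply, mul_one]
      · rw [indicator_of_notMem (show φ.symm z ∉ Prod.mk t ⁻¹' A from hzA),
          indicator_of_notMem (show (t, z) ∉ B from fun h => hzA h.2), mul_zero]
    · rw [indicator_of_notMem hz, indicator_of_notMem (show (t, z) ∉ B from fun h => hz h.1.2)]
  · rw [indicator_of_notMem ht]
    simp only [indicator_of_notMem (show (t, _) ∉ B from fun h => ht h.1.1), lintegral_zero]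

/-- Both sides are integrals over the same coordinate set. The change of variables for the collar in
coordinates of `Y e` yields the Gram determinant of the metric of `X`, and the isometry of the
collar identifies it with that of `Y e`. -/
theorem collarVol_apply_of_mapsTo (e : E) (y₀ : S.Y e) (x₀ : S.X) {A : Set (ℝ × S.Y e)}
    (hA : MeasurableSet A) (hsub : A ⊆ Ioo 0 S.ellMinus ×ˢ (extChartAt (S.Y e).I y₀).source)
    (hx : MapsTo (S.collar e) A (extChartAt S.X.I x₀).source) :
    S.collarVol e A = S.X.vol (S.collar e '' A) := by
  set φ := extChartAt (S.Y e).I y₀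
  set s := splitEquiv n ⁻¹' (Ioo 0 S.ellMinus ×ˢ φ.target) ∩ S.collarChart e y₀ ⁻¹' A with hsdef
  have hcont : ContinuousOn (S.collarChart e y₀) (splitEquiv n ⁻¹' (Ioo 0 S.ellMinus ×ˢ φ.target)) :=
    (continuous_fst.comp (splitEquiv n).continuous).continuousOn.prodMk
      ((continuousOn_extChartAt_symm y₀).comp
        (continuous_snd.comp (splitEquiv n).continuous).continuousOn fun z hz => hz.2)
  have hs : MeasurableSet s := measurableSet_inter_preimage_of_continuousOn hcont
    ((splitEquiv n).continuous.measurable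
      (measurableSet_Ioo.prod ((S.Y e).measurableSet_extChartAt_target y₀))) hA
  have himg : S.collarChart e y₀ '' s = A := by
    ext p
    constructor
    · rintro ⟨z, hz, rfl⟩
      exact hz.2
    · intro hp
      have hp' := hsub hp
      have e1 : splitEquiv n ((splitEquiv n).symm (p.1, φ p.2)) = (p.1, φ p.2) :=
        (splitEquiv n).apply_symm_apply _
      have e2 : S.collarChart e y₀ ((splitEquiv n).symm (p.1, φ p.2)) = p := by
        rw [collarChart, e1]
        exact Prod.ext rfl (φ.left_inv hp'.2)
      refine ⟨(splitEquiv n).symm (p.1, φ p.2), ⟨?_, ?_⟩, e2⟩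
      · rw [mem_preimage, e1]
        exact ⟨hp'.1, φ.map_source hp'.2⟩
      · rw [mem_preimage, e2]
        exact hp
  have hsD : s ⊆ S.collarDomain e := fun z hz =>
    ⟨hz.1.1, extChartAt_target_subset_range y₀ hz.1.2⟩
  have hinj : InjOn (S.collar e ∘ S.collarChart e y₀) s := by
    refine (S.injOn_collar e).comp ?_ fun z hz => ⟨Ioo_subset_Ico_self hz.1.1, mem_univ _⟩
    intro z hz z' hz' h
    have h1 := congrArg Prod.fst h
    have h2 := φ.symm.injOn hz.1.2 hz'.1.2 (congrArg Prod.snd h)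
    exact (splitEquiv n).injective (Prod.ext h1 h2)
  have hP (z) (hz : z ∈ s) := S.X.sqrt_det_gramMatrix_param x₀
    (S.uniqueDiffOn_collarDomain e z (hsD hz))
    ((S.mdifferentiableAt_collar e hz.1.1 _).comp_mdifferentiableWithinAt z
      (S.hasMFDerivWithinAt_collarChart e y₀ hz.1.2).mdifferentiableWithinAt) (hx hz.2)
  have h := S.X.chartVol_image x₀ hs hinj (fun z hz => hx hz.2)
    (fun z hz => (hP z hz).1.mono hsD)
  rw [image_comp, himg] at h
  rw [S.X.vol_apply_of_subset x₀ h.1 (image_subset_iff.2 hx), h.2,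
    S.collarVol_apply_of_subset e y₀ hA hsub]
  refine setLIntegral_congr_fun hs fun z hz => ?_
  rw [← S.sqrt_det_gram_collar e y₀ (hsD hz) hz.1.2, (hP z hz).2, ENNReal.ofReal_mul (abs_nonneg _)]

theorem measurableSet_collar_image (e : E) {A : Set (ℝ × S.Y e)} (hA : MeasurableSet A)
    (hsub : A ⊆ Ico 0 S.ellMinus ×ˢ univ) : MeasurableSet (S.collar e '' A) := by
  have h1 := (S.collar_embedding e).measurableEmbedding.measurableSet_image.2
    (measurable_subtype_coe hA)
  convert h1 using 1
  ext x
  constructor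
  · rintro ⟨p, hp, rfl⟩
    exact ⟨⟨p, hsub hp⟩, hp, rfl⟩
  · rintro ⟨p, hp, rfl⟩
    exact ⟨p, hp, rfl⟩

/-- Partitions of `Y e` and of `X` into pieces of chart domains cut `A` into finitely many sets
covered by the previous lemma. Injectivity of the collar keeps their images disjoint. -/
theorem collarVol_apply (e : E) {A : Set (ℝ × S.Y e)} (hA : MeasurableSet A)
    (hsub : A ⊆ Ioo 0 S.ellMinus ×ˢ univ) : S.collarVol e A = S.X.vol (S.collar e '' A) := by
  obtain ⟨m, c, P, hPm, hPd, hPu, hPs⟩ := (S.Y e).exists_finite_partition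
  obtain ⟨m', c', P', hPm', hPd', hPu', hPs'⟩ := S.X.exists_finite_partition
  have hI : A ⊆ Ico 0 S.ellMinus ×ˢ univ := fun p hp => ⟨Ioo_subset_Ico_self (hsub hp).1, mem_univ _⟩
  let B : Fin m × Fin m' → Set (ℝ × S.Y e) := fun ij =>
    (A ∩ S.collar e ⁻¹' P' ij.2) ∩ (Prod.snd ⁻¹' P ij.1)
  have hBm (ij) : MeasurableSet (B ij) := (measurableSet_inter_preimage_of_continuousOn
    ((S.continuousOn_collar e).mono hI) hA (hPm' ij.2)).inter (measurable_snd (hPm ij.1))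
  have hBA (ij) : B ij ⊆ A := inter_subset_left.trans inter_subset_left
  have hBd : Pairwise (Function.onFun Disjoint B) := by
    intro ij kl hne
    refine Set.disjoint_left.2 fun p hp hp' => hne ?_
    refine Prod.ext ?_ ?_
    · by_contra h
      exact Set.disjoint_left.1 (hPd h) hp.2 hp'.2
    · by_contra h
      exact Set.disjoint_left.1 (hPd' h) hp.1.2 hp'.1.2
  have hBu : ⋃ ij, B ij = A := by
    refine Subset.antisymm (iUnion_subset hBA) fun p hp => ?_
    obtain ⟨i, hi⟩ := mem_iUnion.1 (hPu.symm ▸ mem_univ p.2)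
    obtain ⟨j, hj⟩ := mem_iUnion.1 (hPu'.symm ▸ mem_univ (S.collar e p))
    exact mem_iUnion.2 ⟨(i, j), ⟨hp, hj⟩, hi⟩
  rw [← hBu, image_iUnion, measure_iUnion hBd hBm, measure_iUnion]
  · refine tsum_congr fun ij => S.collarVol_apply_of_mapsTo e (c ij.1) (c' ij.2) (hBm ij)
      (fun p hp => ⟨(hsub (hBA ij hp)).1, hPs _ hp.2⟩) (fun p hp => hPs' _ hp.1.2)
  · intro ij kl hne
    refine Set.disjoint_left.2 ?_
    rintro x ⟨p, hp, rfl⟩ ⟨p', hp', h⟩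
    rw [S.injOn_collar e (hI (hBA kl hp')) (hI (hBA ij hp)) h] at hp'
    exact Set.disjoint_left.1 (hBd hne) hp hp'
  · exact fun ij => S.measurableSet_collar_image e (hBm ij) ((hBA ij).trans hI)

/-- The open collar of the edge `e` in `X`. -/
def collarSet (e : E) : Set S.X := S.collar e '' (Ioo 0 S.ellMinus ×ˢ univ)

theorem measurableSet_collarSet (e : E) : MeasurableSet (S.collarSet e) :=
  S.measurableSet_collar_image e (measurableSet_Ioo.prod MeasurableSet.univ)
    (prod_mono_left Ioo_subset_Ico_self)

theorem pairwise_disjoint_collarSet : Pairwise (Function.onFun Disjoint S.collarSet) :=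
  fun e e' h => (S.collar_disjoint e e' h).mono
    (image_mono (prod_mono_left Ioo_subset_Ico_self))
    (image_mono (prod_mono_left Ioo_subset_Ico_self))

theorem collarVol_eq_restrict (e : E) :
    S.collarVol e = (volume.prod (S.Y e).vol).restrict (Ioo 0 S.ellMinus ×ˢ univ) := by
  rw [collarVol, ← Measure.prod_restrict, Measure.restrict_univ]

theorem aemeasurable_collar (e : E) : AEMeasurable (S.collar e) (S.collarVol e) := by
  rw [collarVol_eq_restrict]
  exact ((S.continuousOn_collar e).mono (prod_mono_left Ioo_subset_Ico_self)).aemeasurable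
    (measurableSet_Ioo.prod MeasurableSet.univ)

/-- The collar is measure preserving onto its image. -/
theorem map_collar (e : E) :
    (S.collarVol e).map (S.collar e) = S.X.vol.restrict (S.collarSet e) := by
  ext B hB
  have hI : MeasurableSet (Ioo 0 S.ellMinus ×ˢ (univ : Set (S.Y e))) :=
    measurableSet_Ioo.prod MeasurableSet.univ
  have hA := measurableSet_inter_preimage_of_continuousOn
    ((S.continuousOn_collar e).mono (prod_mono_left Ioo_subset_Ico_self)) hI hB
  rw [Measure.map_apply_of_aemeasurable (S.aemeasurable_collar e) hB, Measure.restrict_apply hB]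
  have h1 : S.collarVol e (S.collar e ⁻¹' B) =
      S.collarVol e ((Ioo 0 S.ellMinus ×ˢ univ) ∩ S.collar e ⁻¹' B) := by
    rw [inter_comm]
    refine (measure_inter_conull ?_).symm
    rw [collarVol_eq_restrict, Measure.restrict_apply hI.compl, compl_inter_self, measure_empty]
  rw [h1, S.collarVol_apply e hA inter_subset_left, image_inter_preimage, inter_comm]
  rfl

end FatStar

/-! ### Elementary integral inequalities -/

theorem sq_norm_integral_le {α : Type*} [MeasurableSpace α] {μ : Measure α} [IsFiniteMeasure μ]
    {g : α → ℂ} (hg : MemLp g 2 μ) :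
    ‖∫ x, g x ∂μ‖ ^ 2 ≤ μ.real univ * ∫ x, ‖g x‖ ^ 2 ∂μ := by
  set V := μ.real univ
  set A := ∫ x, ‖g x‖ ∂μ
  have hi : Integrable (fun x => ‖g x‖) μ := (hg.integrable (by norm_num)).norm
  have hi2 : Integrable (fun x => ‖g x‖ ^ 2) μ := (memLp_two_iff_integrable_sq_norm hg.1).1 hg
  have hle : ‖∫ x, g x ∂μ‖ ≤ A := norm_integral_le_integral_norm _
  have hA0 : 0 ≤ A := integral_nonneg fun _ => norm_nonneg _
  have hV0 : 0 ≤ V := measureReal_nonneg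
  -- The variance of `‖g‖`, multiplied out so that no division by `V` is needed. Its nonnegativity
  -- is the Cauchy–Schwarz inequality when `V > 0`; when `V = 0` the measure vanishes.
  have hexp : ∫ x, (V * ‖g x‖ - A) ^ 2 ∂μ = V * (V * ∫ x, ‖g x‖ ^ 2 ∂μ - A ^ 2) := by
    have : ∀ x, (V * ‖g x‖ - A) ^ 2 = V ^ 2 * ‖g x‖ ^ 2 - 2 * V * A * ‖g x‖ + A ^ 2 :=
      fun x => by ring
    simp_rw [this]
    have hi3 : Integrable (fun x => V ^ 2 * ‖g x‖ ^ 2 - 2 * V * A * ‖g x‖) μ :=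
      (hi2.const_mul _).sub (hi.const_mul _)
    rw [integral_add hi3 (integrable_const _),
      integral_sub (hi2.const_mul _) (hi.const_mul _), integral_const_mul, integral_const_mul,
      integral_const, smul_eq_mul]
    change V ^ 2 * _ - 2 * V * A * A + V * A ^ 2 = _
    ring
  have h0 : 0 ≤ V * (V * ∫ x, ‖g x‖ ^ 2 ∂μ - A ^ 2) :=
    hexp ▸ integral_nonneg fun _ => sq_nonneg _
  rcases hV0.eq_or_lt with hV | hV
  · have hμ : μ = 0 := by
      rw [← Measure.measure_univ_eq_zero]
      exact (measureReal_eq_zero_iff).1 hV.symm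
    simp [hμ]
  · have := nonneg_of_mul_nonneg_right h0 hV
    nlinarith [norm_nonneg (∫ x, g x ∂μ)]

/-- The trace estimate on an interval. -/
theorem sq_norm_initial_le {b : ℝ} (hb : 0 < b) {f g : ℝ → ℂ} {f₀ : ℂ}
    (hf : MemLp f 2 (volume.restrict (Ioo 0 b))) (hg : MemLp g 2 (volume.restrict (Ioo 0 b)))
    (hfg : ∀ᵐ s ∂volume.restrict (Ioo 0 b), f s = f₀ + ∫ t in (0 : ℝ)..s, g t) :
    ‖f₀‖ ^ 2 ≤ b * (∫ s in Ioo 0 b, ‖g s‖ ^ 2) + 2 / b * ∫ s in Ioo 0 b, ‖f s‖ ^ 2 := by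
  have hf2 := (memLp_two_iff_integrable_sq_norm hf.1).1 hf
  have hg2 := (memLp_two_iff_integrable_sq_norm hg.1).1 hg
  set G := ∫ s in Ioo 0 b, ‖g s‖ ^ 2
  -- The initial value is `f s` minus an integral whose square is at most `s * G`. Averaging over `s
  -- ∈ (0, b)` turns `2 G s` into `b G`, whence the two coefficients.
  have hpt : ∀ᵐ s ∂volume.restrict (Ioo 0 b), ‖f₀‖ ^ 2 ≤ 2 * ‖f s‖ ^ 2 + 2 * G * s := by
    filter_upwards [hfg, ae_restrict_mem measurableSet_Ioo] with s hs hsI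
    have hsub : Ioc 0 s ⊆ Ioo 0 b := fun t ht => ⟨ht.1, ht.2.trans_lt hsI.2⟩
    have h1 : ‖∫ t in (0 : ℝ)..s, g t‖ ^ 2 ≤ s * G := by
      rw [intervalIntegral.integral_of_le hsI.1.le]
      refine (sq_norm_integral_le (hg.mono_measure (Measure.restrict_mono hsub le_rfl))).trans ?_
      have hvol : (volume.restrict (Ioc 0 s)).real univ = s := by
        simp [hsI.1.le]
      rw [hvol]
      exact mul_le_mul_of_nonneg_left (setIntegral_mono_set hg2
        (Eventually.of_forall fun _ => sq_nonneg _) hsub.eventuallyLE) hsI.1.le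
    have h2 : ‖f₀‖ ≤ ‖f s‖ + ‖∫ t in (0 : ℝ)..s, g t‖ := by
      have : f₀ = f s - ∫ t in (0 : ℝ)..s, g t := by rw [hs]; ring
      rw [this]
      exact norm_sub_le _ _
    nlinarith [sq_nonneg (‖f s‖ - ‖∫ t in (0 : ℝ)..s, g t‖), norm_nonneg f₀]
  have hid : IntegrableOn (fun s : ℝ => 2 * G * s) (Ioo 0 b) :=
    (continuous_const.mul continuous_id).integrableOn_Icc.mono_set Ioo_subset_Icc_self
  have hint := integral_mono_ae (integrable_const _) ((hf2.const_mul 2).add hid) hpt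
  simp only [Pi.add_apply] at hint
  rw [integral_add (hf2.const_mul 2) hid, integral_const_mul, integral_const_mul] at hint
  have hs : ∫ s in Ioo 0 b, s = b ^ 2 / 2 := by
    rw [← integral_Ioc_eq_integral_Ioo, ← intervalIntegral.integral_of_le hb.le, integral_id]
    ring
  have hc : ∫ _ in Ioo 0 b, ‖f₀‖ ^ 2 = b * ‖f₀‖ ^ 2 := by
    simp [hb.le]
  rw [hs, hc] at hint
  have : ‖f₀‖ ^ 2 = (b * ‖f₀‖ ^ 2) / b := by field_simp
  rw [this, div_le_iff₀ hb]
  calc _ ≤ _ := hint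
    _ = _ := by field_simp; ring

/-! ### The Poincaré inequality -/

namespace RiemMfd

variable {n : ℕ} (M : RiemMfd.{u} n)

/-- The mean value of a function. -/
def mean (f : M → ℂ) : ℂ := (∫ x, f x ∂M.vol) / M.totalVol

/-- The Dirichlet form of the Neumann Laplacian. -/
def dirichlet (f g : M → ℂ) : ℂ := ∫ x, M.coInner x (M.d f x) (M.d g x) ∂M.vol

variable {M} {f g : M → ℂ}

theorem Smooth.continuous (hf : M.Smooth f) : Continuous f := ContMDiff.continuous hf

theorem Smooth.mdifferentiableAt (hf : M.Smooth f) (x : M) :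
    MDifferentiableAt M.I 𝓘(ℝ, ℂ) f x := ContMDiff.mdifferentiable hf (by simp) x

theorem memLp_of_continuous (hf : Continuous f) (p : ENNReal) : MemLp f p M.vol := by
  obtain ⟨C, hC⟩ := isCompact_univ.exists_bound_of_continuousOn hf.continuousOn
  exact MemLp.of_bound hf.aestronglyMeasurable C (Eventually.of_forall fun x => hC x (mem_univ x))

theorem integrable_of_continuous (hf : Continuous f) : Integrable f M.vol :=
  memLp_one_iff_integrable.1 (memLp_of_continuous hf 1)

theorem contMDiffOn_snd_comp (hf : M.Smooth f) : ContMDiffOn (𝓘(ℝ, ℝ).prod M.I) 𝓘(ℝ, ℂ) ∞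
      (fun p : ℝ × M => f p.2) (univ ×ˢ univ) := by
  have : ContMDiff (𝓘(ℝ, ℝ).prod M.I) 𝓘(ℝ, ℂ) ∞ (fun p : ℝ × M => f p.2) := 
   ContMDiff.comp (I' := M.I) hf contMDiff_snd
  exact this.contMDiffOn

theorem continuous_coInner (hf : M.Smooth f) (hg : M.Smooth g) :
    Continuous fun x => M.coInner x (M.d f x) (M.d g x) := by
  have h0 := continuousOn_coInner_slice (M := M) (T := univ) (w := fun p : ℝ × M => f p.2)
      (w' := fun p : ℝ × M => g p.2) uniqueDiffOn_univ
      (contMDiffOn_snd_comp hf) (contMDiffOn_snd_comp hg)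
  have h1 := (continuousOn_univ.1 (univ_prod_univ (α := ℝ) (β := M) ▸ h0)).comp
    (Continuous.prodMk_right (0 : ℝ))
  exact h1

theorem integrable_coInner (hf : M.Smooth f) (hg : M.Smooth g) :
    Integrable (fun x => M.coInner x (M.d f x) (M.d g x)) M.vol :=
  integrable_of_continuous (continuous_coInner hf hg)

theorem Smooth.add (hf : M.Smooth f) (hg : M.Smooth g) : M.Smooth (f + g) := ContMDiff.add hf hg

theorem Smooth.const_smul (hf : M.Smooth f) (c : ℂ) : M.Smooth (c • f) := by
  have : ContMDiff 𝓘(ℝ, ℂ) 𝓘(ℝ, ℂ) ∞ (fun z : ℂ => c * z) :=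
    (contDiff_const.mul contDiff_id).contMDiff
  exact this.comp hf

theorem smooth_const (c : ℂ) : M.Smooth fun _ => c := contMDiff_const

theorem d_add (hf : M.Smooth f) (hg : M.Smooth g) (x : M) : M.d (f + g) x = M.d f x + M.d g x :=
  mfderiv_add (hf.mdifferentiableAt x) (hg.mdifferentiableAt x)

theorem d_const_smul (hf : M.Smooth f) (c : ℂ) (x : M) : M.d (c • f) x = c • M.d f x := by
  have h := (hf.mdifferentiableAt x).hasMFDerivAt
  have : HasMFDerivAt M.I 𝓘(ℝ, ℂ) (c • f) x (c • M.d f x) :=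
    ⟨h.1.const_smul c, h.2.const_smul c⟩
  exact this.mfderiv

theorem d_const (c : ℂ) (x : M) : M.d (fun _ => c) x = 0 := mfderiv_const

theorem dirichlet_add_right {k : M → ℂ} (hf : M.Smooth f) (hg : M.Smooth g) (hk : M.Smooth k) :
    M.dirichlet f (g + k) = M.dirichlet f g + M.dirichlet f k := by
  rw [dirichlet, dirichlet, dirichlet,
    ← integral_add (integrable_coInner hf hg) (integrable_coInner hf hk)]
  exact integral_congr_ae (Eventually.of_forall fun x => by
    simp only [d_add hg hk, coInner_add_right])

theorem dirichlet_smul_right (hg : M.Smooth g) (c : ℂ) :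
    M.dirichlet f (c • g) = c * M.dirichlet f g := by
  rw [dirichlet, dirichlet, ← integral_const_mul]
  exact integral_congr_ae (Eventually.of_forall fun x => by
    simp only [d_const_smul hg, coInner_smul_right])

theorem conj_dirichlet (f g : M → ℂ) : conj (M.dirichlet f g) = M.dirichlet g f := by
  rw [dirichlet, dirichlet, ← integral_conj]
  simp only [conj_coInner]

theorem dirichlet_self_re (hf : M.Smooth f) :
    (M.dirichlet f f).re = ∫ x, (M.coInner x (M.d f x) (M.d f x)).re ∂M.vol :=
  (integral_re (integrable_coInner hf hf)).symm

theorem dirichlet_self_re_nonneg (hf : M.Smooth f) : 0 ≤ (M.dirichlet f f).re := by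
  rw [dirichlet_self_re hf]
  exact integral_nonneg fun x => M.coInner_self_re_nonneg x _

variable (M)

theorem totalVol_nonneg : 0 ≤ M.totalVol := measureReal_nonneg

theorem totalVol_pos_of_neumannEigenvalue_pos (h : 0 < M.neumannEigenvalue 2) :
    0 < M.totalVol := by
  refine M.totalVol_nonneg.lt_of_ne fun h0 => h.ne' ?_
  have hμ : M.vol = 0 := by
    rw [← Measure.measure_univ_eq_zero]
    exact (measureReal_eq_zero_iff).1 h0.symm
  by_contra hne
  rw [neumannEigenvalue] at hne
  rcases eq_empty_or_nonempty {r : ℝ | 0 ≤ r ∧ ∃ L : Submodule ℂ (M → ℂ),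
    Module.finrank ℂ L = 2 ∧ ∀ u ∈ L, M.Smooth u ∧
      (∫ x, M.coInner x (M.d u x) (M.d u x) ∂M.vol).re ≤ r * ∫ x, ‖u x‖ ^ 2 ∂M.vol} with h1 | h1
  · rw [h1, Real.sInf_empty] at hne
    exact hne rfl
  obtain ⟨r, -, L, hL, hLu⟩ := h1
  refine h.not_ge (csInf_le ⟨0, fun r hr => hr.1⟩ ⟨le_rfl, L, hL, fun v hv => ⟨(hLu v hv).1, ?_⟩⟩)
  simp [hμ]

variable {M}

theorem dirichlet_affine (hf : M.Smooth f) (a b : ℂ) :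
    (M.dirichlet (a • (fun _ => 1) + b • f) (a • (fun _ => 1) + b • f)).re =
      ‖b‖ ^ 2 * (M.dirichlet f f).re := by
  have h1 := (smooth_const (M := M) 1).const_smul a
  have hd (x : M) : M.d (a • (fun _ => 1) + b • f) x = b • M.d f x := by
    rw [d_add h1 (hf.const_smul b), d_const_smul (smooth_const 1), d_const_smul hf, d_const]
    exact (congrArg (· + b • M.d f x) (smul_zero a)).trans (zero_add _)
  have hs := h1.add (hf.const_smul b)
  rw [dirichlet_self_re hs, dirichlet_self_re hf, ← integral_const_mul]
  refine integral_congr_ae (Eventually.of_forall fun x => ?_)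
  simp only [hd]
  have h2 : M.coInner x (b • M.d f x) (b • M.d f x) =
      (↑(‖b‖ ^ 2) : ℂ) * M.coInner x (M.d f x) (M.d f x) := by
    rw [coInner_smul_right, ← conj_coInner, coInner_smul_right, map_mul, conj_coInner, ← mul_assoc,
      RCLike.mul_conj]
    push_cast
    rfl
  rw [h2, Complex.re_ofReal_mul]

theorem integral_sub_mean (hM : 0 < M.totalVol) (hf : Continuous f) :
    ∫ x, (f x - M.mean f) ∂M.vol = 0 := by
  rw [integral_sub (integrable_of_continuous hf) (integrable_const _), integral_const, mean,
    Complex.real_smul]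
  change _ - (M.totalVol : ℂ) * _ = 0
  have : (M.totalVol : ℂ) ≠ 0 := by exact_mod_cast hM.ne'
  field_simp
  ring

theorem integral_sq_norm_affine (hf : Continuous f) (h0 : ∫ x, f x ∂M.vol = 0) (a b : ℂ) :
    ∫ x, ‖a + b * f x‖ ^ 2 ∂M.vol =
      ‖a‖ ^ 2 * M.totalVol + ‖b‖ ^ 2 * ∫ x, ‖f x‖ ^ 2 ∂M.vol := by
  have hpt (x : M) : ‖a + b * f x‖ ^ 2 =
      ‖a‖ ^ 2 + ‖b‖ ^ 2 * ‖f x‖ ^ 2 + 2 * (conj a * b * f x).re := by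
    rw [← Complex.normSq_eq_norm_sq, Complex.normSq_add, Complex.normSq_eq_norm_sq,
      Complex.normSq_eq_norm_sq, norm_mul, mul_pow, ← Complex.conj_re (a * _)]
    simp only [map_mul, Complex.conj_conj]
    ring_nf
  have hi2 : Integrable (fun x => ‖f x‖ ^ 2) M.vol :=
    (memLp_two_iff_integrable_sq_norm (memLp_of_continuous hf 2).1).1 (memLp_of_continuous hf 2)
  have hi : Integrable (fun x => conj a * b * f x) M.vol := (integrable_of_continuous hf).const_mul _
  simp_rw [hpt]
  have hi' : Integrable (fun x => (conj a * b * f x).re) M.vol := hi.re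
  have hi3 : Integrable (fun x => ‖a‖ ^ 2 + ‖b‖ ^ 2 * ‖f x‖ ^ 2) M.vol :=
    (integrable_const _).add (hi2.const_mul _)
  rw [integral_add hi3 (hi'.const_mul 2),
    integral_add (integrable_const _) (hi2.const_mul _), integral_const_mul, integral_const_mul,
    integral_const, smul_eq_mul]
  have : ∫ x, (conj a * b * f x).re ∂M.vol = 0 := by
    have := integral_re hi
    simp only [RCLike.re_to_complex] at this
    rw [this, integral_const_mul, h0]
    simp
  rw [this]
  change M.totalVol * _ + _ + _ = _
  ring

/-- The Poincaré inequality, for the second Neumann eigenvalue. -/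
theorem poincare (hlam : 0 < M.neumannEigenvalue 2) (hf : M.Smooth f) :
    ∫ x, ‖f x - M.mean f‖ ^ 2 ∂M.vol ≤ (M.dirichlet f f).re / M.neumannEigenvalue 2 := by
  have hM := M.totalVol_pos_of_neumannEigenvalue_pos hlam
  set g : M → ℂ := fun x => f x - M.mean f
  have hg : M.Smooth g := ContMDiff.sub hf contMDiff_const
  have hg0 : ∫ x, g x ∂M.vol = 0 := integral_sub_mean hM hf.continuous
  have hfg : f = M.mean f • (fun _ => 1) + (1 : ℂ) • g := by
    ext x
    simp [g]
  have hE : (M.dirichlet f f).re = (M.dirichlet g g).re := by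
    conv_lhs => rw [hfg]
    rw [dirichlet_affine hg]
    simp
  rw [hE]
  set N := ∫ x, ‖g x‖ ^ 2 ∂M.vol
  have hN0 : 0 ≤ N := integral_nonneg fun _ => sq_nonneg _
  have hD0 := dirichlet_self_re_nonneg hg
  rcases hN0.eq_or_lt with hN | hN
  · rw [← hN]
    positivity
  rw [le_div_iff₀ hlam, mul_comm, ← le_div_iff₀ hN]
  -- The span of `1` and `g` is a two-dimensional test space in the min-max definition. The constant
  -- contributes nothing to the energy and, being orthogonal to `g`, only increases the norm, so the
  -- Rayleigh quotient of `g` is an admissible bound on the whole span.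
  have hind : LinearIndependent ℂ ![(fun _ => 1 : M → ℂ), g] := by
    rw [LinearIndependent.pair_iff]
    intro a b hab
    have h := integral_sq_norm_affine (M := M) hg.continuous hg0 a b
    have h0 (x : M) : a + b * g x = 0 := by simpa using congrFun hab x
    simp only [h0, norm_zero] at h
    have ha : ‖a‖ ^ 2 * M.totalVol = 0 := by
      nlinarith [mul_nonneg (sq_nonneg ‖a‖) hM.le, mul_nonneg (sq_nonneg ‖b‖) hN.le,
        (by simpa using h : 0 = ‖a‖ ^ 2 * M.totalVol + ‖b‖ ^ 2 * N)]
    have hb : ‖b‖ ^ 2 * N = 0 := by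
      nlinarith [(by simpa using h : 0 = ‖a‖ ^ 2 * M.totalVol + ‖b‖ ^ 2 * N)]
    exact ⟨by simpa [hM.ne'] using ha, by simpa [hN.ne'] using hb⟩
  refine csInf_le ⟨0, fun r hr => hr.1⟩ ⟨by positivity,
    Submodule.span ℂ (range ![(fun _ => 1 : M → ℂ), g]), by simpa using finrank_span_eq_card hind, ?_⟩
  intro v hv
  rw [Matrix.range_cons, Matrix.range_cons, Matrix.range_empty, union_empty, singleton_union,
    Submodule.mem_span_pair] at hv
  obtain ⟨a, b, rfl⟩ := hv
  refine ⟨((smooth_const 1).const_smul a).add (hg.const_smul b), ?_⟩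
  refine (dirichlet_affine hg a b).trans_le ?_
  have h := integral_sq_norm_affine (M := M) hg.continuous hg0 a b
  have h' : ∫ x, ‖(a • (fun _ => 1 : M → ℂ) + b • g) x‖ ^ 2 ∂M.vol =
      ‖a‖ ^ 2 * M.totalVol + ‖b‖ ^ 2 * N := by
    rw [← h]
    simp
  rw [h', mul_add]
  have : ‖b‖ ^ 2 * (M.dirichlet g g).re =
      (M.dirichlet g g).re / N * (‖b‖ ^ 2 * N) := by field_simp
  rw [this]
  have : 0 ≤ (M.dirichlet g g).re / N * (‖a‖ ^ 2 * M.totalVol) := by positivity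
  linarith

theorem integral_sq_norm_eq_mean (hM : 0 < M.totalVol) (hf : Continuous f) :
    ∫ x, ‖f x‖ ^ 2 ∂M.vol =
      ‖M.mean f‖ ^ 2 * M.totalVol + ∫ x, ‖f x - M.mean f‖ ^ 2 ∂M.vol := by
  have h := integral_sq_norm_affine (M := M) (hf.sub continuous_const) (integral_sub_mean hM hf)
    (M.mean f) 1
  simpa using h

end RiemMfd

/-! ### Operators associated with forms, and closeness of their resolvents -/

section AbstractForms

variable {V H : Type*} [NormedAddCommGroup V] [InnerProductSpace ℂ V]
  [NormedAddCommGroup H] [InnerProductSpace ℂ H]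

/-- A bounded operator with `|⟨x, T x⟩| ≥ c ‖x‖²` is bijective. -/
theorem bijective_of_le_norm_inner [CompleteSpace V] (T : V →L[ℂ] V) {c : ℝ} (hc : 0 < c)
    (h : ∀ x, c * ‖x‖ ^ 2 ≤ ‖inner ℂ x (T x)‖) : Function.Bijective T := by
  have hbelow (x : V) : c * ‖x‖ ≤ ‖T x‖ := by
    rcases (norm_nonneg x).eq_or_lt with hx | hx
    · rw [← hx, mul_zero]
      exact norm_nonneg _
    · have h1 := (h x).trans (norm_inner_le_norm x (T x))
      have h2 : ‖x‖ * (c * ‖x‖) ≤ ‖x‖ * ‖T x‖ := by nlinarith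
      exact le_of_mul_le_mul_left h2 hx
  have hanti : AntilipschitzWith (Real.toNNReal c⁻¹) T := by
    refine T.antilipschitz_of_bound fun x => ?_
    rw [Real.coe_toNNReal _ (inv_nonneg.2 hc.le), inv_mul_eq_div, le_div_iff₀ hc, mul_comm]
    exact hbelow x
  refine ⟨hanti.injective, ?_⟩
  have hcl : IsClosed (range T) := hanti.isClosed_range T.uniformContinuous
  have hcl' : IsClosed ((LinearMap.range (T : V →ₗ[ℂ] V) : Submodule ℂ V) : Set V) := hcl
  have hcomp : CompleteSpace (LinearMap.range (T : V →ₗ[ℂ] V)) := hcl'.completeSpace_coe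
  -- The range is closed. A vector `v` orthogonal to it satisfies `⟨T v, v⟩ = 0`, so it vanishes by
  -- coercivity.
  have htop : LinearMap.range (T : V →ₗ[ℂ] V) = ⊤ := by
    rw [← Submodule.orthogonal_eq_bot_iff, Submodule.eq_bot_iff]
    intro v hv
    have h0 : inner ℂ (T v) v = 0 := (Submodule.mem_orthogonal _ _).1 hv _ ⟨v, rfl⟩
    have h1 := h v
    rw [← inner_conj_symm, h0, map_zero, norm_zero] at h1
    have : ‖v‖ ^ 2 ≤ 0 := by nlinarith
    have h2 : ‖v‖ = 0 := pow_eq_zero_iff two_ne_zero |>.1 (le_antisymm this (sq_nonneg ‖v‖))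
    exact norm_eq_zero.1 h2
  exact LinearMap.range_eq_top.1 htop

variable (ι : V →L[ℂ] H) (A : V →L[ℂ] V)

/-- The operator associated with the form `⟨x, A y⟩` on `V`, where `ι : V → H`, as a graph. -/
def formRel : Set (H × H) :=
  {p | ∃ x : V, ι x = p.1 ∧ ∀ φ, inner ℂ φ (A x) = inner ℂ (ι φ) p.2}

/-- `x` is the weak solution of `(A - z) x = g`. -/
def IsSol (z : ℂ) (g : H) (x : V) : Prop :=
  ∀ φ, inner ℂ φ (A x) = inner ℂ (ι φ) (g + z • ι x)

variable {ι A}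

/-- The weak equation says `(A - z ι* ι) x = ι* g`, and the hypothesis is the coercivity that makes
the operator on the left invertible (Lax–Milgram). -/
theorem exists_solution [CompleteSpace V] [CompleteSpace H] {z : ℂ} {c : ℝ} (hc : 0 < c)
    (h : ∀ x, c * ‖x‖ ^ 2 ≤ ‖inner ℂ x (A x) - z * inner ℂ (ι x) (ι x)‖) :
    ∃ R : V →L[ℂ] V, ∀ g x, IsSol ι A z g x ↔ x = R (ContinuousLinearMap.adjoint ι g) := by
  set T : V →L[ℂ] V := A - z • (ContinuousLinearMap.adjoint ι ∘L ι) with hT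
  have hbij : Function.Bijective T := bijective_of_le_norm_inner T hc fun x => by
    refine (h x).trans_eq ?_
    rw [hT, sub_apply, smul_apply, inner_sub_right, inner_smul_right, ContinuousLinearMap.comp_apply,
      ContinuousLinearMap.adjoint_inner_right]
  let e : V ≃L[ℂ] V := ContinuousLinearEquiv.ofBijective T
    (LinearMap.ker_eq_bot.2 hbij.1) (LinearMap.range_eq_top.2 hbij.2)
  have he (x : V) : e x = T x := rfl
  refine ⟨e.symm, fun g x => ?_⟩
  have key : IsSol ι A z g x ↔ T x = ContinuousLinearMap.adjoint ι g := by
    constructor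
    · intro hx
      refine ext_inner_left ℂ fun φ => ?_
      have := hx φ
      simp only [hT, ContinuousLinearMap.adjoint_inner_right, inner_add_right, inner_smul_right,
        sub_apply, smul_apply, ContinuousLinearMap.comp_apply, inner_sub_right] at this ⊢
      rw [this]
      ring
    · intro hx φ
      have := congrArg (fun v => inner ℂ φ v) hx
      simp only [hT, ContinuousLinearMap.adjoint_inner_right, inner_smul_right,
        sub_apply, smul_apply, ContinuousLinearMap.comp_apply, inner_sub_right] at this
      rw [inner_add_right, inner_smul_right, ← this]
      ring
  rw [key, ← he]
  constructor
  · intro h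
    exact (e.symm_apply_eq.2 h.symm).symm
  · intro h
    rw [h]
    exact e.apply_symm_apply _

/-- Any `x` that witnesses membership in the relation is a weak solution, hence unique in `V`.
Therefore `ι` need not be injective. -/
theorem isResolvent_formRel [CompleteSpace V] [CompleteSpace H] {z : ℂ} {R : V →L[ℂ] V}
    (hR : ∀ g x, IsSol ι A z g x ↔ x = R (ContinuousLinearMap.adjoint ι g)) :
    IsResolvent (formRel ι A) z (ι ∘L R ∘L ContinuousLinearMap.adjoint ι) := by
  intro g f
  constructor
  · rintro rfl
    exact ⟨R (ContinuousLinearMap.adjoint ι g), rfl, (hR g _).2 rfl⟩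
  · rintro ⟨x, hx, h⟩
    simp only at hx h
    subst hx
    rw [(hR g x).1 h]
    simp

theorem inner_self_eq_re (hA : ∀ x y, inner ℂ (A x) y = inner ℂ x (A y)) (x : V) :
    inner ℂ x (A x) = ((inner ℂ x (A x)).re : ℂ) := by
  refine (Complex.conj_eq_iff_re.1 ?_).symm
  rw [inner_conj_symm, hA]

/-- Shifting by `C + 1` adds `(C + 1) ‖ι x‖²` to the form, twice what is needed to compensate the
negative term of the lower bound. -/
theorem coercive_real {C : ℝ} (hC : 0 ≤ C)
    (hlow : ∀ x, 1 / 2 * ‖x‖ ^ 2 - (C + 1) / 2 * ‖ι x‖ ^ 2 ≤ (inner ℂ x (A x)).re)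
    (x : V) : (1 / 2 : ℝ) * ‖x‖ ^ 2 ≤
    ‖inner ℂ x (A x) - ((-C - 1 : ℝ) : ℂ) * inner ℂ (ι x) (ι x)‖ := by
  refine le_trans ?_ (Complex.re_le_norm _)
  have : (inner ℂ (ι x) (ι x) : ℂ) = ((‖ι x‖ ^ 2 : ℝ) : ℂ) := by
    rw [inner_self_eq_norm_sq_to_K]; norm_cast
  rw [this, Complex.sub_re, ← Complex.ofReal_mul, Complex.ofReal_re]
  nlinarith [hlow x, mul_nonneg (add_nonneg hC zero_le_one) (sq_nonneg ‖ι x‖)]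

/-- The form is real and `z` is imaginary of modulus one, so `N` dominates both the value `h` of the
form and `k = ‖ι x‖²`. Then `½‖x‖² ≤ h + ½(C + 1) k ≤ ½(C + 3) N`. -/
theorem coercive_imaginary (hA : ∀ x y, inner ℂ (A x) y = inner ℂ x (A y))
    {C : ℝ} (hC : 0 ≤ C) (hlow : ∀ x, 1 / 2 * ‖x‖ ^ 2 - (C + 1) / 2 * ‖ι x‖ ^ 2 ≤ (inner ℂ x (A x)).re)
    {z : ℂ} (hz : z.re = 0) (hz1 : z.im ^ 2 = 1) (x : V) :
    1 / (C + 3) * ‖x‖ ^ 2 ≤ ‖inner ℂ x (A x) - z * inner ℂ (ι x) (ι x)‖ := by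
  have : (inner ℂ (ι x) (ι x) : ℂ) = ((‖ι x‖ ^ 2 : ℝ) : ℂ) := by
    rw [inner_self_eq_norm_sq_to_K]; norm_cast
  rw [this, inner_self_eq_re hA]
  set h := (inner ℂ x (A x)).re
  set k := ‖ι x‖ ^ 2
  set N := ‖(h : ℂ) - z * (k : ℂ)‖
  have h1 : h ≤ N := by
    have := Complex.re_le_norm ((h : ℂ) - z * (k : ℂ))
    simpa [hz] using this
  have h2 : k ≤ N := by
    have := Complex.abs_im_le_norm ((h : ℂ) - z * (k : ℂ))
    simp only [Complex.sub_im, Complex.ofReal_im, Complex.mul_im, hz, zero_mul, zero_sub,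
      Complex.ofReal_re, abs_neg, abs_mul, zero_add] at this
    have hz' : |z.im| = 1 := by
      rw [← Real.sqrt_sq_eq_abs, hz1, Real.sqrt_one]
    rw [hz', one_mul] at this
    exact (le_abs_self k).trans this
  have h3 : 1 / 2 * ‖x‖ ^ 2 - (C + 1) / 2 * k ≤ h := hlow x
  rw [div_mul_eq_mul_div, one_mul, div_le_iff₀ (by positivity)]
  nlinarith

/-- Test the equation with `x` itself; `r` plays the role of the operator applied to `x`. The first
bound is Young's inequality for `⟨ι x, g⟩`. The second holds because in `‖r + (C + 1) ι x‖²` the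
terms other than `‖r‖²` add up to a nonnegative number by the lower bound of the form. -/
theorem sol_bounds_real {C : ℝ} (hC : 0 ≤ C)
    (hlow : ∀ x, 1 / 2 * ‖x‖ ^ 2 - (C + 1) / 2 * ‖ι x‖ ^ 2 ≤ (inner ℂ x (A x)).re)
    {g : H} {x : V} (hx : IsSol ι A ((-C - 1 : ℝ) : ℂ) g x) :
    ‖x‖ ≤ ‖g‖ ∧ ‖g + ((-C - 1 : ℝ) : ℂ) • ι x‖ ≤ ‖g‖ := by
  have h1 := congrArg Complex.re (hx x)
  have h3 := hlow x
  set r := g + ((-C - 1 : ℝ) : ℂ) • ι x with hr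
  have hg : g = r + ((C + 1 : ℝ) : ℂ) • ι x := by
    rw [hr, add_assoc, ← add_smul]
    push_cast
    simp
  have hgn : ‖g‖ ^ 2 = ‖r‖ ^ 2 + 2 * (C + 1) * (inner ℂ (ι x) r).re + (C + 1) ^ 2 * ‖ι x‖ ^ 2 := by
    rw [hg, @norm_add_sq ℂ, inner_smul_right, norm_smul, Complex.norm_real, mul_pow,
      Real.norm_eq_abs, sq_abs, ← inner_conj_symm]
    simp only [RCLike.re_to_complex, Complex.re_ofReal_mul, Complex.conj_re]
    ring
  have hxx : (inner ℂ (ι x) r).re = (inner ℂ (ι x) g).re - (C + 1) * ‖ι x‖ ^ 2 := by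
    have : (inner ℂ (ι x) (ι x) : ℂ) = ((‖ι x‖ ^ 2 : ℝ) : ℂ) := by
      rw [inner_self_eq_norm_sq_to_K]; norm_cast
    rw [hr, inner_add_right, inner_smul_right, this, Complex.add_re, Complex.re_ofReal_mul,
      Complex.ofReal_re]
    ring
  have hcs : (inner ℂ (ι x) g).re ≤ ‖ι x‖ * ‖g‖ := (Complex.re_le_norm _).trans (norm_inner_le_norm _ _)
  constructor
  · refine abs_le_of_sq_le_sq' ?_ (norm_nonneg _) |>.2
    nlinarith [sq_nonneg (‖ι x‖ - ‖g‖), mul_nonneg hC (sq_nonneg ‖ι x‖)]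
  · refine abs_le_of_sq_le_sq' ?_ (norm_nonneg _) |>.2
    have : 0 ≤ 2 * (C + 1) * ((inner ℂ (ι x) r).re + (C + 1) / 2 * ‖ι x‖ ^ 2) := by
      refine mul_nonneg (by linarith) ?_
      nlinarith [sq_nonneg ‖x‖]
    nlinarith

/-- Since `⟨ι x, r⟩` is real and `z` is imaginary, Pythagoras gives `‖g‖² = ‖r‖² + ‖ι x‖²`. With
`2‖ι x‖‖r‖ ≤ ‖ι x‖² + ‖r‖²` the lower bound becomes `‖x‖² ≤ ‖r‖² + (C + 2)‖ι x‖²`. -/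
theorem sol_bounds_imaginary (hA : ∀ x y, inner ℂ (A x) y = inner ℂ x (A y))
    {C : ℝ} (hC : 0 ≤ C) (hlow : ∀ x, 1 / 2 * ‖x‖ ^ 2 - (C + 1) / 2 * ‖ι x‖ ^ 2 ≤ (inner ℂ x (A x)).re)
    {z : ℂ} (hz : z.re = 0) (hz1 : z.im ^ 2 = 1) {g : H} {x : V}
    (hx : IsSol ι A z g x) : ‖x‖ ≤ Real.sqrt (C + 2) * ‖g‖ ∧ ‖g + z • ι x‖ ≤ ‖g‖ := by
  have h1 := (inner_self_eq_re hA x).symm.trans (hx x)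
  have h3 := hlow x
  set r := g + z • ι x with hr
  have hzn : ‖z‖ ^ 2 = 1 := by
    rw [← Complex.normSq_eq_norm_sq, Complex.normSq_apply, hz, ← hz1]
    ring
  have hg : g = r - z • ι x := by rw [hr]; abel
  have hgn : ‖g‖ ^ 2 = ‖r‖ ^ 2 + ‖ι x‖ ^ 2 := by
    rw [hg, @norm_sub_sq ℂ, inner_smul_right, norm_smul, mul_pow, hzn, ← inner_conj_symm, ← h1]
    simp [hz]
  have hcs : (inner ℂ x (A x)).re ≤ ‖ι x‖ * ‖r‖ := by
    have := congrArg Complex.re h1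
    rw [Complex.ofReal_re] at this
    rw [this]
    exact (Complex.re_le_norm _).trans (norm_inner_le_norm _ _)
  constructor
  · refine abs_le_of_sq_le_sq' ?_ (by positivity) |>.2
    rw [mul_pow, Real.sq_sqrt (by linarith)]
    nlinarith [sq_nonneg (‖ι x‖ - ‖r‖), mul_nonneg hC (sq_nonneg ‖r‖)]
  · refine abs_le_of_sq_le_sq' ?_ (norm_nonneg _) |>.2
    nlinarith [sq_nonneg ‖ι x‖]

end AbstractForms

/-! ### From closeness of forms to closeness of resolvents -/

section Closeness

variable {V H V' H' : Type*} [NormedAddCommGroup V] [InnerProductSpace ℂ V]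
  [NormedAddCommGroup H] [InnerProductSpace ℂ H] [CompleteSpace H]
  [NormedAddCommGroup V'] [InnerProductSpace ℂ V']
  [NormedAddCommGroup H'] [InnerProductSpace ℂ H'] [CompleteSpace H']
  {ι : V →L[ℂ] H} {A : V →L[ℂ] V} {ι' : V' →L[ℂ] H'} {A' : V' →L[ℂ] V'} {J : H →L[ℂ] H'}

/-- The forms `A` and `A'` are close with respect to `J`, on dense subsets of the form domains. -/
def FormsClose (ι : V →L[ℂ] H) (A : V →L[ℂ] V) (ι' : V' →L[ℂ] H') (A' : V' →L[ℂ] V')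
    (J : H →L[ℂ] H') (D : Set V) (N : Set V') (δ₁ δ₂ δ₃ K : ℝ) : Prop :=
  ∀ x ∈ D, ∀ y ∈ N, ∃ (v : V') (k : V), ‖v‖ ≤ K * ‖x‖ ∧ ‖k‖ ≤ K * ‖y‖ ∧
    ‖J (ι x) - ι' v‖ ≤ δ₁ * ‖x‖ ∧ ‖ContinuousLinearMap.adjoint J (ι' y) - ι k‖ ≤ δ₂ * ‖y‖ ∧
    ‖inner ℂ (A' y) v - inner ℂ k (A x)‖ ≤ δ₃ * ‖x‖ * ‖y‖

variable {D : Set V} {N : Set V'} {δ₁ δ₂ δ₃ K : ℝ}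

/-- Replace `J ι x` by `ι' v` and `J* ι' y` by `ι k`, at the cost of `δ₁` and `δ₂`. The weak
equations turn the two products into `⟨A' y, v⟩` and `⟨k, A x⟩`, which differ by `δ₃`. As `v` and
`k` exist only for elements of dense sets, `x` and `y` are approximated; the bounds by `K` serve
only to make the resulting errors tend to zero. -/
theorem FormsClose.norm_inner_sub_le (h : FormsClose ι A ι' A' J D N δ₁ δ₂ δ₃ K)
    (hD : Dense D) (hN : Dense N) {x : V} {y : V'} {g : H} {w : H'}
    (hx : ∀ φ, inner ℂ φ (A x) = inner ℂ (ι φ) g)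
    (hy : ∀ φ, inner ℂ φ (A' y) = inner ℂ (ι' φ) w) :
    ‖inner ℂ w (J (ι x)) - inner ℂ (ContinuousLinearMap.adjoint J (ι' y)) g‖ ≤
      δ₁ * ‖x‖ * ‖w‖ + δ₂ * ‖y‖ * ‖g‖ + δ₃ * ‖x‖ * ‖y‖ := by
  obtain ⟨xs, hxs, hxl⟩ := mem_closure_iff_seq_limit.1 (hD x)
  obtain ⟨ys, hys, hyl⟩ := mem_closure_iff_seq_limit.1 (hN y)
  have hpt (m : ℕ) : ‖inner ℂ w (J (ι (xs m))) -
      inner ℂ (ContinuousLinearMap.adjoint J (ι' (ys m))) g‖ ≤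
      δ₁ * ‖xs m‖ * ‖w‖ + δ₂ * ‖ys m‖ * ‖g‖ + δ₃ * ‖xs m‖ * ‖ys m‖ +
      (‖A' (y - ys m)‖ * (K * ‖xs m‖) + (K * ‖ys m‖) * ‖A (x - xs m)‖) := by
    obtain ⟨v, k, hv, hk, h1, h2, h3⟩ := h _ (hxs m) _ (hys m)
    have e1 : inner ℂ w (ι' v) = inner ℂ (A' y) v := by
      rw [← inner_conj_symm, ← hy, inner_conj_symm]
    have e2 : inner ℂ (ι k) g = inner ℂ k (A x) := (hx k).symm
    have e3 : inner ℂ (A' y) v = inner ℂ (A' (y - ys m)) v + inner ℂ (A' (ys m)) v := by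
      rw [← inner_add_left, ← map_add, sub_add_cancel]
    have e4 : inner ℂ k (A x) = inner ℂ k (A (x - xs m)) + inner ℂ k (A (xs m)) := by
      rw [← inner_add_right, ← map_add, sub_add_cancel]
    have key : inner ℂ w (J (ι (xs m))) - inner ℂ (ContinuousLinearMap.adjoint J (ι' (ys m))) g =
        inner ℂ w (J (ι (xs m)) - ι' v) -
        inner ℂ (ContinuousLinearMap.adjoint J (ι' (ys m)) - ι k) g +
        (inner ℂ (A' (ys m)) v - inner ℂ k (A (xs m))) +
        (inner ℂ (A' (y - ys m)) v - inner ℂ k (A (x - xs m))) := by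
      rw [inner_sub_right, inner_sub_left, e1, e2, e3, e4]
      ring
    rw [key]
    have b1 : ‖inner ℂ w (J (ι (xs m)) - ι' v)‖ ≤ δ₁ * ‖xs m‖ * ‖w‖ := by
      refine (norm_inner_le_norm _ _).trans ?_
      rw [mul_comm]
      exact mul_le_mul_of_nonneg_right h1 (norm_nonneg _)
    have b2 : ‖inner ℂ (ContinuousLinearMap.adjoint J (ι' (ys m)) - ι k) g‖ ≤
        δ₂ * ‖ys m‖ * ‖g‖ := (norm_inner_le_norm _ _).trans
      (mul_le_mul_of_nonneg_right h2 (norm_nonneg _))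
    have b4 : ‖inner ℂ (A' (y - ys m)) v‖ ≤ ‖A' (y - ys m)‖ * (K * ‖xs m‖) :=
      (norm_inner_le_norm _ _).trans (mul_le_mul_of_nonneg_left hv (norm_nonneg _))
    have b5 : ‖inner ℂ k (A (x - xs m))‖ ≤ (K * ‖ys m‖) * ‖A (x - xs m)‖ :=
      (norm_inner_le_norm _ _).trans (mul_le_mul_of_nonneg_right hk (norm_nonneg _))
    refine (norm_add_le _ _).trans (add_le_add ((norm_add_le _ _).trans
      (add_le_add ((norm_sub_le _ _).trans (add_le_add b1 b2)) h3))
      ((norm_sub_le _ _).trans (add_le_add b4 b5)))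
  have hl : Tendsto (fun m => ‖inner ℂ w (J (ι (xs m))) -
      inner ℂ (ContinuousLinearMap.adjoint J (ι' (ys m))) g‖) atTop
      (𝓝 ‖inner ℂ w (J (ι x)) - inner ℂ (ContinuousLinearMap.adjoint J (ι' y)) g‖) := by
    refine Tendsto.norm (Tendsto.sub (tendsto_const_nhds.inner ?_) (Tendsto.inner ?_
      tendsto_const_nhds))
    · exact ((J ∘L ι).continuous.tendsto x).comp hxl
    · exact ((ContinuousLinearMap.adjoint J ∘L ι').continuous.tendsto y).comp hyl
  have hA0 : Tendsto (fun m => ‖A (x - xs m)‖) atTop (𝓝 0) := by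
    have := ((A.continuous.tendsto _).comp (hxl.const_sub x)).norm
    simpa using this
  have hA0' : Tendsto (fun m => ‖A' (y - ys m)‖) atTop (𝓝 0) := by
    have := ((A'.continuous.tendsto _).comp (hyl.const_sub y)).norm
    simpa using this
  have hr := (((hxl.norm.const_mul δ₁).mul_const ‖w‖).add ((hyl.norm.const_mul δ₂).mul_const ‖g‖)).add
    ((hxl.norm.const_mul δ₃).mul hyl.norm) |>.add
    ((hA0'.mul (hxl.norm.const_mul K)).add ((hyl.norm.const_mul K).mul hA0))
  have := le_of_tendsto_of_tendsto' hl hr hpt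
  simpa using this

/-- Closeness of the forms implies closeness of the resolvents. -/
theorem FormsClose.norm_resolvent_sub_le [CompleteSpace V] [CompleteSpace V']
    (h : FormsClose ι A ι' A' J D N δ₁ δ₂ δ₃ K)
    (hD : Dense D) (hN : Dense N) {z : ℂ} {R : V →L[ℂ] V} {R' S' : V' →L[ℂ] V'}
    (hR : ∀ g x, IsSol ι A z g x ↔ x = R (ContinuousLinearMap.adjoint ι g))
    (hR' : ∀ g x, IsSol ι' A' z g x ↔ x = R' (ContinuousLinearMap.adjoint ι' g))
    (hS' : ∀ g x, IsSol ι' A' (conj z) g x ↔ x = S' (ContinuousLinearMap.adjoint ι' g))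
    (hA' : ∀ x y, inner ℂ (A' x) y = inner ℂ x (A' y))
    (hδ₁ : 0 ≤ δ₁) (hδ₂ : 0 ≤ δ₂) (hδ₃ : 0 ≤ δ₃) {a : ℝ} (ha : 0 ≤ a)
    (hb : ∀ g x, IsSol ι A z g x → ‖x‖ ≤ a * ‖g‖ ∧ ‖g + z • ι x‖ ≤ ‖g‖)
    (hb' : ∀ g x, IsSol ι' A' (conj z) g x → ‖x‖ ≤ a * ‖g‖ ∧ ‖g + conj z • ι' x‖ ≤ ‖g‖) :
    ‖J ∘L (ι ∘L R ∘L ContinuousLinearMap.adjoint ι) -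
      (ι' ∘L R' ∘L ContinuousLinearMap.adjoint ι') ∘L J‖ ≤ (δ₁ + δ₂) * a + δ₃ * a ^ 2 := by
  refine ContinuousLinearMap.opNorm_le_bound _ (by positivity) fun g => ?_
  set x := R (ContinuousLinearMap.adjoint ι g)
  set x' := R' (ContinuousLinearMap.adjoint ι' (J g))
  have hx : IsSol ι A z g x := (hR g x).2 rfl
  have hx' : IsSol ι' A' z (J g) x' := (hR' _ x').2 rfl
  set w := J (ι x) - ι' x'
  change ‖w‖ ≤ _
  -- Duality: solving the adjoint problem with the difference `w` itself as right-hand side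
  -- expresses `‖w‖²` through the pairings of `norm_inner_sub_le`. The terms with `z` cancel.
  set y := S' (ContinuousLinearMap.adjoint ι' w)
  have hy : IsSol ι' A' (conj z) w y := (hS' w y).2 rfl
  have key : inner ℂ w w = inner ℂ (w + conj z • ι' y) (J (ι x)) -
      inner ℂ (ContinuousLinearMap.adjoint J (ι' y)) (g + z • ι x) := by
    have e1 : inner ℂ w (ι' x') = inner ℂ (ι' y) (J g) := by
      have h1 := hx' y
      have h2 := hy x'
      rw [← hA', ← inner_conj_symm, h2, inner_conj_symm, inner_add_left, inner_add_right,
        inner_smul_left, inner_smul_right, Complex.conj_conj] at h1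
      exact add_right_cancel h1
    have e2 : inner ℂ w w = inner ℂ w (J (ι x)) - inner ℂ w (ι' x') := by
      rw [← inner_sub_right]
    rw [e2, e1, ContinuousLinearMap.adjoint_inner_left, map_add, map_smul, inner_add_right,
      inner_add_left, inner_smul_left, inner_smul_right, Complex.conj_conj]
    ring
  have hn : ‖w‖ ^ 2 = ‖inner ℂ w w‖ := by
    rw [inner_self_eq_norm_sq_to_K]
    simp
  have hmain := h.norm_inner_sub_le hD hN hx hy
  rw [← key, ← hn] at hmain
  obtain ⟨b1, b2⟩ := hb g x hx
  obtain ⟨b3, b4⟩ := hb' w y hy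
  have hfin : ‖w‖ * ‖w‖ ≤ ‖w‖ * (((δ₁ + δ₂) * a + δ₃ * a ^ 2) * ‖g‖) := by
    calc ‖w‖ * ‖w‖ = ‖w‖ ^ 2 := (sq _).symm
      _ ≤ _ := hmain
      _ ≤ δ₁ * (a * ‖g‖) * ‖w‖ + δ₂ * (a * ‖w‖) * ‖g‖ + δ₃ * (a * ‖g‖) * (a * ‖w‖) := by
        gcongr
      _ = _ := by ring
  rcases (norm_nonneg w).eq_or_lt with h0 | h0
  · rw [← h0]
    positivity
  · exact le_of_mul_le_mul_left hfin h0

end Closeness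

/-! ### Traces on products of an interval and a manifold -/

namespace RiemMfd

variable {n : ℕ} {M : RiemMfd.{u} n} {T : Set ℝ} {w : ℝ × M → ℂ}

theorem continuousOn_slice
    (hw : ContMDiffOn (𝓘(ℝ, ℝ).prod M.I) 𝓘(ℝ, ℂ) ∞ w (T ×ˢ univ)) (y : M) :
    ContinuousOn (fun t => w (t, y)) T :=
  hw.continuousOn.comp (Continuous.prodMk_left y).continuousOn fun _ ht => ⟨ht, mem_univ _⟩

theorem continuousOn_derivWithin_slice (hT : UniqueDiffOn ℝ T)
    (hw : ContMDiffOn (𝓘(ℝ, ℝ).prod M.I) 𝓘(ℝ, ℂ) ∞ w (T ×ˢ univ)) (y : M) :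
    ContinuousOn (fun s => derivWithin (fun t => w (t, y)) T s) T := by
  have h := (continuousOn_derivWithin hT hw).comp (Continuous.prodMk_left y).continuousOn
    fun t (ht : t ∈ T) => ⟨ht, mem_univ _⟩
  exact h

theorem eq_add_integral_derivWithin (hT : UniqueDiffOn ℝ T)
    (hw : ContMDiffOn (𝓘(ℝ, ℝ).prod M.I) 𝓘(ℝ, ℂ) ∞ w (T ×ˢ univ)) (y : M) {s : ℝ} (hs : 0 ≤ s)
    (hsT : Icc 0 s ⊆ T) :
    w (s, y) = w (0, y) + ∫ t in (0 : ℝ)..s, derivWithin (fun t => w (t, y)) T t := by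
  have h := intervalIntegral.integral_eq_sub_of_hasDerivAt_of_le hs
    ((continuousOn_slice hw y).mono hsT) (fun t ht =>
      (hasDerivWithinAt_derivWithin hw (hsT (Ioo_subset_Icc_self ht)) y).hasDerivAt
        (mem_of_superset (Icc_mem_nhds ht.1 ht.2) hsT))
    (((continuousOn_derivWithin_slice hT hw y).mono hsT).intervalIntegrable_of_Icc hs)
  rw [h]
  ring

/-- The trace estimate on a product, integrated over `M`. -/
theorem integral_trace_le {b : ℝ} (hb : 0 < b) (hT : UniqueDiffOn ℝ T) (hbT : Ico 0 b ⊆ T)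
    (hw : ContMDiffOn (𝓘(ℝ, ℝ).prod M.I) 𝓘(ℝ, ℂ) ∞ w (T ×ˢ univ)) {A : Set ℝ}
    (hA : MeasurableSet A) (hbA : Ioo 0 b ⊆ A) {P R : ℝ × M → ℝ}
    (hP : Integrable P ((volume.restrict A).prod M.vol))
    (hR : Integrable R ((volume.restrict A).prod M.vol))
    (hwP : ∀ s ∈ A, ∀ y, ‖derivWithin (fun t => w (t, y)) T s‖ ^ 2 ≤ P (s, y))
    (hwR : ∀ s ∈ A, ∀ y, ‖w (s, y)‖ ^ 2 ≤ R (s, y)) :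
    ∫ y, ‖w (0, y)‖ ^ 2 ∂M.vol ≤ b * (∫ p, P p ∂(volume.restrict A).prod M.vol) +
      2 / b * ∫ p, R p ∂(volume.restrict A).prod M.vol := by
  have h0 : (0 : ℝ) ∈ T := hbT ⟨le_rfl, hb⟩
  -- Almost every slice is treated by the one-dimensional estimate. As `P` and `R` need only
  -- dominate, the same statement serves for the edges, where equality holds, and for the collars,
  -- where `P` is the full energy density.
  have hpt : ∀ᵐ y ∂M.vol, ‖w (0, y)‖ ^ 2 ≤ b * (∫ s in A, P (s, y)) +
      2 / b * ∫ s in A, R (s, y) := by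
    filter_upwards [hP.prod_left_ae, hR.prod_left_ae] with y hPy hRy
    have hbound {f : ℝ → ℂ} {F : ℝ → ℝ} (hf : ContinuousOn f (Ioo 0 b)) (hF : IntegrableOn F A)
        (hfF : ∀ s ∈ A, ‖f s‖ ^ 2 ≤ F s) : MemLp f 2 (volume.restrict (Ioo 0 b)) ∧
        ∫ s in Ioo 0 b, ‖f s‖ ^ 2 ≤ ∫ s in A, F s := by
      have hm : AEStronglyMeasurable f (volume.restrict (Ioo 0 b)) :=
        hf.aestronglyMeasurable measurableSet_Ioo
      have hFb := hF.mono_set hbA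
      have hi : IntegrableOn (fun s => ‖f s‖ ^ 2) (Ioo 0 b) := by
        refine Integrable.mono' hFb (hm.norm.pow 2) ?_
        filter_upwards [ae_restrict_mem measurableSet_Ioo] with s hs
        rw [Real.norm_of_nonneg (sq_nonneg _)]
        exact hfF s (hbA hs)
      refine ⟨(memLp_two_iff_integrable_sq_norm hm).2 hi, ?_⟩
      calc _ ≤ ∫ s in Ioo 0 b, F s :=
            setIntegral_mono_on hi hFb measurableSet_Ioo fun s hs => hfF s (hbA hs)
        _ ≤ _ := by
          refine setIntegral_mono_set hF ?_ hbA.eventuallyLE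
          filter_upwards [ae_restrict_mem hA] with s hs
          exact (sq_nonneg _).trans (hfF s hs)
    have hbT' : Ioo 0 b ⊆ T := Ioo_subset_Ico_self.trans hbT
    obtain ⟨m1, l1⟩ := hbound ((continuousOn_slice hw y).mono hbT') hRy (fun s hs => hwR s hs y)
    obtain ⟨m2, l2⟩ := hbound ((continuousOn_derivWithin_slice hT hw y).mono hbT') hPy
      (fun s hs => hwP s hs y)
    refine (sq_norm_initial_le hb m1 m2 ?_).trans ?_
    · filter_upwards [ae_restrict_mem measurableSet_Ioo] with s hs
      exact eq_add_integral_derivWithin hT hw y hs.1.le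
        fun t ht => hbT ⟨ht.1, ht.2.trans_lt hs.2⟩
    · gcongr
  have hcont : Continuous fun y => w (0, y) := (contMDiff_slice hw h0).continuous
  have hl : Integrable (fun y => ‖w (0, y)‖ ^ 2) M.vol :=
    (memLp_two_iff_integrable_sq_norm (memLp_of_continuous hcont 2).1).1 (memLp_of_continuous hcont 2)
  have hr := (hP.integral_prod_right.const_mul b).add (hR.integral_prod_right.const_mul (2 / b))
  refine (integral_mono_ae hl hr hpt).trans_eq ?_
  simp only [Pi.add_apply]
  rw [integral_add (hP.integral_prod_right.const_mul b) (hR.integral_prod_right.const_mul (2 / b)),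
    integral_const_mul, integral_const_mul, ← integral_prod_symm _ hP, ← integral_prod_symm _ hR]

theorem totalVol_mul_sq_mean_le {f : M → ℂ} (hf : Continuous f) :
    M.totalVol * ‖M.mean f‖ ^ 2 ≤ ∫ y, ‖f y‖ ^ 2 ∂M.vol := by
  rcases M.totalVol_nonneg.eq_or_lt with h | h
  · rw [← h, zero_mul]
    exact integral_nonneg fun _ => sq_nonneg _
  · have := sq_norm_integral_le (memLp_of_continuous (M := M) hf 2)
    rw [mean, norm_div, div_pow, Complex.norm_real, Real.norm_eq_abs, sq_abs, mul_div_assoc',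
      div_le_iff₀ (by positivity)]
    calc _ ≤ M.totalVol * (M.totalVol * ∫ y, ‖f y‖ ^ 2 ∂M.vol) :=
          mul_le_mul_of_nonneg_left this h.le
      _ = _ := by ring

end RiemMfd

namespace FatStar

variable {n : ℕ} {E : Type w} (S : FatStar.{u, w} n E)

/-! ### The collar -/

theorem contMDiffOn_comp_collar {f : S.X → ℂ} (hf : S.X.Smooth f) (e : E) :
    ContMDiffOn (𝓘(ℝ, ℝ).prod (S.Y e).I) 𝓘(ℝ, ℂ) ∞ (fun p => f (S.collar e p))
      (Ico 0 S.ellMinus ×ˢ univ) :=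
  ContMDiff.comp_contMDiffOn (I' := S.X.I) hf (S.collar_smooth e)

/-- By the isometry, `∂_s` is mapped to a unit vector of `X`, on which a covector takes a value no
larger than its norm. -/
theorem norm_sq_derivWithin_collar_le {f : S.X → ℂ} (hf : S.X.Smooth f) (e : E) {s : ℝ}
    (hs : s ∈ Ioo 0 S.ellMinus) (y : S.Y e) :
    ‖derivWithin (fun t => f (S.collar e (t, y))) (Ico 0 S.ellMinus) s‖ ^ 2 ≤
      (S.X.coInner (S.collar e (s, y)) (S.X.d f (S.collar e (s, y)))
        (S.X.d f (S.collar e (s, y)))).re := by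
  have hc := S.mdifferentiableAt_collar e hs y
  have hi : HasMFDerivAt 𝓘(ℝ, ℝ) (𝓘(ℝ, ℝ).prod (S.Y e).I) (fun t : ℝ => (t, y)) s
      ((ContinuousLinearMap.id ℝ ℝ).prod 0) :=
    (hasMFDerivAt_id s).prodMk (hasMFDerivAt_const y s)
  have h1 := ((hf.mdifferentiableAt _).hasMFDerivAt.comp (s, y) hc.hasMFDerivAt).comp s hi
  have h2 : HasFDerivAt (fun t => f (S.collar e (t, y)))
      (((S.X.d f (S.collar e (s, y))).comp (mfderiv (𝓘(ℝ, ℝ).prod (S.Y e).I) S.X.I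
        (S.collar e) (s, y))).comp ((ContinuousLinearMap.id ℝ ℝ).prod 0) : ℝ →L[ℝ] ℂ) s :=
    h1.hasFDerivAt
  have h3 : derivWithin (fun t => f (S.collar e (t, y))) (Ico 0 S.ellMinus) s =
      S.X.d f (S.collar e (s, y)) (mfderiv (𝓘(ℝ, ℝ).prod (S.Y e).I) S.X.I (S.collar e) (s, y)
        ((S.Y e).prodVec s y 1 0)) := by
    rw [derivWithin_of_mem_nhds (Ico_mem_nhds hs.1 hs.2)]
    refine h2.hasDerivAt.deriv.trans ?_
    refine congrArg (S.X.d f (S.collar e (s, y))) ?_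
    exact congrArg (mfderiv (𝓘(ℝ, ℝ).prod (S.Y e).I) S.X.I (S.collar e) (s, y)) rfl
  rw [h3]
  refine (S.X.norm_sq_apply_le_coInner _ _ _).trans_eq ?_
  rw [S.collar_isometric e s hs y 1 1 0 0]
  simp

theorem integrable_comp_collar {F : S.X → ℝ} (hF : Continuous F) (e : E) :
    Integrable (fun p => F (S.collar e p)) (S.collarVol e) ∧
      ∫ p, F (S.collar e p) ∂S.collarVol e = ∫ x in S.collarSet e, F x ∂S.X.vol := by
  have hi : Integrable F S.X.vol := by
    obtain ⟨C, hC⟩ := isCompact_univ.exists_bound_of_continuousOn hF.continuousOn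
    exact (MemLp.of_bound hF.aestronglyMeasurable C
      (Eventually.of_forall fun x => hC x (mem_univ x)) : MemLp F 1 S.X.vol).integrable le_rfl
  have h1 : Integrable F ((S.collarVol e).map (S.collar e)) := by
    rw [S.map_collar]
    exact hi.integrableOn
  exact ⟨(integrable_map_measure h1.1 (S.aemeasurable_collar e)).1 h1, by
    rw [← S.map_collar, integral_map (S.aemeasurable_collar e) h1.1]⟩

theorem sum_setIntegral_collarSet_le [Fintype E] {F : S.X → ℝ} (hF : Continuous F)
    (h0 : ∀ x, 0 ≤ F x) : ∑ e, ∫ x in S.collarSet e, F x ∂S.X.vol ≤ ∫ x, F x ∂S.X.vol := by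
  have hi : Integrable F S.X.vol := by
    obtain ⟨C, hC⟩ := isCompact_univ.exists_bound_of_continuousOn hF.continuousOn
    exact (MemLp.of_bound hF.aestronglyMeasurable C
      (Eventually.of_forall fun x => hC x (mem_univ x)) : MemLp F 1 S.X.vol).integrable le_rfl
  rw [← integral_iUnion_fintype (fun e => S.measurableSet_collarSet e)
    S.pairwise_disjoint_collarSet fun e => hi.integrableOn]
  exact setIntegral_le_integral hi (Eventually.of_forall h0)

/-- The mean over the cross-section `{0} × Y e` of a function on `X`. -/
def edgeMean (f : S.X → ℂ) (e : E) : ℂ := (S.Y e).mean fun y => f (S.collar e (0, y))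

/-- The mean over `X` is close to the means over the cross-sections. -/
theorem sum_sq_edgeMean_sub_mean_le [Fintype E] (hlam : 0 < S.lamV)
    (hvol : ∀ e, 0 < (S.Y e).totalVol) {f : S.X → ℂ}
    (hf : S.X.Smooth f) {a : ℝ} (ha : 0 < a) (haℓ : a ≤ S.ellMinus) :
    ∑ e, (S.Y e).totalVol * ‖S.X.mean f - S.edgeMean f e‖ ^ 2 ≤
      (a + 2 / (a * S.lamV)) * (S.X.dirichlet f f).re := by
  set m := S.X.mean f
  have hfm : S.X.Smooth fun x => f x - m := ContMDiff.sub hf contMDiff_const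
  have hc1 : Continuous fun x => (S.X.coInner x (S.X.d f x) (S.X.d f x)).re :=
    Complex.continuous_re.comp (RiemMfd.continuous_coInner hf hf)
  have hc2 : Continuous fun x => ‖f x - m‖ ^ 2 := (hfm.continuous.norm.pow 2)
  -- Apply the trace estimate to `f - m` on `(0, a) × Y e`, after Jensen's inequality for the mean.
  -- Summation over the disjoint collars is bounded by integrals over `X`, and the Poincaré
  -- inequality trades `‖f - m‖²` for energy, which produces `2 / (a λ₂)`.
  have hedge (e : E) : (S.Y e).totalVol * ‖m - S.edgeMean f e‖ ^ 2 ≤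
      a * (∫ x in S.collarSet e, (S.X.coInner x (S.X.d f x) (S.X.d f x)).re ∂S.X.vol) +
      2 / a * ∫ x in S.collarSet e, ‖f x - m‖ ^ 2 ∂S.X.vol := by
    have hw := S.contMDiffOn_comp_collar hfm e
    have h0 : (0 : ℝ) ∈ Ico 0 S.ellMinus := ⟨le_rfl, S.ellMinus_pos⟩
    have hcont : Continuous fun y => f (S.collar e (0, y)) - m :=
      (RiemMfd.contMDiff_slice hw h0).continuous
    have hcont' : Continuous fun y => f (S.collar e (0, y)) := by
      exact (hcont.add (continuous_const (y := m))).congr fun y => sub_add_cancel _ _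
    have hmean : (S.Y e).mean (fun y => f (S.collar e (0, y)) - m) = S.edgeMean f e - m := by
      rw [RiemMfd.mean, integral_sub (RiemMfd.integrable_of_continuous hcont') (integrable_const _),
        integral_const, edgeMean, RiemMfd.mean, Complex.real_smul, sub_div]
      congr 1
      exact mul_div_cancel_left₀ _ (by exact_mod_cast (hvol e).ne')
    have h1 := RiemMfd.totalVol_mul_sq_mean_le hcont
    rw [hmean, norm_sub_rev] at h1
    refine h1.trans ?_
    obtain ⟨i1, e1⟩ := S.integrable_comp_collar hc1 e
    obtain ⟨i2, e2⟩ := S.integrable_comp_collar hc2 e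
    rw [← e1, ← e2]
    refine RiemMfd.integral_trace_le ha (uniqueDiffOn_Ico 0 S.ellMinus)
      (Ico_subset_Ico_right haℓ) hw measurableSet_Ioo (Ioo_subset_Ioo_right haℓ) i1 i2
      (fun s hs y => ?_) (fun s hs y => le_rfl)
    have h2 := S.norm_sq_derivWithin_collar_le hf e hs y
    rwa [derivWithin_sub_const]
  refine (Finset.sum_le_sum fun e _ => hedge e).trans ?_
  rw [Finset.sum_add_distrib, ← Finset.mul_sum, ← Finset.mul_sum]
  have hD := S.sum_setIntegral_collarSet_le hc1 fun x => S.X.coInner_self_re_nonneg x _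
  have hL := S.sum_setIntegral_collarSet_le hc2 fun x => sq_nonneg _
  have hP := RiemMfd.poincare (M := S.X) hlam hf
  rw [← RiemMfd.dirichlet_self_re hf] at hD
  have hlv : S.X.neumannEigenvalue 2 = S.lamV := rfl
  rw [hlv] at hP
  calc _ ≤ a * (S.X.dirichlet f f).re + 2 / a * ((S.X.dirichlet f f).re / S.lamV) := by
        gcongr
        exact hL.trans hP
    _ = _ := by field_simp

end FatStar

namespace FatStar

variable {n : ℕ} {E : Type w} (S : FatStar.{u, w} n E) {ε : ℝ}

/-! ### Smooth functions on the edge neighbourhoods -/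

/-- The arc length parameters near the edge `e`, including the scaled collar. -/
def edgeDom (ε : ℝ) (e : E) : Set ℝ :=
  {t | -(ε * S.ellMinus) < t ∧ ENNReal.ofReal t ≤ S.len e}

theorem isOpen_edge (e : E) : IsOpen (S.edge e) :=
  (isOpen_lt continuous_const continuous_id).inter
    (isOpen_lt ENNReal.continuous_ofReal continuous_const)

theorem Ioo_subset_edge (e : E) : Ioo 0 S.ellMinus ⊆ S.edge e := fun _ hs =>
  ⟨hs.1, ((ENNReal.ofReal_lt_ofReal_iff S.ellMinus_pos).2 hs.2).trans_le (S.ellMinus_le e)⟩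

theorem edge_subset_edgeDom (hε : 0 < ε) (e : E) : S.edge e ⊆ S.edgeDom ε e := fun _ hs =>
  ⟨(neg_nonpos.2 (mul_nonneg hε.le S.ellMinus_pos.le)).trans_lt hs.1, hs.2.le⟩

theorem Ico_subset_edgeDom (hε : 0 < ε) (e : E) : Ico 0 S.ellMinus ⊆ S.edgeDom ε e := fun _ hs =>
  ⟨(neg_neg_of_pos (mul_pos hε S.ellMinus_pos)).trans_le hs.1,
    (ENNReal.ofReal_le_ofReal hs.2.le).trans (S.ellMinus_le e)⟩

theorem edge_mem_nhds {e : E} {s : ℝ} (hs : s ∈ S.edge e) : S.edge e ∈ 𝓝 s :=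
  (S.isOpen_edge e).mem_nhds hs

theorem Icc_subset_edgeDom (hε : 0 < ε) {e : E} {s : ℝ} (hs : s ∈ S.edge e) :
    Icc 0 s ⊆ S.edgeDom ε e := fun _ ht =>
  ⟨(neg_neg_of_pos (mul_pos hε S.ellMinus_pos)).trans_le ht.1,
    (ENNReal.ofReal_le_ofReal ht.2).trans hs.2.le⟩

theorem uniqueDiffOn_edgeDom (hε : 0 < ε) (e : E) : UniqueDiffOn ℝ (S.edgeDom ε e) := by
  have hc : OrdConnected (S.edgeDom ε e) := ⟨fun x hx y hy z hz =>
    ⟨hx.1.trans_le hz.1, (ENNReal.ofReal_le_ofReal hz.2).trans hy.2⟩⟩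
  have hℓ := S.ellMinus_pos
  refine uniqueDiffOn_convex hc.convex ⟨S.ellMinus / 2, ?_⟩
  exact interior_maximal (S.edge_subset_edgeDom hε e) (S.isOpen_edge e)
    (S.Ioo_subset_edge e ⟨by linarith, by linarith⟩)

variable {S}

section Smooth

variable {u v : S.Fn}

theorem contMDiffOn_glue (hu : u ∈ S.smoothFn ε) (e : E) :
    ContMDiffOn (𝓘(ℝ, ℝ).prod (S.Y e).I) 𝓘(ℝ, ℂ) ∞ (S.glue ε u e) (S.edgeDom ε e ×ˢ univ) := by
  have h := hu.2.2.1 e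
  have hset : {z : ℝ × S.Y e | -(ε * S.ellMinus) < z.1 ∧ ENNReal.ofReal z.1 ≤ S.len e} =
      S.edgeDom ε e ×ˢ univ := by
    ext z
    simp [edgeDom]
  rwa [hset] at h

theorem glue_of_pos {e : E} {s : ℝ} (hs : 0 < s) (y : S.Y e) :
    S.glue ε u e (s, y) = u.2 e (s, y) := if_neg (not_le.2 hs)

theorem glue_zero (hu : u ∈ S.smoothFn ε) (e : E) (y : S.Y e) :
    S.glue ε u e (0, y) = u.2 e (0, y) := by
  rw [hu.2.1 e y, glue, if_pos le_rfl]
  simp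

theorem glue_zero_eq (hu : u ∈ S.smoothFn ε) (e : E) (y : S.Y e) :
    S.glue ε u e (0, y) = u.1 (S.collar e (0, y)) := by
  rw [glue_zero hu, hu.2.1]

theorem glue_add (u v : S.Fn) (e : E) : S.glue ε (u + v) e = S.glue ε u e + S.glue ε v e := by
  ext z
  simp only [glue, Pi.add_apply]
  split_ifs <;> rfl

theorem glue_smul (a : ℂ) (u : S.Fn) (e : E) : S.glue ε (a • u) e = a • S.glue ε u e := by
  ext z
  simp only [glue, Pi.smul_apply]
  split_ifs <;> rfl

variable (S ε) in
/-- The space of smooth functions with compact support. -/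
def smoothSpace : Submodule ℂ S.Fn where
  carrier := S.smoothFn ε
  zero_mem' := by
    refine ⟨contMDiff_const, fun e y => rfl, fun e => ?_, fun e => ⟨0, fun _ _ _ => rfl⟩⟩
    have : S.glue ε 0 e = fun _ => 0 := by
      ext z
      simp [glue]
    rw [this]
    exact contMDiffOn_const
  add_mem' := by
    intro u v hu hv
    refine ⟨hu.1.add hv.1, fun e y => ?_, fun e => ?_, fun e => ?_⟩
    · exact congrArg₂ (· + ·) (hu.2.1 e y) (hv.2.1 e y)
    · rw [glue_add]
      exact (hu.2.2.1 e).add (hv.2.2.1 e)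
    · obtain ⟨b, hb⟩ := hu.2.2.2 e
      obtain ⟨b', hb'⟩ := hv.2.2.2 e
      refine ⟨max b b', fun z hz hz' => ?_⟩
      have h1 := hb z ((le_max_left _ _).trans_lt hz) hz'
      have h2 := hb' z ((le_max_right _ _).trans_lt hz) hz'
      simp [h1, h2]
  smul_mem' := by
    intro a u hu
    refine ⟨hu.1.const_smul a, fun e y => ?_, fun e => ?_, fun e => ?_⟩
    · exact congrArg (a * ·) (hu.2.1 e y)
    · rw [glue_smul]
      have : ContMDiff 𝓘(ℝ, ℂ) 𝓘(ℝ, ℂ) ∞ (fun z : ℂ => a * z) :=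
        (contDiff_const.mul contDiff_id).contMDiff
      exact this.comp_contMDiffOn (hu.2.2.1 e)
    · obtain ⟨b, hb⟩ := hu.2.2.2 e
      exact ⟨b, fun z hz hz' => by simp [hb z hz hz']⟩

variable (u) in
/-- The derivative along the edge. -/
def ds (e : E) (z : ℝ × S.Y e) : ℂ := deriv (fun s => u.2 e (s, z.2)) z.1

variable (u v) in
/-- The inner product of the transversal derivatives. -/
def dy (e : E) (z : ℝ × S.Y e) : ℂ :=
  (S.Y e).coInner z.2 ((S.Y e).d (fun y => u.2 e (z.1, y)) z.2)
    ((S.Y e).d (fun y => v.2 e (z.1, y)) z.2)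

theorem hasDerivAt_edge (hε : 0 < ε) (hu : u ∈ S.smoothFn ε) {e : E} {s : ℝ} (hs : s ∈ S.edge e)
    (y : S.Y e) : HasDerivAt (fun t => u.2 e (t, y))
      (derivWithin (fun t => S.glue ε u e (t, y)) (S.edgeDom ε e) s) s := by
  have h := (RiemMfd.hasDerivWithinAt_derivWithin (contMDiffOn_glue hu e)
    (S.edge_subset_edgeDom hε e hs) y).hasDerivAt
      (mem_of_superset (S.edge_mem_nhds hs) (S.edge_subset_edgeDom hε e))
  refine h.congr_of_eventuallyEq ?_
  filter_upwards [S.edge_mem_nhds hs] with t ht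
  exact (glue_of_pos ht.1 y).symm

theorem ds_eq (hε : 0 < ε) (hu : u ∈ S.smoothFn ε) {e : E} {s : ℝ} (hs : s ∈ S.edge e)
    (y : S.Y e) : ds u e (s, y) =
      derivWithin (fun t => S.glue ε u e (t, y)) (S.edgeDom ε e) s :=
  (hasDerivAt_edge hε hu hs y).deriv

theorem slice_eq {e : E} {s : ℝ} (hs : s ∈ S.edge e) :
    (fun y => u.2 e (s, y)) = fun y => S.glue ε u e (s, y) :=
  funext fun y => (glue_of_pos hs.1 y).symm

theorem smooth_slice (hε : 0 < ε) (hu : u ∈ S.smoothFn ε) {e : E} {s : ℝ} (hs : s ∈ S.edge e) :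
    (S.Y e).Smooth fun y => u.2 e (s, y) := by
  rw [slice_eq (ε := ε) hs]
  exact RiemMfd.contMDiff_slice (contMDiffOn_glue hu e) (S.edge_subset_edgeDom hε e hs)

variable (S) in
theorem edgeVol_eq_restrict (e : E) :
    S.edgeVol e = (volume.prod (S.Y e).vol).restrict (S.edge e ×ˢ univ) := by
  rw [← Measure.prod_restrict, Measure.restrict_univ]
  rfl

variable (S) in
theorem ae_mem_edge (e : E) : ∀ᵐ z ∂S.edgeVol e, z.1 ∈ S.edge e := by
  rw [edgeVol_eq_restrict]
  filter_upwards [ae_restrict_mem ((S.isOpen_edge e).measurableSet.prod MeasurableSet.univ)]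
    with z hz using hz.1

/-- Edges may be infinite, so integrability rests on the vanishing beyond `b`. What is left of the
edge lies in a compact subset of the domain of continuity, because `edgeDom` contains both `0` and a
finite end point. -/
theorem memLp_edgeVol (hε : 0 < ε) {e : E} {F : ℝ × S.Y e → ℂ}
    (hF : ContinuousOn F (S.edgeDom ε e ×ˢ univ)) {b : ℝ}
    (hb : ∀ z, b < z.1 → z.1 ∈ S.edge e → F z = 0) (p : ENNReal) : MemLp F p (S.edgeVol e) := by
  have hK : IsCompact ((Icc 0 b ∩ {t | ENNReal.ofReal t ≤ S.len e}) ×ˢ (univ : Set (S.Y e))) :=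
    (isCompact_Icc.inter_right
      (isClosed_le ENNReal.continuous_ofReal continuous_const)).prod isCompact_univ
  have hsub : (Icc 0 b ∩ {t | ENNReal.ofReal t ≤ S.len e}) ×ˢ (univ : Set (S.Y e)) ⊆
      S.edgeDom ε e ×ˢ univ := fun z hz =>
    ⟨⟨(neg_neg_of_pos (mul_pos hε S.ellMinus_pos)).trans_le hz.1.1.1, hz.1.2⟩, mem_univ _⟩
  obtain ⟨C, hC⟩ := hK.exists_bound_of_continuousOn (hF.mono hsub)
  have hm : AEStronglyMeasurable F (S.edgeVol e) := by
    rw [edgeVol_eq_restrict]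
    refine (hF.mono ?_).aestronglyMeasurable
      ((S.isOpen_edge e).measurableSet.prod MeasurableSet.univ)
    exact prod_mono (S.edge_subset_edgeDom hε e) Subset.rfl
  have hmeas : MeasurableSet (Iic b ×ˢ (univ : Set (S.Y e))) :=
    measurableSet_Iic.prod MeasurableSet.univ
  have heq : F =ᵐ[S.edgeVol e] (Iic b ×ˢ (univ : Set (S.Y e))).indicator F := by
    filter_upwards [S.ae_mem_edge e] with z hz
    by_cases h : z.1 ≤ b
    · rw [indicator_of_mem (show z ∈ Iic b ×ˢ (univ : Set (S.Y e)) from ⟨h, mem_univ _⟩)]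
    · rw [indicator_of_notMem fun h' => h h'.1, hb z (not_le.1 h) hz]
  rw [memLp_congr_ae heq, memLp_indicator_iff_restrict hmeas]
  have hfin : IsFiniteMeasure ((S.edgeVol e).restrict (Iic b ×ˢ (univ : Set (S.Y e)))) := by
    refine ⟨?_⟩
    rw [Measure.restrict_apply_univ, edgeVol, Measure.prod_prod,
      Measure.restrict_apply measurableSet_Iic]
    refine ENNReal.mul_lt_top ((measure_mono fun t ht => ?_).trans_lt
      (measure_Icc_lt_top (a := (0 : ℝ)) (b := b))) (measure_lt_top _ _)
    exact ⟨ht.2.1.le, ht.1⟩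
  refine MemLp.of_bound hm.restrict C ?_
  filter_upwards [ae_restrict_of_ae (S.ae_mem_edge e), ae_restrict_mem hmeas] with z hz hz'
  exact hC z ⟨⟨⟨hz.1.le, hz'.1⟩, hz.2.le⟩, mem_univ _⟩

theorem memLp_edge (hε : 0 < ε) (hu : u ∈ S.smoothFn ε) (e : E) (p : ENNReal) :
    MemLp (u.2 e) p (S.edgeVol e) := by
  obtain ⟨b, hb⟩ := hu.2.2.2 e
  have h := memLp_edgeVol hε (contMDiffOn_glue hu e).continuousOn (b := b) (fun z hz hz' => by
    rw [← hb z hz hz'.2.le]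
    exact glue_of_pos hz'.1 z.2) p
  refine (memLp_congr_ae ?_).1 h
  filter_upwards [S.ae_mem_edge e] with z hz using glue_of_pos hz.1 z.2

theorem memLp_ds (hε : 0 < ε) (hu : u ∈ S.smoothFn ε) (e : E) (p : ENNReal) :
    MemLp (ds u e) p (S.edgeVol e) := by
  obtain ⟨b, hb⟩ := hu.2.2.2 e
  have h := memLp_edgeVol hε (RiemMfd.continuousOn_derivWithin (S.uniqueDiffOn_edgeDom hε e)
    (contMDiffOn_glue hu e)) (b := b) (fun z hz hz' => by
    rw [← ds_eq hε hu hz' z.2, ds]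
    have : (fun s => u.2 e (s, z.2)) =ᶠ[𝓝 z.1] fun _ => 0 := by
      filter_upwards [S.edge_mem_nhds hz', Ioi_mem_nhds hz] with t ht ht'
      exact hb (t, z.2) ht' ht.2.le
    rw [this.deriv_eq, deriv_const]) p
  refine (memLp_congr_ae ?_).1 h
  filter_upwards [S.ae_mem_edge e] with z hz using (ds_eq hε hu hz z.2).symm

theorem integrable_dy (hε : 0 < ε) (hu : u ∈ S.smoothFn ε) (hv : v ∈ S.smoothFn ε) (e : E) :
    Integrable (dy u v e) (S.edgeVol e) := by
  obtain ⟨b, hb⟩ := hv.2.2.2 e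
  have hdy (z : ℝ × S.Y e) (hz : z.1 ∈ S.edge e) : dy u v e z =
      (S.Y e).coInner z.2 ((S.Y e).d (fun y => S.glue ε u e (z.1, y)) z.2)
        ((S.Y e).d (fun y => S.glue ε v e (z.1, y)) z.2) := by
    rw [dy, slice_eq (u := u) (ε := ε) hz, slice_eq (u := v) (ε := ε) hz]
  have h := memLp_edgeVol hε (RiemMfd.continuousOn_coInner_slice (w := S.glue ε u e)
    (w' := S.glue ε v e) (T := S.edgeDom ε e) (S.uniqueDiffOn_edgeDom hε e)
    (contMDiffOn_glue hu e) (contMDiffOn_glue hv e)) (b := b) (fun z hz hz' => by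
    rw [← hdy z hz', dy]
    have : (fun y => v.2 e (z.1, y)) = fun _ => 0 := funext fun y => hb (z.1, y) hz hz'.2.le
    rw [this, RiemMfd.d_const, RiemMfd.coInner]
    simp) 1
  refine memLp_one_iff_integrable.1 ((memLp_congr_ae ?_).1 h)
  filter_upwards [S.ae_mem_edge e] with z hz using (hdy z hz).symm

theorem ds_add (hε : 0 < ε) (hu : u ∈ S.smoothFn ε) (hv : v ∈ S.smoothFn ε) (e : E) :
    ds (u + v) e =ᵐ[S.edgeVol e] ds u e + ds v e := by
  filter_upwards [S.ae_mem_edge e] with z hz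
  exact deriv_add (hasDerivAt_edge hε hu hz z.2).differentiableAt
    (hasDerivAt_edge hε hv hz z.2).differentiableAt

theorem ds_smul (a : ℂ) (u : S.Fn) (e : E) : ds (a • u) e = a • ds u e := by
  ext z
  exact deriv_const_mul_field a

theorem dy_add (hε : 0 < ε) (u : S.Fn) {v v' : S.Fn} (hv : v ∈ S.smoothFn ε)
    (hv' : v' ∈ S.smoothFn ε) (e : E) :
    dy u (v + v') e =ᵐ[S.edgeVol e] dy u v e + dy u v' e := by
  filter_upwards [S.ae_mem_edge e] with z hz
  have h : (S.Y e).d (fun y => (v + v').2 e (z.1, y)) z.2 = _ :=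
    RiemMfd.d_add (smooth_slice hε hv hz) (smooth_slice hε hv' hz) z.2
  rw [dy, h, RiemMfd.coInner_add_right]
  rfl

theorem dy_smul (hε : 0 < ε) (u : S.Fn) (hv : v ∈ S.smoothFn ε) (a : ℂ) (e : E) :
    dy u (a • v) e =ᵐ[S.edgeVol e] a • dy u v e := by
  filter_upwards [S.ae_mem_edge e] with z hz
  have h : (S.Y e).d (fun y => (a • v).2 e (z.1, y)) z.2 = _ :=
    RiemMfd.d_const_smul (smooth_slice hε hv hz) a z.2
  rw [dy, h, RiemMfd.coInner_smul_right]
  rfl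

theorem conj_dy (u v : S.Fn) (e : E) (z : ℝ × S.Y e) : conj (dy u v e z) = dy v u e z :=
  (S.Y e).conj_coInner _ _ _

theorem dy_self_re_nonneg (u : S.Fn) (e : E) (z : ℝ × S.Y e) : 0 ≤ (dy u u e z).re :=
  (S.Y e).coInner_self_re_nonneg _ _

theorem integrable_conj_mul {α : Type*} [MeasurableSpace α] {μ : Measure α} {f g : α → ℂ}
    (hf : MemLp f 2 μ) (hg : MemLp g 2 μ) : Integrable (fun x => conj (f x) * g x) μ :=
  MemLp.integrable_mul (p := 2) (q := 2) hf.star hg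

end Smooth

end FatStar

namespace FatStar

variable {n : ℕ} {E : Type w} {S : FatStar.{u, w} n E} {ε : ℝ} {u v : S.Fn}

/-! ### The energy form on smooth functions -/

/-- The longitudinal part of the energy on an edge. -/
def longForm (u v : S.Fn) (e : E) : ℂ := ∫ z, conj (ds u e z) * ds v e z ∂S.edgeVol e

/-- The transversal part of the energy on an edge. -/
def transForm (u v : S.Fn) (e : E) : ℂ := ∫ z, dy u v e z ∂S.edgeVol e

theorem longForm_add (hε : 0 < ε) {v' : S.Fn} (hu : u ∈ S.smoothFn ε) (hv : v ∈ S.smoothFn ε)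
    (hv' : v' ∈ S.smoothFn ε) (e : E) :
    longForm u (v + v') e = longForm u v e + longForm u v' e := by
  rw [longForm, longForm, longForm, ← integral_add
    (integrable_conj_mul (memLp_ds hε hu e 2) (memLp_ds hε hv e 2))
    (integrable_conj_mul (memLp_ds hε hu e 2) (memLp_ds hε hv' e 2))]
  refine integral_congr_ae ?_
  filter_upwards [ds_add hε hv hv' e] with z hz
  rw [hz, Pi.add_apply, mul_add]

theorem longForm_smul (u v : S.Fn) (a : ℂ) (e : E) :
    longForm u (a • v) e = a * longForm u v e := by
  rw [longForm, longForm, ← integral_const_mul, ds_smul]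
  refine integral_congr_ae (Eventually.of_forall fun z => ?_)
  simp only [Pi.smul_apply, smul_eq_mul]
  ring

theorem conj_longForm (u v : S.Fn) (e : E) : conj (longForm u v e) = longForm v u e := by
  rw [longForm, longForm, ← integral_conj]
  refine integral_congr_ae (Eventually.of_forall fun z => ?_)
  simp only [map_mul, Complex.conj_conj]
  ring

theorem conj_mul_self_eq (a : ℂ) : conj a * a = ((‖a‖ ^ 2 : ℝ) : ℂ) := by
  rw [mul_comm, Complex.mul_conj, Complex.normSq_eq_norm_sq]

theorem longForm_self (u : S.Fn) (e : E) :
    longForm u u e = ((∫ z, ‖ds u e z‖ ^ 2 ∂S.edgeVol e : ℝ) : ℂ) := by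
  rw [longForm, ← integral_complex_ofReal]
  exact integral_congr_ae (Eventually.of_forall fun z => conj_mul_self_eq _)

theorem transForm_add (hε : 0 < ε) {v' : S.Fn} (hu : u ∈ S.smoothFn ε) (hv : v ∈ S.smoothFn ε)
    (hv' : v' ∈ S.smoothFn ε) (e : E) :
    transForm u (v + v') e = transForm u v e + transForm u v' e := by
  rw [transForm, transForm, transForm,
    ← integral_add (integrable_dy hε hu hv e) (integrable_dy hε hu hv' e)]
  exact integral_congr_ae (dy_add hε u hv hv' e)

theorem transForm_smul (hε : 0 < ε) (u : S.Fn) (hv : v ∈ S.smoothFn ε) (a : ℂ) (e : E) :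
    transForm u (a • v) e = a * transForm u v e := by
  rw [transForm, transForm, ← integral_const_mul]
  exact integral_congr_ae (dy_smul hε u hv a e)

theorem conj_transForm (u v : S.Fn) (e : E) : conj (transForm u v e) = transForm v u e := by
  rw [transForm, transForm, ← integral_conj]
  exact integral_congr_ae (Eventually.of_forall fun z => conj_dy u v e z)

theorem transForm_self_re (hε : 0 < ε) (hu : u ∈ S.smoothFn ε) (e : E) :
    (transForm u u e).re = ∫ z, (dy u u e z).re ∂S.edgeVol e :=
  (integral_re (integrable_dy hε hu hu e)).symm

theorem transForm_self_re_nonneg (hε : 0 < ε) (hu : u ∈ S.smoothFn ε) (e : E) :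
    0 ≤ (transForm u u e).re := by
  rw [transForm_self_re hε hu]
  exact integral_nonneg fun z => dy_self_re_nonneg u e z

theorem inner_toLp {α : Type*} [MeasurableSpace α] {μ : Measure α} {f g : α → ℂ}
    (hf : MemLp f 2 μ) (hg : MemLp g 2 μ) :
    inner ℂ (hf.toLp f) (hg.toLp g) = ∫ x, conj (f x) * g x ∂μ := by
  rw [L2.inner_def]
  refine integral_congr_ae ?_
  filter_upwards [hf.coeFn_toLp, hg.coeFn_toLp] with x h1 h2
  rw [h1, h2, RCLike.inner_apply, mul_comm]

variable (S ε) in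
/-- Smooth functions with compact support, with the `H¹` inner product. -/
def H1Pre : Type (max u w) := S.smoothSpace ε

instance : AddCommGroup (S.H1Pre ε) := inferInstanceAs (AddCommGroup (S.smoothSpace ε))

instance : Module ℂ (S.H1Pre ε) := inferInstanceAs (Module ℂ (S.smoothSpace ε))

/-- The underlying function. -/
def H1Pre.fn (u : S.H1Pre ε) : S.Fn := Subtype.val (p := fun u => u ∈ S.smoothSpace ε) u

theorem H1Pre.mem (u : S.H1Pre ε) : u.fn ∈ S.smoothFn ε :=
  Subtype.property (p := fun u => u ∈ S.smoothSpace ε) u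

theorem H1Pre.fn_add (u v : S.H1Pre ε) : (u + v).fn = u.fn + v.fn := rfl

theorem H1Pre.fn_smul (a : ℂ) (u : S.H1Pre ε) : (a • u).fn = a • u.fn := rfl

theorem memLp_smul_edge (hε : 0 < ε) (hu : u ∈ S.smoothFn ε) (e : E) :
    MemLp (u.2 e) 2 (ENNReal.ofReal (ε ^ n) • S.edgeVol e) :=
  (memLp_edge hε hu e 2).smul_measure ENNReal.ofReal_ne_top

theorem memLp_smul_vertex (hu : u ∈ S.smoothFn ε) :
    MemLp u.1 2 (ENNReal.ofReal (ε ^ (n + 1)) • S.X.vol) :=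
  (RiemMfd.memLp_of_continuous hu.1.continuous 2).smul_measure ENNReal.ofReal_ne_top

variable [Fintype E]

theorem dForm_eq (hε : 0 < ε) (hu : u ∈ S.smoothFn ε) (hv : v ∈ S.smoothFn ε) :
    S.dForm ε u v = ∑ e, (ε : ℂ) ^ n * (longForm u v e + ((ε : ℂ) ^ 2)⁻¹ * transForm u v e) +
      (ε : ℂ) ^ (n + 1) * (((ε : ℂ) ^ 2)⁻¹ * S.X.dirichlet u.1 v.1) := by
  rw [dForm, integral_const_mul]
  congr 1
  refine Finset.sum_congr rfl fun e _ => ?_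
  congr 1
  rw [longForm, transForm, ← integral_const_mul, ← integral_add
    (integrable_conj_mul (memLp_ds hε hu e 2) (memLp_ds hε hv e 2))
    ((integrable_dy hε hu hv e).const_mul _)]
  rfl

theorem dForm_add (hε : 0 < ε) {v' : S.Fn} (hu : u ∈ S.smoothFn ε) (hv : v ∈ S.smoothFn ε)
    (hv' : v' ∈ S.smoothFn ε) : S.dForm ε u (v + v') = S.dForm ε u v + S.dForm ε u v' := by
  have hvv : v + v' ∈ S.smoothFn ε := (S.smoothSpace ε).add_mem hv hv'
  rw [dForm_eq hε hu hvv, dForm_eq hε hu hv, dForm_eq hε hu hv',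
    show (v + v').1 = v.1 + v'.1 from rfl, RiemMfd.dirichlet_add_right hu.1 hv.1 hv'.1]
  simp only [longForm_add hε hu hv hv', transForm_add hε hu hv hv', mul_add, Finset.sum_add_distrib]
  ring

theorem dForm_smul (hε : 0 < ε) (hu : u ∈ S.smoothFn ε) (hv : v ∈ S.smoothFn ε) (a : ℂ) :
    S.dForm ε u (a • v) = a * S.dForm ε u v := by
  have hav : a • v ∈ S.smoothFn ε := (S.smoothSpace ε).smul_mem a hv
  rw [dForm_eq hε hu hav, dForm_eq hε hu hv, show (a • v).1 = a • v.1 from rfl,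
    RiemMfd.dirichlet_smul_right hv.1, mul_add, Finset.mul_sum]
  simp only [longForm_smul, transForm_smul hε u hv]
  congr 1
  · exact Finset.sum_congr rfl fun e _ => by ring
  · ring

theorem conj_dForm (hε : 0 < ε) (hu : u ∈ S.smoothFn ε) (hv : v ∈ S.smoothFn ε) :
    conj (S.dForm ε u v) = S.dForm ε v u := by
  rw [dForm_eq hε hu hv, dForm_eq hε hv hu]
  simp only [map_add, map_sum, map_mul, map_pow, map_inv₀, Complex.conj_ofReal, conj_longForm,
    conj_transForm, RiemMfd.conj_dirichlet]

theorem dForm_self_re (hε : 0 < ε) (hu : u ∈ S.smoothFn ε) :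
    (S.dForm ε u u).re = ∑ e, ε ^ n * ((∫ z, ‖ds u e z‖ ^ 2 ∂S.edgeVol e) +
      (ε ^ 2)⁻¹ * (transForm u u e).re) +
      ε ^ (n + 1) * ((ε ^ 2)⁻¹ * (S.X.dirichlet u.1 u.1).re) := by
  rw [dForm_eq hε hu hu]
  simp only [longForm_self, ← Complex.ofReal_pow, ← Complex.ofReal_inv, Complex.add_re,
    Complex.re_sum, Complex.re_ofReal_mul, Complex.ofReal_re]

theorem dForm_self_re_nonneg (hε : 0 < ε) (hu : u ∈ S.smoothFn ε) : 0 ≤ (S.dForm ε u u).re := by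
  rw [dForm_self_re hε hu]
  have h1 := RiemMfd.dirichlet_self_re_nonneg hu.1
  have h2 (e : E) := transForm_self_re_nonneg hε hu e
  have h3 (e : E) : 0 ≤ ∫ z, ‖ds u e z‖ ^ 2 ∂S.edgeVol e := integral_nonneg fun z => sq_nonneg _
  refine add_nonneg (Finset.sum_nonneg fun e _ => ?_) (by positivity)
  have := h2 e
  have := h3 e
  positivity

/-! ### The space `H¹` of the thin manifold -/

variable [hε : Fact (0 < ε)]

variable (S ε) in
/-- The inclusion of the smooth functions in `L²`. -/
def toL2 : S.H1Pre ε →ₗ[ℂ] S.L2X ε where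
  toFun u := WithLp.toLp 2 (WithLp.toLp 2 fun e => (memLp_smul_edge hε.out u.mem e).toLp _,
    (memLp_smul_vertex u.mem).toLp _)
  map_add' _ _ := rfl
  map_smul' _ _ := rfl

theorem represents_toL2 (u : S.H1Pre ε) : S.Represents ε u.fn (toL2 S ε u) :=
  ⟨fun e => (memLp_smul_edge hε.out u.mem e).coeFn_toLp, (memLp_smul_vertex u.mem).coeFn_toLp⟩

theorem Represents.eq_toL2 {u : S.H1Pre ε} {U : S.L2X ε} (h : S.Represents ε u.fn U) :
    U = toL2 S ε u := by
  refine WithLp.ofLp_injective 2 (Prod.ext (WithLp.ofLp_injective 2 (funext fun e => ?_)) ?_)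
  · exact Lp.ext ((h.1 e).trans ((represents_toL2 u).1 e).symm)
  · exact Lp.ext (h.2.trans (represents_toL2 u).2.symm)

theorem inner_toL2 (u v : S.H1Pre ε) : inner ℂ (toL2 S ε u) (toL2 S ε v) =
    ∑ e, (ε : ℂ) ^ n * ∫ z, conj (u.fn.2 e z) * v.fn.2 e z ∂S.edgeVol e +
      (ε : ℂ) ^ (n + 1) * ∫ x, conj (u.fn.1 x) * v.fn.1 x ∂S.X.vol := by
  rw [WithLp.prod_inner_apply, PiLp.inner_apply]
  have h0 := hε.out
  congr 1
  · refine Finset.sum_congr rfl fun e _ => (inner_toLp (memLp_smul_edge h0 u.mem e)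
      (memLp_smul_edge h0 v.mem e)).trans ?_
    rw [integral_smul_measure, ENNReal.toReal_ofReal (by positivity), Complex.real_smul,
      Complex.ofReal_pow]
  · refine (inner_toLp (memLp_smul_vertex u.mem) (memLp_smul_vertex v.mem)).trans ?_
    rw [integral_smul_measure, ENNReal.toReal_ofReal (by positivity), Complex.real_smul,
      Complex.ofReal_pow]

theorem norm_sq_toL2 (u : S.H1Pre ε) : ‖toL2 S ε u‖ ^ 2 =
    ∑ e, ε ^ n * (∫ z, ‖u.fn.2 e z‖ ^ 2 ∂S.edgeVol e) +
      ε ^ (n + 1) * ∫ x, ‖u.fn.1 x‖ ^ 2 ∂S.X.vol := by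
  have h := inner_toL2 u u
  rw [inner_self_eq_norm_sq_to_K] at h
  simp only [conj_mul_self_eq, integral_complex_ofReal] at h
  apply Complex.ofReal_injective
  push_cast
  exact h

instance : PreInnerProductSpace.Core ℂ (S.H1Pre ε) where
  inner u v := S.dForm ε u.fn v.fn + inner ℂ (toL2 S ε u) (toL2 S ε v)
  conj_inner_symm u v := by
    rw [map_add, conj_dForm hε.out v.mem u.mem, inner_conj_symm]
  re_inner_nonneg u := by
    rw [map_add]
    exact add_nonneg (dForm_self_re_nonneg hε.out u.mem) inner_self_nonneg
  add_left u v t := by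
    have h : S.dForm ε (u + v).fn t.fn = S.dForm ε u.fn t.fn + S.dForm ε v.fn t.fn := by
      rw [← conj_dForm hε.out t.mem (u + v).mem, H1Pre.fn_add,
        dForm_add hε.out t.mem u.mem v.mem, map_add, conj_dForm hε.out t.mem u.mem,
        conj_dForm hε.out t.mem v.mem]
    rw [h, map_add, inner_add_left]
    ring
  smul_left u v a := by
    have h : S.dForm ε (a • u).fn v.fn = conj a * S.dForm ε u.fn v.fn := by
      rw [← conj_dForm hε.out v.mem (a • u).mem, H1Pre.fn_smul,
        dForm_smul hε.out v.mem u.mem, map_mul, conj_dForm hε.out v.mem u.mem]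
    rw [h, map_smul, inner_smul_left]
    ring

/-- Only a seminorm: elements of `Fn` may differ at parameters outside the edges, where the form
does not see them. The completion identifies them. -/
instance : SeminormedAddCommGroup (S.H1Pre ε) :=
  InnerProductSpace.Core.toSeminormedAddCommGroup (𝕜 := ℂ)

instance : InnerProductSpace ℂ (S.H1Pre ε) := InnerProductSpace.ofCore inferInstance

theorem H1Pre.inner_eq (u v : S.H1Pre ε) :
    inner ℂ u v = S.dForm ε u.fn v.fn + inner ℂ (toL2 S ε u) (toL2 S ε v) := rfl

theorem H1Pre.norm_sq_eq (u : S.H1Pre ε) :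
    ‖u‖ ^ 2 = (S.dForm ε u.fn u.fn).re + ‖toL2 S ε u‖ ^ 2 := by
  rw [← inner_self_eq_norm_sq (𝕜 := ℂ), H1Pre.inner_eq, map_add, inner_self_eq_norm_sq]
  rfl

theorem norm_toL2_le (u : S.H1Pre ε) : ‖toL2 S ε u‖ ≤ ‖u‖ := by
  refine (sq_le_sq₀ (norm_nonneg _) (norm_nonneg _)).1 ?_
  rw [H1Pre.norm_sq_eq]
  linarith [dForm_self_re_nonneg hε.out u.mem]

variable (S ε) in
/-- The Sobolev space `H¹(X_ε)`. -/
abbrev H1X : Type (max u w) := UniformSpace.Completion (S.H1Pre ε)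

variable (S ε) in
/-- The map `H¹(X_ε) → L²(X_ε)`. -/
def embX : S.H1X ε →L[ℂ] S.L2X ε :=
  ((toL2 S ε).mkContinuous 1 fun u => by rw [one_mul]; exact norm_toL2_le u).extend
    UniformSpace.Completion.toComplL

theorem embX_coe (u : S.H1Pre ε) : embX S ε (u : S.H1X ε) = toL2 S ε u :=
  ContinuousLinearMap.extend_eq _ UniformSpace.Completion.denseRange_coe
    (UniformSpace.Completion.isUniformInducing_coe _) u

end FatStar

namespace FatStar

variable {n : ℕ} {E : Type w} {S : FatStar.{u, w} n E} {ε : ℝ} {Q : S.X → ℝ}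

/-! ### The operator of the thin manifold as the operator of a bounded form on `H¹` -/

theorem memLp_potential (hQ : MemLp Q ⊤ S.X.vol) (ε : ℝ) :
    MemLp (fun x => ((ε⁻¹ * Q x : ℝ) : ℂ)) ⊤ (ENNReal.ofReal (ε ^ (n + 1)) • S.X.vol) :=
  ((hQ.const_mul ε⁻¹).smul_measure ENNReal.ofReal_ne_top).ofReal

variable [Fintype E]

/-- Multiplication by the potential `Q_ε`. -/
def potOp (hQ : MemLp Q ⊤ S.X.vol) (ε : ℝ) : S.L2X ε →L[ℂ] S.L2X ε :=
  (WithLp.prodContinuousLinearEquiv 2 ℂ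
      (PiLp 2 fun e : E => Lp ℂ 2 (ENNReal.ofReal (ε ^ n) • S.edgeVol e))
      (Lp ℂ 2 (ENNReal.ofReal (ε ^ (n + 1)) • S.X.vol))).symm.toContinuousLinearMap ∘L
    ContinuousLinearMap.inr ℂ _ _ ∘L
    (ContinuousLinearMap.mul ℂ ℂ).holderL _ ⊤ 2 2 ((memLp_potential hQ ε).toLp _) ∘L
    WithLp.sndL 2 ℂ _ _

theorem potOp_fst (hQ : MemLp Q ⊤ S.X.vol) (U : S.L2X ε) : (potOp hQ ε U).fst = 0 := rfl

theorem coeFn_potOp_snd (hQ : MemLp Q ⊤ S.X.vol) (U : S.L2X ε) :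
    (potOp hQ ε U).snd =ᵐ[ENNReal.ofReal (ε ^ (n + 1)) • S.X.vol]
      fun x => ((ε⁻¹ * Q x : ℝ) : ℂ) * U.snd x := by
  have h := (ContinuousLinearMap.mul ℂ ℂ).coeFn_holder (r := 2) ((memLp_potential hQ ε).toLp _)
    U.snd
  filter_upwards [h, (memLp_potential hQ ε).coeFn_toLp] with x h1 h2
  rw [h2] at h1
  exact h1

theorem inner_potOp (hQ : MemLp Q ⊤ S.X.vol) (U W : S.L2X ε) :
    inner ℂ U (potOp hQ ε W) = ∫ x, conj (U.snd x) * (((ε⁻¹ * Q x : ℝ) : ℂ) * W.snd x)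
      ∂(ENNReal.ofReal (ε ^ (n + 1)) • S.X.vol) := by
  rw [WithLp.prod_inner_apply]
  have h0 : inner ℂ U.fst (potOp hQ ε W).fst = 0 := by rw [potOp_fst, inner_zero_right]
  refine (congrArg₂ (· + ·) h0 (L2.inner_def (𝕜 := ℂ) U.snd (potOp hQ ε W).snd)).trans ?_
  rw [zero_add]
  refine integral_congr_ae ?_
  filter_upwards [coeFn_potOp_snd hQ W] with x hx
  rw [hx, RCLike.inner_apply, mul_comm]

theorem potOp_symm (hQ : MemLp Q ⊤ S.X.vol) (U W : S.L2X ε) :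
    inner ℂ (potOp hQ ε U) W = inner ℂ U (potOp hQ ε W) := by
  rw [← inner_conj_symm, inner_potOp, inner_potOp, ← integral_conj]
  refine integral_congr_ae (Eventually.of_forall fun x => ?_)
  simp only [map_mul, Complex.conj_conj, Complex.conj_ofReal]
  ring

variable [hε : Fact (0 < ε)]

theorem hForm_eq (hQ : MemLp Q ⊤ S.X.vol) (u v : S.H1Pre ε) :
    S.hForm Q ε u.fn v.fn =
      S.dForm ε u.fn v.fn + inner ℂ (toL2 S ε u) (potOp hQ ε (toL2 S ε v)) := by
  have h0 := hε.out
  rw [hForm, inner_potOp]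
  congr 1
  have h : (ε : ℂ) ^ (n + 1) * ∫ x, conj (u.fn.1 x) * (((ε⁻¹ * Q x : ℝ) : ℂ) * v.fn.1 x) ∂S.X.vol =
      ∫ x, conj (u.fn.1 x) * (((ε⁻¹ * Q x : ℝ) : ℂ) * v.fn.1 x)
        ∂(ENNReal.ofReal (ε ^ (n + 1)) • S.X.vol) := by
    rw [integral_smul_measure, ENNReal.toReal_ofReal (by positivity), Complex.real_smul,
      Complex.ofReal_pow]
  rw [h]
  refine integral_congr_ae ?_
  filter_upwards [(represents_toL2 u).2, (represents_toL2 v).2] with x h1 h2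
  rw [h1, h2]

/-- The bounded operator on `H¹(X_ε)` that represents the form `h_ε`. -/
def formX (hQ : MemLp Q ⊤ S.X.vol) (ε : ℝ) [Fact (0 < ε)] : S.H1X ε →L[ℂ] S.H1X ε :=
  ContinuousLinearMap.id ℂ _ - ContinuousLinearMap.adjoint (embX S ε) ∘L embX S ε +
    ContinuousLinearMap.adjoint (embX S ε) ∘L potOp hQ ε ∘L embX S ε

theorem inner_formX (hQ : MemLp Q ⊤ S.X.vol) (x y : S.H1X ε) :
    inner ℂ x (formX hQ ε y) = inner ℂ x y - inner ℂ (embX S ε x) (embX S ε y) +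
      inner ℂ (embX S ε x) (potOp hQ ε (embX S ε y)) := by
  have h : formX hQ ε y = y - ContinuousLinearMap.adjoint (embX S ε) (embX S ε y) +
      ContinuousLinearMap.adjoint (embX S ε) (potOp hQ ε (embX S ε y)) := rfl
  rw [h, inner_add_right, inner_sub_right, ContinuousLinearMap.adjoint_inner_right,
    ContinuousLinearMap.adjoint_inner_right]

theorem formX_symm (hQ : MemLp Q ⊤ S.X.vol) (x y : S.H1X ε) :
    inner ℂ (formX hQ ε x) y = inner ℂ x (formX hQ ε y) := by
  rw [← inner_conj_symm, inner_formX, inner_formX, map_add, map_sub, inner_conj_symm,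
    inner_conj_symm, inner_conj_symm, potOp_symm]

theorem inner_formX_coe (hQ : MemLp Q ⊤ S.X.vol) (u v : S.H1Pre ε) :
    inner ℂ (u : S.H1X ε) (formX hQ ε (v : S.H1X ε)) = S.hForm Q ε u.fn v.fn := by
  rw [inner_formX, embX_coe, embX_coe, UniformSpace.Completion.inner_coe, H1Pre.inner_eq,
    hForm_eq hQ]
  ring

theorem dForm_self_re_le (u : S.H1Pre ε) : (S.dForm ε u.fn u.fn).re ≤ ‖u‖ ^ 2 := by
  rw [H1Pre.norm_sq_eq]
  exact le_add_of_nonneg_right (sq_nonneg _)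

/-- The `H¹` norm is the energy plus the `L²` norm, so a sequence as in `ApproxH1` is Cauchy in
`H1Pre` and defines a point of the completion; conversely each point of the completion is a limit of
smooth functions. Continuity of the bounded form identifies the limits, and density extends the weak
equation from smooth test functions to all. -/
theorem mfdOp_eq_formRel (hQ : MemLp Q ⊤ S.X.vol) :
    S.mfdOp Q ε = formRel (embX S ε) (formX hQ ε) := by
  ext ⟨U, W⟩
  constructor
  · rintro ⟨c, ⟨hc, ⟨V, hV, hlim⟩, hcauchy⟩, hform⟩
    simp only at hlim hform
    let a (k : ℕ) : S.H1Pre ε := ⟨c k, hc k⟩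
    have hVa (k : ℕ) : V k = toL2 S ε (a k) := Represents.eq_toL2 (u := a k) (hV k)
    have ha : CauchySeq a := by
      rw [Metric.cauchySeq_iff]
      intro η hη
      obtain ⟨N₁, h₁⟩ := hcauchy (η ^ 2 / 2) (by positivity)
      obtain ⟨N₂, h₂⟩ := Metric.cauchySeq_iff.1 hlim.cauchySeq (η / 2) (by positivity)
      refine ⟨max N₁ N₂, fun j hj k hk => ?_⟩
      have d1 := h₁ j (le_of_max_le_left hj) k (le_of_max_le_left hk)
      have d2 := h₂ j (le_of_max_le_right hj) k (le_of_max_le_right hk)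
      rw [dist_eq_norm] at d2 ⊢
      have d3 : ‖a j - a k‖ ^ 2 = (S.dForm ε (c j - c k) (c j - c k)).re + ‖V j - V k‖ ^ 2 := by
        rw [H1Pre.norm_sq_eq, hVa, hVa, map_sub]
        rfl
      refine (sq_lt_sq₀ (norm_nonneg _) hη.le).1 ?_
      nlinarith [norm_nonneg (V j - V k)]
    obtain ⟨x, hx⟩ := cauchySeq_tendsto_of_complete
      ((UniformSpace.Completion.uniformContinuous_coe (S.H1Pre ε)).comp_cauchySeq ha)
    have hx' : Tendsto (fun k => ((a k : S.H1Pre ε) : S.H1X ε)) atTop (𝓝 x) := hx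
    refine ⟨x, ?_, fun φ => ?_⟩
    · refine tendsto_nhds_unique (((embX S ε).continuous.tendsto x).comp hx') ?_
      refine hlim.congr fun k => ?_
      rw [hVa k]
      exact (embX_coe (a k)).symm
    · induction φ using UniformSpace.Completion.induction_on with
      | hp =>
        exact isClosed_eq (continuous_id.inner continuous_const)
          ((embX S ε).continuous.inner continuous_const)
      | ih φ =>
        have h1 := hform φ.fn φ.mem (toL2 S ε φ) (represents_toL2 φ)
        rw [embX_coe]
        refine tendsto_nhds_unique ?_ h1
        have h2 : Tendsto (fun k => inner ℂ (φ : S.H1X ε) (formX hQ ε (a k : S.H1X ε))) atTop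
            (𝓝 (inner ℂ (φ : S.H1X ε) (formX hQ ε x))) :=
          (((innerSL ℂ (φ : S.H1X ε)).continuous.comp (formX hQ ε).continuous).tendsto x).comp hx'
        refine h2.congr fun k => ?_
        exact inner_formX_coe hQ φ (a k)
  · rintro ⟨x, hx, hform⟩
    simp only at hx hform
    obtain ⟨b, hb, hbx⟩ := mem_closure_iff_seq_limit.1
      (UniformSpace.Completion.denseRange_coe (α := S.H1Pre ε) x)
    choose a ha using hb
    have hax : Tendsto (fun k => ((a k : S.H1Pre ε) : S.H1X ε)) atTop (𝓝 x) :=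
      hbx.congr fun k => (ha k).symm
    refine ⟨fun k => (a k).fn, ⟨fun k => (a k).mem, ⟨fun k => toL2 S ε (a k),
      fun k => represents_toL2 _, ?_⟩, fun η hη => ?_⟩, fun φ hφ Φ hΦ => ?_⟩
    · simp only
      rw [← hx]
      exact (((embX S ε).continuous.tendsto x).comp hax).congr fun k => embX_coe _
    · obtain ⟨N, hN⟩ := Metric.cauchySeq_iff.1 hax.cauchySeq (Real.sqrt η) (Real.sqrt_pos.2 hη)
      refine ⟨N, fun j hj k hk => (dForm_self_re_le (a j - a k)).trans_lt ?_⟩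
      have h := hN j hj k hk
      rw [dist_eq_norm, ← UniformSpace.Completion.coe_sub, UniformSpace.Completion.norm_coe] at h
      rwa [Real.lt_sqrt (norm_nonneg _)] at h
    · let f : S.H1Pre ε := ⟨φ, hφ⟩
      have hΦ' : Φ = toL2 S ε f := Represents.eq_toL2 (u := f) hΦ
      simp only
      rw [hΦ', ← embX_coe, ← hform]
      have h2 : Tendsto (fun k => inner ℂ (f : S.H1X ε) (formX hQ ε (a k : S.H1X ε))) atTop
          (𝓝 (inner ℂ (f : S.H1X ε) (formX hQ ε x))) :=
        (((innerSL ℂ (f : S.H1X ε)).continuous.comp (formX hQ ε).continuous).tendsto x).comp hax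
      exact h2.congr fun k => inner_formX_coe hQ f (a k)

end FatStar

namespace FatStar

variable {n : ℕ} {E : Type w} {S : FatStar.{u, w} n E}

/-! ### The Sobolev space of the graph -/

theorem volume_restrict_Ioc_ne_top (A : Set ℝ) (s : ℝ) : volume.restrict A (Ioc 0 s) ≠ ⊤ :=
  ((Measure.restrict_apply_le _ _).trans_lt measure_Ioc_lt_top).ne

variable (S) in
/-- The primitive at `s` of a square-integrable function on the edge `e`. -/
def primL (e : E) (s : ℝ) : Lp ℂ 2 (volume.restrict (S.edge e) : Measure ℝ) →L[ℂ] ℂ :=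
  innerSL ℂ (indicatorConstLp 2 (measurableSet_Ioc (a := (0 : ℝ)) (b := s))
    (volume_restrict_Ioc_ne_top (S.edge e) s) (1 : ℂ))

theorem Ioc_subset_edge {e : E} {s : ℝ} (hs : s ∈ S.edge e) : Ioc 0 s ⊆ S.edge e := fun _ ht =>
  ⟨ht.1, (ENNReal.ofReal_le_ofReal ht.2).trans_lt hs.2⟩

theorem primL_eq {e : E} {s : ℝ} (hs : s ∈ S.edge e)
    (g : Lp ℂ 2 (volume.restrict (S.edge e) : Measure ℝ)) :
    S.primL e s g = ∫ t in (0 : ℝ)..s, g t := by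
  rw [primL, innerSL_apply_apply, L2.inner_indicatorConstLp_one, Measure.restrict_restrict
    measurableSet_Ioc, inter_eq_left.2 (Ioc_subset_edge hs),
    intervalIntegral.integral_of_le hs.1.le]

theorem ae_restrict_edge_mem (e : E) :
    ∀ᵐ s ∂(volume.restrict (S.edge e) : Measure ℝ), s ∈ S.edge e :=
  ae_restrict_mem (S.isOpen_edge e).measurableSet

/-- The primitive is now a bounded functional of the derivative. In this form the condition is
visibly linear and stable under limits. -/
theorem isH1G_iff {f g : S.L2G} {c : ℂ} : S.IsH1G f g c ↔
    ∀ e, ∀ᵐ s ∂(volume.restrict (S.edge e) : Measure ℝ),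
      f e s = c * S.p e + S.primL e s (g e) := by
  refine forall_congr' fun e => ⟨fun h => ?_, fun h => ?_⟩ <;>
  · filter_upwards [h, ae_restrict_edge_mem e] with s h1 h2
    rw [h1, primL_eq h2]

theorem sq_p (e : E) : S.p e ^ 2 = (S.Y e).totalVol := Real.sq_sqrt (S.Y e).totalVol_nonneg

variable [Fintype E]

theorem IsH1G.add {f g f' g' : S.L2G} {c c' : ℂ} (h : S.IsH1G f g c) (h' : S.IsH1G f' g' c') :
    S.IsH1G (f + f') (g + g') (c + c') := by
  rw [isH1G_iff] at *
  intro e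
  filter_upwards [h e, h' e, Lp.coeFn_add (f e) (f' e)] with s h1 h2 h3
  rw [PiLp.add_apply, PiLp.add_apply, h3, Pi.add_apply, h1, h2, map_add]
  ring

theorem IsH1G.smul {f g : S.L2G} {c : ℂ} (h : S.IsH1G f g c) (a : ℂ) :
    S.IsH1G (a • f) (a • g) (a * c) := by
  rw [isH1G_iff] at *
  intro e
  filter_upwards [h e, Lp.coeFn_smul a (f e)] with s h1 h3
  rw [PiLp.smul_apply, PiLp.smul_apply, h3, Pi.smul_apply, h1, map_smul, smul_eq_mul, smul_eq_mul]
  ring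

theorem isH1G_zero : S.IsH1G 0 0 0 := by
  rw [isH1G_iff]
  intro e
  filter_upwards [Lp.coeFn_zero ℂ 2 (volume.restrict (S.edge e) : Measure ℝ)] with s h
  rw [PiLp.zero_apply, h, map_zero]
  simp

theorem norm_sq_Lp {α : Type*} [MeasurableSpace α] {μ : Measure α} (f : Lp ℂ 2 μ) :
    ‖f‖ ^ 2 = ∫ x, ‖f x‖ ^ 2 ∂μ := by
  rw [← inner_self_eq_norm_sq (𝕜 := ℂ), L2.inner_def, ← integral_re (L2.integrable_inner f f)]
  exact integral_congr_ae (Eventually.of_forall fun x => inner_self_eq_norm_sq (𝕜 := ℂ) _)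

theorem setIntegral_sq_norm_le {α : Type*} [MeasurableSpace α] {μ : Measure α} (f : Lp ℂ 2 μ)
    (A : Set α) : ∫ x in A, ‖f x‖ ^ 2 ∂μ ≤ ‖f‖ ^ 2 := by
  rw [norm_sq_Lp]
  exact setIntegral_le_integral ((memLp_two_iff_integrable_sq_norm (Lp.aestronglyMeasurable f)).1
    (Lp.memLp f)) (Eventually.of_forall fun x => sq_nonneg _)

/-- The trace estimate at the vertex of the graph. -/
theorem IsH1G.trace {f g : S.L2G} {c : ℂ} (h : S.IsH1G f g c) {b : ℝ} (hb : 0 < b)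
    (hbℓ : b ≤ S.ellMinus) :
    (∑ e, (S.Y e).totalVol) * ‖c‖ ^ 2 ≤ b * ‖g‖ ^ 2 + 2 / b * ‖f‖ ^ 2 := by
  rw [PiLp.norm_sq_eq_of_L2, PiLp.norm_sq_eq_of_L2, Finset.sum_mul, Finset.mul_sum, Finset.mul_sum,
    ← Finset.sum_add_distrib]
  refine Finset.sum_le_sum fun e _ => ?_
  have hsub : Ioo 0 b ⊆ S.edge e := (Ioo_subset_Ioo_right hbℓ).trans (S.Ioo_subset_edge e)
  have hres : (volume.restrict (S.edge e)).restrict (Ioo 0 b) = volume.restrict (Ioo 0 b) := by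
    rw [Measure.restrict_restrict measurableSet_Ioo, inter_eq_left.2 hsub]
  have h1 := setIntegral_sq_norm_le (g e) (Ioo 0 b)
  have h2 := setIntegral_sq_norm_le (f e) (Ioo 0 b)
  have h3 := sq_norm_initial_le hb (hres ▸ (Lp.memLp (f e)).restrict (Ioo 0 b))
    (hres ▸ (Lp.memLp (g e)).restrict (Ioo 0 b)) (f₀ := c * S.p e)
    (hres ▸ ae_restrict_of_ae (h e))
  rw [hres] at h1 h2
  rw [norm_mul, mul_pow, Complex.norm_real, Real.norm_eq_abs, sq_abs, sq_p, mul_comm] at h3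
  refine h3.trans ?_
  gcongr

variable (S) in
/-- The space of the pairs `(f, f')` with `f` in the Sobolev space `H¹_p(G)`. -/
def sobolevPairs : Submodule ℂ (WithLp 2 (S.L2G × S.L2G)) where
  carrier := {x | ∃ c, S.IsH1G x.fst x.snd c}
  zero_mem' := ⟨0, isH1G_zero⟩
  add_mem' := fun ⟨c, h⟩ ⟨c', h'⟩ => ⟨c + c', h.add h'⟩
  smul_mem' := fun a _ ⟨c, h⟩ => ⟨a * c, h.smul a⟩

variable (S) in
/-- The Sobolev space `H¹_p(G)`. -/
def H1G : Type w := S.sobolevPairs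

instance : NormedAddCommGroup S.H1G := inferInstanceAs (NormedAddCommGroup S.sobolevPairs)

instance : InnerProductSpace ℂ S.H1G := inferInstanceAs (InnerProductSpace ℂ S.sobolevPairs)

/-- The element of `H¹_p(G)` with given derivative. -/
def IsH1G.toH1G {f g : S.L2G} {c : ℂ} (h : S.IsH1G f g c) : S.H1G :=
  (⟨WithLp.toLp 2 (f, g), c, h⟩ : S.sobolevPairs)

/-- The inclusion of `H¹_p(G)` in `L²(G)`. -/
def embG (S : FatStar.{u, w} n E) : S.H1G →L[ℂ] S.L2G :=
  (WithLp.fstL 2 ℂ _ _ ∘L S.sobolevPairs.subtypeL : S.sobolevPairs →L[ℂ] S.L2G)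

/-- The derivative, as an operator from `H¹_p(G)` to `L²(G)`. -/
def derG (S : FatStar.{u, w} n E) : S.H1G →L[ℂ] S.L2G :=
  (WithLp.sndL 2 ℂ _ _ ∘L S.sobolevPairs.subtypeL : S.sobolevPairs →L[ℂ] S.L2G)

theorem H1G.exists_isH1G (x : S.H1G) : ∃ c, S.IsH1G (embG S x) (derG S x) c :=
  Subtype.property (p := fun x => x ∈ S.sobolevPairs) x

theorem H1G.inner_eq (x y : S.H1G) :
    inner ℂ x y = inner ℂ (embG S x) (embG S y) + inner ℂ (derG S x) (derG S y) :=
  WithLp.prod_inner_apply _ _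

theorem H1G.norm_sq_eq (x : S.H1G) : ‖x‖ ^ 2 = ‖embG S x‖ ^ 2 + ‖derG S x‖ ^ 2 :=
  WithLp.prod_norm_sq_eq_of_L2 (Subtype.val (p := fun x => x ∈ S.sobolevPairs) x)

variable [Nonempty E] (hvol : ∀ e, 0 < (S.Y e).totalVol)

theorem sum_totalVol_pos (hvol : ∀ e, 0 < (S.Y e).totalVol) : 0 < ∑ e, (S.Y e).totalVol :=
  Finset.sum_pos (fun e _ => hvol e) Finset.univ_nonempty

theorem IsH1G.vertex_bound (hvol : ∀ e, 0 < (S.Y e).totalVol) {f g : S.L2G} {c : ℂ}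
    (h : S.IsH1G f g c) : ‖c‖ ^ 2 ≤ (S.ellMinus + 2 / S.ellMinus) / (∑ e, (S.Y e).totalVol) *
      (‖f‖ ^ 2 + ‖g‖ ^ 2) := by
  have h1 := h.trace S.ellMinus_pos le_rfl
  have h2 := S.ellMinus_pos
  have h4 : 0 < 2 / S.ellMinus := by positivity
  have h3 := sum_totalVol_pos hvol
  rw [div_mul_eq_mul_div, le_div_iff₀ h3, mul_comm]
  nlinarith [sq_nonneg ‖f‖, sq_nonneg ‖g‖, mul_nonneg h2.le (sq_nonneg ‖f‖),
    mul_nonneg h4.le (sq_nonneg ‖g‖)]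

/-- The trace estimate for the difference, whose function and derivative both vanish. This makes the
vertex value a linear map on `H¹_p(G)`. -/
theorem IsH1G.vertex_unique (hvol : ∀ e, 0 < (S.Y e).totalVol) {f g : S.L2G} {c c' : ℂ}
    (h : S.IsH1G f g c) (h' : S.IsH1G f g c') : c = c' := by
  have h1 := (h.add (h'.smul (-1))).vertex_bound hvol
  have h2 : f + (-1 : ℂ) • f = 0 := by simp
  have h3 : g + (-1 : ℂ) • g = 0 := by simp
  rw [h2, h3] at h1
  have h4 : ‖c + -1 * c'‖ ^ 2 ≤ 0 := by simpa using h1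
  have h5 : c + -1 * c' = 0 := by
    rw [← norm_eq_zero]
    exact pow_eq_zero_iff two_ne_zero |>.1 (le_antisymm h4 (sq_nonneg _))
  linear_combination h5

/-- The value at the vertex. -/
def vertexG (hvol : ∀ e, 0 < (S.Y e).totalVol) : S.H1G →L[ℂ] ℂ :=
  LinearMap.mkContinuous
    { toFun := fun x => x.exists_isH1G.choose
      map_add' := fun x y => ((x + y).exists_isH1G.choose_spec).vertex_unique hvol
        (x.exists_isH1G.choose_spec.add y.exists_isH1G.choose_spec)
      map_smul' := fun a x => ((a • x).exists_isH1G.choose_spec).vertex_unique hvol (x.exists_isH1G.choose_spec.smul a) }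
    (Real.sqrt ((S.ellMinus + 2 / S.ellMinus) / (∑ e, (S.Y e).totalVol))) fun x => by
      have h := x.exists_isH1G.choose_spec.vertex_bound hvol
      have h0 : 0 ≤ (S.ellMinus + 2 / S.ellMinus) / ∑ e, (S.Y e).totalVol := by
        have h2 := S.ellMinus_pos
        have h3 := sum_totalVol_pos hvol
        positivity
      refine (sq_le_sq₀ (norm_nonneg _) (by positivity)).1 ?_
      rw [mul_pow, Real.sq_sqrt h0, H1G.norm_sq_eq]
      exact h

theorem isH1G_vertexG (x : S.H1G) : S.IsH1G (embG S x) (derG S x) (vertexG hvol x) :=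
  x.exists_isH1G.choose_spec

/-- Vertex values of a convergent sequence converge by the trace bound, primitives converge at each
point, and a subsequence of the functions converges almost everywhere. -/
theorem isClosed_sobolevPairs (hvol : ∀ e, 0 < (S.Y e).totalVol) :
    IsClosed (S.sobolevPairs : Set (WithLp 2 (S.L2G × S.L2G))) := by
  refine IsSeqClosed.isClosed fun xs x hxs hx => ?_
  let a (k : ℕ) : S.H1G := (⟨xs k, hxs k⟩ : S.sobolevPairs)
  have ha : CauchySeq a := by
    have h := Metric.cauchySeq_iff.1 (hx.cauchySeq : CauchySeq xs)
    exact Metric.cauchySeq_iff.2 h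
  obtain ⟨c, hc⟩ := cauchySeq_tendsto_of_complete
    ((vertexG hvol).uniformContinuous.comp_cauchySeq ha)
  refine ⟨c, isH1G_iff.2 fun e => ?_⟩
  have hf : Tendsto (fun k => (xs k).fst e) atTop (𝓝 (x.fst e)) :=
    ((PiLp.continuous_apply 2 _ e).comp (WithLp.fstL 2 ℂ S.L2G S.L2G).continuous).tendsto x
      |>.comp hx
  have hg : Tendsto (fun k => (xs k).snd e) atTop (𝓝 (x.snd e)) :=
    ((PiLp.continuous_apply 2 _ e).comp (WithLp.sndL 2 ℂ S.L2G S.L2G).continuous).tendsto x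
      |>.comp hx
  obtain ⟨ns, hns, hae⟩ := (tendstoInMeasure_of_tendsto_Lp hf).exists_seq_tendsto_ae
  have hall : ∀ᵐ s ∂(volume.restrict (S.edge e) : Measure ℝ), ∀ k,
      (xs k).fst e s = vertexG hvol (a k) * S.p e + S.primL e s ((xs k).snd e) :=
    ae_all_iff.2 fun k => isH1G_iff.1 (isH1G_vertexG hvol (a k)) e
  filter_upwards [hae, hall] with s h1 h2
  refine tendsto_nhds_unique h1 ?_
  have h3 : Tendsto (fun k => vertexG hvol (a k) * S.p e + S.primL e s ((xs k).snd e)) atTop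
      (𝓝 (c * S.p e + S.primL e s (x.snd e))) :=
    (hc.mul_const _).add (((S.primL e s).continuous.tendsto _).comp hg)
  exact (h3.comp hns.tendsto_atTop).congr fun k => (h2 (ns k)).symm

theorem completeSpace_H1G (hvol : ∀ e, 0 < (S.Y e).totalVol) : CompleteSpace S.H1G :=
  (isClosed_sobolevPairs hvol).completeSpace_coe

variable [CompleteSpace S.H1G] (Q : S.X → ℝ)

/-- The bounded operator on `H¹_p(G)` that represents the form `h`. -/
def formG (Q : S.X → ℝ) : S.H1G →L[ℂ] S.H1G :=
  ContinuousLinearMap.id ℂ _ - ContinuousLinearMap.adjoint (embG S) ∘L embG S +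
    (S.q Q : ℂ) • (vertexG hvol).smulRight ((InnerProductSpace.toDual ℂ S.H1G).symm (vertexG hvol))

theorem inner_formG (x y : S.H1G) : inner ℂ x (formG hvol Q y) =
    inner ℂ (derG S x) (derG S y) + S.q Q * (conj (vertexG hvol x) * vertexG hvol y) := by
  have h : formG hvol Q y = y - ContinuousLinearMap.adjoint (embG S) (embG S y) +
    (S.q Q : ℂ) • vertexG hvol y • (InnerProductSpace.toDual ℂ S.H1G).symm (vertexG hvol) := rfl
  rw [h, inner_add_right, inner_sub_right, inner_smul_right, inner_smul_right,
    ContinuousLinearMap.adjoint_inner_right, H1G.inner_eq, ← inner_conj_symm x,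
    InnerProductSpace.toDual_symm_apply]
  ring

theorem formG_symm (x y : S.H1G) :
    inner ℂ (formG hvol Q x) y = inner ℂ x (formG hvol Q y) := by
  rw [← inner_conj_symm, inner_formG, inner_formG, map_add, inner_conj_symm]
  simp only [map_mul, Complex.conj_conj, Complex.conj_ofReal]
  ring

theorem graphOp_eq_formRel : S.graphOp Q = formRel (embG S) (formG hvol Q) := by
  ext ⟨f, W⟩
  constructor
  · rintro ⟨g, c, h, hform⟩
    simp only at h hform
    let x : S.H1G := h.toH1G
    have hc : vertexG hvol x = c := (isH1G_vertexG hvol x).vertex_unique hvol h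
    refine ⟨x, rfl, fun φ => ?_⟩
    rw [inner_formG, hc]
    exact hform _ _ _ (isH1G_vertexG hvol φ)
  · rintro ⟨x, rfl, hform⟩
    refine ⟨derG S x, vertexG hvol x, isH1G_vertexG hvol x, fun φ φ' b hφ => ?_⟩
    simp only at hform ⊢
    let y : S.H1G := hφ.toH1G
    have hb : vertexG hvol y = b := (isH1G_vertexG hvol y).vertex_unique hvol hφ
    have h1 := hform y
    rw [inner_formG, hb] at h1
    exact h1

end FatStar

/-! ### Partial averages -/

section Average

variable {α β : Type*} [MeasurableSpace α] [MeasurableSpace β] {μ : Measure α} {ν : Measure β}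
  [IsFiniteMeasure ν] {F : α × β → ℂ}

theorem memLp_integral_right [SFinite μ] (hF : MemLp F 2 (μ.prod ν)) :
    MemLp (fun s => ∫ y, F (s, y) ∂ν) 2 μ := by
  have hF2 := (memLp_two_iff_integrable_sq_norm hF.1).1 hF
  refine (memLp_two_iff_integrable_sq_norm hF.1.integral_prod_right').2 ?_
  refine (hF2.integral_prod_left.const_mul (ν.real univ)).mono'
    (hF.1.integral_prod_right'.norm.pow 2) ?_
  filter_upwards [hF2.prod_right_ae, hF.1.prodMk_left] with s h1 h2
  rw [Real.norm_of_nonneg (sq_nonneg _)]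
  exact sq_norm_integral_le ((memLp_two_iff_integrable_sq_norm h2).2 h1)

theorem memLp_comp_fst {f : α → ℂ} (hf : MemLp f 2 μ) :
    MemLp (fun z : α × β => f z.1) 2 (μ.prod ν) := by
  have hm : AEStronglyMeasurable (fun z : α × β => f z.1) (μ.prod ν) := hf.1.comp_fst
  refine (memLp_two_iff_integrable_sq_norm hm).2 ?_
  exact ((memLp_two_iff_integrable_sq_norm hf.1).1 hf).comp_fst ν

theorem integral_conj_comp_fst_mul [SFinite μ] {f : α → ℂ} (hf : MemLp f 2 μ) (hF : MemLp F 2 (μ.prod ν)) :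
    ∫ z, conj (f z.1) * F z ∂μ.prod ν = ∫ s, conj (f s) * ∫ y, F (s, y) ∂ν ∂μ := by
  rw [integral_prod _ (FatStar.integrable_conj_mul (memLp_comp_fst hf) hF)]
  exact integral_congr_ae (Eventually.of_forall fun s =>
    integral_const_mul (conj (f s)) fun y => F (s, y))

end Average

namespace FatStar

variable {n : ℕ} {E : Type w} {S : FatStar.{u, w} n E} {ε : ℝ} {u : S.Fn}

/-! ### Estimates for smooth functions on the thin manifold -/

/-- The trace estimate from the side of the edge. Gluing identifies the mean over the boundary
component of `X` with the mean of the edge function at `s = 0`. -/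
theorem sq_edgeMean_le (hε : 0 < ε) (hu : u ∈ S.smoothFn ε) (e : E) {b : ℝ} (hb : 0 < b)
    (hbℓ : b ≤ S.ellMinus) : (S.Y e).totalVol * ‖S.edgeMean u.1 e‖ ^ 2 ≤
      b * (∫ z, ‖ds u e z‖ ^ 2 ∂S.edgeVol e) + 2 / b * ∫ z, ‖u.2 e z‖ ^ 2 ∂S.edgeVol e := by
  have hw := contMDiffOn_glue hu e
  have h0 : (0 : ℝ) ∈ S.edgeDom ε e := S.Ico_subset_edgeDom hε e ⟨le_rfl, S.ellMinus_pos⟩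
  have hmean : S.edgeMean u.1 e = (S.Y e).mean fun y => S.glue ε u e (0, y) := by
    simp only [edgeMean, glue_zero_eq hu]
  have hi (f : ℝ × S.Y e → ℂ) (hf : MemLp f 2 (S.edgeVol e)) :
      Integrable (fun z => ‖f z‖ ^ 2) (S.edgeVol e) := (memLp_two_iff_integrable_sq_norm hf.1).1 hf
  rw [hmean]
  refine (RiemMfd.totalVol_mul_sq_mean_le (RiemMfd.contMDiff_slice hw h0).continuous).trans ?_
  exact RiemMfd.integral_trace_le hb (S.uniqueDiffOn_edgeDom hε e)
    ((Ico_subset_Ico_right hbℓ).trans (S.Ico_subset_edgeDom hε e)) hw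
    (S.isOpen_edge e).measurableSet ((Ioo_subset_Ioo_right hbℓ).trans (S.Ioo_subset_edge e))
    (hi _ (memLp_ds hε hu e 2)) (hi _ (memLp_edge hε hu e 2))
    (fun s hs y => by rw [ds_eq hε hu hs y]) (fun s hs y => by rw [glue_of_pos hs.1])

/-- The average over the cross-section. -/
def avg (u : S.Fn) (e : E) (s : ℝ) : ℂ := (S.Y e).mean fun y => u.2 e (s, y)

/-- The average of the longitudinal derivative over the cross-section. -/
def avgDs (u : S.Fn) (e : E) (s : ℝ) : ℂ := (S.Y e).mean fun y => ds u e (s, y)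

theorem memLp_avg (hε : 0 < ε) (hu : u ∈ S.smoothFn ε) (e : E) :
    MemLp (avg u e) 2 (volume.restrict (S.edge e)) := by
  have h := (memLp_integral_right (memLp_edge hε hu e 2)).const_mul
    (((S.Y e).totalVol : ℂ)⁻¹)
  refine (memLp_congr_ae (Eventually.of_forall fun s => ?_)).1 h
  simp only [avg, RiemMfd.mean]
  rw [div_eq_inv_mul]

theorem memLp_avgDs (hε : 0 < ε) (hu : u ∈ S.smoothFn ε) (e : E) :
    MemLp (avgDs u e) 2 (volume.restrict (S.edge e)) := by
  have h := (memLp_integral_right (memLp_ds hε hu e 2)).const_mul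
    (((S.Y e).totalVol : ℂ)⁻¹)
  refine (memLp_congr_ae (Eventually.of_forall fun s => ?_)).1 h
  simp only [avgDs, RiemMfd.mean]
  rw [div_eq_inv_mul]

/-- The Poincaré inequality on the cross-sections. -/
theorem integral_sq_norm_edge_le (hε : 0 < ε) (hu : u ∈ S.smoothFn ε) (e : E)
    (hlam : 0 < S.lamEdge e) :
    ∫ z, ‖u.2 e z‖ ^ 2 ∂S.edgeVol e ≤ (S.Y e).totalVol * (∫ s in S.edge e, ‖avg u e s‖ ^ 2) +
      (transForm u u e).re / S.lamEdge e := by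
  have hvol := (S.Y e).totalVol_pos_of_neumannEigenvalue_pos hlam
  have h1 := memLp_edge hε hu e 2
  have i1 := (memLp_two_iff_integrable_sq_norm h1.1).1 h1
  have h2 := memLp_avg hε hu e
  have i2 := (memLp_two_iff_integrable_sq_norm h2.1).1 h2
  have i3 : Integrable (fun z => (dy u u e z).re)
      ((volume.restrict (S.edge e)).prod (S.Y e).vol) := (integrable_dy hε hu hu e).re
  rw [transForm_self_re hε hu]
  have e1 : ∫ z, ‖u.2 e z‖ ^ 2 ∂S.edgeVol e =
    ∫ s in S.edge e, ∫ y, ‖u.2 e (s, y)‖ ^ 2 ∂(S.Y e).vol := integral_prod _ i1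
  have e3 : ∫ z, (dy u u e z).re ∂S.edgeVol e =
    ∫ s in S.edge e, ∫ y, (dy u u e (s, y)).re ∂(S.Y e).vol := integral_prod _ i3
  rw [e1, e3, ← integral_const_mul, ← integral_div,
    ← integral_add (i2.const_mul _) (i3.integral_prod_left.div_const _)]
  refine setIntegral_mono_on i1.integral_prod_left
    ((i2.const_mul _).add (i3.integral_prod_left.div_const _)) (S.isOpen_edge e).measurableSet
    fun s hs => ?_
  have hsm := smooth_slice hε hu hs
  rw [RiemMfd.integral_sq_norm_eq_mean hvol hsm.continuous, mul_comm]
  refine add_le_add le_rfl ?_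
  have h := RiemMfd.poincare (M := S.Y e) hlam hsm
  rw [RiemMfd.dirichlet_self_re hsm] at h
  exact h

/-- The averages satisfy `⨍ u(s) = ⨍ u(0) + ∫₀ˢ ⨍ ∂ₛu`. -/
theorem avg_eq (hε : 0 < ε) (hu : u ∈ S.smoothFn ε) {e : E} {s : ℝ} (hs : s ∈ S.edge e) :
    avg u e s = S.edgeMean u.1 e + ∫ t in (0 : ℝ)..s, avgDs u e t := by
  have hw := contMDiffOn_glue hu e
  have h0 : (0 : ℝ) ∈ S.edgeDom ε e := S.Ico_subset_edgeDom hε e ⟨le_rfl, S.ellMinus_pos⟩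
  have hsub := Ioc_subset_edge hs
  have hpt (y : S.Y e) : u.2 e (s, y) = S.glue ε u e (0, y) + ∫ t in Ioc 0 s, ds u e (t, y) := by
    rw [← glue_of_pos (ε := ε) hs.1, RiemMfd.eq_add_integral_derivWithin
      (S.uniqueDiffOn_edgeDom hε e) hw y hs.1.le (S.Icc_subset_edgeDom hε hs),
      intervalIntegral.integral_of_le hs.1.le]
    congr 1
    refine setIntegral_congr_fun measurableSet_Ioc fun t ht => ?_
    exact (ds_eq hε hu (hsub ht) y).symm
  have hint : Integrable (ds u e) ((volume.restrict (Ioc 0 s)).prod (S.Y e).vol) :=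
    (memLp_one_iff_integrable.1 (memLp_ds hε hu e 1)).mono_measure
      (Measure.prod_mono (Measure.restrict_mono hsub le_rfl) le_rfl)
  have hg : Integrable (fun y => S.glue ε u e (0, y)) (S.Y e).vol :=
    RiemMfd.integrable_of_continuous (RiemMfd.contMDiff_slice hw h0).continuous
  rw [avg, RiemMfd.mean, edgeMean, RiemMfd.mean]
  simp only [hpt, ← glue_zero_eq hu]
  rw [integral_add hg hint.integral_prod_right, add_div, intervalIntegral.integral_of_le hs.1.le]
  congr 1
  simp only [avgDs, RiemMfd.mean]
  rw [integral_div, integral_integral_swap (f := fun y t => ds u e (t, y)) hint.swap]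

variable [Fintype E]

theorem totalVol_eq_cVol [Nonempty E] (hvol : ∀ e, 0 < (S.Y e).totalVol) :
    S.X.totalVol = S.cVol * ∑ e, (S.Y e).totalVol := by
  rw [cVol, div_mul_cancel₀ _ (sum_totalVol_pos hvol).ne']

theorem cVol_nonneg : 0 ≤ S.cVol :=
  div_nonneg S.X.totalVol_nonneg (Finset.sum_nonneg fun e _ => (S.Y e).totalVol_nonneg)

/-- Split into the mean and the deviation from it. The deviation is the Poincaré inequality; the
mean is compared with the boundary means through collars of length `a`, and these with the edge
functions over length `b`. The two lengths are independent: `b` may be adapted to the potential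
while `a` is kept long. -/
theorem integral_sq_norm_vertex_le [Nonempty E] (hlamV : 0 < S.lamV)
    (hvol : ∀ e, 0 < (S.Y e).totalVol) (hε : 0 < ε) (hu : u ∈ S.smoothFn ε) {a b : ℝ}
    (ha : 0 < a) (haℓ : a ≤ S.ellMinus) (hb : 0 < b) (hbℓ : b ≤ S.ellMinus) :
    ∫ x, ‖u.1 x‖ ^ 2 ∂S.X.vol ≤
      (1 / S.lamV + 2 * S.cVol * (a + 2 / (a * S.lamV))) * (S.X.dirichlet u.1 u.1).re +
      2 * S.cVol * (b * (∑ e, ∫ z, ‖ds u e z‖ ^ 2 ∂S.edgeVol e) +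
        2 / b * ∑ e, ∫ z, ‖u.2 e z‖ ^ 2 ∂S.edgeVol e) := by
  have hX := S.X.totalVol_pos_of_neumannEigenvalue_pos hlamV
  rw [RiemMfd.integral_sq_norm_eq_mean hX hu.1.continuous]
  have h1 : ∫ x, ‖u.1 x - S.X.mean u.1‖ ^ 2 ∂S.X.vol ≤ (S.X.dirichlet u.1 u.1).re / S.lamV :=
    RiemMfd.poincare hlamV hu.1
  have h2 := S.sum_sq_edgeMean_sub_mean_le hlamV hvol hu.1 ha haℓ
  have h3 : ∑ e, (S.Y e).totalVol * ‖S.edgeMean u.1 e‖ ^ 2 ≤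
      b * (∑ e, ∫ z, ‖ds u e z‖ ^ 2 ∂S.edgeVol e) +
        2 / b * ∑ e, ∫ z, ‖u.2 e z‖ ^ 2 ∂S.edgeVol e := by
    rw [Finset.mul_sum, Finset.mul_sum, ← Finset.sum_add_distrib]
    exact Finset.sum_le_sum fun e _ => sq_edgeMean_le hε hu e hb hbℓ
  have h4 : (∑ e, (S.Y e).totalVol) * ‖S.X.mean u.1‖ ^ 2 ≤
      2 * (∑ e, (S.Y e).totalVol * ‖S.X.mean u.1 - S.edgeMean u.1 e‖ ^ 2 +
        ∑ e, (S.Y e).totalVol * ‖S.edgeMean u.1 e‖ ^ 2) := by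
    rw [Finset.sum_mul, ← Finset.sum_add_distrib, Finset.mul_sum]
    refine Finset.sum_le_sum fun e _ => ?_
    have h5 : ‖S.X.mean u.1‖ ≤ ‖S.X.mean u.1 - S.edgeMean u.1 e‖ + ‖S.edgeMean u.1 e‖ := by
      simpa using norm_add_le (S.X.mean u.1 - S.edgeMean u.1 e) (S.edgeMean u.1 e)
    have h6 : ‖S.X.mean u.1‖ ^ 2 ≤
        2 * (‖S.X.mean u.1 - S.edgeMean u.1 e‖ ^ 2 + ‖S.edgeMean u.1 e‖ ^ 2) :=
      (pow_le_pow_left₀ (norm_nonneg _) h5 2).trans (add_sq_le)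
    calc _ ≤ (S.Y e).totalVol *
          (2 * (‖S.X.mean u.1 - S.edgeMean u.1 e‖ ^ 2 + ‖S.edgeMean u.1 e‖ ^ 2)) :=
          mul_le_mul_of_nonneg_left h6 (hvol e).le
      _ = _ := by ring
  have h7 := mul_le_mul_of_nonneg_left h4 (cVol_nonneg (S := S))
  have h8 := mul_le_mul_of_nonneg_left (add_le_add h2 h3)
    (mul_nonneg zero_le_two (cVol_nonneg (S := S)))
  rw [totalVol_eq_cVol hvol]
  calc _ ≤ S.cVol * ((∑ e, (S.Y e).totalVol) * ‖S.X.mean u.1‖ ^ 2) +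
        (S.X.dirichlet u.1 u.1).re / S.lamV := by
        refine add_le_add (le_of_eq ?_) h1
        ring
    _ ≤ _ := by
        refine (add_le_add (h7.trans ?_) le_rfl).trans_eq (b := 2 * S.cVol * ((a + 2 / (a * S.lamV)) *
          (S.X.dirichlet u.1 u.1).re + (b * (∑ e, ∫ z, ‖ds u e z‖ ^ 2 ∂S.edgeVol e) +
          2 / b * ∑ e, ∫ z, ‖u.2 e z‖ ^ 2 ∂S.edgeVol e)) + (S.X.dirichlet u.1 u.1).re / S.lamV) ?_
        · refine le_trans (le_of_eq ?_) h8
          ring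
        · ring

end FatStar

namespace FatStar

variable {n : ℕ} {E : Type w} {S : FatStar.{u, w} n E} {ε : ℝ}

/-! ### The identification operator -/

theorem ae_fst {e : E} {P : ℝ → Prop} (h : ∀ᵐ s ∂(volume.restrict (S.edge e) : Measure ℝ), P s)
    (c : ENNReal) : ∀ᵐ z ∂(c • S.edgeVol e), P z.1 :=
  Measure.ae_smul_measure (Measure.quasiMeasurePreserving_fst.ae h) c

theorem memLp_ident (ε : ℝ) (e : E) (f : Lp ℂ 2 (volume.restrict (S.edge e) : Measure ℝ)) :
    MemLp (fun z : ℝ × S.Y e => ((ε ^ (-(n : ℝ) / 2) * (S.p e)⁻¹ : ℝ) : ℂ) * f z.1) 2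
      (ENNReal.ofReal (ε ^ n) • S.edgeVol e) :=
  ((memLp_comp_fst (Lp.memLp f)).const_mul _).smul_measure ENNReal.ofReal_ne_top

theorem rpow_neg_half_sq (hε : 0 < ε) : ε ^ n * (ε ^ (-(n : ℝ) / 2)) ^ 2 = 1 := by
  rw [← Real.rpow_natCast, ← Real.rpow_natCast, ← Real.rpow_mul hε.le, ← Real.rpow_add hε]
  norm_num

theorem p_pos {e : E} (h : 0 < (S.Y e).totalVol) : 0 < S.p e := Real.sqrt_pos.2 h

variable [Fintype E]

variable (S ε) in
/-- The identification operator, as a linear map. -/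
def identLin : S.L2G →ₗ[ℂ] S.L2X ε where
  toFun f := WithLp.toLp 2 (WithLp.toLp 2 fun e => (memLp_ident ε e (f e)).toLp _, 0)
  map_add' f g := by
    refine WithLp.ofLp_injective 2 (Prod.ext (WithLp.ofLp_injective 2 (funext fun e => ?_)) ?_)
    · refine Lp.ext ((memLp_ident ε e _).coeFn_toLp.trans ?_)
      refine EventuallyEq.trans ?_ (Lp.coeFn_add ((memLp_ident ε e (f e)).toLp _)
        ((memLp_ident ε e (g e)).toLp _)).symm
      filter_upwards [(memLp_ident ε e (f e)).coeFn_toLp, (memLp_ident ε e (g e)).coeFn_toLp,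
        ae_fst (Lp.coeFn_add (f e) (g e)) _] with z h1 h2 h3
      rw [Pi.add_apply, h1, h2, PiLp.add_apply, h3, Pi.add_apply, mul_add]
    · exact (add_zero _).symm
  map_smul' a f := by
    refine WithLp.ofLp_injective 2 (Prod.ext (WithLp.ofLp_injective 2 (funext fun e => ?_)) ?_)
    · refine Lp.ext ((memLp_ident ε e _).coeFn_toLp.trans ?_)
      refine EventuallyEq.trans ?_ (Lp.coeFn_smul a ((memLp_ident ε e (f e)).toLp _)).symm
      filter_upwards [(memLp_ident ε e (f e)).coeFn_toLp,
        ae_fst (Lp.coeFn_smul a (f e)) _] with z h1 h3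
      rw [Pi.smul_apply, h1, PiLp.smul_apply, h3, Pi.smul_apply, smul_eq_mul, smul_eq_mul]
      ring
    · exact (smul_zero a).symm

theorem inner_identLin (hε : 0 < ε) (f : S.L2G) {U : S.L2X ε} {F : ∀ e, ℝ × S.Y e → ℂ}
    (hF : ∀ e, MemLp (F e) 2 (S.edgeVol e))
    (hU : ∀ e, U.fst e =ᵐ[ENNReal.ofReal (ε ^ n) • S.edgeVol e] F e) :
    inner ℂ (identLin S ε f) U = ∑ e, ((ε ^ n * (ε ^ (-(n : ℝ) / 2) * (S.p e)⁻¹) : ℝ) : ℂ) *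
      ∫ s in S.edge e, conj (f e s) * ∫ y, F e (s, y) ∂(S.Y e).vol := by
  rw [WithLp.prod_inner_apply, PiLp.inner_apply]
  have h0 : inner ℂ (identLin S ε f).snd U.snd = 0 := inner_zero_left _
  refine (congrArg₂ (· + ·) (Finset.sum_congr rfl fun e _ => ?_) h0).trans (add_zero _)
  refine (L2.inner_def ((memLp_ident ε e (f e)).toLp _) (U.fst e)).trans ?_
  have h1 : ∫ z, inner ℂ ((memLp_ident ε e (f e)).toLp _ z) (U.fst e z)
      ∂(ENNReal.ofReal (ε ^ n) • S.edgeVol e) =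
      ∫ z, ((ε ^ (-(n : ℝ) / 2) * (S.p e)⁻¹ : ℝ) : ℂ) * (conj (f e z.1) * F e z)
        ∂(ENNReal.ofReal (ε ^ n) • S.edgeVol e) := by
    refine integral_congr_ae ?_
    filter_upwards [(memLp_ident ε e (f e)).coeFn_toLp, hU e] with z h1 h2
    rw [h1, h2, RCLike.inner_apply, map_mul, Complex.conj_ofReal]
    ring
  rw [h1, integral_smul_measure, ENNReal.toReal_ofReal (by positivity), integral_const_mul,
    Complex.real_smul, ← mul_assoc, ← Complex.ofReal_mul]
  congr 1
  exact integral_conj_comp_fst_mul (Lp.memLp (f e)) (hF e)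

/-- The density `ε^n` cancels the square of `ε^(-n/2)`, and the volume of `Y e` cancels the square
of `(p e)⁻¹`. -/
theorem norm_identLin (hε : 0 < ε) (hvol : ∀ e, 0 < (S.Y e).totalVol) (f : S.L2G) :
    ‖identLin S ε f‖ = ‖f‖ := by
  rw [← sq_eq_sq₀ (norm_nonneg _) (norm_nonneg _)]
  have h := inner_identLin hε f (U := identLin S ε f)
    (F := fun e z => ((ε ^ (-(n : ℝ) / 2) * (S.p e)⁻¹ : ℝ) : ℂ) * f e z.1)
    (fun e => (memLp_comp_fst (Lp.memLp (f e))).const_mul _)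
    (fun e => (memLp_ident ε e (f e)).coeFn_toLp)
  rw [inner_self_eq_norm_sq_to_K] at h
  apply Complex.ofReal_injective
  refine (Complex.ofReal_pow _ _).trans (h.trans ?_)
  rw [PiLp.norm_sq_eq_of_L2, Complex.ofReal_sum]
  refine Finset.sum_congr rfl fun e _ => ?_
  have hp := p_pos (hvol e)
  simp only [integral_const, Complex.real_smul]
  have h1 (s : ℝ) : conj (f e s) * (((S.Y e).vol.real univ : ℂ) *
      (((ε ^ (-(n : ℝ) / 2) * (S.p e)⁻¹ : ℝ) : ℂ) * f e s)) =
      (((S.Y e).totalVol * (ε ^ (-(n : ℝ) / 2) * (S.p e)⁻¹) : ℝ) : ℂ) *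
        ((‖f e s‖ ^ 2 : ℝ) : ℂ) := by
    rw [← conj_mul_self_eq, RiemMfd.totalVol]
    push_cast
    ring
  simp only [h1]
  rw [integral_const_mul, integral_complex_ofReal, ← mul_assoc, ← Complex.ofReal_mul, norm_sq_Lp,
    ← sq_p]
  have h2 : ε ^ n * (ε ^ (-(n : ℝ) / 2) * (S.p e)⁻¹) *
      (S.p e ^ 2 * (ε ^ (-(n : ℝ) / 2) * (S.p e)⁻¹)) = 1 := by
    rw [← rpow_neg_half_sq (n := n) hε]
    field_simp
  rw [h2, Complex.ofReal_one, one_mul]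

/-- The identification operator `J`. -/
def identJ (hε : 0 < ε) (hvol : ∀ e, 0 < (S.Y e).totalVol) : S.L2G →L[ℂ] S.L2X ε :=
  (identLin S ε).mkContinuous 1 fun f => by rw [one_mul, norm_identLin hε hvol]

variable (hε : 0 < ε) (hvol : ∀ e, 0 < (S.Y e).totalVol)

theorem isIdentification_identJ : S.IsIdentification ε (identJ hε hvol) := fun f =>
  ⟨fun e => (memLp_ident ε e (f e)).coeFn_toLp, rfl⟩

theorem norm_identJ_apply (f : S.L2G) : ‖identJ hε hvol f‖ = ‖f‖ := norm_identLin hε hvol f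

theorem adjoint_comp_identJ : ContinuousLinearMap.adjoint (identJ hε hvol) ∘L identJ hε hvol =
    ContinuousLinearMap.id ℂ S.L2G :=
  (ContinuousLinearMap.norm_map_iff_adjoint_comp_self _).1 (norm_identJ_apply hε hvol)

/-- As `J` is isometric, `JJ*` is an orthogonal projection, and this is Pythagoras. -/
theorem norm_sq_sub_identJ (U : S.L2X ε) :
    ‖U - identJ hε hvol (ContinuousLinearMap.adjoint (identJ hε hvol) U)‖ ^ 2 =
      ‖U‖ ^ 2 - ‖ContinuousLinearMap.adjoint (identJ hε hvol) U‖ ^ 2 := by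
  rw [@norm_sub_sq ℂ, ← ContinuousLinearMap.adjoint_inner_left, inner_self_eq_norm_sq,
    norm_identJ_apply]
  ring

/-- The adjoint of the identification operator takes averages over the cross-sections. -/
theorem adjoint_identJ_toL2 [Fact (0 < ε)] (u : S.H1Pre ε) :
    ContinuousLinearMap.adjoint (identJ hε hvol) (toL2 S ε u) =
      WithLp.toLp 2 fun e => ((memLp_avg hε u.mem e).const_mul
        (((ε ^ (-(n : ℝ) / 2))⁻¹ * S.p e : ℝ) : ℂ)).toLp _ := by
  refine ext_inner_left ℂ fun f => ?_
  rw [ContinuousLinearMap.adjoint_inner_right]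
  refine (inner_identLin hε f (fun e => memLp_edge hε u.mem e 2)
    (represents_toL2 u).1).trans ?_
  rw [PiLp.inner_apply]
  refine Finset.sum_congr rfl fun e _ => ?_
  have hp := p_pos (hvol e)
  have hr : 0 < ε ^ (-(n : ℝ) / 2) := Real.rpow_pos_of_pos hε _
  have h1 : inner ℂ (f e) (((memLp_avg hε u.mem e).const_mul
        (((ε ^ (-(n : ℝ) / 2))⁻¹ * S.p e : ℝ) : ℂ)).toLp _) =
      ∫ s in S.edge e, (((ε ^ (-(n : ℝ) / 2))⁻¹ * S.p e * (S.p e ^ 2)⁻¹ : ℝ) : ℂ) *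
        (conj (f e s) * ∫ y, u.fn.2 e (s, y) ∂(S.Y e).vol) := by
    refine (L2.inner_def _ _).trans (integral_congr_ae ?_)
    filter_upwards [((memLp_avg hε u.mem e).const_mul
      (((ε ^ (-(n : ℝ) / 2))⁻¹ * S.p e : ℝ) : ℂ)).coeFn_toLp] with s hs
    rw [hs, RCLike.inner_apply, avg, RiemMfd.mean, ← sq_p]
    push_cast
    ring
  refine Eq.trans ?_ h1.symm
  rw [integral_const_mul]
  congr 2
  have h2 := rpow_neg_half_sq (n := n) hε
  clear h1
  generalize ε ^ (-(n : ℝ) / 2) = r at hr h2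
  field_simp
  linear_combination h2

theorem norm_sq_adjoint_identJ_toL2 [Fact (0 < ε)] (u : S.H1Pre ε) :
    ‖ContinuousLinearMap.adjoint (identJ hε hvol) (toL2 S ε u)‖ ^ 2 =
      ∑ e, ε ^ n * ((S.Y e).totalVol * ∫ s in S.edge e, ‖avg u.fn e s‖ ^ 2) := by
  rw [adjoint_identJ_toL2, PiLp.norm_sq_eq_of_L2]
  refine Finset.sum_congr rfl fun e _ => ?_
  have hr : 0 < ε ^ (-(n : ℝ) / 2) := Real.rpow_pos_of_pos hε _
  have h2 := rpow_neg_half_sq (n := n) hε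
  refine (norm_sq_Lp _).trans ?_
  rw [← sq_p, ← mul_assoc, ← integral_const_mul]
  refine integral_congr_ae ?_
  filter_upwards [((memLp_avg hε u.mem e).const_mul
      (((ε ^ (-(n : ℝ) / 2))⁻¹ * S.p e : ℝ) : ℂ)).coeFn_toLp] with s hs
  rw [hs, norm_mul, mul_pow, Complex.norm_real, Real.norm_eq_abs, sq_abs, mul_pow, inv_pow,
    eq_inv_of_mul_eq_one_left h2]

end FatStar

namespace FatStar

variable {n : ℕ} {E : Type w} {S : FatStar.{u, w} n E} {ε : ℝ} {Q : S.X → ℝ}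

/-! ### The constants -/

theorem supNorm_nonneg : 0 ≤ S.supNorm Q := ENNReal.toReal_nonneg

theorem ae_abs_le_supNorm (hQ : MemLp Q ⊤ S.X.vol) : ∀ᵐ x ∂S.X.vol, |Q x| ≤ S.supNorm Q := by
  have hfin : eLpNorm Q ⊤ S.X.vol ≠ ⊤ := hQ.2.ne
  filter_upwards [ae_le_eLpNormEssSup (f := Q) (μ := S.X.vol)] with x hx
  rw [← eLpNorm_exponent_top] at hx
  rw [supNorm, ← Real.norm_eq_abs, ← toReal_enorm]
  exact ENNReal.toReal_mono hfin hx

theorem abs_q_le (hQ : MemLp Q ⊤ S.X.vol) : |S.q Q| ≤ S.supNorm Q * S.X.totalVol := by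
  rw [← Real.norm_eq_abs]
  exact norm_integral_le_of_norm_le_const (ae_abs_le_supNorm hQ)

theorem ell0_pos : 0 < S.ell0 := lt_min one_pos S.ellMinus_pos

theorem ell0_le_one : S.ell0 ≤ 1 := min_le_left _ _

theorem ell0_le : S.ell0 ≤ S.ellMinus := min_le_right _ _

variable [Fintype E]

theorem delta_nonneg : 0 ≤ S.delta Q ε := Real.sqrt_nonneg _

theorem le_delta_sq {t : ℝ}
    (h : t ≤ max (8 * ε * S.cVol / S.ell0) (max (ε ^ 2 / S.lamE)
    (max (4 * ε ^ 2 * (1 / S.lamV + S.cVol * (1 + 2 / (S.ell0 * S.lamV))))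
      (max (2 * ε / S.ell0 * (1 + 2 / (S.ell0 * S.lamV)))
        (4 * ε * S.cVol * S.supNorm Q ^ 2 / (S.ell0 * S.lamV)))))) (hε : 0 < ε) :
    t ≤ S.delta Q ε ^ 2 := by
  rw [delta, Real.sq_sqrt]
  · exact h
  · have h1 := ell0_pos (S := S)
    have h2 := cVol_nonneg (S := S)
    exact le_max_of_le_left (by positivity)

theorem delta_sq_ge_cVol (hε : 0 < ε) : 8 * ε * S.cVol / S.ell0 ≤ S.delta Q ε ^ 2 :=
  le_delta_sq (le_max_left _ _) hε

theorem lamE_pos [Nonempty E] (hlamEdge : ∀ e, 0 < S.lamEdge e) : 0 < S.lamE := by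
  obtain ⟨e, he⟩ := exists_eq_ciInf_of_finite (f := S.lamEdge)
  rw [lamE, ← he]
  exact hlamEdge e

theorem delta_sq_ge_lamEdge [Nonempty E] (hlamEdge : ∀ e, 0 < S.lamEdge e) (hε : 0 < ε) (e : E) :
    ε ^ 2 / S.lamEdge e ≤ S.delta Q ε ^ 2 := by
  have h1 : ε ^ 2 / S.lamE ≤ S.delta Q ε ^ 2 :=
    le_delta_sq (le_max_of_le_right (le_max_left _ _)) hε
  refine le_trans ?_ h1
  exact div_le_div_of_nonneg_left (sq_nonneg ε) (lamE_pos hlamEdge)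
    (ciInf_le (Set.finite_range _).bddBelow e)

theorem delta_sq_ge_vertex (hε : 0 < ε) :
    4 * ε ^ 2 * (1 / S.lamV + S.cVol * (1 + 2 / (S.ell0 * S.lamV))) ≤ S.delta Q ε ^ 2 :=
  le_delta_sq (le_max_of_le_right (le_max_of_le_right (le_max_left _ _))) hε

theorem delta_sq_ge_collar (hε : 0 < ε) :
    2 * ε / S.ell0 * (1 + 2 / (S.ell0 * S.lamV)) ≤ S.delta Q ε ^ 2 :=
  le_delta_sq (le_max_of_le_right (le_max_of_le_right (le_max_of_le_right (le_max_left _ _)))) hε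

theorem delta_sq_ge_potential (hε : 0 < ε) :
    4 * ε * S.cVol * S.supNorm Q ^ 2 / (S.ell0 * S.lamV) ≤ S.delta Q ε ^ 2 :=
  le_delta_sq (le_max_of_le_right (le_max_of_le_right (le_max_of_le_right (le_max_right _ _)))) hε

theorem cTilde_nonneg (η : ℝ) : 0 ≤ S.cTilde Q η := by
  have h1 := cVol_nonneg (S := S)
  have h2 := supNorm_nonneg (Q := Q)
  have h3 := S.ellMinus_pos
  have h4 : 0 ≤ max (4 * S.cVol * S.supNorm Q / η) (1 / S.ellMinus) :=
    le_max_of_le_right (by positivity)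
  rw [cTilde]
  positivity

/-- A length that is adapted to the strength of the potential. -/
theorem exists_trace_length : ∃ b, 0 < b ∧ b ≤ S.ellMinus ∧ S.supNorm Q * S.cVol * b ≤ 1 / 4 ∧
    S.supNorm Q * S.cVol * (2 / b) ≤ S.cTilde Q (1 / 2) / 4 := by
  have h1 := cVol_nonneg (S := S)
  have h2 := supNorm_nonneg (Q := Q)
  have h3 := S.ellMinus_pos
  have hC : S.cTilde Q (1 / 2) = 8 * (S.supNorm Q * S.cVol) *
      max (8 * (S.supNorm Q * S.cVol)) (1 / S.ellMinus) := by
    rw [cTilde]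
    congr 1
    · ring
    · congr 1
      ring
  rw [hC]
  generalize hK : S.supNorm Q * S.cVol = K
  have hK0 : 0 ≤ K := hK ▸ mul_nonneg h2 h1
  -- For `K = 0` the quotient `1 / (4 * K)` would be `0` instead of infinite, so this case is
  -- treated apart.
  rcases hK0.eq_or_lt with h0 | h0
  · exact ⟨S.ellMinus, h3, le_rfl, by simp [← h0], by simp [← h0]⟩
  · refine ⟨min S.ellMinus (1 / (4 * K)), lt_min h3 (by positivity), min_le_left _ _, ?_, ?_⟩
    · calc K * min S.ellMinus (1 / (4 * K)) ≤ K * (1 / (4 * K)) :=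
          mul_le_mul_of_nonneg_left (min_le_right _ _) hK0
        _ = 1 / 4 := by field_simp
    · rcases min_choice S.ellMinus (1 / (4 * K)) with h | h <;> rw [h]
      · have := le_max_right (8 * K) (1 / S.ellMinus)
        calc K * (2 / S.ellMinus) = 2 * K * (1 / S.ellMinus) := by ring
          _ ≤ 2 * K * max (8 * K) (1 / S.ellMinus) := by gcongr
          _ = _ := by ring
      · have := le_max_left (8 * K) (1 / S.ellMinus)
        calc K * (2 / (1 / (4 * K))) = 2 * K * (4 * K) := by field_simp
          _ ≤ 2 * K * max (8 * K) (1 / S.ellMinus) := by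
            gcongr
            linarith
          _ = _ := by ring

/-- Multiplying out in `ENNReal` avoids a separate case for `Q = 0`, where the threshold is
infinite. -/
theorem eps_mul_le (hε : 0 < ε)
    (h : ENNReal.ofReal ε ≤ S.epsEta Q (1 / 2)) :
    ε * (4 * S.supNorm Q *
      (1 / S.lamV + S.cVol * (S.ellMinus + 2 / (S.ellMinus * S.lamV)))) ≤ 1 / 2 := by
  have h1 := ENNReal.mul_le_of_le_div h
  rw [← ENNReal.ofReal_mul hε.le] at h1
  exact (ENNReal.ofReal_le_ofReal_iff (by norm_num)).1 h1

/-! ### Lower bounds of the forms -/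

section Graph

variable [Nonempty E] (hvol : ∀ e, 0 < (S.Y e).totalVol)

theorem H1G.trace (x : S.H1G) {b : ℝ} (hb : 0 < b) (hbℓ : b ≤ S.ellMinus) :
    S.X.totalVol * ‖vertexG hvol x‖ ^ 2 ≤
      S.cVol * (b * ‖derG S x‖ ^ 2 + 2 / b * ‖embG S x‖ ^ 2) := by
  rw [totalVol_eq_cVol hvol, mul_assoc]
  exact mul_le_mul_of_nonneg_left ((isH1G_vertexG hvol x).trace hb hbℓ) cVol_nonneg

/-- The trace estimate over a length `b` adapted to `Q` gives `|q| ‖f(v)‖² ≤ ¼‖f'‖² + ¼ C̃ ‖f‖²`,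
more than enough since half of each is allowed. -/
theorem formG_lower [CompleteSpace S.H1G] (hQ : MemLp Q ⊤ S.X.vol) (x : S.H1G) :
    1 / 2 * ‖x‖ ^ 2 - (S.cTilde Q (1 / 2) + 1) / 2 * ‖embG S x‖ ^ 2 ≤
      (inner ℂ x (formG hvol Q x)).re := by
  obtain ⟨b, hb, hbℓ, h1, h2⟩ := exists_trace_length (S := S) (Q := Q)
  have h3 := mul_le_mul_of_nonneg_left (H1G.trace hvol x hb hbℓ) (supNorm_nonneg (Q := Q))
  have h4 := mul_le_mul_of_nonneg_right (abs_q_le hQ) (sq_nonneg ‖vertexG hvol x‖)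
  have h5 : (inner ℂ x (formG hvol Q x)).re = ‖derG S x‖ ^ 2 + S.q Q * ‖vertexG hvol x‖ ^ 2 := by
    rw [inner_formG, conj_mul_self_eq, ← Complex.ofReal_mul, Complex.add_re, Complex.ofReal_re]
    congr 1
    exact inner_self_eq_norm_sq (𝕜 := ℂ) _
  have h6 : -|S.q Q| * ‖vertexG hvol x‖ ^ 2 ≤ S.q Q * ‖vertexG hvol x‖ ^ 2 :=
    mul_le_mul_of_nonneg_right (neg_abs_le _) (sq_nonneg _)
  have h7 := mul_le_mul_of_nonneg_right h1 (sq_nonneg ‖derG S x‖)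
  have h8 := mul_le_mul_of_nonneg_right h2 (sq_nonneg ‖embG S x‖)
  have h9 := mul_nonneg (cTilde_nonneg (S := S) (Q := Q) (1 / 2)) (sq_nonneg ‖embG S x‖)
  rw [h5, H1G.norm_sq_eq]
  nlinarith [sq_nonneg ‖derG S x‖]

end Graph

section Manifold

variable [hε : Fact (0 < ε)]

theorem H1Pre.norm_sq_expand (u : S.H1Pre ε) : ‖u‖ ^ 2 =
    ε ^ n * (∑ e, (∫ z, ‖ds u.fn e z‖ ^ 2 ∂S.edgeVol e) +
      (ε ^ 2)⁻¹ * ∑ e, (transForm u.fn u.fn e).re +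
      ∑ e, (∫ z, ‖u.fn.2 e z‖ ^ 2 ∂S.edgeVol e)) +
    ε ^ (n + 1) * ((ε ^ 2)⁻¹ * (S.X.dirichlet u.fn.1 u.fn.1).re +
      ∫ x, ‖u.fn.1 x‖ ^ 2 ∂S.X.vol) := by
  rw [H1Pre.norm_sq_eq, dForm_self_re hε.out u.mem, norm_sq_toL2]
  simp only [mul_add, Finset.sum_add_distrib, Finset.mul_sum]
  ring

theorem sum_ds_nonneg (u : S.Fn) : 0 ≤ ∑ e, ∫ z, ‖ds u e z‖ ^ 2 ∂S.edgeVol e :=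
  Finset.sum_nonneg fun _ _ => integral_nonneg fun _ => sq_nonneg _

theorem sum_edge_nonneg (u : S.Fn) : 0 ≤ ∑ e, ∫ z, ‖u.2 e z‖ ^ 2 ∂S.edgeVol e :=
  Finset.sum_nonneg fun _ _ => integral_nonneg fun _ => sq_nonneg _

theorem sum_trans_nonneg (u : S.H1Pre ε) : 0 ≤ ∑ e, (transForm u.fn u.fn e).re :=
  Finset.sum_nonneg fun e _ => transForm_self_re_nonneg hε.out u.mem e

theorem norm_integral_potential_le (hQ : MemLp Q ⊤ S.X.vol) {f : S.X → ℂ} (hf : Continuous f) :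
    ‖∫ x, conj (f x) * (((ε⁻¹ * Q x : ℝ) : ℂ) * f x) ∂S.X.vol‖ ≤
      ε⁻¹ * S.supNorm Q * ∫ x, ‖f x‖ ^ 2 ∂S.X.vol := by
  have h0 := hε.out
  have hm := RiemMfd.memLp_of_continuous (M := S.X) hf 2
  rw [← integral_const_mul]
  refine norm_integral_le_of_norm_le
    (((memLp_two_iff_integrable_sq_norm hm.1).1 hm).const_mul _) ?_
  filter_upwards [ae_abs_le_supNorm hQ] with x hx
  rw [norm_mul, norm_mul, RCLike.norm_conj, Complex.norm_real, Real.norm_eq_abs, abs_mul,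
    abs_of_pos (inv_pos.2 h0)]
  have h1 : |Q x| * ‖f x‖ ^ 2 ≤ S.supNorm Q * ‖f x‖ ^ 2 :=
    mul_le_mul_of_nonneg_right hx (sq_nonneg _)
  calc _ = ε⁻¹ * (|Q x| * ‖f x‖ ^ 2) := by ring
    _ ≤ ε⁻¹ * (S.supNorm Q * ‖f x‖ ^ 2) :=
      mul_le_mul_of_nonneg_left h1 (inv_nonneg.2 h0.le)
    _ = _ := by ring

/-- After scaling, the potential contributes at most `ε^n ‖Q‖` times the integral of `‖u‖²` over
`X`. By the vertex estimate, with collar length `ℓ₋` and edge length `b`, this is at most half of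
the energy plus `½ C̃` times the squared norm on the edges. -/
theorem hForm_lower [Nonempty E] (hvol : ∀ e, 0 < (S.Y e).totalVol) (hlamV : 0 < S.lamV)
    (hQ : MemLp Q ⊤ S.X.vol) (h : ENNReal.ofReal ε ≤ S.epsEta Q (1 / 2)) (u : S.H1Pre ε) :
    1 / 2 * ‖u‖ ^ 2 - (S.cTilde Q (1 / 2) + 1) / 2 * ‖toL2 S ε u‖ ^ 2 ≤
      (S.hForm Q ε u.fn u.fn).re := by
  have h0 := hε.out
  obtain ⟨b, hb, hbℓ, h1, h2⟩ := exists_trace_length (S := S) (Q := Q)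
  have h3 := mul_le_mul_of_nonneg_left (integral_sq_norm_vertex_le hlamV hvol h0 u.mem
    S.ellMinus_pos le_rfl hb hbℓ) (supNorm_nonneg (Q := Q))
  have h4 := norm_integral_potential_le (ε := ε) hQ u.mem.1.continuous
  have h5 := eps_mul_le h0 h
  have hD := RiemMfd.dirichlet_self_re_nonneg u.mem.1
  have hσ := sum_ds_nonneg u.fn
  have hτ := sum_trans_nonneg u
  have hN := sum_edge_nonneg u.fn
  have hNv : 0 ≤ ∫ x, ‖u.fn.1 x‖ ^ 2 ∂S.X.vol := integral_nonneg fun x => sq_nonneg _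
  have hre : (S.hForm Q ε u.fn u.fn).re ≥ (S.dForm ε u.fn u.fn).re -
      ε ^ (n + 1) * (ε⁻¹ * S.supNorm Q * ∫ x, ‖u.fn.1 x‖ ^ 2 ∂S.X.vol) := by
    rw [hForm, Complex.add_re, ← Complex.ofReal_pow, Complex.re_ofReal_mul]
    have h6 := (abs_le.1 ((Complex.abs_re_le_norm _).trans h4)).1
    have h7 : 0 < ε ^ (n + 1) := by positivity
    nlinarith
  have hd : (S.dForm ε u.fn u.fn).re = ‖u‖ ^ 2 - ‖toL2 S ε u‖ ^ 2 := by
    rw [H1Pre.norm_sq_eq]; ring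
  have hL : ε ^ n * ∑ e, (∫ z, ‖u.fn.2 e z‖ ^ 2 ∂S.edgeVol e) ≤ ‖toL2 S ε u‖ ^ 2 := by
    rw [norm_sq_toL2, Finset.mul_sum]
    exact le_add_of_nonneg_right (by positivity)
  have hd' : ε ^ n * ∑ e, (∫ z, ‖ds u.fn e z‖ ^ 2 ∂S.edgeVol e) +
      ε ^ n * ε⁻¹ * (S.X.dirichlet u.fn.1 u.fn.1).re ≤ (S.dForm ε u.fn u.fn).re := by
    rw [dForm_self_re h0 u.mem]
    simp only [mul_add, Finset.sum_add_distrib, Finset.mul_sum]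
    have h8 : 0 ≤ ∑ e, ε ^ n * ((ε ^ 2)⁻¹ * (transForm u.fn u.fn e).re) :=
      Finset.sum_nonneg fun e _ => by
        have := transForm_self_re_nonneg h0 u.mem e
        positivity
    have h9 : ε ^ (n + 1) * ((ε ^ 2)⁻¹ * (S.X.dirichlet u.fn.1 u.fn.1).re) =
        ε ^ n * ε⁻¹ * (S.X.dirichlet u.fn.1 u.fn.1).re := by
      rw [pow_succ]
      field_simp
    linarith
  have hC := cTilde_nonneg (S := S) (Q := Q) (1 / 2)
  have hCL := mul_le_mul_of_nonneg_left hL hC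
  set D := (S.X.dirichlet u.fn.1 u.fn.1).re
  set σ := ∑ e, ∫ z, ‖ds u.fn e z‖ ^ 2 ∂S.edgeVol e
  set N := ∑ e, ∫ z, ‖u.fn.2 e z‖ ^ 2 ∂S.edgeVol e
  set Nv := ∫ x, ‖u.fn.1 x‖ ^ 2 ∂S.X.vol
  have hc := cVol_nonneg (S := S)
  have hs := supNorm_nonneg (Q := Q)
  -- Here the threshold for `ε` enters: the vertex energy in the form carries `ε⁻¹` relative to the
  -- edges, and half of it absorbs the Dirichlet term of the vertex estimate.
  have hDb : S.supNorm Q * ((1 / S.lamV + 2 * S.cVol *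
      (S.ellMinus + 2 / (S.ellMinus * S.lamV))) * D) ≤ 1 / 2 * (ε⁻¹ * D) := by
    have hℓ := S.ellMinus_pos
    have h10 : S.supNorm Q * (1 / S.lamV + 2 * S.cVol *
      (S.ellMinus + 2 / (S.ellMinus * S.lamV))) ≤ 1 / 2 * ε⁻¹ := by
      rw [mul_comm (1 / 2), inv_mul_eq_div, le_div_iff₀ h0]
      have h11 : 0 ≤ S.supNorm Q * ε * (1 / S.lamV) := by positivity
      have h12 : 0 ≤ S.supNorm Q * ε *
        (S.cVol * (S.ellMinus + 2 / (S.ellMinus * S.lamV))) := by positivity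
      nlinarith
    calc _ = S.supNorm Q * (1 / S.lamV + 2 * S.cVol *
          (S.ellMinus + 2 / (S.ellMinus * S.lamV))) * D := by ring
      _ ≤ 1 / 2 * ε⁻¹ * D := mul_le_mul_of_nonneg_right h10 hD
      _ = _ := by ring
  have hσb := mul_le_mul_of_nonneg_right h1 hσ
  have hNb := mul_le_mul_of_nonneg_right h2 hN
  have hall : S.supNorm Q * Nv ≤ 1 / 2 * (ε⁻¹ * D) + 1 / 2 * σ + S.cTilde Q (1 / 2) / 2 * N := by
    refine h3.trans ?_
    have : S.supNorm Q * ((1 / S.lamV + 2 * S.cVol * (S.ellMinus + 2 / (S.ellMinus * S.lamV))) * D +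
        2 * S.cVol * (b * σ + 2 / b * N)) = S.supNorm Q * ((1 / S.lamV + 2 * S.cVol *
      (S.ellMinus + 2 / (S.ellMinus * S.lamV))) * D) + 2 * (S.supNorm Q * S.cVol * b * σ) +
        2 * (S.supNorm Q * S.cVol * (2 / b) * N) := by ring
    rw [this]
    linarith
  have hpow : 0 < ε ^ n := by positivity
  have hall' := mul_le_mul_of_nonneg_left hall hpow.le
  have hε' : ε ^ (n + 1) * (ε⁻¹ * S.supNorm Q * Nv) = ε ^ n * (S.supNorm Q * Nv) := by
    rw [pow_succ]
    field_simp
  rw [hε'] at hre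
  rw [hd] at hre hd'
  linarith

theorem formX_lower [Nonempty E] (hvol : ∀ e, 0 < (S.Y e).totalVol) (hlamV : 0 < S.lamV)
    (hQ : MemLp Q ⊤ S.X.vol) (h : ENNReal.ofReal ε ≤ S.epsEta Q (1 / 2)) (x : S.H1X ε) :
    1 / 2 * ‖x‖ ^ 2 - (S.cTilde Q (1 / 2) + 1) / 2 * ‖embX S ε x‖ ^ 2 ≤
      (inner ℂ x (formX hQ ε x)).re := by
  induction x using UniformSpace.Completion.induction_on with
  | hp =>
    refine isClosed_le ?_ (Complex.continuous_re.comp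
      (continuous_id.inner (formX hQ ε).continuous))
    have := (embX S ε).continuous
    fun_prop
  | ih u =>
    rw [embX_coe, inner_formX_coe, UniformSpace.Completion.norm_coe]
    exact hForm_lower hvol hlamV hQ h u

/-- Functions of finite energy are nearly constant on the cross-sections. -/
theorem norm_sub_identJ_toL2_le [Nonempty E] (hvol : ∀ e, 0 < (S.Y e).totalVol)
    (hlamV : 0 < S.lamV) (hlamEdge : ∀ e, 0 < S.lamEdge e) (u : S.H1Pre ε) :
    ‖toL2 S ε u - identJ hε.out hvol (ContinuousLinearMap.adjoint (identJ hε.out hvol)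
      (toL2 S ε u))‖ ≤ S.delta Q ε * ‖u‖ := by
  have h0 := hε.out
  refine (sq_le_sq₀ (norm_nonneg _) (mul_nonneg delta_nonneg (norm_nonneg _))).1 ?_
  rw [norm_sq_sub_identJ, norm_sq_adjoint_identJ_toL2, norm_sq_toL2, mul_pow]
  have hℓ := ell0_pos (S := S)
  have hℓ1 := ell0_le_one (S := S)
  have hc := cVol_nonneg (S := S)
  have hD := RiemMfd.dirichlet_self_re_nonneg u.mem.1
  have hσ := sum_ds_nonneg u.fn
  have hτ := sum_trans_nonneg u
  have hN := sum_edge_nonneg u.fn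
  have hNv : 0 ≤ ∫ x, ‖u.fn.1 x‖ ^ 2 ∂S.X.vol := integral_nonneg fun x => sq_nonneg _
  have hV := integral_sq_norm_vertex_le hlamV hvol h0 u.mem hℓ ell0_le hℓ ell0_le
  have d1 := delta_sq_ge_cVol (S := S) (Q := Q) h0
  have d3 := delta_sq_ge_vertex (S := S) (Q := Q) h0
  have hpow : 0 < ε ^ n := by positivity
  -- Subtracting the averages on the edges leaves the deviation from the means over the
  -- cross-sections. The factor `ε²` reflects that the transversal energy enters the `H¹` norm with
  -- `ε⁻²`.
  have hE : ∑ e, ε ^ n * (∫ z, ‖u.fn.2 e z‖ ^ 2 ∂S.edgeVol e) -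
      ∑ e, ε ^ n * ((S.Y e).totalVol * ∫ s in S.edge e, ‖avg u.fn e s‖ ^ 2) ≤
      S.delta Q ε ^ 2 * (ε ^ n * ((ε ^ 2)⁻¹ * ∑ e, (transForm u.fn u.fn e).re)) := by
    rw [← Finset.sum_sub_distrib, Finset.mul_sum, Finset.mul_sum, Finset.mul_sum]
    refine Finset.sum_le_sum fun e _ => ?_
    have h1 := integral_sq_norm_edge_le h0 u.mem e (hlamEdge e)
    have d2 := delta_sq_ge_lamEdge (Q := Q) hlamEdge h0 e
    have hT := transForm_self_re_nonneg h0 u.mem e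
    rw [← mul_sub]
    calc _ ≤ ε ^ n * ((transForm u.fn u.fn e).re / S.lamEdge e) :=
          mul_le_mul_of_nonneg_left (by linarith) hpow.le
      _ = ε ^ 2 / S.lamEdge e * (ε ^ n * ((ε ^ 2)⁻¹ * (transForm u.fn u.fn e).re)) := by
          field_simp
      _ ≤ _ := mul_le_mul_of_nonneg_right d2 (by positivity)
  rw [H1Pre.norm_sq_expand]
  set D := (S.X.dirichlet u.fn.1 u.fn.1).re
  set σ := ∑ e, ∫ z, ‖ds u.fn e z‖ ^ 2 ∂S.edgeVol e
  set N := ∑ e, ∫ z, ‖u.fn.2 e z‖ ^ 2 ∂S.edgeVol e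
  set Nv := ∫ x, ‖u.fn.1 x‖ ^ 2 ∂S.X.vol
  set T := ∑ e, (transForm u.fn u.fn e).re
  set δ := S.delta Q ε
  -- The coefficients of the vertex estimate, with both lengths equal to `ℓ₀`, are compared with
  -- `δ²`: the vertex energy with its third entry, the longitudinal energy and the edge norm with
  -- the first.
  have hVD : ε ^ 2 * (1 / S.lamV + 2 * S.cVol * (S.ell0 + 2 / (S.ell0 * S.lamV))) ≤ δ ^ 2 := by
    refine le_trans ?_ d3
    have h1 : 0 ≤ 1 / S.lamV := by positivity
    have h2 : 0 ≤ S.cVol * (2 / (S.ell0 * S.lamV)) := by positivity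
    have h3 : S.cVol * S.ell0 ≤ S.cVol := mul_le_of_le_one_right hc hℓ1
    have h4 : 0 < ε ^ 2 := by positivity
    have h5 : 1 / S.lamV + 2 * S.cVol * (S.ell0 + 2 / (S.ell0 * S.lamV)) ≤
        4 * (1 / S.lamV + S.cVol * (1 + 2 / (S.ell0 * S.lamV))) := by nlinarith
    nlinarith
  have hVσ : ε * (2 * S.cVol * S.ell0) ≤ δ ^ 2 := by
    refine le_trans ?_ d1
    rw [le_div_iff₀ hℓ]
    have : S.ell0 * S.ell0 ≤ 1 := by nlinarith
    have h2 : 0 ≤ ε * S.cVol := by positivity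
    nlinarith
  have hVN : ε * (2 * S.cVol * (2 / S.ell0)) ≤ δ ^ 2 := by
    have h1 : 0 ≤ ε * S.cVol / S.ell0 := by positivity
    have h2 : 8 * ε * S.cVol / S.ell0 = 8 * (ε * S.cVol / S.ell0) := by ring
    have h3 : ε * (2 * S.cVol * (2 / S.ell0)) = 4 * (ε * S.cVol / S.ell0) := by ring
    linarith
  have hδ : 0 ≤ δ ^ 2 := sq_nonneg _
  have key : ε ^ (n + 1) * Nv ≤ δ ^ 2 * (ε ^ n * (σ + N)) +
      δ ^ 2 * (ε ^ (n + 1) * ((ε ^ 2)⁻¹ * D)) := by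
    have k1 := mul_le_mul_of_nonneg_right hVD (show 0 ≤ ε ^ (n + 1) * ((ε ^ 2)⁻¹ * D) by positivity)
    have k2 := mul_le_mul_of_nonneg_right hVσ (show 0 ≤ ε ^ n * σ by positivity)
    have k3 := mul_le_mul_of_nonneg_right hVN (show 0 ≤ ε ^ n * N by positivity)
    calc ε ^ (n + 1) * Nv ≤ ε ^ (n + 1) * ((1 / S.lamV + 2 * S.cVol *
          (S.ell0 + 2 / (S.ell0 * S.lamV))) * D +
          2 * S.cVol * (S.ell0 * σ + 2 / S.ell0 * N)) :=
          mul_le_mul_of_nonneg_left hV (by positivity)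
      _ = ε ^ 2 * (1 / S.lamV + 2 * S.cVol * (S.ell0 + 2 / (S.ell0 * S.lamV))) *
            (ε ^ (n + 1) * ((ε ^ 2)⁻¹ * D)) + ε * (2 * S.cVol * S.ell0) * (ε ^ n * σ) +
            ε * (2 * S.cVol * (2 / S.ell0)) * (ε ^ n * N) := by
          have : ε ^ 2 * (1 / S.lamV + 2 * S.cVol * (S.ell0 + 2 / (S.ell0 * S.lamV))) *
            (ε ^ (n + 1) * ((ε ^ 2)⁻¹ * D)) = (ε ^ 2 * (ε ^ 2)⁻¹) * (ε ^ (n + 1) *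
              ((1 / S.lamV + 2 * S.cVol * (S.ell0 + 2 / (S.ell0 * S.lamV))) * D)) := by ring
          rw [this, mul_inv_cancel₀ (by positivity)]
          ring
      _ ≤ _ := by linarith
  have hNv' : 0 ≤ δ ^ 2 * (ε ^ (n + 1) * Nv) := by positivity
  nlinarith [hE, key, hNv']

theorem norm_sub_identJ_embX_le [Nonempty E] (hvol : ∀ e, 0 < (S.Y e).totalVol)
    (hlamV : 0 < S.lamV) (hlamEdge : ∀ e, 0 < S.lamEdge e) (x : S.H1X ε) :
    ‖embX S ε x - identJ hε.out hvol (ContinuousLinearMap.adjoint (identJ hε.out hvol)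
      (embX S ε x))‖ ≤ S.delta Q ε * ‖x‖ := by
  induction x using UniformSpace.Completion.induction_on with
  | hp =>
    have := (embX S ε).continuous
    exact isClosed_le (by fun_prop) (by fun_prop)
  | ih u =>
    rw [embX_coe, UniformSpace.Completion.norm_coe]
    exact norm_sub_identJ_toL2_le hvol hlamV hlamEdge u

end Manifold

end FatStar

namespace FatStar

variable {n : ℕ} {E : Type w} {S : FatStar.{u, w} n E} {ε : ℝ} {Q : S.X → ℝ}

/-! ### From the manifold to the graph -/

theorem isH1G_toLp [Fintype E] {f g : ∀ _ : E, ℝ → ℂ}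
    (hf : ∀ e, MemLp (f e) 2 (volume.restrict (S.edge e)))
    (hg : ∀ e, MemLp (g e) 2 (volume.restrict (S.edge e))) {c : ℂ}
    (h : ∀ e, ∀ s ∈ S.edge e, f e s = c * S.p e + ∫ t in (0 : ℝ)..s, g e t) :
    S.IsH1G (WithLp.toLp 2 fun e => (hf e).toLp _) (WithLp.toLp 2 fun e => (hg e).toLp _) c := by
  intro e
  filter_upwards [(hf e).coeFn_toLp, ae_restrict_edge_mem e] with s h1 h2
  refine (h1.trans (h e s h2)).trans ?_
  congr 1
  rw [intervalIntegral.integral_of_le h2.1.le, intervalIntegral.integral_of_le h2.1.le]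
  refine integral_congr_ae ?_
  exact ae_restrict_of_ae_restrict_of_subset (Ioc_subset_edge h2) (hg e).coeFn_toLp.symm

theorem integrableOn_Ioc_of_memLp {e : E} {g : ℝ → ℂ}
    (hg : MemLp g 2 (volume.restrict (S.edge e))) {s : ℝ} (hs : s ∈ S.edge e) :
    IntegrableOn g (Ioc 0 s) := by
  have h : MemLp g 2 (volume.restrict (Ioc 0 s)) :=
    hg.mono_measure (Measure.restrict_mono (Ioc_subset_edge hs) le_rfl)
  exact h.integrable (by norm_num)

variable (S) in
/-- The cut-off function that decreases linearly from `1` to `0` on `(0, ℓ₀]`. -/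
def cutoff (s : ℝ) : ℂ := (Ioc 0 S.ell0).indicator (fun s => ((1 - s / S.ell0 : ℝ) : ℂ)) s

variable (S) in
/-- The derivative of the cut-off function. -/
def cutoffDeriv (s : ℝ) : ℂ := (Ioc 0 S.ell0).indicator (fun _ => ((-S.ell0⁻¹ : ℝ) : ℂ)) s

/-- The half-open indicator makes the cut-off vanish at `0`, while its limit from the right is `1`.
Only positive parameters matter on an edge. -/
theorem cutoff_eq {s : ℝ} (hs : 0 < s) :
    S.cutoff s = 1 + ∫ t in (0 : ℝ)..s, S.cutoffDeriv t := by
  have hℓ := ell0_pos (S := S)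
  rw [intervalIntegral.integral_of_le hs.le]
  simp only [cutoffDeriv]
  rw [setIntegral_indicator measurableSet_Ioc, Ioc_inter_Ioc, setIntegral_const, sup_idem,
    Real.volume_real_Ioc_of_le (le_min hs.le hℓ.le), sub_zero, cutoff]
  rcases le_or_gt s S.ell0 with h | h
  · rw [indicator_of_mem (show s ∈ Ioc 0 S.ell0 from ⟨hs, h⟩), min_eq_left h, Complex.real_smul]
    push_cast
    ring
  · rw [indicator_of_notMem fun h' => h.not_ge h'.2, min_eq_right h.le, Complex.real_smul,
      ← Complex.ofReal_mul, mul_neg, mul_inv_cancel₀ hℓ.ne']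
    simp

theorem norm_cutoff_le (s : ℝ) :
    ‖S.cutoff s‖ ≤ ‖(Ioc 0 S.ell0).indicator (fun _ => (1 : ℂ)) s‖ := by
  have hℓ := ell0_pos (S := S)
  rw [cutoff]
  by_cases h : s ∈ Ioc 0 S.ell0
  · rw [indicator_of_mem h, indicator_of_mem h, Complex.norm_real, norm_one, Real.norm_eq_abs,
      abs_le]
    have h1 : s / S.ell0 ≤ 1 := (div_le_one hℓ).2 h.2
    have h2 : 0 ≤ s / S.ell0 := div_nonneg h.1.le hℓ.le
    constructor <;> linarith
  · rw [indicator_of_notMem h, indicator_of_notMem h]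

theorem memLp_indicator_Ioc (A : Set ℝ) (b : ℝ) (a : ℂ) :
    MemLp ((Ioc 0 b).indicator fun _ => a) 2 (volume.restrict A) :=
  memLp_indicator_const 2 measurableSet_Ioc a (Or.inr (volume_restrict_Ioc_ne_top A b))

theorem memLp_cutoff (A : Set ℝ) : MemLp S.cutoff 2 (volume.restrict A) := by
  refine (memLp_indicator_Ioc A S.ell0 1).mono ?_ (Eventually.of_forall norm_cutoff_le)
  refine (Measurable.indicator ?_ measurableSet_Ioc).aestronglyMeasurable
  fun_prop

theorem memLp_cutoffDeriv (A : Set ℝ) : MemLp S.cutoffDeriv 2 (volume.restrict A) :=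
  memLp_indicator_Ioc A _ _

theorem integral_sq_norm_indicator_le (A : Set ℝ) {b : ℝ} (hb : 0 ≤ b) (a : ℂ) :
    ∫ s in A, ‖(Ioc 0 b).indicator (fun _ => a) s‖ ^ 2 ≤ ‖a‖ ^ 2 * b := by
  have h1 (s : ℝ) : ‖(Ioc 0 b).indicator (fun _ => a) s‖ ^ 2 =
      (Ioc 0 b).indicator (fun _ => ‖a‖ ^ 2) s := by
    by_cases h : s ∈ Ioc 0 b <;> simp [h]
  simp only [h1]
  rw [integral_indicator_const _ measurableSet_Ioc, smul_eq_mul, mul_comm]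
  refine mul_le_mul_of_nonneg_left ?_ (sq_nonneg _)
  calc (volume.restrict A).real (Ioc 0 b) ≤ volume.real (Ioc 0 b) :=
        ENNReal.toReal_mono measure_Ioc_lt_top.ne (Measure.restrict_apply_le _ _)
    _ = b := by rw [Real.volume_real_Ioc_of_le hb, sub_zero]

theorem integral_sq_norm_cutoff_le (A : Set ℝ) : ∫ s in A, ‖S.cutoff s‖ ^ 2 ≤ S.ell0 := by
  have h := integral_sq_norm_indicator_le A (ell0_pos (S := S)).le 1
  rw [norm_one, one_pow, one_mul] at h
  refine le_trans ?_ h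
  have h1 := memLp_cutoff (S := S) A
  have h2 := memLp_indicator_Ioc A S.ell0 1
  exact integral_mono ((memLp_two_iff_integrable_sq_norm h1.1).1 h1)
    ((memLp_two_iff_integrable_sq_norm h2.1).1 h2) fun s =>
    pow_le_pow_left₀ (norm_nonneg _) (norm_cutoff_le s) 2

theorem integral_sq_norm_cutoffDeriv_le (A : Set ℝ) :
    ∫ s in A, ‖S.cutoffDeriv s‖ ^ 2 ≤ S.ell0⁻¹ := by
  have hℓ := ell0_pos (S := S)
  refine (integral_sq_norm_indicator_le A hℓ.le _).trans_eq ?_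
  rw [Complex.norm_real, Real.norm_eq_abs, sq_abs]
  field_simp

theorem norm_sq_toLp {α : Type*} [MeasurableSpace α] {μ : Measure α} {f : α → ℂ}
    (hf : MemLp f 2 μ) : ‖hf.toLp f‖ ^ 2 = ∫ x, ‖f x‖ ^ 2 ∂μ := by
  rw [norm_sq_Lp]
  refine integral_congr_ae ?_
  filter_upwards [hf.coeFn_toLp] with x hx
  rw [hx]

variable [Fintype E]

section Correction

variable (S ε) in
/-- The scaling factor of averages over the cross-section. -/
def scale (e : E) : ℂ := (((ε ^ (-(n : ℝ) / 2))⁻¹ * S.p e : ℝ) : ℂ)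

theorem norm_sq_scale (hε : 0 < ε) (e : E) : ‖scale S ε e‖ ^ 2 = ε ^ n * (S.Y e).totalVol := by
  rw [scale, Complex.norm_real, Real.norm_eq_abs, sq_abs, mul_pow, sq_p, inv_pow,
    eq_inv_of_mul_eq_one_left (rpow_neg_half_sq (n := n) hε)]

variable [hε : Fact (0 < ε)]

/-- The correction at the vertex, with the profile `χ`. -/
def correction (χ : ℝ → ℂ) (hχ : ∀ e, MemLp χ 2 (volume.restrict (S.edge e)))
    (u : S.H1Pre ε) : S.L2G :=
  WithLp.toLp 2 fun e => ((hχ e).const_mul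
    (scale S ε e * (S.X.mean u.fn.1 - S.edgeMean u.fn.1 e))).toLp _

/-- On the vertex part the volume scales like `ε^(n+1)` and the squared derivative like `ε⁻²`.
Compared with `ε^n`, the scale of the edges, the Dirichlet integral gains a factor `ε`, which is the
source of the order `√ε`. -/
theorem dirichlet_le_norm_sq (u : S.H1Pre ε) :
    ε ^ n * ε⁻¹ * (S.X.dirichlet u.fn.1 u.fn.1).re ≤ ‖u‖ ^ 2 := by
  have h0 := hε.out
  rw [H1Pre.norm_sq_expand]
  have hσ := sum_ds_nonneg u.fn
  have hτ := sum_trans_nonneg u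
  have hN := sum_edge_nonneg u.fn
  have hNv : 0 ≤ ∫ x, ‖u.fn.1 x‖ ^ 2 ∂S.X.vol := integral_nonneg fun x => sq_nonneg _
  have h5 : ε ^ n * ε⁻¹ = ε ^ (n + 1) * (ε ^ 2)⁻¹ := by
    rw [pow_succ]
    field_simp
  rw [h5, mul_add (ε ^ (n + 1)), ← mul_assoc (ε ^ (n + 1))]
  have h6 : 0 ≤ ε ^ n * (∑ e, (∫ z, ‖ds u.fn e z‖ ^ 2 ∂S.edgeVol e) +
    (ε ^ 2)⁻¹ * ∑ e, (transForm u.fn u.fn e).re +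
    ∑ e, (∫ z, ‖u.fn.2 e z‖ ^ 2 ∂S.edgeVol e)) := by positivity
  have h7 : 0 ≤ ε ^ (n + 1) * ∫ x, ‖u.fn.1 x‖ ^ 2 ∂S.X.vol := by positivity
  linarith

/-- The squared scaling factor is `ε^n` times the volume of `Y e`, precisely the weight with which
the jumps of the means are bounded by the Dirichlet integral. The latter gains the factor `ε`. -/
theorem norm_sq_correction_le {χ : ℝ → ℂ} (hχ : ∀ e, MemLp χ 2 (volume.restrict (S.edge e)))
    (hvol : ∀ e, 0 < (S.Y e).totalVol) (hlamV : 0 < S.lamV)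
    (u : S.H1Pre ε) {B : ℝ} (hB : ∀ e, ∫ s in S.edge e, ‖χ s‖ ^ 2 ≤ B) (hB0 : 0 ≤ B) :
    ‖correction χ hχ u‖ ^ 2 ≤ B * (1 + 2 / (S.ell0 * S.lamV)) * ε * ‖u‖ ^ 2 := by
  have h0 := hε.out
  have hℓ := ell0_pos (S := S)
  have hD := RiemMfd.dirichlet_self_re_nonneg u.mem.1
  have h1 : ‖correction χ hχ u‖ ^ 2 ≤ ε ^ n * B *
      ∑ e, (S.Y e).totalVol * ‖S.X.mean u.fn.1 - S.edgeMean u.fn.1 e‖ ^ 2 := by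
    rw [correction, PiLp.norm_sq_eq_of_L2, Finset.mul_sum]
    refine Finset.sum_le_sum fun e _ => ?_
    refine (norm_sq_toLp ((hχ e).const_mul
      (scale S ε e * (S.X.mean u.fn.1 - S.edgeMean u.fn.1 e)))).trans_le ?_
    simp only [norm_mul, mul_pow]
    rw [integral_const_mul, norm_sq_scale h0]
    have h2 : 0 ≤ ε ^ n * (S.Y e).totalVol * ‖S.X.mean u.fn.1 - S.edgeMean u.fn.1 e‖ ^ 2 := by
      have := hvol e
      positivity
    refine (mul_le_mul_of_nonneg_left (hB e) h2).trans_eq ?_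
    ring
  have h3 := S.sum_sq_edgeMean_sub_mean_le hlamV hvol u.mem.1 hℓ ell0_le
  have h4 := dirichlet_le_norm_sq u
  have h8 : S.ell0 + 2 / (S.ell0 * S.lamV) ≤ 1 + 2 / (S.ell0 * S.lamV) := by
    linarith [ell0_le_one (S := S)]
  calc _ ≤ ε ^ n * B * ((1 + 2 / (S.ell0 * S.lamV)) * (S.X.dirichlet u.fn.1 u.fn.1).re) :=
        h1.trans (mul_le_mul_of_nonneg_left (h3.trans (mul_le_mul_of_nonneg_right h8 hD))
          (by positivity))
    _ = B * (1 + 2 / (S.ell0 * S.lamV)) * ε *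
        (ε ^ n * ε⁻¹ * (S.X.dirichlet u.fn.1 u.fn.1).re) := by
        field_simp
    _ ≤ _ := mul_le_mul_of_nonneg_left h4 (by positivity)

theorem norm_correction_cutoff_le (hvol : ∀ e, 0 < (S.Y e).totalVol) (hlamV : 0 < S.lamV)
    (u : S.H1Pre ε) :
    ‖correction S.cutoff (fun e => memLp_cutoff (S.edge e)) u‖ ≤ S.delta Q ε * ‖u‖ := by
  have h0 := hε.out
  have hℓ := ell0_pos (S := S)
  have hℓ1 := ell0_le_one (S := S)
  refine (sq_le_sq₀ (norm_nonneg _) (mul_nonneg delta_nonneg (norm_nonneg _))).1 ?_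
  refine (norm_sq_correction_le _ hvol hlamV u
    (fun e => integral_sq_norm_cutoff_le (S.edge e)) hℓ.le).trans ?_
  rw [mul_pow]
  refine mul_le_mul_of_nonneg_right ?_ (sq_nonneg _)
  refine le_trans ?_ (delta_sq_ge_collar (S := S) (Q := Q) h0)
  have h1 : 0 ≤ 1 + 2 / (S.ell0 * S.lamV) := by positivity
  have h2 : S.ell0 ≤ 2 / S.ell0 := by
    rw [le_div_iff₀ hℓ]
    nlinarith
  calc _ = S.ell0 * (ε * (1 + 2 / (S.ell0 * S.lamV))) := by ring
    _ ≤ 2 / S.ell0 * (ε * (1 + 2 / (S.ell0 * S.lamV))) :=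
      mul_le_mul_of_nonneg_right h2 (by positivity)
    _ = _ := by ring

/-- The slope of the cut-off has squared norm at most `1 / ℓ₀`, and the fourth entry of `δ²`
contains the factor `2`. This factor lets two errors of this kind add up to `√2 δ`. -/
theorem two_mul_norm_sq_correction_cutoffDeriv_le (hvol : ∀ e, 0 < (S.Y e).totalVol)
    (hlamV : 0 < S.lamV) (u : S.H1Pre ε) :
    2 * ‖correction S.cutoffDeriv (fun e => memLp_cutoffDeriv (S.edge e)) u‖ ^ 2 ≤
      (S.delta Q ε * ‖u‖) ^ 2 := by
  have h0 := hε.out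
  have hℓ := ell0_pos (S := S)
  have h1 := norm_sq_correction_le (fun e => memLp_cutoffDeriv (S.edge e)) hvol hlamV u
    (fun e => integral_sq_norm_cutoffDeriv_le (S := S) (S.edge e)) (inv_nonneg.2 hℓ.le)
  have h2 := mul_le_mul_of_nonneg_right (delta_sq_ge_collar (S := S) (Q := Q) h0) (sq_nonneg ‖u‖)
  rw [mul_pow]
  refine le_trans ?_ h2
  calc _ ≤ 2 * (S.ell0⁻¹ * (1 + 2 / (S.ell0 * S.lamV)) * ε * ‖u‖ ^ 2) :=
        mul_le_mul_of_nonneg_left h1 zero_le_two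
    _ = _ := by ring

/-- The scaled averages of the longitudinal derivative. -/
def avgDeriv (u : S.H1Pre ε) : S.L2G :=
  WithLp.toLp 2 fun e => ((memLp_avgDs hε.out u.mem e).const_mul (scale S ε e)).toLp _

theorem norm_avgDeriv_le (hvol : ∀ e, 0 < (S.Y e).totalVol) (u : S.H1Pre ε) :
    ‖avgDeriv u‖ ≤ ‖u‖ := by
  have h0 := hε.out
  refine (sq_le_sq₀ (norm_nonneg _) (norm_nonneg _)).1 ?_
  have h1 : ‖avgDeriv u‖ ^ 2 ≤ ε ^ n * ∑ e, ∫ z, ‖ds u.fn e z‖ ^ 2 ∂S.edgeVol e := by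
    rw [avgDeriv, PiLp.norm_sq_eq_of_L2, Finset.mul_sum]
    refine Finset.sum_le_sum fun e _ => ?_
    refine (norm_sq_toLp ((memLp_avgDs h0 u.mem e).const_mul (scale S ε e))).trans_le ?_
    simp only [norm_mul, mul_pow]
    rw [integral_const_mul, norm_sq_scale h0, mul_assoc]
    refine mul_le_mul_of_nonneg_left ?_ (by positivity)
    have m1 := memLp_ds h0 u.mem e 2
    have i1 := (memLp_two_iff_integrable_sq_norm m1.1).1 m1
    have m2 := memLp_avgDs h0 u.mem e
    have i2 := (memLp_two_iff_integrable_sq_norm m2.1).1 m2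
    rw [← integral_const_mul]
    have e1 : ∫ z, ‖ds u.fn e z‖ ^ 2 ∂S.edgeVol e =
      ∫ s in S.edge e, ∫ y, ‖ds u.fn e (s, y)‖ ^ 2 ∂(S.Y e).vol := integral_prod _ i1
    rw [e1]
    refine integral_mono_ae (i2.const_mul _) i1.integral_prod_left ?_
    filter_upwards [Integrable.prod_right_ae i1, AEStronglyMeasurable.prodMk_left m1.1] with s h1 h2
    have h3 := sq_norm_integral_le ((memLp_two_iff_integrable_sq_norm h2).2 h1)
    have hv := hvol e
    simp only [avgDs, RiemMfd.mean]
    rw [norm_div, div_pow, Complex.norm_real, Real.norm_eq_abs, sq_abs, mul_div_assoc',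
      div_le_iff₀ (by positivity)]
    calc _ ≤ (S.Y e).totalVol * ((S.Y e).totalVol * ∫ y, ‖ds u.fn e (s, y)‖ ^ 2 ∂(S.Y e).vol) :=
          mul_le_mul_of_nonneg_left h3 hv.le
      _ = _ := by ring
  refine h1.trans ?_
  rw [H1Pre.norm_sq_expand]
  have hσ := sum_ds_nonneg u.fn
  have hτ := sum_trans_nonneg u
  have hN := sum_edge_nonneg u.fn
  have hD := RiemMfd.dirichlet_self_re_nonneg u.mem.1
  have hNv : 0 ≤ ∫ x, ‖u.fn.1 x‖ ^ 2 ∂S.X.vol := integral_nonneg fun x => sq_nonneg _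
  rw [add_assoc (∑ e, ∫ z, ‖ds u.fn e z‖ ^ 2 ∂S.edgeVol e), mul_add (ε ^ n), add_assoc]
  refine le_add_of_nonneg_right ?_
  positivity

/-- The averages, corrected at the vertex, are in `H¹_p(G)`. -/
theorem isH1G_average (hvol : ∀ e, 0 < (S.Y e).totalVol) (u : S.H1Pre ε) :
    S.IsH1G (ContinuousLinearMap.adjoint (identJ hε.out hvol) (toL2 S ε u) +
        correction S.cutoff (fun e => memLp_cutoff (S.edge e)) u)
      (avgDeriv u + correction S.cutoffDeriv (fun e => memLp_cutoffDeriv (S.edge e)) u)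
      (((ε ^ (-(n : ℝ) / 2))⁻¹ : ℝ) * S.X.mean u.fn.1) := by
  have h0 := hε.out
  rw [adjoint_identJ_toL2]
  refine isH1G_toLp (f := fun e s => scale S ε e * avg u.fn e s +
      scale S ε e * (S.X.mean u.fn.1 - S.edgeMean u.fn.1 e) * S.cutoff s)
    (g := fun e s => scale S ε e * avgDs u.fn e s +
      scale S ε e * (S.X.mean u.fn.1 - S.edgeMean u.fn.1 e) * S.cutoffDeriv s)
    (fun e => ((memLp_avg h0 u.mem e).const_mul _).add ((memLp_cutoff _).const_mul _))
    (fun e => ((memLp_avgDs h0 u.mem e).const_mul _).add ((memLp_cutoffDeriv _).const_mul _))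
    fun e s hs => ?_
  have i1 := (integrableOn_Ioc_of_memLp (memLp_avgDs h0 u.mem e) hs).const_mul (scale S ε e)
  have i2 := (integrableOn_Ioc_of_memLp (memLp_cutoffDeriv (S := S) (S.edge e)) hs).const_mul
    (scale S ε e * (S.X.mean u.fn.1 - S.edgeMean u.fn.1 e))
  rw [avg_eq h0 u.mem hs, cutoff_eq hs.1, intervalIntegral.integral_of_le hs.1.le,
    intervalIntegral.integral_of_le hs.1.le, intervalIntegral.integral_of_le hs.1.le,
    integral_add i1 i2, integral_const_mul, integral_const_mul, scale]
  push_cast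
  ring

end Correction

end FatStar

/-! ### Approximation by smooth functions on an interval -/

section Approximation

variable {A : Set ℝ} {f g : ℝ → ℂ}

theorem integral_sq_norm_add_le {α : Type*} [MeasurableSpace α] {μ : Measure α} {f g : α → ℂ}
    (hf : MemLp f 2 μ) (hg : MemLp g 2 μ) :
    ∫ x, ‖f x + g x‖ ^ 2 ∂μ ≤ 2 * (∫ x, ‖f x‖ ^ 2 ∂μ) + 2 * ∫ x, ‖g x‖ ^ 2 ∂μ := by
  have i1 := (memLp_two_iff_integrable_sq_norm hf.1).1 hf
  have i2 := (memLp_two_iff_integrable_sq_norm hg.1).1 hg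
  have i3 := (memLp_two_iff_integrable_sq_norm (hf.add hg).1).1 (hf.add hg)
  rw [← integral_const_mul, ← integral_const_mul,
    ← integral_add (i1.const_mul 2) (i2.const_mul 2)]
  refine integral_mono i3 ((i1.const_mul 2).add (i2.const_mul 2)) fun x => ?_
  have h := pow_le_pow_left₀ (norm_nonneg _) (norm_add_le (f x) (g x)) 2
  have h2 := add_sq_le (a := ‖f x‖) (b := ‖g x‖)
  linarith

/-- Dominated convergence for products with bounded functions that vanish eventually. -/
theorem tendsto_integral_sq_norm_mul {μ : Measure ℝ} (hf : MemLp f 2 μ) {φ : ℕ → ℝ → ℝ}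
    (hφ : ∀ k, Continuous (φ k)) {C : ℝ} (hC : ∀ k t, |φ k t| ≤ C)
    (h0 : ∀ᵐ t ∂μ, ∀ᶠ k in atTop, φ k t = 0) :
    Tendsto (fun k => ∫ t, ‖(φ k t : ℂ) * f t‖ ^ 2 ∂μ) atTop (𝓝 0) := by
  have hi := (memLp_two_iff_integrable_sq_norm hf.1).1 hf
  have h := tendsto_integral_of_dominated_convergence (f := fun _ => (0 : ℝ))
    (F := fun k t => ‖(φ k t : ℂ) * f t‖ ^ 2) (μ := μ) (fun t => C ^ 2 * ‖f t‖ ^ 2)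
    (fun k => (((Complex.continuous_ofReal.comp (hφ k)).aestronglyMeasurable.mul hf.1).norm.pow 2))
    (hi.const_mul _) (fun k => Eventually.of_forall fun t => ?_) ?_
  · simpa using h
  · rw [Real.norm_of_nonneg (sq_nonneg _), norm_mul, mul_pow, Complex.norm_real, Real.norm_eq_abs]
    exact mul_le_mul_of_nonneg_right (pow_le_pow_left₀ (abs_nonneg _) (hC k t) 2) (sq_nonneg _)
  · filter_upwards [h0] with t ht
    refine tendsto_const_nhds.congr' ?_
    filter_upwards [ht] with k hk
    simp [hk]

theorem memLp_restrict_of_continuous (hA : A ⊆ Ioi 0) (hAm : MeasurableSet A) (hf : Continuous f)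
    {b : ℝ} (hb : ∀ t, b < t → f t = 0) : MemLp f 2 (volume.restrict A) := by
  obtain ⟨C, hC⟩ := (isCompact_Icc (a := (0 : ℝ)) (b := b)).exists_bound_of_continuousOn
    hf.continuousOn
  have h1 : MemLp ((Ioc 0 b).indicator fun _ => (C : ℂ)) 2 (volume.restrict A) :=
    FatStar.memLp_indicator_Ioc A b C
  refine h1.mono hf.aestronglyMeasurable ?_
  filter_upwards [ae_restrict_mem hAm] with t ht
  by_cases h : t ≤ b
  · have h2 : t ∈ Ioc 0 b := ⟨hA ht, h⟩
    rw [indicator_of_mem h2, Complex.norm_real]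
    exact (hC t ⟨h2.1.le, h⟩).trans (le_abs_self C)
  · rw [hb t (not_le.1 h), norm_zero]
    exact norm_nonneg _

theorem exists_abs_deriv_smoothTransition_le : ∃ C, ∀ t, |deriv Real.smoothTransition t| ≤ C := by
  have hc : Continuous (deriv Real.smoothTransition) :=
    (Real.smoothTransition.contDiff (n := 1)).continuous_deriv le_rfl
  obtain ⟨C, hC⟩ := (isCompact_Icc (a := (0 : ℝ)) (b := 1)).exists_bound_of_continuousOn
    hc.continuousOn
  have hC0 : 0 ≤ C := (norm_nonneg _).trans (hC 0 ⟨le_rfl, zero_le_one⟩)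
  refine ⟨C, fun t => ?_⟩
  rcases lt_or_ge t 0 with h | h
  · have : Real.smoothTransition =ᶠ[𝓝 t] fun _ => 0 := by
      filter_upwards [Iio_mem_nhds h] with s hs using Real.smoothTransition.zero_of_nonpos hs.le
    rw [this.deriv_eq, deriv_const, abs_zero]
    exact hC0
  · rcases lt_or_ge 1 t with h1 | h1
    · have : Real.smoothTransition =ᶠ[𝓝 t] fun _ => 1 := by
        filter_upwards [Ioi_mem_nhds h1] with s hs using Real.smoothTransition.one_of_one_le hs.le
      rw [this.deriv_eq, deriv_const, abs_zero]
      exact hC0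
    · exact hC t ⟨h, h1⟩

/-- A smooth function that is `1` up to `k` and vanishes from `k + 1` on. -/
def cutAt (k : ℕ) (t : ℝ) : ℝ := 1 - Real.smoothTransition (t - k)

theorem contDiff_cutAt (k : ℕ) : ContDiff ℝ ∞ (cutAt k) :=
  contDiff_const.sub (Real.smoothTransition.contDiff.comp (contDiff_id.sub contDiff_const))

theorem cutAt_of_le {k : ℕ} {t : ℝ} (h : t ≤ k) : cutAt k t = 1 := by
  rw [cutAt, Real.smoothTransition.zero_of_nonpos (sub_nonpos.2 h), sub_zero]

theorem cutAt_of_ge {k : ℕ} {t : ℝ} (h : k + 1 ≤ t) : cutAt k t = 0 := by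
  rw [cutAt, Real.smoothTransition.one_of_one_le (by linarith), sub_self]

theorem abs_cutAt_le (k : ℕ) (t : ℝ) : |cutAt k t| ≤ 1 := by
  rw [cutAt, abs_le]
  constructor <;> linarith [Real.smoothTransition.nonneg (t - k), Real.smoothTransition.le_one (t - k)]

theorem abs_one_sub_cutAt_le (k : ℕ) (t : ℝ) : |1 - cutAt k t| ≤ 1 := by
  rw [cutAt, sub_sub_cancel, abs_of_nonneg (Real.smoothTransition.nonneg _)]
  exact Real.smoothTransition.le_one _

theorem deriv_cutAt (k : ℕ) (t : ℝ) :
    deriv (cutAt k) t = -deriv Real.smoothTransition (t - k) := by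
  have h : cutAt k = fun t => 1 - Real.smoothTransition (t - k) := rfl
  rw [h, deriv_const_sub, deriv_comp_sub_const]

theorem deriv_cutAt_of_lt {k : ℕ} {t : ℝ} (h : t < k) : deriv (cutAt k) t = 0 := by
  have : cutAt k =ᶠ[𝓝 t] fun _ => 1 := by
    filter_upwards [Iio_mem_nhds h] with s hs using cutAt_of_le (le_of_lt hs)
  rw [this.deriv_eq, deriv_const]

theorem eventually_lt_natCast (t : ℝ) : ∀ᶠ k : ℕ in atTop, t < k :=
  tendsto_natCast_atTop_atTop.eventually_gt_atTop t

/-- Square-integrable functions are approximated by smooth functions with compact support that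
vanish near `0`. -/
theorem exists_smooth_approx (hA : A ⊆ Ioi 0) (hAm : MeasurableSet A)
    (hg : MemLp g 2 (volume.restrict A)) {η : ℝ} (hη : 0 < η) :
    ∃ h : ℝ → ℂ, ContDiff ℝ ∞ h ∧ (∃ r > 0, ∀ t ≤ r, h t = 0) ∧
      MemLp h 2 (volume.restrict A) ∧ ∫ t in A, ‖g t - h t‖ ^ 2 ≤ η := by
  obtain ⟨h₀, hs, hd, hle⟩ := hg.exist_eLpNorm_sub_le (by norm_num) (by norm_num)
    (Real.sqrt_pos.2 (show 0 < η / 4 by positivity))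
  have hm₀ : MemLp h₀ 2 (volume.restrict A) := hd.continuous.memLp_of_hasCompactSupport hs
  have hle' : ∫ t in A, ‖g t - h₀ t‖ ^ 2 ≤ η / 4 := by
    have h1 := FatStar.norm_sq_toLp (hg.sub hm₀)
    simp only [Pi.sub_apply] at h1
    rw [← h1, Lp.norm_toLp]
    have h2 := ENNReal.toReal_mono ENNReal.ofReal_ne_top hle
    rw [ENNReal.toReal_ofReal (Real.sqrt_nonneg _)] at h2
    calc _ ≤ Real.sqrt (η / 4) ^ 2 := pow_le_pow_left₀ ENNReal.toReal_nonneg h2 2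
      _ = η / 4 := Real.sq_sqrt (by positivity)
  -- The function `φ k` is `1` up to `1 / (k + 1)` and `0` from `2 / (k + 1)` on. Removing `φ k *
  -- h₀` makes `h₀` vanish near `0`, at a cost that tends to zero by dominated convergence.
  let φ (k : ℕ) (t : ℝ) : ℝ := 1 - Real.smoothTransition ((k + 1) * t - 1)
  have hφc (k : ℕ) : ContDiff ℝ ∞ (fun t : ℝ => Real.smoothTransition ((k + 1) * t - 1)) :=
    Real.smoothTransition.contDiff.comp ((contDiff_const.mul contDiff_id).sub contDiff_const)
  have hlim := tendsto_integral_sq_norm_mul hm₀ (φ := φ)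
    (fun k => continuous_const.sub (hφc k).continuous) (C := 1)
    (fun k t => by
      rw [abs_le]
      constructor <;> linarith [Real.smoothTransition.nonneg ((k + 1) * t - 1),
        Real.smoothTransition.le_one ((k + 1) * t - 1)])
    (by
      filter_upwards [ae_restrict_mem hAm] with t ht
      have ht0 : 0 < t := hA ht
      filter_upwards [eventually_lt_natCast (2 / t)] with k hk
      rw [div_lt_iff₀ ht0] at hk
      simp only [φ]
      rw [Real.smoothTransition.one_of_one_le (by linarith), sub_self])
  obtain ⟨k, hk⟩ := (hlim.eventually (gt_mem_nhds (show (0 : ℝ) < η / 4 by positivity))).exists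
  have hsm : ContDiff ℝ ∞ fun t : ℝ => ((Real.smoothTransition ((k + 1) * t - 1) : ℝ) : ℂ) * h₀ t :=
    (Complex.ofRealCLM.contDiff.comp (hφc k)).mul hd
  have hmul : MemLp (fun t => ((φ k t : ℝ) : ℂ) * h₀ t) 2 (volume.restrict A) := by
    have hcs : HasCompactSupport fun t => ((φ k t : ℝ) : ℂ) * h₀ t := hs.mul_left
    refine Continuous.memLp_of_hasCompactSupport ?_ hcs
    exact (Complex.continuous_ofReal.comp (continuous_const.sub (hφc k).continuous)).mul
      hd.continuous
  refine ⟨_, hsm, ⟨1 / (k + 1), by positivity, fun t ht => ?_⟩, ?_, ?_⟩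
  · rw [le_div_iff₀ (by positivity)] at ht
    rw [Real.smoothTransition.zero_of_nonpos (by linarith)]
    simp
  · exact hsm.continuous.memLp_of_hasCompactSupport hs.mul_left
  · have h1 := integral_sq_norm_add_le (hg.sub hm₀) hmul
    have h2 (t : ℝ) : g t - ((Real.smoothTransition ((k + 1) * t - 1) : ℝ) : ℂ) * h₀ t =
        (g - h₀) t + ((φ k t : ℝ) : ℂ) * h₀ t := by
      simp only [φ, Pi.sub_apply]
      push_cast
      ring
    simp only [h2]
    refine h1.trans ?_
    simp only [Pi.sub_apply]
    linarith

theorem contDiff_primitive {h : ℝ → ℂ} (hh : ContDiff ℝ ∞ h) :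
    ContDiff ℝ ∞ fun t => ∫ x in (0 : ℝ)..t, h x := by
  have hd (t : ℝ) : HasDerivAt (fun t => ∫ x in (0 : ℝ)..t, h x) (h t) t :=
    hh.continuous.integral_hasStrictDerivAt 0 t |>.hasDerivAt
  rw [contDiff_infty_iff_deriv]
  refine ⟨fun t => (hd t).differentiableAt, ?_⟩
  rw [show deriv (fun t => ∫ x in (0 : ℝ)..t, h x) = h from funext fun t => (hd t).deriv]
  exact hh

/-- Functions with square-integrable derivative are approximated by smooth functions that are
constant near `0` and vanish near infinity. -/
theorem exists_smooth_approx_primitive (hA : A ⊆ Ioi 0) (hAm : MeasurableSet A)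
    (hAs : ∀ s ∈ A, Ioc 0 s ⊆ A) (hf : MemLp f 2 (volume.restrict A))
    (hg : MemLp g 2 (volume.restrict A)) {a : ℂ}
    (hfg : ∀ᵐ s ∂volume.restrict A, f s = a + ∫ t in (0 : ℝ)..s, g t) {η : ℝ} (hη : 0 < η) :
    ∃ F : ℝ → ℂ, ContDiff ℝ ∞ F ∧ (∃ r > 0, ∀ t ≤ r, F t = a) ∧ (∃ b, ∀ t, b < t → F t = 0) ∧
      MemLp F 2 (volume.restrict A) ∧ MemLp (deriv F) 2 (volume.restrict A) ∧
      ∫ t in A, ‖f t - F t‖ ^ 2 ≤ η ∧ ∫ t in A, ‖g t - deriv F t‖ ^ 2 ≤ η := by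
  obtain ⟨C, hC⟩ := exists_abs_deriv_smoothTransition_le
  have hC0 : 0 ≤ C := (abs_nonneg _).trans (hC 0)
  have hθc (k : ℕ) : Continuous (cutAt k) := (contDiff_cutAt k).continuous
  have hθd (k : ℕ) : Continuous (deriv (cutAt k)) :=
    (contDiff_cutAt k).continuous_deriv (by simp)
  have hθdC (k : ℕ) (t : ℝ) : |deriv (cutAt k) t| ≤ C := by
    rw [deriv_cutAt, abs_neg]
    exact hC _
  have hvanish : ∀ t : ℝ, ∀ᶠ k : ℕ in atTop, 1 - cutAt k t = 0 := fun t => by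
    filter_upwards [eventually_lt_natCast t] with k hk
    rw [cutAt_of_le hk.le, sub_self]
  have l1 := tendsto_integral_sq_norm_mul hf (φ := fun k t => 1 - cutAt k t)
    (fun k => continuous_const.sub (hθc k)) abs_one_sub_cutAt_le (Eventually.of_forall hvanish)
  have l2 := tendsto_integral_sq_norm_mul hg (φ := fun k t => 1 - cutAt k t)
    (fun k => continuous_const.sub (hθc k)) abs_one_sub_cutAt_le (Eventually.of_forall hvanish)
  have l3 := tendsto_integral_sq_norm_mul hf (φ := fun k t => deriv (cutAt k) t) hθd hθdC
    (Eventually.of_forall fun t => by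
      filter_upwards [eventually_lt_natCast t] with k hk using deriv_cutAt_of_lt hk)
  have hη8 : 0 < η / 16 := by positivity
  -- The cut-off is fixed first, so that the three tail terms are small. Positivity of `k` ensures
  -- that it equals `1` in a neighbourhood of `0`.
  obtain ⟨k, ⟨⟨hk1, hk2⟩, hk3⟩, hk0⟩ := ((((l1.eventually (gt_mem_nhds hη8)).and
    (l2.eventually (gt_mem_nhds hη8))).and (l3.eventually (gt_mem_nhds hη8))).and
    (eventually_gt_atTop 0)).exists
  set K : ℝ := (k : ℝ) + 1 with hK
  have hK0 : 0 < K := by positivity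
  -- The accuracy for the derivative is chosen after the cut-off. On `(0, K]` the squared error of
  -- the primitive is at most `K η'`, so it integrates to at most `K² η'`, or to `C² K² η'` after
  -- multiplication by the derivative of the cut-off.
  set η' := η / (16 * (1 + K ^ 2 + C ^ 2 * K ^ 2)) with hη'
  have hden : 0 < 16 * (1 + K ^ 2 + C ^ 2 * K ^ 2) := by positivity
  have hη'0 : 0 < η' := by positivity
  have hη'1 : η' * 1 ≤ η / 16 ∧ K ^ 2 * η' ≤ η / 16 ∧ C ^ 2 * K ^ 2 * η' ≤ η / 16 := by
    have h1 : η' * (1 + K ^ 2 + C ^ 2 * K ^ 2) = η / 16 := by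
      rw [hη']
      field_simp
    have h2 : 0 ≤ K ^ 2 * η' := by positivity
    have h3 : 0 ≤ C ^ 2 * K ^ 2 * η' := by positivity
    refine ⟨?_, ?_, ?_⟩ <;> nlinarith
  obtain ⟨h, hh, ⟨r, hr, hr0⟩, hhm, hle⟩ := exists_smooth_approx hA hAm hg hη'0
  set H : ℝ → ℂ := fun t => a + ∫ x in (0 : ℝ)..t, h x with hH
  have hHd (t : ℝ) : HasDerivAt H (h t) t :=
    ((hh.continuous.integral_hasStrictDerivAt 0 t).hasDerivAt).const_add a
  have hHs : ContDiff ℝ ∞ H := contDiff_const.add (contDiff_primitive hh)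
  set F : ℝ → ℂ := fun t => ((cutAt k t : ℝ) : ℂ) * H t with hF
  have hFs : ContDiff ℝ ∞ F := (Complex.ofRealCLM.contDiff.comp (contDiff_cutAt k)).mul hHs
  have hFd (t : ℝ) : deriv F t = ((deriv (cutAt k) t : ℝ) : ℂ) * H t + ((cutAt k t : ℝ) : ℂ) * h t := by
    have h1 : HasDerivAt (cutAt k) (deriv (cutAt k) t) t :=
      ((contDiff_cutAt k).differentiable (by simp) t).hasDerivAt
    exact (h1.ofReal_comp.mul (hHd t)).deriv
  have hF0 : ∀ t, K < t → F t = 0 := fun t ht => by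
    simp only [hF]
    rw [cutAt_of_ge ht.le]
    simp
  have hFd0 : ∀ t, K < t → deriv F t = 0 := fun t ht => by
    have : F =ᶠ[𝓝 t] fun _ => 0 := by
      filter_upwards [Ioi_mem_nhds ht] with s hs using hF0 s hs
    rw [this.deriv_eq, deriv_const]
  have hFm : MemLp F 2 (volume.restrict A) :=
    memLp_restrict_of_continuous hA hAm hFs.continuous hF0
  have hFdm : MemLp (deriv F) 2 (volume.restrict A) :=
    memLp_restrict_of_continuous hA hAm (hFs.continuous_deriv (by simp)) hFd0
  -- the error of the primitive
  have hw : ∀ᵐ s ∂volume.restrict A, s ≤ K → ‖f s - H s‖ ^ 2 ≤ K * η' := by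
    filter_upwards [hfg, ae_restrict_mem hAm] with s h1 h2 h3
    have hs0 : 0 < s := hA h2
    have hgs : MemLp g 2 (volume.restrict (Ioc 0 s)) :=
      hg.mono_measure (Measure.restrict_mono (hAs s h2) le_rfl)
    have hhs : MemLp h 2 (volume.restrict (Ioc 0 s)) :=
      hhm.mono_measure (Measure.restrict_mono (hAs s h2) le_rfl)
    have h4 : f s - H s = ∫ t in Ioc 0 s, (g t - h t) := by
      rw [h1, hH, integral_sub (hgs.integrable (by norm_num)) (hhs.integrable (by norm_num)),
        intervalIntegral.integral_of_le hs0.le]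
      simp only [intervalIntegral.integral_of_le hs0.le]
      ring
    rw [h4]
    have h5 := sq_norm_integral_le (hgs.sub hhs)
    simp only [Pi.sub_apply] at h5
    rw [measureReal_restrict_apply_univ, Real.volume_real_Ioc_of_le hs0.le, sub_zero] at h5
    have hm := hg.sub hhm
    have h6 : ∫ t in Ioc 0 s, ‖g t - h t‖ ^ 2 ≤ ∫ t in A, ‖g t - h t‖ ^ 2 :=
      setIntegral_mono_set ((memLp_two_iff_integrable_sq_norm hm.1).1 hm)
        (Eventually.of_forall fun t => sq_nonneg _) (hAs s h2).eventuallyLE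
    have h7 : 0 ≤ ∫ t in Ioc 0 s, ‖g t - h t‖ ^ 2 := integral_nonneg fun _ => sq_nonneg _
    calc _ ≤ s * ∫ t in Ioc 0 s, ‖g t - h t‖ ^ 2 := h5
      _ ≤ K * η' := mul_le_mul h3 (h6.trans hle) h7 hK0.le
  have hprod {φ : ℝ → ℝ} (hφ : Continuous φ) (hφ0 : ∀ t, K < t → φ t = 0) {B : ℝ}
      (hB : ∀ t, |φ t| ≤ B) : MemLp (fun t => ((φ t : ℝ) : ℂ) * (f t - H t)) 2 (volume.restrict A) ∧
      ∫ t in A, ‖((φ t : ℝ) : ℂ) * (f t - H t)‖ ^ 2 ≤ B ^ 2 * K ^ 2 * η' := by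
    have hb : ∀ᵐ t ∂volume.restrict A, ‖((φ t : ℝ) : ℂ) * (f t - H t)‖ ^ 2 ≤
        ‖(Ioc 0 K).indicator (fun _ => ((B * Real.sqrt (K * η') : ℝ) : ℂ)) t‖ ^ 2 := by
      filter_upwards [hw, ae_restrict_mem hAm] with t h1 h2
      by_cases h3 : t ≤ K
      · rw [indicator_of_mem (show t ∈ Ioc 0 K from ⟨hA h2, h3⟩), norm_mul, mul_pow,
          Complex.norm_real, Complex.norm_real, Real.norm_eq_abs, Real.norm_eq_abs, sq_abs, sq_abs,
          mul_pow, Real.sq_sqrt (by positivity)]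
        exact mul_le_mul (sq_le_sq.2 ((hB t).trans (le_abs_self B))) (h1 h3) (sq_nonneg _)
          (sq_nonneg _)
      · rw [hφ0 t (not_le.1 h3)]
        simp
    have hi := FatStar.memLp_indicator_Ioc A K ((B * Real.sqrt (K * η') : ℝ) : ℂ)
    have hm : MemLp (fun t => ((φ t : ℝ) : ℂ) * (f t - H t)) 2 (volume.restrict A) := by
      refine hi.mono ?_ ?_
      · exact (Complex.continuous_ofReal.comp hφ).aestronglyMeasurable.mul
          (hf.1.sub hHs.continuous.aestronglyMeasurable)
      · filter_upwards [hb] with t ht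
        exact (sq_le_sq₀ (norm_nonneg _) (norm_nonneg _)).1 ht
    refine ⟨hm, ?_⟩
    refine (integral_mono_ae ((memLp_two_iff_integrable_sq_norm hm.1).1 hm)
      ((memLp_two_iff_integrable_sq_norm hi.1).1 hi) hb).trans ?_
    refine (FatStar.integral_sq_norm_indicator_le A hK0.le _).trans_eq ?_
    rw [Complex.norm_real, Real.norm_eq_abs, sq_abs, mul_pow, Real.sq_sqrt (by positivity)]
    ring
  obtain ⟨m1, b1⟩ := hprod (hθc k) (fun t ht => cutAt_of_ge ht.le) (abs_cutAt_le k)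
  obtain ⟨m2, b2⟩ := hprod (hθd k) (fun t ht => by
    have : cutAt k =ᶠ[𝓝 t] fun _ => 0 := by
      filter_upwards [Ioi_mem_nhds ht] with s hs using cutAt_of_ge (le_of_lt hs)
    rw [this.deriv_eq, deriv_const]) (hθdC k)
  have hbdd {φ : ℝ → ℝ} (hφ : Continuous φ) {B : ℝ} (hB : ∀ t, |φ t| ≤ B) {w : ℝ → ℂ}
      (hw : MemLp w 2 (volume.restrict A)) :
      MemLp (fun t => ((φ t : ℝ) : ℂ) * w t) 2 (volume.restrict A) := by
    refine (hw.const_mul (B : ℂ)).mono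
      ((Complex.continuous_ofReal.comp hφ).aestronglyMeasurable.mul hw.1)
      (Eventually.of_forall fun t => ?_)
    rw [norm_mul, norm_mul, Complex.norm_real, Complex.norm_real]
    exact mul_le_mul_of_nonneg_right ((hB t).trans (le_abs_self B)) (norm_nonneg _)
  have n1 := hbdd (φ := fun t => 1 - cutAt k t) (continuous_const.sub (hθc k))
    (abs_one_sub_cutAt_le k) hf
  have n2 := hbdd (φ := fun t => 1 - cutAt k t) (continuous_const.sub (hθc k))
    (abs_one_sub_cutAt_le k) hg
  have n3 := hbdd (φ := fun t => -deriv (cutAt k) t) (hθd k).neg (B := C)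
    (fun t => by rw [abs_neg]; exact hθdC k t) hf
  have n4 := hbdd (hθc k) (abs_cutAt_le k) (hg.sub hhm)
  have n3' : ∫ t in A, ‖((-deriv (cutAt k) t : ℝ) : ℂ) * f t‖ ^ 2 ≤ η / 16 := by
    simp only [Complex.ofReal_neg, neg_mul, norm_neg]
    exact hk3.le
  have n4' : ∫ t in A, ‖((cutAt k t : ℝ) : ℂ) * (g - h) t‖ ^ 2 ≤ η' := by
    refine le_trans (integral_mono ((memLp_two_iff_integrable_sq_norm n4.1).1 n4)
      ((memLp_two_iff_integrable_sq_norm (hg.sub hhm).1).1 (hg.sub hhm)) fun t => ?_) hle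
    simp only
    rw [norm_mul, mul_pow, Complex.norm_real, Real.norm_eq_abs]
    exact mul_le_of_le_one_left (sq_nonneg _) (pow_le_one₀ (abs_nonneg _) (abs_cutAt_le k t))
  refine ⟨F, hFs, ⟨min r k, lt_min hr (by exact_mod_cast hk0), fun t ht => ?_⟩, ⟨K, hF0⟩, hFm,
    hFdm, ?_, ?_⟩
  · have h1 : ∫ x in (0 : ℝ)..t, h x = 0 := by
      refine intervalIntegral.integral_zero_ae (Eventually.of_forall fun x hx => hr0 x ?_)
      exact hx.2.trans (max_le hr.le (ht.trans (min_le_left _ _)))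
    simp only [hF, hH]
    rw [cutAt_of_le (ht.trans (min_le_right _ _)), h1]
    simp
  · have h1 (t : ℝ) : f t - F t =
        ((1 - cutAt k t : ℝ) : ℂ) * f t + ((cutAt k t : ℝ) : ℂ) * (f t - H t) := by
      simp only [hF]
      push_cast
      ring
    simp only [h1]
    refine (integral_sq_norm_add_le n1 m1).trans ?_
    linarith [hη'1.2.1]
  -- There are four error terms of size `η / 16`. Each acquires the factor `4` from applying `‖a +
  -- b‖² ≤ 2‖a‖² + 2‖b‖²` twice, which adds up to `η`.
  · have h1 (t : ℝ) : g t - deriv F t =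
        (((1 - cutAt k t : ℝ) : ℂ) * g t + ((-deriv (cutAt k) t : ℝ) : ℂ) * f t) +
        (((deriv (cutAt k) t : ℝ) : ℂ) * (f t - H t) + ((cutAt k t : ℝ) : ℂ) * (g - h) t) := by
      rw [hFd, Pi.sub_apply]
      push_cast
      ring
    simp only [h1]
    refine (integral_sq_norm_add_le (n2.add n3) (m2.add n4)).trans ?_
    have e1 := integral_sq_norm_add_le n2 n3
    have e2 := integral_sq_norm_add_le m2 n4
    simp only [Pi.add_apply]
    linarith [hη'1.1, hη'1.2.2]

end Approximation

namespace FatStar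

variable {n : ℕ} {E : Type w} [Fintype E] {S : FatStar.{u, w} n E} {ε : ℝ} {Q : S.X → ℝ}

/-! ### Smooth functions on the graph -/

/-- `x` is given by smooth functions `F e` that are constant for `t ≤ 0` and vanish near infinity,
with the value `c` at the vertex. -/
structure IsSmoothG (x : S.H1G) (F : E → ℝ → ℂ) (c : ℂ) : Prop where
  contDiff : ∀ e, ContDiff ℝ ∞ (F e)
  of_nonpos : ∀ e, ∀ t ≤ 0, F e t = c * S.p e
  vanish : ∀ e, ∃ b, ∀ t, b < t → F e t = 0
  isH1G : S.IsH1G (embG S x) (derG S x) c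
  emb_eq : ∀ e, embG S x e =ᵐ[volume.restrict (S.edge e)] F e
  der_eq : ∀ e, derG S x e =ᵐ[volume.restrict (S.edge e)] deriv (F e)

/-- Approximate the derivative on each edge by a function that vanishes near `0`, integrate from the
given vertex value and cut off far out. Since the initial value `c * p e` is never changed, the
vertex condition persists. -/
theorem dense_isSmoothG : Dense {x : S.H1G | ∃ F c, IsSmoothG x F c} := by
  intro x
  obtain ⟨c, hx⟩ := x.exists_isH1G
  rw [Metric.mem_closure_iff]
  intro η hη
  have hcard : (0 : ℝ) < 2 * Fintype.card E + 1 := by positivity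
  -- There are two errors per edge; the additional `1` makes the final inequality strict and the
  -- quotient meaningful.
  have hη₁ : 0 < η ^ 2 / (2 * Fintype.card E + 1) := by positivity
  choose F hFs hr hb hFm hFdm h1 h2 using fun e => exists_smooth_approx_primitive
    (A := S.edge e) (fun s hs => hs.1) (S.isOpen_edge e).measurableSet
    (fun s hs => Ioc_subset_edge hs) (Lp.memLp (embG S x e)) (Lp.memLp (derG S x e)) (hx e) hη₁
  have hF0 (e : E) : ∀ t ≤ 0, F e t = c * S.p e := by
    obtain ⟨r, hr0, h⟩ := hr e
    exact fun t ht => h t (ht.trans hr0.le)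
  have hH1 : S.IsH1G (WithLp.toLp 2 fun e => (hFm e).toLp _)
      (WithLp.toLp 2 fun e => (hFdm e).toLp _) c := by
    refine isH1G_toLp hFm hFdm fun e s hs => ?_
    rw [intervalIntegral.integral_deriv_eq_sub
      (fun t _ => (hFs e).differentiable (by simp) t)
      (((hFs e).continuous_deriv (by simp)).intervalIntegrable _ _), hF0 e 0 le_rfl]
    ring
  refine ⟨hH1.toH1G, ⟨F, c, hFs, hF0, hb, hH1, fun e => (hFm e).coeFn_toLp,
    fun e => (hFdm e).coeFn_toLp⟩, ?_⟩
  rw [dist_eq_norm, ← sq_lt_sq₀ (norm_nonneg _) hη.le, H1G.norm_sq_eq, map_sub, map_sub,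
    PiLp.norm_sq_eq_of_L2, PiLp.norm_sq_eq_of_L2]
  have hdiff {e : E} {f : Lp ℂ 2 (volume.restrict (S.edge e) : Measure ℝ)} {G : ℝ → ℂ}
      (hG : MemLp G 2 (volume.restrict (S.edge e))) :
      ‖f - hG.toLp G‖ ^ 2 = ∫ t in S.edge e, ‖f t - G t‖ ^ 2 := by
    rw [norm_sq_Lp]
    refine integral_congr_ae ?_
    filter_upwards [Lp.coeFn_sub f (hG.toLp G), hG.coeFn_toLp] with t h1 h2
    rw [h1, Pi.sub_apply, h2]
  have e1 : ∑ e, ‖(embG S x - embG S hH1.toH1G) e‖ ^ 2 ≤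
      ∑ _e : E, η ^ 2 / (2 * Fintype.card E + 1) :=
    Finset.sum_le_sum fun e _ => (hdiff (hFm e)).trans_le (h1 e)
  have e2 : ∑ e, ‖(derG S x - derG S hH1.toH1G) e‖ ^ 2 ≤
      ∑ _e : E, η ^ 2 / (2 * Fintype.card E + 1) :=
    Finset.sum_le_sum fun e _ => (hdiff (hFdm e)).trans_le (h2 e)
  rw [Finset.sum_const, Finset.card_univ, nsmul_eq_mul] at e1 e2
  have e3 : η ^ 2 / (2 * Fintype.card E + 1) * (2 * Fintype.card E + 1) = η ^ 2 :=
    div_mul_cancel₀ _ hcard.ne'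
  nlinarith

/-! ### From the graph to the manifold -/

section Lift

theorem coInner_zero_right {m : ℕ} {M : RiemMfd.{u} m} (y : M) (α : TangentSpace M.I y →L[ℝ] ℂ) :
    M.coInner y α 0 = 0 := by
  simp [RiemMfd.coInner]

variable {x : S.H1G} {F : E → ℝ → ℂ} {c : ℂ}

/-- The function on the thin manifold that belongs to a smooth function on the graph. -/
def liftFn (ε : ℝ) (F : E → ℝ → ℂ) (c : ℂ) : S.Fn :=
  (fun _ => ((ε ^ (-(n : ℝ) / 2) : ℝ) : ℂ) * c,
    fun e z => ((ε ^ (-(n : ℝ) / 2) * (S.p e)⁻¹ : ℝ) : ℂ) * F e z.1)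

/-- For `t ≤ 0` the edge function is the constant `c * p e`, and division by `p e` makes it the
constant on `X`. So on each edge and its scaled collar the glued function is given by one smooth
formula. -/
theorem liftFn_mem (hvol : ∀ e, 0 < (S.Y e).totalVol) (h : IsSmoothG x F c) :
    liftFn ε F c ∈ S.smoothFn ε := by
  have hval (e : E) {t : ℝ} (ht : t ≤ 0) : ((ε ^ (-(n : ℝ) / 2) : ℝ) : ℂ) * c =
      ((ε ^ (-(n : ℝ) / 2) * (S.p e)⁻¹ : ℝ) : ℂ) * F e t := by
    have hp : (S.p e : ℂ) ≠ 0 := by exact_mod_cast (p_pos (hvol e)).ne'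
    rw [h.of_nonpos e t ht]
    push_cast
    field_simp
  refine ⟨contMDiff_const, fun e y => (hval e le_rfl).symm, fun e => ?_, fun e => ?_⟩
  · have hglue : S.glue ε (liftFn ε F c) e =
        fun z => ((ε ^ (-(n : ℝ) / 2) * (S.p e)⁻¹ : ℝ) : ℂ) * F e z.1 := by
      ext z
      rw [glue]
      split_ifs with hz
      · exact hval e hz
      · rfl
    rw [hglue]
    have h1 : ContMDiff 𝓘(ℝ, ℝ) 𝓘(ℝ, ℂ) ∞
        fun t => ((ε ^ (-(n : ℝ) / 2) * (S.p e)⁻¹ : ℝ) : ℂ) * F e t :=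
      (contDiff_const.mul (h.contDiff e)).contMDiff
    have h2 : ContMDiff (𝓘(ℝ, ℝ).prod (S.Y e).I) 𝓘(ℝ, ℂ) ∞
        fun z : ℝ × S.Y e => ((ε ^ (-(n : ℝ) / 2) * (S.p e)⁻¹ : ℝ) : ℂ) * F e z.1 :=
      h1.comp contMDiff_fst
    exact h2.contMDiffOn
  · obtain ⟨b, hb⟩ := h.vanish e
    refine ⟨b, fun z hz _ => ?_⟩
    simp [liftFn, hb z.1 hz]

/-- The element of `H¹(X_ε)` that belongs to a smooth function on the graph. -/
def lift (ε : ℝ) (hvol : ∀ e, 0 < (S.Y e).totalVol) (h : IsSmoothG x F c) : S.H1Pre ε :=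
  ⟨liftFn ε F c, liftFn_mem hvol h⟩

theorem ds_liftFn (h : IsSmoothG x F c) (e : E) (z : ℝ × S.Y e) : ds (liftFn (S := S) ε F c) e z =
    ((ε ^ (-(n : ℝ) / 2) * (S.p e)⁻¹ : ℝ) : ℂ) * deriv (F e) z.1 :=
  deriv_const_mul _ ((h.contDiff e).differentiable (by simp) z.1)

theorem transForm_liftFn (u : S.Fn) (e : E) : transForm u (liftFn (S := S) ε F c) e = 0 := by
  have h1 (z : ℝ × S.Y e) : dy u (liftFn (S := S) ε F c) e z = 0 := by
    have h2 : (S.Y e).d (fun y => (liftFn (S := S) ε F c).2 e (z.1, y)) z.2 = 0 :=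
      RiemMfd.d_const (M := S.Y e) (((ε ^ (-(n : ℝ) / 2) * (S.p e)⁻¹ : ℝ) : ℂ) * F e z.1) z.2
    rw [dy, h2, coInner_zero_right]
  rw [transForm]
  simp [h1]

theorem dirichlet_liftFn (u : S.Fn) : S.X.dirichlet u.1 (liftFn (S := S) ε F c).1 = 0 := by
  have h1 (y : S.X) : S.X.coInner y (S.X.d u.1 y) (S.X.d (liftFn (S := S) ε F c).1 y) = 0 := by
    have h2 : S.X.d (liftFn (S := S) ε F c).1 y = 0 := RiemMfd.d_const _ _
    rw [h2, coInner_zero_right]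
  rw [RiemMfd.dirichlet]
  simp [h1]

variable [hε : Fact (0 < ε)]

/-- The lift has the longitudinal energy of the graph function. -/
theorem dForm_lift (hvol : ∀ e, 0 < (S.Y e).totalVol) (h : IsSmoothG x F c) (u : S.H1Pre ε) :
    S.dForm ε u.fn (lift ε hvol h).fn = inner ℂ (avgDeriv u) (derG S x) := by
  have h0 := hε.out
  have hfn : (lift ε hvol h).fn = liftFn ε F c := rfl
  rw [dForm_eq h0 u.mem (lift ε hvol h).mem, hfn, dirichlet_liftFn, mul_zero, mul_zero, add_zero,
    avgDeriv, PiLp.inner_apply]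
  refine Finset.sum_congr rfl fun e _ => ?_
  rw [transForm_liftFn, mul_zero, add_zero]
  have hp : (S.p e : ℂ) ≠ 0 := by exact_mod_cast (p_pos (hvol e)).ne'
  have hr : 0 < ε ^ (-(n : ℝ) / 2) := Real.rpow_pos_of_pos h0 _
  have hL : longForm u.fn (liftFn ε F c) e = ((ε ^ (-(n : ℝ) / 2) * (S.p e)⁻¹ : ℝ) : ℂ) *
      conj (∫ s in S.edge e, conj (derG S x e s) * ∫ y, ds u.fn e (s, y) ∂(S.Y e).vol) := by
    rw [← integral_conj_comp_fst_mul (Lp.memLp (derG S x e)) (memLp_ds h0 u.mem e 2), ← integral_conj,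
      ← integral_const_mul, longForm]
    refine integral_congr_ae ?_
    have hae : ∀ᵐ z ∂S.edgeVol e, derG S x e z.1 = deriv (F e) z.1 :=
      Measure.quasiMeasurePreserving_fst.ae (h.der_eq e)
    filter_upwards [hae] with z hz
    rw [ds_liftFn h, hz, map_mul, Complex.conj_conj]
    ring
  have hR : inner ℂ (((memLp_avgDs h0 u.mem e).const_mul (scale S ε e)).toLp _) (derG S x e) =
      (((ε ^ (-(n : ℝ) / 2))⁻¹ * (S.p e)⁻¹ : ℝ) : ℂ) *
      conj (∫ s in S.edge e, conj (derG S x e s) * ∫ y, ds u.fn e (s, y) ∂(S.Y e).vol) := by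
    rw [← integral_conj, ← integral_const_mul]
    refine (L2.inner_def _ _).trans (integral_congr_ae ?_)
    filter_upwards [((memLp_avgDs h0 u.mem e).const_mul (scale S ε e)).coeFn_toLp] with s hs
    rw [hs, RCLike.inner_apply, avgDs, RiemMfd.mean, ← sq_p, scale]
    simp only [map_mul, map_div₀, Complex.conj_conj, Complex.conj_ofReal]
    push_cast
    field_simp
  rw [hL]
  refine Eq.trans ?_ hR.symm
  rw [← mul_assoc]
  congr 1
  rw [← Complex.ofReal_pow, ← Complex.ofReal_mul]
  congr 1
  have h2 := rpow_neg_half_sq (n := n) h0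
  generalize ε ^ (-(n : ℝ) / 2) = r at hr h2
  have hp' : S.p e ≠ 0 := (p_pos (hvol e)).ne'
  field_simp
  linear_combination h2

/-- On the edges `J` and the lift agree, and `J` vanishes on the vertex part. The difference is the
constant `ε^(-n/2) c` there, with respect to a measure of mass `ε^(n+1)` times the volume of `X`. -/
theorem norm_sq_identJ_sub_lift (hvol : ∀ e, 0 < (S.Y e).totalVol) (h : IsSmoothG x F c) :
    ‖identJ hε.out hvol (embG S x) - toL2 S ε (lift ε hvol h)‖ ^ 2 =
      ε * (S.X.totalVol * ‖c‖ ^ 2) := by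
  have h0 := hε.out
  have hfst : (identJ hε.out hvol (embG S x) - toL2 S ε (lift ε hvol h)).fst = 0 := by
    refine sub_eq_zero.2 (WithLp.ofLp_injective 2 (funext fun e => Lp.ext ?_))
    have h1 := (isIdentification_identJ hε.out hvol (embG S x)).1 e
    have h2 := (represents_toL2 (lift ε hvol h)).1 e
    refine h1.trans (EventuallyEq.trans ?_ h2.symm)
    filter_upwards [ae_fst (h.emb_eq e) (ENNReal.ofReal (ε ^ n))] with z hz
    rw [hz]
    rfl
  have hsnd : (identJ hε.out hvol (embG S x) - toL2 S ε (lift ε hvol h)).snd =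
      -(toL2 S ε (lift ε hvol h)).snd := by
    have h1 := (isIdentification_identJ hε.out hvol (embG S x)).2
    refine (congrArg (· - (toL2 S ε (lift ε hvol h)).snd) h1).trans (zero_sub _)
  rw [WithLp.prod_norm_sq_eq_of_L2, hfst, hsnd, norm_zero, norm_neg]
  have h3 : ‖(toL2 S ε (lift ε hvol h)).snd‖ ^ 2 =
      ∫ _x, ‖((ε ^ (-(n : ℝ) / 2) : ℝ) : ℂ) * c‖ ^ 2
        ∂(ENNReal.ofReal (ε ^ (n + 1)) • S.X.vol) :=
    norm_sq_toLp (memLp_smul_vertex (lift ε hvol h).mem)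
  rw [h3, integral_smul_measure, ENNReal.toReal_ofReal (by positivity), integral_const, norm_mul,
    mul_pow, Complex.norm_real, Real.norm_eq_abs, sq_abs, smul_eq_mul, smul_eq_mul, pow_succ ε n]
  have h2 := rpow_neg_half_sq (n := n) h0
  change 0 ^ 2 + ε ^ n * ε * (S.X.totalVol * _) = _
  linear_combination (ε * S.X.totalVol * ‖c‖ ^ 2) * h2

end Lift

end FatStar

namespace FatStar

variable {n : ℕ} {E : Type w} {S : FatStar.{u, w} n E} {ε : ℝ} {Q : S.X → ℝ}

/-! ### Closeness of the forms -/

theorem memLp_conj_mul_potential (hQ : MemLp Q ⊤ S.X.vol) {f : S.X → ℂ} (hf : Continuous f) :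
    MemLp (fun y => conj (f y) * (Q y : ℂ)) 2 S.X.vol := by
  have h1 : MemLp (fun y => conj (f y)) 2 S.X.vol :=
    RiemMfd.memLp_of_continuous (Complex.continuous_conj.comp hf) 2
  have h2 : MemLp (fun y => (Q y : ℂ)) ⊤ S.X.vol := hQ.ofReal
  exact h2.mul (r := 2) h1

/-- Cauchy–Schwarz against the constant `1`, the bound on `Q`, then the Poincaré inequality. -/
theorem sq_norm_integral_conj_sub_mean_le (hQ : MemLp Q ⊤ S.X.vol) (hlamV : 0 < S.lamV)
    {f : S.X → ℂ} (hf : S.X.Smooth f) :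
    ‖∫ y, conj (f y - S.X.mean f) * (Q y : ℂ) ∂S.X.vol‖ ^ 2 ≤
      S.X.totalVol * (S.supNorm Q ^ 2 * ((S.X.dirichlet f f).re / S.lamV)) := by
  have hc : Continuous fun y => f y - S.X.mean f := hf.continuous.sub continuous_const
  have m1 := memLp_conj_mul_potential hQ hc
  refine (sq_norm_integral_le m1).trans (mul_le_mul_of_nonneg_left ?_ measureReal_nonneg)
  refine le_trans ?_ (mul_le_mul_of_nonneg_left (RiemMfd.poincare hlamV hf) (sq_nonneg _))
  rw [← integral_const_mul]
  have m2 := RiemMfd.memLp_of_continuous (M := S.X) hc 2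
  refine integral_mono_ae ((memLp_two_iff_integrable_sq_norm m1.1).1 m1)
    (((memLp_two_iff_integrable_sq_norm m2.1).1 m2).const_mul _) ?_
  filter_upwards [ae_abs_le_supNorm hQ] with y hy
  rw [norm_mul, RCLike.norm_conj, Complex.norm_real, Real.norm_eq_abs, mul_pow, mul_comm]
  exact mul_le_mul_of_nonneg_right (pow_le_pow_left₀ (abs_nonneg _) hy 2) (sq_nonneg _)

theorem integral_conj_sub_mean_mul (hQ : MemLp Q ⊤ S.X.vol) {f : S.X → ℂ} (hf : Continuous f) :
    ∫ y, conj (f y - S.X.mean f) * (Q y : ℂ) ∂S.X.vol =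
      ∫ y, conj (f y) * (Q y : ℂ) ∂S.X.vol - conj (S.X.mean f) * S.q Q := by
  have h1 := (memLp_conj_mul_potential hQ hf).integrable (by norm_num)
  have h2 : Integrable (fun y => conj (S.X.mean f) * (Q y : ℂ)) S.X.vol :=
    ((hQ.integrable le_top).ofReal).const_mul _
  simp only [map_sub, sub_mul]
  rw [integral_sub h1 h2, integral_const_mul, q, integral_complex_ofReal]

variable [Fintype E] [hε : Fact (0 < ε)] {x : S.H1G} {F : E → ℝ → ℂ} {c : ℂ}

/-- The powers combine as `ε^(n+1) ε⁻¹ ε^(-n/2) = ε^(n/2)`, the scale of the vertex value of the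
averaged function. This is why a potential of size `ε⁻¹` leads to a coupling that does not depend on
`ε`. -/
theorem hForm_lift (hvol : ∀ e, 0 < (S.Y e).totalVol) (h : IsSmoothG x F c) (u : S.H1Pre ε) :
    S.hForm Q ε u.fn (lift ε hvol h).fn = inner ℂ (avgDeriv u) (derG S x) +
      (((ε ^ (-(n : ℝ) / 2))⁻¹ : ℝ) : ℂ) * c * ∫ y, conj (u.fn.1 y) * (Q y : ℂ) ∂S.X.vol := by
  have h0 := hε.out
  rw [hForm, dForm_lift]
  congr 1
  rw [← integral_const_mul, ← integral_const_mul]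
  congr 1
  ext y
  change (ε : ℂ) ^ (n + 1) * (conj (u.fn.1 y) * (((ε⁻¹ * Q y : ℝ) : ℂ) *
    (((ε ^ (-(n : ℝ) / 2) : ℝ) : ℂ) * c))) = _
  have h2 := rpow_neg_half_sq (n := n) h0
  have hr : 0 < ε ^ (-(n : ℝ) / 2) := Real.rpow_pos_of_pos h0 _
  have h3 : ε ^ (n + 1) * ε⁻¹ * ε ^ (-(n : ℝ) / 2) = (ε ^ (-(n : ℝ) / 2))⁻¹ := by
    generalize ε ^ (-(n : ℝ) / 2) = r at *
    rw [pow_succ]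
    field_simp
    linear_combination h2
  rw [← h3]
  push_cast
  ring

theorem H1G.norm_embG_le (x : S.H1G) : ‖embG S x‖ ≤ ‖x‖ :=
  (sq_le_sq₀ (norm_nonneg _) (norm_nonneg _)).1 (by
    rw [H1G.norm_sq_eq]
    exact le_add_of_nonneg_right (sq_nonneg _))

theorem H1G.norm_derG_le (x : S.H1G) : ‖derG S x‖ ≤ ‖x‖ :=
  (sq_le_sq₀ (norm_nonneg _) (norm_nonneg _)).1 (by
    rw [H1G.norm_sq_eq]
    exact le_add_of_nonneg_left (sq_nonneg _))

variable (Q) in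
-- Only the existence of such a bound matters: it enters as the constant `K`, which disappears in
-- the density argument.
theorem norm_average_le (hvol : ∀ e, 0 < (S.Y e).totalVol) (hlamV : 0 < S.lamV)
    (u : S.H1Pre ε) :
    ‖(isH1G_average hvol u).toH1G‖ ≤ 2 * (1 + S.delta Q ε) * ‖u‖ := by
  have hδ := delta_nonneg (S := S) (Q := Q) (ε := ε)
  have h1 : ‖embG S (isH1G_average hvol u).toH1G‖ ≤ (1 + S.delta Q ε) * ‖u‖ := by
    have hJ : ‖ContinuousLinearMap.adjoint (identJ hε.out hvol)‖ ≤ 1 := by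
      rw [LinearIsometryEquiv.norm_map]
      exact ContinuousLinearMap.opNorm_le_bound _ zero_le_one fun f => by
        rw [norm_identJ_apply, one_mul]
    have h2 := ContinuousLinearMap.le_of_opNorm_le _ hJ (toL2 S ε u)
    have h3 := norm_correction_cutoff_le (Q := Q) hvol hlamV u
    refine (norm_add_le _ _).trans ?_
    linarith [norm_toL2_le u]
  have h2 : ‖derG S (isH1G_average hvol u).toH1G‖ ≤ (1 + S.delta Q ε) * ‖u‖ := by
    have h3 := two_mul_norm_sq_correction_cutoffDeriv_le (Q := Q) hvol hlamV u
    have h4 : ‖correction S.cutoffDeriv (fun e => memLp_cutoffDeriv (S.edge e)) u‖ ≤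
        S.delta Q ε * ‖u‖ :=
      (sq_le_sq₀ (norm_nonneg _) (mul_nonneg hδ (norm_nonneg _))).1 (by
        linarith [sq_nonneg ‖correction S.cutoffDeriv (fun e => memLp_cutoffDeriv (S.edge e)) u‖])
    refine (norm_add_le _ _).trans ?_
    linarith [norm_avgDeriv_le hvol u]
  have h3 := H1G.norm_sq_eq (isH1G_average hvol u).toH1G
  have h4 : 0 ≤ (1 + S.delta Q ε) * ‖u‖ := by positivity
  rw [mul_assoc]
  generalize (1 + S.delta Q ε) * ‖u‖ = a at *
  refine (sq_le_sq₀ (norm_nonneg _) (by positivity)).1 ?_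
  have h5 := pow_le_pow_left₀ (norm_nonneg _) h1 2
  have h6 := pow_le_pow_left₀ (norm_nonneg _) h2 2
  nlinarith

variable [Nonempty E]

/-- The trace estimate over the length `ℓ₀`; as `ℓ₀ ≤ 1`, both of its coefficients are at most `2 /
ℓ₀`. -/
theorem totalVol_mul_sq_vertex_le (hvol : ∀ e, 0 < (S.Y e).totalVol) (h : IsSmoothG x F c) :
    S.X.totalVol * ‖c‖ ^ 2 ≤ 2 * S.cVol / S.ell0 * ‖x‖ ^ 2 := by
  have hℓ := ell0_pos (S := S)
  have hc := cVol_nonneg (S := S)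
  have h1 := H1G.trace hvol x hℓ ell0_le
  rw [(isH1G_vertexG hvol x).vertex_unique hvol h.isH1G] at h1
  refine h1.trans ?_
  have h2 : S.ell0 ≤ 2 / S.ell0 := by
    rw [le_div_iff₀ hℓ]
    nlinarith [ell0_le_one (S := S)]
  rw [H1G.norm_sq_eq]
  calc _ ≤ S.cVol * (2 / S.ell0 * ‖derG S x‖ ^ 2 + 2 / S.ell0 * ‖embG S x‖ ^ 2) := by gcongr
    _ = _ := by ring

variable (Q) in
theorem norm_identJ_sub_lift_le (hvol : ∀ e, 0 < (S.Y e).totalVol) (h : IsSmoothG x F c) :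
    ‖identJ hε.out hvol (embG S x) - toL2 S ε (lift ε hvol h)‖ ≤ S.delta Q ε * ‖x‖ := by
  have h0 := hε.out
  have hℓ := ell0_pos (S := S)
  have hc := cVol_nonneg (S := S)
  refine (sq_le_sq₀ (norm_nonneg _) (mul_nonneg delta_nonneg (norm_nonneg _))).1 ?_
  rw [norm_sq_identJ_sub_lift, mul_pow]
  have h1 := mul_le_mul_of_nonneg_left (totalVol_mul_sq_vertex_le hvol h) h0.le
  have h2 := mul_le_mul_of_nonneg_right (delta_sq_ge_cVol (S := S) (Q := Q) h0) (sq_nonneg ‖x‖)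
  have h3 : 0 ≤ ε * S.cVol / S.ell0 * ‖x‖ ^ 2 := by positivity
  have h4 : 8 * ε * S.cVol / S.ell0 * ‖x‖ ^ 2 = 8 * (ε * S.cVol / S.ell0 * ‖x‖ ^ 2) := by ring
  have h5 : ε * (2 * S.cVol / S.ell0 * ‖x‖ ^ 2) = 2 * (ε * S.cVol / S.ell0 * ‖x‖ ^ 2) := by ring
  linarith

variable (Q) in
-- The energy of the lift is its pairing with `f'`, hence at most `‖lift‖ ‖x‖`. With `a = (1 +
-- δ)‖x‖` this gives `‖lift‖² ≤ a ‖lift‖ + a²`, which forces `‖lift‖ ≤ 2a`.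
theorem norm_lift_le (hvol : ∀ e, 0 < (S.Y e).totalVol) (h : IsSmoothG x F c) :
    ‖lift ε hvol h‖ ≤ 2 * (1 + S.delta Q ε) * ‖x‖ := by
  have hδ := delta_nonneg (S := S) (Q := Q) (ε := ε)
  have h1 : (S.dForm ε (lift ε hvol h).fn (lift ε hvol h).fn).re ≤ ‖lift ε hvol h‖ * ‖x‖ := by
    rw [dForm_lift]
    refine (Complex.re_le_norm _).trans ((norm_inner_le_norm _ _).trans ?_)
    exact mul_le_mul (norm_avgDeriv_le hvol _) (H1G.norm_derG_le x) (norm_nonneg _) (norm_nonneg _)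
  have h2 : ‖toL2 S ε (lift ε hvol h)‖ ≤ (1 + S.delta Q ε) * ‖x‖ := by
    have h3 := norm_identJ_sub_lift_le (ε := ε) Q hvol h
    have h4 := norm_sub_norm_le (toL2 S ε (lift ε hvol h)) (identJ hε.out hvol (embG S x))
    rw [norm_sub_rev, norm_identJ_apply] at h4
    linarith [H1G.norm_embG_le x]
  have h5 := H1Pre.norm_sq_eq (lift ε hvol h)
  have h6 : ‖toL2 S ε (lift ε hvol h)‖ ^ 2 ≤ ((1 + S.delta Q ε) * ‖x‖) ^ 2 :=
    pow_le_pow_left₀ (norm_nonneg _) h2 2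
  have h7 : ‖x‖ ≤ (1 + S.delta Q ε) * ‖x‖ := by nlinarith [norm_nonneg x]
  have h8 := mul_le_mul_of_nonneg_left h7 (norm_nonneg (lift ε hvol h))
  have h9 : 0 ≤ (1 + S.delta Q ε) * ‖x‖ := by positivity
  rw [mul_assoc]
  generalize (1 + S.delta Q ε) * ‖x‖ = a at *
  by_contra! hlt
  nlinarith [norm_nonneg (lift ε hvol h)]

/-- The vertex value is bounded by `‖x‖` through the trace estimate, and the deviation from the mean
gains `√ε` through the vertex energy. The product is the fifth entry of `δ²`, which includes the
factor `2`. -/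
theorem two_mul_sq_norm_potential_sub_le (hvol : ∀ e, 0 < (S.Y e).totalVol) (hlamV : 0 < S.lamV)
    (hQ : MemLp Q ⊤ S.X.vol) (h : IsSmoothG x F c) (u : S.H1Pre ε) :
    2 * ‖(((ε ^ (-(n : ℝ) / 2))⁻¹ : ℝ) : ℂ) * c *
      ∫ y, conj (u.fn.1 y - S.X.mean u.fn.1) * (Q y : ℂ) ∂S.X.vol‖ ^ 2 ≤
      (S.delta Q ε * ‖x‖ * ‖u‖) ^ 2 := by
  have h0 := hε.out
  have hℓ := ell0_pos (S := S)
  have hc := cVol_nonneg (S := S)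
  have hD := RiemMfd.dirichlet_self_re_nonneg u.mem.1
  have h1 := sq_norm_integral_conj_sub_mean_le hQ hlamV u.mem.1
  have h2 := totalVol_mul_sq_vertex_le hvol h
  have h3 := dirichlet_le_norm_sq u
  have h4 := delta_sq_ge_potential (S := S) (Q := Q) h0
  have hρ : ‖(((ε ^ (-(n : ℝ) / 2))⁻¹ : ℝ) : ℂ)‖ ^ 2 = ε ^ n := by
    rw [Complex.norm_real, Real.norm_eq_abs, sq_abs, inv_pow,
      eq_inv_of_mul_eq_one_left (rpow_neg_half_sq (n := n) h0)]
  rw [norm_mul, norm_mul, mul_pow, mul_pow, hρ]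
  set D := (S.X.dirichlet u.fn.1 u.fn.1).re
  calc _ ≤ 2 * (ε ^ n * ‖c‖ ^ 2 * (S.X.totalVol * (S.supNorm Q ^ 2 * (D / S.lamV)))) := by gcongr
    _ = 2 * ε * S.supNorm Q ^ 2 / S.lamV * (S.X.totalVol * ‖c‖ ^ 2) * (ε ^ n * ε⁻¹ * D) := by
      field_simp
    _ ≤ 2 * ε * S.supNorm Q ^ 2 / S.lamV * (2 * S.cVol / S.ell0 * ‖x‖ ^ 2) * ‖u‖ ^ 2 := by
      gcongr
    _ = 4 * ε * S.cVol * S.supNorm Q ^ 2 / (S.ell0 * S.lamV) * (‖x‖ ^ 2 * ‖u‖ ^ 2) := by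
      field_simp
      ring
    _ ≤ S.delta Q ε ^ 2 * (‖x‖ ^ 2 * ‖u‖ ^ 2) := by gcongr
    _ = _ := by ring

/-- The longitudinal energies cancel, and so do the contributions of the mean to the potential
terms. The two remaining terms have squares at most half of the square of `δ‖x‖‖u‖`, so their sum is
at most `√2` times that product. -/
theorem norm_form_sub_le [CompleteSpace S.H1G] (hvol : ∀ e, 0 < (S.Y e).totalVol)
    (hlamV : 0 < S.lamV) (hQ : MemLp Q ⊤ S.X.vol) (h : IsSmoothG x F c) (u : S.H1Pre ε) :
    ‖inner ℂ (formX hQ ε (u : S.H1X ε)) (lift ε hvol h : S.H1X ε) -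
      inner ℂ (isH1G_average hvol u).toH1G (formG hvol Q x)‖ ≤
      Real.sqrt 2 * S.delta Q ε * ‖x‖ * ‖u‖ := by
  have hk : vertexG hvol (isH1G_average hvol u).toH1G =
      ((ε ^ (-(n : ℝ) / 2))⁻¹ : ℝ) * S.X.mean u.fn.1 :=
    (isH1G_vertexG hvol _).vertex_unique hvol (isH1G_average hvol u)
  have hd : derG S (isH1G_average hvol u).toH1G =
    avgDeriv u + correction S.cutoffDeriv (fun e => memLp_cutoffDeriv (S.edge e)) u := rfl
  have h1 := two_mul_norm_sq_correction_cutoffDeriv_le (Q := Q) hvol hlamV u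
  have h2 := two_mul_sq_norm_potential_sub_le hvol hlamV hQ h u
  rw [formX_symm, inner_formX_coe, hForm_lift, inner_formG, hk, hd,
    (isH1G_vertexG hvol x).vertex_unique hvol h.isH1G]
  set k := correction S.cutoffDeriv (fun e => memLp_cutoffDeriv (S.edge e)) u
  set P := (((ε ^ (-(n : ℝ) / 2))⁻¹ : ℝ) : ℂ) * c *
      ∫ y, conj (u.fn.1 y - S.X.mean u.fn.1) * (Q y : ℂ) ∂S.X.vol with hP
  have hdiff : inner ℂ (avgDeriv u) (derG S x) +
      (((ε ^ (-(n : ℝ) / 2))⁻¹ : ℝ) : ℂ) * c * ∫ y, conj (u.fn.1 y) * (Q y : ℂ) ∂S.X.vol -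
      (inner ℂ (avgDeriv u + k) (derG S x) + (S.q Q : ℂ) *
        (conj ((((ε ^ (-(n : ℝ) / 2))⁻¹ : ℝ) : ℂ) * S.X.mean u.fn.1) * c)) =
      P - inner ℂ k (derG S x) := by
    rw [hP, integral_conj_sub_mean_mul hQ u.mem.1.continuous, inner_add_left, map_mul,
      Complex.conj_ofReal]
    ring
  rw [hdiff]
  have h3 : ‖inner ℂ k (derG S x)‖ ≤ ‖k‖ * ‖x‖ := (norm_inner_le_norm _ _).trans
    (mul_le_mul_of_nonneg_left (H1G.norm_derG_le x) (norm_nonneg _))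
  have h4 : 2 * (‖k‖ * ‖x‖) ^ 2 ≤ (S.delta Q ε * ‖x‖ * ‖u‖) ^ 2 := by
    have := mul_le_mul_of_nonneg_right h1 (sq_nonneg ‖x‖)
    calc _ = 2 * ‖k‖ ^ 2 * ‖x‖ ^ 2 := by ring
      _ ≤ _ := this
      _ = _ := by ring
  refine (norm_sub_le _ _).trans ((add_le_add_right h3 _).trans ?_)
  have h5 : 0 ≤ S.delta Q ε * ‖x‖ * ‖u‖ :=
    mul_nonneg (mul_nonneg delta_nonneg (norm_nonneg _)) (norm_nonneg _)
  have h6 : Real.sqrt 2 * S.delta Q ε * ‖x‖ * ‖u‖ = Real.sqrt 2 * (S.delta Q ε * ‖x‖ * ‖u‖) := by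
    ring
  rw [h6]
  refine (sq_le_sq₀ (by positivity) (by positivity)).1 ?_
  rw [mul_pow, Real.sq_sqrt zero_le_two]
  nlinarith [sq_nonneg (‖P‖ - ‖k‖ * ‖x‖)]

/-- The forms of the graph and of the thin manifold are close. -/
theorem formsClose [CompleteSpace S.H1G] (hvol : ∀ e, 0 < (S.Y e).totalVol)
    (hlamV : 0 < S.lamV) (hQ : MemLp Q ⊤ S.X.vol) :
    FormsClose (embG S) (formG hvol Q) (embX S ε) (formX hQ ε) (identJ hε.out hvol)
      {x : S.H1G | ∃ F c, IsSmoothG x F c} (range ((↑) : S.H1Pre ε → S.H1X ε))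
      (S.delta Q ε) (S.delta Q ε) (Real.sqrt 2 * S.delta Q ε) (2 * (1 + S.delta Q ε)) := by
  rintro x ⟨F, c, h⟩ _ ⟨u, rfl⟩
  refine ⟨(lift ε hvol h : S.H1X ε), (isH1G_average hvol u).toH1G, ?_, ?_, ?_, ?_, ?_⟩
  · rw [UniformSpace.Completion.norm_coe]
    exact norm_lift_le Q hvol h
  · rw [UniformSpace.Completion.norm_coe]
    exact norm_average_le Q hvol hlamV u
  · rw [embX_coe]
    exact norm_identJ_sub_lift_le Q hvol h
  · rw [embX_coe, UniformSpace.Completion.norm_coe]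
    have h1 : embG S (isH1G_average hvol u).toH1G =
      ContinuousLinearMap.adjoint (identJ hε.out hvol) (toL2 S ε u) +
        correction S.cutoff (fun e => memLp_cutoff (S.edge e)) u := rfl
    rw [h1, sub_add_cancel_left, norm_neg]
    exact norm_correction_cutoff_le hvol hlamV u
  · rw [UniformSpace.Completion.norm_coe]
    exact norm_form_sub_le hvol hlamV hQ h u

end FatStar

namespace FatStar

variable {n : ℕ} {E : Type w} [Fintype E] {S : FatStar.{u, w} n E} {ε : ℝ} {Q : S.X → ℝ}

/-! ### Closeness of the operators -/

/-- For `ε < 1` each of the five entries is a constant times at most `ε`; their maximum is bounded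
by the sum of the constants. -/
theorem delta_isBigO [Nonempty E] (hlamV : 0 < S.lamV) (hlamEdge : ∀ e, 0 < S.lamEdge e) :
    S.delta Q =O[𝓝[>] 0] fun ε : ℝ => ε ^ (1 / 2 : ℝ) := by
  have hℓ := ell0_pos (S := S)
  have hc := cVol_nonneg (S := S)
  have hE := lamE_pos hlamEdge
  set A := 8 * S.cVol / S.ell0 with hA
  set B := 1 / S.lamE with hB
  set C := 4 * (1 / S.lamV + S.cVol * (1 + 2 / (S.ell0 * S.lamV))) with hC
  set D := 2 / S.ell0 * (1 + 2 / (S.ell0 * S.lamV)) with hD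
  set G := 4 * S.cVol * S.supNorm Q ^ 2 / (S.ell0 * S.lamV) with hG
  have hA0 : 0 ≤ A := by positivity
  have hB0 : 0 ≤ B := by positivity
  have hC0 : 0 ≤ C := by positivity
  have hD0 : 0 ≤ D := by positivity
  have hG0 : 0 ≤ G := by positivity
  refine Asymptotics.IsBigO.of_bound (Real.sqrt (A + B + C + D + G)) ?_
  filter_upwards [Ioo_mem_nhdsGT one_pos] with ε hε
  have hεε : ε ^ 2 ≤ ε := by nlinarith [hε.1, hε.2]
  rw [Real.norm_of_nonneg delta_nonneg,
    Real.norm_of_nonneg (Real.rpow_nonneg hε.1.le _), ← Real.sqrt_eq_rpow,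
    ← Real.sqrt_mul (by positivity), delta]
  refine Real.sqrt_le_sqrt ?_
  have hε0 := hε.1
  have a1 : 0 ≤ A * ε := by positivity
  have a2 : 0 ≤ B * ε := by positivity
  have a3 : 0 ≤ C * ε := by positivity
  have a4 : 0 ≤ D * ε := by positivity
  have a5 : 0 ≤ G * ε := by positivity
  have b2 := mul_le_mul_of_nonneg_left hεε hB0
  have b3 := mul_le_mul_of_nonneg_left hεε hC0
  refine max_le ?_ (max_le ?_ (max_le ?_ (max_le ?_ ?_)))
  · have : 8 * ε * S.cVol / S.ell0 = A * ε := by rw [hA]; ring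
    linarith
  · have : ε ^ 2 / S.lamE = B * ε ^ 2 := by rw [hB]; ring
    linarith
  · have : 4 * ε ^ 2 * (1 / S.lamV + S.cVol * (1 + 2 / (S.ell0 * S.lamV))) = C * ε ^ 2 := by
      rw [hC]; ring
    linarith
  · have : 2 * ε / S.ell0 * (1 + 2 / (S.ell0 * S.lamV)) = D * ε := by rw [hD]; ring
    linarith
  · have : 4 * ε * S.cVol * S.supNorm Q ^ 2 / (S.ell0 * S.lamV) = G * ε := by rw [hG]; ring
    linarith

/-- Write `m` for the maximum. As `C + 2 ≥ 1`, the root is at most `C + 2`, and `2 = √2 √2 ≤ √2 m`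
gives `C + 2 ≤ (1 + √2) m`. Then `(2 + √2)(1 + √2) = 4 + 3√2 ≤ 10`. -/
theorem add_two_le_mul_max {C : ℝ} (hC : 0 ≤ C) :
    2 * Real.sqrt (C + 2) + Real.sqrt 2 * Real.sqrt (C + 2) ^ 2 ≤ 10 * max C (Real.sqrt 2) := by
  have h2 : Real.sqrt 2 ^ 2 = 2 := Real.sq_sqrt zero_le_two
  have h20 := Real.sqrt_nonneg 2
  have h21 : Real.sqrt 2 ≤ 3 / 2 := by
    rw [Real.sqrt_le_left (by norm_num)]
    norm_num
  have h1 : Real.sqrt (C + 2) ≤ C + 2 := by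
    rw [Real.sqrt_le_left (by linarith)]
    nlinarith
  have h3 : C ≤ max C (Real.sqrt 2) := le_max_left _ _
  have h4 : Real.sqrt 2 ≤ max C (Real.sqrt 2) := le_max_right _ _
  have h5 : C + 2 ≤ (1 + Real.sqrt 2) * max C (Real.sqrt 2) := by nlinarith
  rw [Real.sq_sqrt (by linarith)]
  generalize max C (Real.sqrt 2) = m at *
  have hm : 0 ≤ m := hC.trans h3
  calc _ ≤ (2 + Real.sqrt 2) * (C + 2) := by linarith
    _ ≤ (2 + Real.sqrt 2) * ((1 + Real.sqrt 2) * m) := by gcongr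
    _ = (4 + 3 * Real.sqrt 2) * m := by linear_combination m * h2
    _ ≤ 10 * m := by nlinarith

variable [Nonempty E] [hε : Fact (0 < ε)]

/-- At the real point a weak solution has `H¹` norm at most `‖g‖`, so no factor is lost here; the
`√2` of the theorem comes from the comparison of the forms. -/
theorem norm_sub_identJ_comp_resolvent_le (hvol : ∀ e, 0 < (S.Y e).totalVol) (hlamV : 0 < S.lamV)
    (hlamEdge : ∀ e, 0 < S.lamEdge e) (hQ : MemLp Q ⊤ S.X.vol)
    (h : ENNReal.ofReal ε ≤ S.epsEta Q (1 / 2)) {R' : S.H1X ε →L[ℂ] S.H1X ε}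
    (hR' : ∀ g x, IsSol (embX S ε) (formX hQ ε) ((-S.cTilde Q (1 / 2) - 1 : ℝ) : ℂ) g x ↔
      x = R' (ContinuousLinearMap.adjoint (embX S ε) g)) :
    ‖(ContinuousLinearMap.id ℂ (S.L2X ε) -
      identJ hε.out hvol ∘L ContinuousLinearMap.adjoint (identJ hε.out hvol)) ∘L
        (embX S ε ∘L R' ∘L ContinuousLinearMap.adjoint (embX S ε))‖ ≤ S.delta Q ε := by
  have hδ := delta_nonneg (S := S) (Q := Q) (ε := ε)
  refine ContinuousLinearMap.opNorm_le_bound _ hδ fun g => ?_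
  have h3 := norm_sub_identJ_embX_le (Q := Q) hvol hlamV hlamEdge
    (R' (ContinuousLinearMap.adjoint (embX S ε) g))
  have h4 := (sol_bounds_real (cTilde_nonneg (1 / 2)) (formX_lower hvol hlamV hQ h)
    ((hR' g _).2 rfl)).1
  exact h3.trans (mul_le_mul_of_nonneg_left h4 hδ)

theorem norm_resolvent_real_sub_le [CompleteSpace S.H1G] (hvol : ∀ e, 0 < (S.Y e).totalVol)
    (hlamV : 0 < S.lamV) (hQ : MemLp Q ⊤ S.X.vol) (h : ENNReal.ofReal ε ≤ S.epsEta Q (1 / 2))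
    {z : ℂ} (hz : z = ((-S.cTilde Q (1 / 2) - 1 : ℝ) : ℂ))
    {R : S.H1G →L[ℂ] S.H1G} {R' : S.H1X ε →L[ℂ] S.H1X ε}
    (hR : ∀ g x, IsSol (embG S) (formG hvol Q) z g x ↔
      x = R (ContinuousLinearMap.adjoint (embG S) g))
    (hR' : ∀ g x, IsSol (embX S ε) (formX hQ ε) z g x ↔
      x = R' (ContinuousLinearMap.adjoint (embX S ε) g)) :
    ‖identJ hε.out hvol ∘L (embG S ∘L R ∘L ContinuousLinearMap.adjoint (embG S)) -
      (embX S ε ∘L R' ∘L ContinuousLinearMap.adjoint (embX S ε)) ∘L identJ hε.out hvol‖ ≤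
      3 * Real.sqrt 2 * S.delta Q ε := by
  have hδ := delta_nonneg (S := S) (Q := Q) (ε := ε)
  have h2 : 1 ≤ Real.sqrt 2 := Real.one_le_sqrt.2 one_le_two
  have hconj : conj z = z := by rw [hz, Complex.conj_ofReal]
  have hS' : ∀ g x, IsSol (embX S ε) (formX hQ ε) (conj z) g x ↔
      x = R' (ContinuousLinearMap.adjoint (embX S ε) g) := hconj.symm ▸ hR'
  have hb (g : S.L2G) (x : S.H1G) (hx : IsSol (embG S) (formG hvol Q) z g x) :
      ‖x‖ ≤ 1 * ‖g‖ ∧ ‖g + z • embG S x‖ ≤ ‖g‖ := by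
    subst hz
    rw [one_mul]
    exact sol_bounds_real (cTilde_nonneg (1 / 2)) (formG_lower hvol hQ) hx
  have hb' (g : S.L2X ε) (x : S.H1X ε) (hx : IsSol (embX S ε) (formX hQ ε) (conj z) g x) :
      ‖x‖ ≤ 1 * ‖g‖ ∧ ‖g + conj z • embX S ε x‖ ≤ ‖g‖ := by
    rw [hconj] at hx ⊢
    subst hz
    rw [one_mul]
    exact sol_bounds_real (cTilde_nonneg (1 / 2)) (formX_lower hvol hlamV hQ h) hx
  refine ((formsClose (ε := ε) hvol hlamV hQ).norm_resolvent_sub_le dense_isSmoothG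
    UniformSpace.Completion.denseRange_coe hR hR' hS' (formX_symm hQ)
    hδ hδ (by positivity) zero_le_one hb hb').trans ?_
  -- With `a = 1` the abstract bound is `2δ + √2 δ`, and `1 ≤ √2`.
  nlinarith

theorem exists_resolvents_real (hvol : ∀ e, 0 < (S.Y e).totalVol) (hlamV : 0 < S.lamV)
    (hlamEdge : ∀ e, 0 < S.lamEdge e) (hQ : MemLp Q ⊤ S.X.vol)
    (h : ENNReal.ofReal ε ≤ S.epsEta Q (1 / 2)) :
    ∃ (R : S.L2G →L[ℂ] S.L2G) (Rε : S.L2X ε →L[ℂ] S.L2X ε),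
      IsResolvent (S.graphOp Q) ((S.lam0 Q - 1 : ℝ) : ℂ) R ∧
      IsResolvent (S.mfdOp Q ε) ((S.lam0 Q - 1 : ℝ) : ℂ) Rε ∧
      ‖(ContinuousLinearMap.id ℂ (S.L2X ε) -
        identJ hε.out hvol ∘L ContinuousLinearMap.adjoint (identJ hε.out hvol)) ∘L Rε‖
        ≤ Real.sqrt 2 * S.delta Q ε ∧
      ‖identJ hε.out hvol ∘L R - Rε ∘L identJ hε.out hvol‖ ≤ 3 * Real.sqrt 2 * S.delta Q ε := by
  have := completeSpace_H1G hvol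
  have hC := cTilde_nonneg (S := S) (Q := Q) (1 / 2)
  rw [graphOp_eq_formRel hvol, mfdOp_eq_formRel hQ, lam0]
  obtain ⟨R, hR⟩ := exists_solution one_half_pos (coercive_real hC (formG_lower hvol hQ))
  obtain ⟨R', hR'⟩ := exists_solution one_half_pos (coercive_real hC (formX_lower hvol hlamV hQ h))
  exact ⟨_, _, isResolvent_formRel hR, isResolvent_formRel hR',
    (norm_sub_identJ_comp_resolvent_le hvol hlamV hlamEdge hQ h hR').trans
      (le_mul_of_one_le_left delta_nonneg (Real.one_le_sqrt.2 one_le_two)),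
    norm_resolvent_real_sub_le hvol hlamV hQ h rfl hR hR'⟩

theorem exists_resolvents_imaginary (hvol : ∀ e, 0 < (S.Y e).totalVol) (hlamV : 0 < S.lamV)
    (hQ : MemLp Q ⊤ S.X.vol) (h : ENNReal.ofReal ε ≤ S.epsEta Q (1 / 2)) :
    ∃ (R : S.L2G →L[ℂ] S.L2G) (Rε : S.L2X ε →L[ℂ] S.L2X ε),
      IsResolvent (S.graphOp Q) Complex.I R ∧ IsResolvent (S.mfdOp Q ε) Complex.I Rε ∧
      ‖identJ hε.out hvol ∘L R - Rε ∘L identJ hε.out hvol‖ ≤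
        10 * S.delta Q ε * max (S.cTilde Q (1 / 2)) (Real.sqrt 2) := by
  have := completeSpace_H1G hvol
  have hC := cTilde_nonneg (S := S) (Q := Q) (1 / 2)
  have hδ := delta_nonneg (S := S) (Q := Q) (ε := ε)
  have hG := formG_lower hvol hQ
  have hX := formX_lower hvol hlamV hQ h
  have hsG := formG_symm hvol Q
  have hsX := formX_symm (ε := ε) hQ
  have hc : 0 < 1 / (S.cTilde Q (1 / 2) + 3) := by positivity
  have z1 : Complex.I.re = 0 := Complex.I_re
  have z2 : Complex.I.im ^ 2 = 1 := by simp
  have z3 : (conj Complex.I).re = 0 := by simp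
  have z4 : (conj Complex.I).im ^ 2 = 1 := by simp
  rw [graphOp_eq_formRel hvol, mfdOp_eq_formRel hQ]
  obtain ⟨R, hR⟩ := exists_solution hc (coercive_imaginary hsG hC hG z1 z2)
  obtain ⟨R', hR'⟩ := exists_solution hc (coercive_imaginary hsX hC hX z1 z2)
  obtain ⟨S', hS'⟩ := exists_solution hc (coercive_imaginary hsX hC hX z3 z4)
  refine ⟨_, _, isResolvent_formRel hR, isResolvent_formRel hR', ?_⟩
  refine ((formsClose (ε := ε) hvol hlamV hQ).norm_resolvent_sub_le dense_isSmoothG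
    UniformSpace.Completion.denseRange_coe hR hR' hS' hsX hδ hδ (by positivity)
    (Real.sqrt_nonneg (S.cTilde Q (1 / 2) + 2))
    (fun g x hx => sol_bounds_imaginary hsG hC hG z1 z2 hx)
    fun g x hx => sol_bounds_imaginary hsX hC hX z3 z4 hx).trans ?_
  have h1 := mul_le_mul_of_nonneg_left (add_two_le_mul_max hC) hδ
  linarith

end FatStar

end ThinStar

end

/-! ### The theorem -/

theorem mainTheorem1 {n : ℕ} {E : Type*} [Fintype E] [Nonempty E]
    (S : ThinStar.FatStar n E) (Q : S.X → ℝ) (hQ : MemLp Q ⊤ S.X.vol)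
    (hlamV : 0 < S.lamV) (hlamEdge : ∀ e, 0 < S.lamEdge e) :
    (S.delta Q =O[𝓝[>] 0] fun ε : ℝ => ε ^ (1 / 2 : ℝ)) ∧
    ∀ ε : ℝ, 0 < ε → ENNReal.ofReal ε ≤ S.epsEta Q (1 / 2) →
      ∃ J : S.L2G →L[ℂ] S.L2X ε,
        S.IsIdentification ε J ∧
        (ContinuousLinearMap.adjoint J) ∘L J = ContinuousLinearMap.id ℂ S.L2G ∧
        (∃ (R : S.L2G →L[ℂ] S.L2G) (Rε : S.L2X ε →L[ℂ] S.L2X ε),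
          ThinStar.IsResolvent (S.graphOp Q) ((S.lam0 Q - 1 : ℝ) : ℂ) R ∧
          ThinStar.IsResolvent (S.mfdOp Q ε) ((S.lam0 Q - 1 : ℝ) : ℂ) Rε ∧
          ‖(ContinuousLinearMap.id ℂ (S.L2X ε) - J ∘L ContinuousLinearMap.adjoint J) ∘L Rε‖
            ≤ Real.sqrt 2 * S.delta Q ε ∧
          ‖J ∘L R - Rε ∘L J‖ ≤ 3 * Real.sqrt 2 * S.delta Q ε) ∧
        ∃ (R : S.L2G →L[ℂ] S.L2G) (Rε : S.L2X ε →L[ℂ] S.L2X ε),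
          ThinStar.IsResolvent (S.graphOp Q) Complex.I R ∧
          ThinStar.IsResolvent (S.mfdOp Q ε) Complex.I Rε ∧
          ‖J ∘L R - Rε ∘L J‖
            ≤ 10 * S.delta Q ε * max (S.cTilde Q (1 / 2)) (Real.sqrt 2) := by
  -- Positive volumes of the cross-sections make every weight `p e` nonzero; this is what makes `J`
  -- isometric and the vertex value well defined.
  have hvol (e : E) : 0 < (S.Y e).totalVol :=
    (S.Y e).totalVol_pos_of_neumannEigenvalue_pos (hlamEdge e)
  refine ⟨ThinStar.FatStar.delta_isBigO hlamV hlamEdge, fun ε h0 hε => ?_⟩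
  have : Fact (0 < ε) := ⟨h0⟩
  exact ⟨ThinStar.FatStar.identJ h0 hvol, ThinStar.FatStar.isIdentification_identJ h0 hvol,
    ThinStar.FatStar.adjoint_comp_identJ h0 hvol,
    ThinStar.FatStar.exists_resolvents_real hvol hlamV hlamEdge hQ hε,
    ThinStar.FatStar.exists_resolvents_imaginary hvol hlamV hQ hε⟩
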